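/- Work over $\mathbb{C}$. Let $V$ have basis $a_1,\dots,a_n$ and let $\Gamma_k=\sum_{i,j}\Gamma^k_{ij}a_ia_j$ ($1\le k\le m$) be linearly independent quadrics in $S(V)=\mathbb{C}[a_1,\dots,a_n]$. Put $I=(\Gamma_1,\dots,\Gamma_m)$ and $A=S(V)/I$, graded with the $a_i$ in degree $1$, and assume that $A$ is Koszul: $\mathrm{Ext}_A^{ij}(\mathbb{C},\mathbb{C})=0$ for $i\neq j$, where $i$ is the cohomological and $j$ the internal degree. Let $A^!=T(V^*)/(Q^\perp)$ be the Koszul dual algebra, where $Q\subseteq V\otimes V$ is the space of quadratic relations of $A$ and $Q^\perp\subseteq V^*\otimes V^*$ its annihilator. Let $L=\bigoplus_{p\ge1}L_p$ be a graded Lie superalgebra with finite-dimensional components, the elements of $L_p$ having parity $p \bmod 2$, such that $A^!\cong U(L)$ as graded algebras. Put $L_{\ge k}=\bigoplus_{p\ge k}L_p$. The algebra of syzygies of $A$ is the homology algebra of the commutative DG algebra $$A\otimes\textstyle\bigwedge(\theta_1,\dots,\theta_n),\qquad d=\sum_i a_i\,\partial/\partial\theta_i ,$$ and the Berkovits homology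 of $A$ is the homology algebra of the commutative DG algebra $$A\otimes\textstyle\bigwedge(\theta_1,\dots,\theta_n)\otimes\mathbb{C}[y_1,\dots,y_m],\qquad d=\sum_i a_i\,\frac{\partial}{\partial\theta_i}+\sum_k\Big(\sum_{i,j}\Gamma^k_{ij}a_i\theta_j\Big)\frac{\partial}{\partial y_k},$$ where the $\theta_i$ have homological degree $1$ and the $y_k$ homological degree $2$. For a graded Lie superalgebra $M=\bigoplus_{p\ge1}M_p$ with finite-dimensional components, $H^*(M,\mathbb{C})$ is the cohomology algebra of the Chevalley–Eilenberg complex of $M$: the exterior algebra, in the super sense, on the graded dual $\bigoplus_p M_p^*$, with the derivation extending the dual of the bracket as differential. Signs follow the homological grading in which $M_p^*$ has degree $p-1$, so that this complex is graded-commutative for that grading. Write $H^i(M,\mathbb{C})_j$ for the part of cohomological degree $i$ (number of exterior factors) and internal degree $j$. Theorem. (1) The algebra of syzygies of $A$ is isomorphic, as a $\mathbb{C}$-algebra, to $H^*(L_{\ge2},\mathbb{C})$. (2) The Berkovits homology of $A$ is isomorphic, as a $\mathbb{C}$-algebra, to $H^*(L_{\ge3},\mathbb{C})$. Moreover, both isomorphisms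 can be chosen to respect the bigradings: for all $i,r\ge0$, the part of homological degree $r$ and $A$-degree $i$ is mapped onto $H^i(L_{\ge2},\mathbb{C})_{i+r}$, respectively $H^i(L_{\ge3},\mathbb{C})_{i+r}$. -/

import Mathlib

/-! ## Free graded-commutative algebras and their odd derivations -/

/-- The relations `x y = (-1)^{|x||y|} y x` between generators `x, y` of degrees `|x| = p x`. -/
inductive SuperComm.Rel (R : Type*) [CommRing R] {X : Type*} (p : X → ℕ) :
    FreeAlgebra R X → FreeAlgebra R X → Prop
  | comm (x y : X) : SuperComm.Rel R p
      (FreeAlgebra.ι R x * FreeAlgebra.ι R y)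
      ((-1) ^ (p x * p y) * (FreeAlgebra.ι R y * FreeAlgebra.ι R x))

/-- The free graded-commutative `R`-algebra `R ⊗ S_•(W)` on a set `X` of generators (a basis of
`W`), the generator `x` having homological degree `p x` (only its parity matters here). All the
coefficient rings below contain `ℂ`, so that `x ^ 2 = 0` for odd `x`: it is the polynomial algebra
on the even generators tensored with the exterior algebra on the odd ones. -/
def SuperComm (R : Type*) [CommRing R] {X : Type*} (p : X → ℕ) : Type _ :=
  RingQuot (SuperComm.Rel R p)

noncomputable instance (R : Type*) [CommRing R] {X : Type*} (p : X → ℕ) : Ring (SuperComm R p) :=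
  inferInstanceAs (Ring (RingQuot (SuperComm.Rel R p)))

noncomputable instance (k R : Type*) [CommRing k] [CommRing R] [Algebra k R] {X : Type*}
    (p : X → ℕ) : Algebra k (SuperComm R p) :=
  inferInstanceAs (Algebra k (RingQuot (SuperComm.Rel R p)))

instance (k R : Type*) [CommRing k] [CommRing R] [Algebra k R] {X : Type*} (p : X → ℕ) :
    IsScalarTower k R (SuperComm R p) :=
  inferInstanceAs (IsScalarTower k R (RingQuot (SuperComm.Rel R p)))

/-- An algebra `S` over `ℂ` with a parity automorphism and an odd derivation `d`. -/
structure OddDerivation (S : Type*) [Ring S] [Algebra ℂ S] where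
  parity : S →ₐ[ℂ] S
  d : S →ₗ[ℂ] S
  leibniz : ∀ a b, d (a * b) = d a * b + parity a * d b

namespace OddDerivation

variable {S : Type*} [Ring S] [Algebra ℂ S] (D : OddDerivation S)

theorem d_one : D.d 1 = 0 := by
  have h := D.leibniz 1 1
  simpa using h

/-- The subalgebra of cycles. -/
def cycles : Subalgebra ℂ S where
  carrier := {z | D.d z = 0}
  mul_mem' {a b} ha hb := by
    have ha' : D.d a = 0 := ha
    have hb' : D.d b = 0 := hb
    simp [D.leibniz, ha', hb']
  add_mem' {a b} ha hb := by
    have ha' : D.d a = 0 := ha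
    have hb' : D.d b = 0 := hb
    simp [ha', hb']
  algebraMap_mem' r := by
    simp [Algebra.algebraMap_eq_smul_one, D.d_one]

/-- Two cycles are homologous if they differ by a boundary. -/
def Homologous (z z' : D.cycles) : Prop := ∃ w : S, (z : S) - z' = D.d w

/-- The homology algebra: cycles modulo boundaries. -/
def Homology : Type _ := RingQuot D.Homologous

noncomputable instance : Ring D.Homology := inferInstanceAs (Ring (RingQuot D.Homologous))

noncomputable instance : Algebra ℂ D.Homology :=
  inferInstanceAs (Algebra ℂ (RingQuot D.Homologous))

/-- The homology class of a cycle. -/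
noncomputable def homologyClass : D.cycles →ₐ[ℂ] D.Homology := RingQuot.mkAlgHom ℂ D.Homologous

/-- The part of the homology represented by the cycles which lie in the subspace `P`. -/
noncomputable def homologyPart (P : Submodule ℂ S) : Submodule ℂ D.Homology :=
  (P.comap D.cycles.val.toLinearMap).map D.homologyClass.toLinearMap

end OddDerivation

namespace SuperComm

section

variable {R : Type*} [CommRing R] {X : Type*} (p : X → ℕ)

variable (R) in
/-- The quotient map from the free algebra. -/
noncomputable def mk : FreeAlgebra R X →ₐ[R] SuperComm R p :=
  RingQuot.mkAlgHom R (SuperComm.Rel R p)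

/-- The generators. -/
noncomputable def gen (x : X) : SuperComm R p := mk R p (FreeAlgebra.ι R x)

theorem gen_mul_gen (x y : X) :
    (gen p x * gen p y : SuperComm R p) = (-1) ^ (p x * p y) * (gen p y * gen p x) := by
  have h : mk R p _ = mk R p _ := RingQuot.mkAlgHom_rel R (Rel.comm (R := R) (p := p) x y)
  simpa [gen] using h

variable {p}

/-- The universal property. -/
noncomputable def lift {B : Type*} [Ring B] [Algebra R B] (f : X → B)
    (hf : ∀ x y, f x * f y = (-1) ^ (p x * p y) * (f y * f x)) : SuperComm R p →ₐ[R] B :=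
  RingQuot.liftAlgHom R ⟨FreeAlgebra.lift R f, by
    rintro _ _ ⟨x, y⟩
    simpa using hf x y⟩

theorem lift_gen {B : Type*} [Ring B] [Algebra R B] (f : X → B)
    (hf : ∀ x y, f x * f y = (-1) ^ (p x * p y) * (f y * f x)) (x : X) :
    lift (R := R) f hf (gen p x) = f x := by
  refine (RingQuot.liftAlgHom_mkAlgHom_apply R (FreeAlgebra.lift R f) _ _).trans ?_
  simp

theorem induction {P : SuperComm R p → Prop} (hR : ∀ r : R, P (algebraMap R _ r))
    (hgen : ∀ x, P (gen p x)) (hmul : ∀ a b, P a → P b → P (a * b))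
    (hadd : ∀ a b, P a → P b → P (a + b)) (s : SuperComm R p) : P s := by
  obtain ⟨t, ht⟩ := RingQuot.mkAlgHom_surjective R (SuperComm.Rel R p) s
  obtain rfl : mk R p t = s := ht
  induction t using FreeAlgebra.induction with
  | grade0 r => rw [AlgHom.commutes]; exact hR r
  | grade1 x => exact hgen x
  | mul a b ha hb => rw [map_mul]; exact hmul _ _ ha hb
  | add a b ha hb => rw [map_add]; exact hadd _ _ ha hb

theorem neg_one_pow_mul_comm {B : Type*} [Ring B] (k : ℕ) (b : B) :
    (-1) ^ k * b = b * (-1) ^ k :=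
  ((Commute.neg_one_left b).pow_left k).eq

/-- The parity automorphism `x ↦ (-1)^{|x|} x`. -/
noncomputable def parity : SuperComm R p →ₐ[R] SuperComm R p :=
  lift (fun x => (-1) ^ p x * gen p x) (by
    intro x y
    rcases neg_one_pow_eq_or (SuperComm R p) (p x) with h | h <;>
    rcases neg_one_pow_eq_or (SuperComm R p) (p y) with h' | h' <;>
    simp [h, h', gen_mul_gen p x y])

end

section

variable {R : Type*} [CommRing R] {X : Type*} {p : X → ℕ}

/-- Upper triangular matrices with rows `(parity s, d s)` and `(0, s)`: this is multiplicative in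
`s` exactly when `d` is an odd derivation. -/
noncomputable def derMatrix (δ : X → SuperComm R p)
    (hδ : ∀ x y, gen p y * δ x = (-1) ^ (p y * (p x + 1)) * (δ x * gen p y)) :
    SuperComm R p →ₐ[R] Matrix (Fin 2) (Fin 2) (SuperComm R p) :=
  lift (fun x => !![(-1) ^ p x * gen p x, δ x; 0, gen p x]) (by
    intro x y
    have hm : ∀ (k : ℕ) (a b c d : SuperComm R p),
        (-1 : Matrix (Fin 2) (Fin 2) (SuperComm R p)) ^ k * !![a, b; c, d]
          = !![(-1) ^ k * a, (-1) ^ k * b; (-1) ^ k * c, (-1) ^ k * d] := by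
      intro k a b c d
      rcases Nat.even_or_odd k with h | h
      · simp [h.neg_one_pow]
      · rw [h.neg_one_pow, h.neg_one_pow]
        ext i j
        fin_cases i <;> fin_cases j <;> simp
    have h1 := gen_mul_gen (R := R) p x y
    have h2 := hδ y x
    have h3 := hδ x y
    rw [Matrix.mul_fin_two, Matrix.mul_fin_two, hm]
    rcases Nat.even_or_odd (p x) with h | h <;> rcases Nat.even_or_odd (p y) with h' | h' <;>
    simp [h.neg_one_pow, h'.neg_one_pow, pow_mul, pow_succ] at h1 h2 h3 ⊢ <;>
    simp [h1, h2, h3, add_comm])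

theorem derMatrix_apply (δ : X → SuperComm R p)
    (hδ : ∀ x y, gen p y * δ x = (-1) ^ (p y * (p x + 1)) * (δ x * gen p y))
    (s : SuperComm R p) :
    derMatrix δ hδ s = !![parity s, derMatrix δ hδ s 0 1; 0, s] := by
  induction s using SuperComm.induction with
  | hR r =>
    ext i j
    fin_cases i <;> fin_cases j <;> simp [Matrix.algebraMap_matrix_apply]
  | hgen x =>
    simp [derMatrix, parity, lift_gen]
  | hmul a b ha hb =>
    rw [map_mul, map_mul, ha, hb, Matrix.mul_fin_two]
    simp
  | hadd a b ha hb =>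
    rw [map_add, map_add, ha, hb]
    simp

/-- The odd `R`-linear derivation of `SuperComm R p` with prescribed values `δ x` on the
generators. The hypothesis says that `δ x` has the commutation rule of an element of parity
`|x| + 1`. -/
noncomputable def der [Algebra ℂ R] (δ : X → SuperComm R p)
    (hδ : ∀ x y, gen p y * δ x = (-1) ^ (p y * (p x + 1)) * (δ x * gen p y)) :
    OddDerivation (SuperComm R p) where
  parity := AlgHom.restrictScalars ℂ parity
  d := ((Matrix.entryLinearMap R (SuperComm R p) (0 : Fin 2) (1 : Fin 2)) ∘ₗ
    (derMatrix δ hδ).toLinearMap).restrictScalars ℂ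
  leibniz a b := by
    have h := derMatrix_apply δ hδ (a * b)
    have ha := derMatrix_apply δ hδ a
    have hb := derMatrix_apply δ hδ b
    change derMatrix δ hδ (a * b) 0 1 =
      derMatrix δ hδ a 0 1 * b + parity a * derMatrix δ hδ b 0 1
    rw [map_mul, ha, hb, Matrix.mul_fin_two]
    simp [add_comm]

theorem der_d_gen [Algebra ℂ R] (δ : X → SuperComm R p)
    (hδ : ∀ x y, gen p y * δ x = (-1) ^ (p y * (p x + 1)) * (δ x * gen p y)) (x : X) :
    (der δ hδ).d (gen p x) = δ x := by
  change derMatrix δ hδ (gen p x) 0 1 = δ x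
  simp [derMatrix, lift_gen]

theorem der_d_algebraMap [Algebra ℂ R] (δ : X → SuperComm R p)
    (hδ : ∀ x y, gen p y * δ x = (-1) ^ (p y * (p x + 1)) * (δ x * gen p y)) (r : R) :
    (der δ hδ).d (algebraMap R _ r) = 0 := by
  change derMatrix δ hδ (algebraMap R _ r) 0 1 = 0
  simp [Matrix.algebraMap_matrix_apply]

end

/-- The subspace spanned by the products `a x₁ ⋯ x_r` with `a ∈ P` and `x₁, …, x_r` generators
such that the list `[x₁, …, x_r]` satisfies `T`. -/
noncomputable def monomialSpan {R : Type*} [CommRing R] [Algebra ℂ R] {X : Type*} (p : X → ℕ)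
    (P : Submodule ℂ R) (T : List X → Prop) : Submodule ℂ (SuperComm R p) :=
  Submodule.span ℂ {z | ∃ a ∈ P, ∃ l : List X, T l ∧ z = algebraMap R _ a * (l.map (gen p)).prod}

end SuperComm

/-! ## Koszul homology with respect to a sequence -/

/-- The Koszul complex of `R` with respect to a sequence `x₁, …, x_k` of elements:
`R ⊗ ⋀(θ₁, …, θ_k)` with differential `∑ xᵢ ∂/∂θᵢ`. -/
noncomputable def koszulComplex {R : Type*} [CommRing R] [Algebra ℂ R] {k : ℕ} (x : Fin k → R) :
    OddDerivation (SuperComm R (fun _ : Fin k => 1)) :=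
  SuperComm.der (fun i => algebraMap R _ (x i)) (by
    intro i j
    simp [Algebra.commutes])

/-! ## Quadratic commutative algebras -/

namespace QuadraticComm

variable {n m : ℕ} (Γ : Fin m → Matrix (Fin n) (Fin n) ℂ)

/-- The quadrics `Γ_k = ∑ Γ^k_{ij} a_i a_j` in `S(V) = ℂ[a₁, …, a_n]`. -/
noncomputable def quadric (k : Fin m) : MvPolynomial (Fin n) ℂ :=
  ∑ i, ∑ j, MvPolynomial.C (Γ k i j) * (MvPolynomial.X i * MvPolynomial.X j)

/-- The algebra `A = S(V)/I`, with `I` the ideal generated by the quadrics `Γ_k`. -/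
abbrev Alg : Type := MvPolynomial (Fin n) ℂ ⧸ Ideal.span (Set.range (quadric Γ))

/-- The generator `a_i` of `A`. -/
noncomputable def a (i : Fin n) : Alg Γ := Ideal.Quotient.mk _ (MvPolynomial.X i)

/-- The homogeneous component `A_i`. -/
noncomputable def deg (i : ℕ) : Submodule ℂ (Alg Γ) :=
  (MvPolynomial.homogeneousSubmodule (Fin n) ℂ i).map
    (Ideal.Quotient.mkₐ ℂ (Ideal.span (Set.range (quadric Γ)))).toLinearMap

/-- The augmentation ideal `A₊`. -/
noncomputable def augIdeal : Ideal (Alg Γ) := Ideal.span (Set.range (a Γ))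

/-! ### `Ext_A^{ij}(ℂ, ℂ)`, from the normalised bar resolution of `ℂ` -/

/-- The cochains `Hom((A₊)^{⊗ i}, ℂ)`. -/
abbrev BarCochain (i : ℕ) : Type := MultilinearMap ℂ (fun _ : Fin i => augIdeal Γ) ℂ

/-- The cochains of internal degree `j`: those vanishing on `A_{d₁} ⊗ ⋯ ⊗ A_{d_i}` unless
`d₁ + ⋯ + d_i = j`. -/
def barCochains (i j : ℕ) : Submodule ℂ (BarCochain Γ i) where
  carrier := {φ | ∀ (x : Fin i → augIdeal Γ) (d : Fin i → ℕ),
    (∀ r, (x r : Alg Γ) ∈ deg Γ (d r)) → ∑ r, d r ≠ j → φ x = 0}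
  zero_mem' := by simp
  add_mem' {φ ψ} hφ hψ x d hx hd := by simp [hφ x d hx hd, hψ x d hx hd]
  smul_mem' c φ hφ x d hx hd := by simp [hφ x d hx hd]

/-- The bar differential
`(dφ)(x₀, …, x_i) = ∑_r (-1)^r φ(x₀, …, x_r x_{r+1}, …, x_i)`. -/
noncomputable def barDiff (i : ℕ) :
    BarCochain Γ i →ₗ[ℂ] ((Fin (i + 1) → augIdeal Γ) → ℂ) where
  toFun φ x := ∑ r : Fin i,
    (-1) ^ (r : ℕ) * φ (Fin.contractNth r.castSucc (fun y z => (y : Alg Γ) • z) x)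
  map_add' φ ψ := by
    ext x
    simp [mul_add, Finset.sum_add_distrib]
  map_smul' c φ := by
    ext x
    simp [Finset.mul_sum, mul_left_comm]

/-- Cocycles of bidegree `(i, j)`. -/
noncomputable def barCocycles (i j : ℕ) : Submodule ℂ (BarCochain Γ i) :=
  barCochains Γ i j ⊓ LinearMap.ker (barDiff Γ i)

/-- The cochains of cohomological degree `i` that are coboundaries of cochains of internal
degree `j`. -/
noncomputable def barCoboundaries : (i j : ℕ) → Submodule ℂ (BarCochain Γ i)
  | 0, _ => ⊥
  | i + 1, j =>
    { carrier := {φ | ∃ ψ ∈ barCochains Γ i j, ∀ x, φ x = barDiff Γ i ψ x}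
      zero_mem' := ⟨0, Submodule.zero_mem _, by simp⟩
      add_mem' := by
        rintro φ φ' ⟨ψ, hψ, h⟩ ⟨ψ', hψ', h'⟩
        exact ⟨ψ + ψ', Submodule.add_mem _ hψ hψ', fun x => by simp [h, h']⟩
      smul_mem' := by
        rintro c φ ⟨ψ, hψ, h⟩
        exact ⟨c • ψ, Submodule.smul_mem _ c hψ, fun x => by simp [h]⟩ }

/-- The bigraded `Ext_A^{ij}(ℂ, ℂ)`, with `i` the cohomological and `j` the internal degree. -/
abbrev Ext (i j : ℕ) : Type :=
  barCocycles Γ i j ⧸ (barCoboundaries Γ i j).comap (barCocycles Γ i j).subtype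

/-- `A` is Koszul: `Ext_A^{ij}(ℂ, ℂ) = 0` whenever `i ≠ j`. -/
def IsKoszul : Prop := ∀ i j, i ≠ j → Subsingleton (Ext Γ i j)

/-! ### The Koszul dual algebra `A^! = T(V*)/(Q^⊥)` -/

/-- The quadratic relations of `A` in `V ⊗ V`, a tensor `∑ q_{ij} a_i ⊗ a_j` being given by its
coefficients. -/
def relations : Set (Fin n → Fin n → ℂ) :=
  {q | ∑ i, ∑ j, q i j • (a Γ i * a Γ j) = 0}

/-- The annihilator of the quadratic relations in `V* ⊗ V*`. -/
def dualRelations : Set (Fin n → Fin n → ℂ) :=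
  {c | ∀ q ∈ relations Γ, ∑ i, ∑ j, c i j * q i j = 0}

/-- The relations `∑ c_{ij} a_i^* a_j^* = 0` of `A^!`. -/
inductive DualRel : FreeAlgebra ℂ (Fin n) → FreeAlgebra ℂ (Fin n) → Prop
  | rel (c : Fin n → Fin n → ℂ) (hc : c ∈ dualRelations Γ) :
      DualRel (∑ i, ∑ j, c i j • (FreeAlgebra.ι ℂ i * FreeAlgebra.ι ℂ j)) 0

/-- The Koszul dual algebra `A^!`. -/
def KoszulDual : Type := RingQuot (DualRel Γ)

noncomputable instance : Ring (KoszulDual Γ) := inferInstanceAs (Ring (RingQuot (DualRel Γ)))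

noncomputable instance : Algebra ℂ (KoszulDual Γ) :=
  inferInstanceAs (Algebra ℂ (RingQuot (DualRel Γ)))

/-- The generators `a_i^*` of `A^!`. -/
noncomputable def dualGen (i : Fin n) : KoszulDual Γ :=
  RingQuot.mkAlgHom ℂ (DualRel Γ) (FreeAlgebra.ι ℂ i)

/-- The homogeneous component `A^!_i`. -/
noncomputable def dualDeg (i : ℕ) : Submodule ℂ (KoszulDual Γ) :=
  Submodule.span ℂ (Set.range (dualGen Γ)) ^ i

/-! ### Syzygies and the Berkovits complex -/

/-- The complex `A[W₁] = A ⊗ ⋀(θ₁, …, θ_n)` with differential `∑ a_i ∂/∂θ_i`. Its homology is the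
algebra of syzygies of `A`. -/
noncomputable def syzygyComplex : OddDerivation (SuperComm (Alg Γ) (fun _ : Fin n => 1)) :=
  koszulComplex (a Γ)

/-- Homological degrees of the generators `θ₁, …, θ_n` (degree 1) and `y₁, …, y_m` (degree 2). -/
def berkovitsDegree : Fin n ⊕ Fin m → ℕ := Sum.elim (fun _ => 1) (fun _ => 2)

/-- The underlying algebra `A ⊗ ⋀(θ₁, …, θ_n) ⊗ S(y₁, …, y_m)` of the Berkovits complex. -/
abbrev BerkovitsAlg : Type := SuperComm (Alg Γ) (berkovitsDegree (n := n) (m := m))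

/-- The values of the Berkovits differential on generators: `θ_i ↦ a_i` and
`y_k ↦ ∑ Γ^k_{ij} a_i θ_j`. -/
noncomputable def berkovitsValue :
    Fin n ⊕ Fin m → BerkovitsAlg Γ
  | .inl i => algebraMap (Alg Γ) _ (a Γ i)
  | .inr k => ∑ i, ∑ j, Γ k i j • (algebraMap (Alg Γ) (BerkovitsAlg Γ) (a Γ i) * SuperComm.gen _ (Sum.inl j))

theorem berkovitsValue_comm (x y : Fin n ⊕ Fin m) :
    SuperComm.gen berkovitsDegree y * berkovitsValue Γ x =
      (-1) ^ (berkovitsDegree y * (berkovitsDegree x + 1)) *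
        (berkovitsValue Γ x * SuperComm.gen berkovitsDegree y) := by
  have key : ∀ (i j : Fin n) (y : Fin n ⊕ Fin m),
      SuperComm.gen berkovitsDegree y * (algebraMap (Alg Γ) (BerkovitsAlg Γ) (a Γ i) *
        SuperComm.gen berkovitsDegree (Sum.inl j)) = (-1) ^ berkovitsDegree y *
        (algebraMap (Alg Γ) (BerkovitsAlg Γ) (a Γ i) * SuperComm.gen berkovitsDegree (Sum.inl j) *
          SuperComm.gen berkovitsDegree y) := by
    intro i j y
    have h := SuperComm.gen_mul_gen (R := Alg Γ) (berkovitsDegree (n := n) (m := m)) y (Sum.inl j)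
    have h1 : berkovitsDegree (n := n) (m := m) (Sum.inl j) = 1 := rfl
    rw [h1, mul_one] at h
    rw [← mul_assoc, ← Algebra.commutes, mul_assoc, h, ← mul_assoc,
      ← SuperComm.neg_one_pow_mul_comm]
    simp only [mul_assoc]
  cases x with
  | inl i =>
    have h : (-1 : BerkovitsAlg Γ) ^
        (berkovitsDegree y * (berkovitsDegree (n := n) (m := m) (Sum.inl i) + 1)) = 1 :=
      Even.neg_one_pow (Even.mul_left even_two _)
    rw [h, one_mul]
    exact (Algebra.commutes _ _).symm
  | inr k =>
    have h : (-1 : BerkovitsAlg Γ) ^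
        (berkovitsDegree y * (berkovitsDegree (n := n) (m := m) (Sum.inr k) + 1)) =
        (-1) ^ berkovitsDegree y := by
      change _ ^ (_ * 3) = _
      rw [mul_comm, pow_mul]
      norm_num
    rw [h]
    simp only [berkovitsValue, Finset.mul_sum, Finset.sum_mul, mul_smul_comm, smul_mul_assoc, key]

/-- The Berkovits complex `A[W₁ ⊕ W₂] = A ⊗ ⋀(θ₁, …, θ_n) ⊗ S(y₁, …, y_m)` with differential
`∑ a_i ∂/∂θ_i + ∑ Γ̃_k ∂/∂y_k`, where `Γ̃_k = ∑ Γ^k_{ij} a_i θ_j`. -/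
noncomputable def berkovitsComplex :
    OddDerivation (BerkovitsAlg Γ) :=
  SuperComm.der (berkovitsValue Γ) (berkovitsValue_comm Γ)

/-- The part of the algebra of syzygies of `A`-degree `i` and homological degree (order) `r`. -/
noncomputable def syzygyPart (i r : ℕ) : Submodule ℂ (syzygyComplex Γ).Homology :=
  (syzygyComplex Γ).homologyPart
    (SuperComm.monomialSpan _ (deg Γ i) (fun l => l.length = r))

/-- The part of the Berkovits homology of `A`-degree `i` and homological degree `r`. -/
noncomputable def berkovitsPart (i r : ℕ) : Submodule ℂ (berkovitsComplex Γ).Homology :=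
  (berkovitsComplex Γ).homologyPart
    (SuperComm.monomialSpan _ (deg Γ i) (fun l => (l.map berkovitsDegree).sum = r))

end QuadraticComm

/-! ## Graded Lie superalgebras -/

/-- A graded Lie superalgebra `L = ⨁_{m ≥ 1} L_m` over `ℂ` with finite-dimensional components; the
elements of `L_m` have parity `m mod 2`. -/
structure GradedLieSuperalgebra (L : Type*) [AddCommGroup L] [Module ℂ L] where
  deg : ℕ → Submodule ℂ L
  isInternal : DirectSum.IsInternal deg
  deg_zero : deg 0 = ⊥
  finite : ∀ m, FiniteDimensional ℂ (deg m)
  bracket : L →ₗ[ℂ] L →ₗ[ℂ] L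
  bracket_mem : ∀ {i j : ℕ} {x y : L}, x ∈ deg i → y ∈ deg j → bracket x y ∈ deg (i + j)
  skew : ∀ {i j : ℕ} {x y : L}, x ∈ deg i → y ∈ deg j →
    bracket x y = -((-1 : ℂ) ^ (i * j) • bracket y x)
  jacobi : ∀ {i j k : ℕ} {x y z : L}, x ∈ deg i → y ∈ deg j → z ∈ deg k →
    (-1 : ℂ) ^ (i * k) • bracket x (bracket y z) + (-1 : ℂ) ^ (j * i) • bracket y (bracket z x) +
      (-1 : ℂ) ^ (k * j) • bracket z (bracket x y) = 0

namespace GradedLieSuperalgebra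

variable {L : Type*} [AddCommGroup L] [Module ℂ L] (G : GradedLieSuperalgebra L)

/-! ### The universal enveloping algebra -/

/-- The relations `x y - (-1)^{|x||y|} y x = [x, y]` for homogeneous `x, y`. -/
inductive EnvRel : TensorAlgebra ℂ L → TensorAlgebra ℂ L → Prop
  | rel {i j : ℕ} {x y : L} (hx : x ∈ G.deg i) (hy : y ∈ G.deg j) :
      EnvRel (TensorAlgebra.ι ℂ x * TensorAlgebra.ι ℂ y -
          (-1 : ℂ) ^ (i * j) • (TensorAlgebra.ι ℂ y * TensorAlgebra.ι ℂ x))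
        (TensorAlgebra.ι ℂ (G.bracket x y))

/-- The universal enveloping algebra `U(L)`. -/
def Env : Type _ := RingQuot G.EnvRel

noncomputable instance : Ring G.Env := inferInstanceAs (Ring (RingQuot G.EnvRel))

noncomputable instance : Algebra ℂ G.Env := inferInstanceAs (Algebra ℂ (RingQuot G.EnvRel))

/-- The canonical map `L → U(L)`. -/
noncomputable def envι : L →ₗ[ℂ] G.Env :=
  (RingQuot.mkAlgHom ℂ G.EnvRel).toLinearMap ∘ₗ TensorAlgebra.ι ℂ

/-! ### The graded Lie superalgebras `L_{≥ k}` -/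

/-- The subspace `⨁_{m ≥ k} L_m`. -/
def tail (k : ℕ) : Submodule ℂ L := ⨆ m, ⨆ _ : k ≤ m, G.deg m

theorem deg_le_tail {k m : ℕ} (h : k ≤ m) : G.deg m ≤ G.tail k :=
  le_iSup₂_of_le m h le_rfl

/-- The bracket preserves `⨁_{m ≥ k} L_m`. -/
theorem bracket_mem_tail (k : ℕ) {x y : L} (hx : x ∈ G.tail k) (hy : y ∈ G.tail k) :
    G.bracket x y ∈ G.tail k := by
  have h1 : ∀ i, k ≤ i → ∀ x ∈ G.deg i, G.tail k ≤ (G.tail k).comap (G.bracket x) := by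
    intro i hi x hx
    refine iSup₂_le fun j hj y hy => ?_
    exact G.deg_le_tail (by omega) (G.bracket_mem hx hy)
  have h2 : G.tail k ≤ (G.tail k).comap (G.bracket.flip y) :=
    iSup₂_le fun i hi x hx => h1 i hi x hx hy
  exact h2 hx

/-- The graded Lie superalgebra `L_{≥ k} = ⨁_{m ≥ k} L_m`. -/
def trunc (k : ℕ) : GradedLieSuperalgebra (G.tail k) where
  deg m := (G.deg m).comap (G.tail k).subtype
  isInternal := by
    rw [DirectSum.isInternal_submodule_iff_iSupIndep_and_iSup_eq_top]
    have hG := (DirectSum.isInternal_submodule_iff_iSupIndep_and_iSup_eq_top _).1 G.isInternal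
    constructor
    · intro m
      rw [disjoint_iff, eq_bot_iff]
      intro x hx
      have h := (hG.1 m).le_bot
      have hx2 : (x : L) ∈ ⨆ j, ⨆ _ : j ≠ m, G.deg j := by
        have : (⨆ j, ⨆ _ : j ≠ m, (G.deg j).comap (G.tail k).subtype) ≤
            (⨆ j, ⨆ _ : j ≠ m, G.deg j).comap (G.tail k).subtype :=
          iSup₂_le fun j hj => Submodule.comap_mono (le_iSup₂_of_le j hj le_rfl)
        exact this hx.2
      have := h ⟨hx.1, hx2⟩
      simpa using this
    · rw [eq_top_iff]
      have : G.tail k ≤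
          (⨆ m, (G.deg m).comap (G.tail k).subtype).map (G.tail k).subtype := by
        refine iSup₂_le fun m hm x hx => ?_
        exact ⟨⟨x, G.deg_le_tail hm hx⟩,
          Submodule.mem_iSup_of_mem m (show x ∈ G.deg m from hx), rfl⟩
      rintro ⟨x, hx⟩ -
      obtain ⟨y, hy, hyx⟩ := this hx
      have : y = ⟨x, hx⟩ := Subtype.ext hyx
      exact this ▸ hy
  deg_zero := by
    rw [G.deg_zero]
    ext x
    simp
  finite m := by
    have := G.finite m
    let f : (G.deg m).comap (G.tail k).subtype →ₗ[ℂ] G.deg m :=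
      (G.tail k).subtype.restrict (fun x hx => hx)
    refine FiniteDimensional.of_injective f ?_
    intro x y h
    have h' : ((f x : G.deg m) : L) = (f y : G.deg m) := congrArg _ h
    exact Subtype.ext (Subtype.ext h')
  bracket := LinearMap.mk₂ ℂ (fun x y => ⟨G.bracket x y, G.bracket_mem_tail k x.2 y.2⟩)
    (fun _ _ _ => Subtype.ext (by simp)) (fun _ _ _ => Subtype.ext (by simp))
    (fun _ _ _ => Subtype.ext (by simp)) (fun _ _ _ => Subtype.ext (by simp))
  bracket_mem hx hy := G.bracket_mem hx hy
  skew hx hy := Subtype.ext (G.skew hx hy)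
  jacobi hx hy hz := Subtype.ext (G.jacobi hx hy hz)

/-! ### The Chevalley–Eilenberg complex with trivial coefficients

It is the exterior algebra (in the super sense) on the graded dual `L^* = ⨁ L_m^*`, with the
differential extending the dual of the bracket as a derivation. The dual of a basis vector of `L_m`
is given the homological degree `m - 1`, and signs follow this degree. -/

/-- Indices of a homogeneous basis of `L`. -/
abbrev Index : Type := Σ m : ℕ, Fin (Module.finrank ℂ (G.deg m))

/-- A homogeneous basis `e` of `L`. -/
noncomputable def basis : Module.Basis G.Index ℂ L :=
  haveI := G.finite
  G.isInternal.collectedBasis (fun m => Module.finBasis ℂ (G.deg m))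

/-- The parity of the generator `ξ_u` dual to `e_u ∈ L_m`: that of `m + 1`, equivalently of its
homological degree `m - 1`. -/
def cePar (u : G.Index) : ℕ := u.1 + 1

/-- The underlying algebra of the Chevalley–Eilenberg complex. -/
abbrev CEAlg : Type := SuperComm ℂ G.cePar

/-- The values of the differential on the generators, dual to the bracket:
`d ξ_u = -½ ∑ (-1)^{|s|(|t|+1)} c_{st}^u ξ_s ξ_t`, where `[e_s, e_t] = ∑ c_{st}^u e_u`. Only the
finitely many pairs with `|s| + |t| = |u|` have `c_{st}^u ≠ 0`. -/
noncomputable def ceValue (u : G.Index) : G.CEAlg :=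
  ∑ q ∈ Finset.HasAntidiagonal.antidiagonal u.1, ∑ i : Fin (Module.finrank ℂ (G.deg q.1)),
    ∑ j : Fin (Module.finrank ℂ (G.deg q.2)),
      (-(1 / 2) * (-1) ^ (q.1 * (q.2 + 1)) *
        G.basis.repr (G.bracket (G.basis ⟨q.1, i⟩) (G.basis ⟨q.2, j⟩)) u : ℂ) •
      (SuperComm.gen G.cePar ⟨q.1, i⟩ * SuperComm.gen G.cePar ⟨q.2, j⟩)

theorem ceValue_comm (u v : G.Index) :
    SuperComm.gen G.cePar v * G.ceValue u =
      (-1) ^ (G.cePar v * (G.cePar u + 1)) * (G.ceValue u * SuperComm.gen G.cePar v) := by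
  simp only [ceValue, Finset.mul_sum, Finset.sum_mul, mul_smul_comm, smul_mul_assoc]
  refine Finset.sum_congr rfl fun q hq => Finset.sum_congr rfl fun i _ =>
    Finset.sum_congr rfl fun j _ => ?_
  congr 1
  have hq' : q.1 + q.2 = u.1 := Finset.HasAntidiagonal.mem_antidiagonal.1 hq
  have h1 := SuperComm.gen_mul_gen (R := ℂ) G.cePar v ⟨q.1, i⟩
  have h2 := SuperComm.gen_mul_gen (R := ℂ) G.cePar v ⟨q.2, j⟩
  have h3 : (-1 : G.CEAlg) ^ (G.cePar v * (G.cePar u + 1)) =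
      (-1) ^ (G.cePar v * G.cePar ⟨q.1, i⟩) * (-1) ^ (G.cePar v * G.cePar ⟨q.2, j⟩) := by
    rw [← pow_add, ← mul_add]
    simp only [cePar, ← hq']
    congr 2
    omega
  rw [h3, ← mul_assoc, h1, mul_assoc, mul_assoc, h2, mul_assoc, ← mul_assoc (SuperComm.gen _ _),
    ← SuperComm.neg_one_pow_mul_comm]
  simp only [mul_assoc]

/-- The Chevalley–Eilenberg complex of `L`. -/
noncomputable def ceComplex : OddDerivation G.CEAlg := SuperComm.der G.ceValue G.ceValue_comm

/-- The cohomology algebra `H^*(L, ℂ)`. -/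
abbrev Cohomology : Type := G.ceComplex.Homology

/-- The part `H^i(L, ℂ)_j` of cohomological degree `i` (number of exterior factors) and internal
degree `j` (induced by the grading of `L`). -/
noncomputable def cohomologyPart (i j : ℕ) : Submodule ℂ G.Cohomology :=
  G.ceComplex.homologyPart
    (SuperComm.monomialSpan _ ⊤ (fun l => l.length = i ∧ (l.map Sigma.fst).sum = j))

end GradedLieSuperalgebra

/-! ## Odd derivations, derivations of given parity and weights on free graded-commutative algebras -/

namespace SuperComm

section

variable {R : Type*} [CommRing R] {X : Type*} {p : X → ℕ}

/-! Koszulness means that `A` is quasi-isomorphic to the Chevalley–Eilenberg complex of `L`: the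
generators `ξ` dual to `L₁` go to the `a_i`, all others to zero. The syzygy complex and the
Berkovits complex are both `A ⊗ S(η_y)`, where `y` runs over a basis of `L_{<k}` for `k = 2` and `k
= 3`. Each is compared with `H^*(L_{≥k})` through a third complex, the window complex generated by
all `ξ_x` and by those `η_y`. It has two surjections of differential algebras: `proj` kills `ξ_y`
and `η_y` for `y` in the window and lands in the Chevalley–Eilenberg complex of `L_{≥k}`, while
`spec` replaces the `ξ` by elements of `A`. Both have acyclic kernel, so both induce isomorphisms of
homology algebras (`OddDerivation.exists_homology_equiv`).

The differential of the window complex has a geometric origin. Regard the `ξ_u` as invariant forms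
on the unipotent supergroup of `L`, let `E` be the Euler field of the grading, and use the functions
`η_u = |u|⁻¹ ι_E ξ_u` as coordinates. As `ξ_u` has weight `|u|`, Cartan's formula forces `dη_u = ξ_u
- |u|⁻¹ ι_E dξ_u`, which is affine in the `η`; no Baker–Campbell–Hausdorff series appears. The Lie
derivative `dι_E + ι_E d` multiplies each generator of the window by its degree. On the kernel of
`proj` it is triangular with positive eigenvalues, hence invertible there, and a cycle in that
kernel is the differential of a contraction (`proj_acyclic`). If the window is all of `L`, it is the
grading operator itself, and the homology of the complex is `ℂ` (`full_acyclic`).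

For the full window the target of `spec` is `A ⊗ S(η)` with differential `∑ a_k ⊗ act_k`, where the
`act_u` are the vector fields dual to the forms `ξ_u`. They represent `L` on `S(η)`, and Euler's
identity `∑ |s| η_s act_s = weight` shows both that no element of positive weight is annihilated by
all of them and that one-cocycles have primitives (`exists_lift`, a Poincaré lemma). Thus `S(η)`
behaves as the graded dual of `U(L) = A^!`, as recorded by `Comodule`, and the target is the Koszul
complex of `A`. Its exactness follows from the vanishing of off-diagonal bar cohomology by duality:
a functional on `A ⊗ M` that vanishes on boundaries is extended, by descending induction on the
degree in `A`, to a twisting cochain with values in bar cochains, and the value of that cochain at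
`1` yields a primitive (`exists_twisting`, `exists_primitive`, `exists_tensorD_eq`). So source and
target of the full `spec` both have homology `ℂ`, and its kernel is acyclic (`full_spec_acyclic`).

To pass from the full window to a smaller one, write the full complex as the window complex tensored
with the algebra of the remaining `η` and filter by the degree in these. To leading order the
differential is that of the window tensored with the identity. By induction on the weight, the
leading terms of a primitive in the full complex can be removed one after the other, until the
primitive lies in the window complex (`exists_lower`, `acyclicAt`, `spec_acyclic`).

It remains to recognise the specialised window complexes. The isomorphism of `A^!` with `U(L)` gives
a basis of `L₁` dual to the `a_i`, and a basis of `L₂` in which the brackets of the generators are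
the symmetrised matrices of the quadrics. In degree one `dη_i = a_i`; in degree two `dη_r = ½ ∑
(Γ^r_{ik} + Γ^r_{ki}) a_i θ_k`, which becomes the Berkovits differential after `y_r` is shifted by a
quadratic expression in the `θ`. The bigrading is carried through the zigzag by one weight operator
with complex eigenvalues, whose real and imaginary parts recover the two degrees. -/

theorem parity_gen (x : X) : parity (gen p x : SuperComm R p) = (-1) ^ p x * gen p x := by
  simp [parity, lift_gen]

theorem parity_gen' (x : X) : parity (gen p x : SuperComm R p) = ((-1) ^ p x : R) • gen p x := by
  rw [parity_gen, Algebra.smul_def, map_pow, map_neg, map_one]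

theorem parity_parity (s : SuperComm R p) : parity (parity s) = s := by
  induction s using SuperComm.induction with
  | hR r => simp
  | hgen x =>
    rw [parity_gen, map_mul, parity_gen, map_pow, map_neg, map_one, ← mul_assoc, ← pow_add]
    simp [← two_mul, pow_mul]
  | hmul a b ha hb => rw [map_mul, map_mul, ha, hb]
  | hadd a b ha hb => rw [map_add, map_add, ha, hb]

theorem parity_pow_gen (q : ℕ) (x : X) :
    (parity ^ q : SuperComm R p →ₐ[R] _) (gen p x) = (-1) ^ (q * p x) * gen p x := by
  induction q with
  | zero => simp
  | succ q ih =>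
    rw [pow_succ', AlgHom.mul_apply, ih, map_mul, parity_gen, map_pow, map_neg, map_one,
      ← mul_assoc, ← pow_add]
    ring_nf

/-- Algebra maps out of `SuperComm R p` agree if they agree on the generators and on `R`. -/
theorem ringHom_ext {B : Type*} [Ring B] {f g : SuperComm R p →+* B}
    (hR : ∀ r : R, f (algebraMap R _ r) = g (algebraMap R _ r))
    (hgen : ∀ x, f (gen p x) = g (gen p x)) : f = g := by
  ext s
  induction s using SuperComm.induction with
  | hR r => exact hR r
  | hgen x => exact hgen x
  | hmul a b ha hb => rw [map_mul, map_mul, ha, hb]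
  | hadd a b ha hb => rw [map_add, map_add, ha, hb]

theorem algHom_ext {B : Type*} [Ring B] [Algebra R B] {f g : SuperComm R p →ₐ[R] B}
    (hgen : ∀ x, f (gen p x) = g (gen p x)) : f = g := by
  have := ringHom_ext (f := (f : SuperComm R p →+* B)) (g := g) (by simp) (by simpa using hgen)
  ext s
  exact congrArg (fun h : SuperComm R p →+* B => h s) this

theorem der_parity [Algebra ℂ R] (δ : X → SuperComm R p)
    (hδ : ∀ x y, gen p y * δ x = (-1) ^ (p y * (p x + 1)) * (δ x * gen p y)) :
    (der δ hδ).parity = AlgHom.restrictScalars ℂ parity := rfl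

theorem der_d_smul [Algebra ℂ R] (δ : X → SuperComm R p)
    (hδ : ∀ x y, gen p y * δ x = (-1) ^ (p y * (p x + 1)) * (δ x * gen p y)) (r : R)
    (s : SuperComm R p) : (der δ hδ).d (r • s) = r • (der δ hδ).d s := by
  rw [Algebra.smul_def, (der δ hδ).leibniz, der_d_algebraMap, zero_mul, zero_add, der_parity,
    AlgHom.restrictScalars_apply, AlgHom.commutes, Algebra.smul_def]

/-- The matrix of a derivation of parity `q`. -/
noncomputable def gderMatrix (q : ℕ) (δ : X → SuperComm R p)
    (hδ : ∀ x y, gen p y * δ x = (-1) ^ (p y * (p x + q)) * (δ x * gen p y)) :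
    SuperComm R p →ₐ[R] Matrix (Fin 2) (Fin 2) (SuperComm R p) :=
  lift (fun x => !![(-1) ^ (q * p x) * gen p x, δ x; 0, gen p x]) (by
    intro x y
    have hm : ∀ (k : ℕ) (a b c d : SuperComm R p),
        (-1 : Matrix (Fin 2) (Fin 2) (SuperComm R p)) ^ k * !![a, b; c, d]
          = !![(-1) ^ k * a, (-1) ^ k * b; (-1) ^ k * c, (-1) ^ k * d] := by
      intro k a b c d
      rcases Nat.even_or_odd k with h | h
      · simp [h.neg_one_pow]
      · rw [h.neg_one_pow, h.neg_one_pow]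
        ext i j
        fin_cases i <;> fin_cases j <;> simp
    have h1 := gen_mul_gen (R := R) p x y
    have h2 := hδ y x
    have h3 := hδ x y
    rw [Matrix.mul_fin_two, Matrix.mul_fin_two, hm]
    rcases Nat.even_or_odd (p x) with h | h <;> rcases Nat.even_or_odd (p y) with h' | h' <;>
    rcases Nat.even_or_odd q with h'' | h'' <;>
    simp [h.neg_one_pow, h'.neg_one_pow, h''.neg_one_pow, pow_mul, pow_add] at h1 h2 h3 ⊢ <;>
    simp [h1, h2, h3, add_comm])

theorem gderMatrix_apply (q : ℕ) (δ : X → SuperComm R p)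
    (hδ : ∀ x y, gen p y * δ x = (-1) ^ (p y * (p x + q)) * (δ x * gen p y))
    (s : SuperComm R p) :
    gderMatrix q δ hδ s = !![(parity^[q]) s, gderMatrix q δ hδ s 0 1; 0, s] := by
  have hq : ∀ a : SuperComm R p, (parity^[q]) a = (parity ^ q : SuperComm R p →ₐ[R] _) a := by
    intro a; rw [AlgHom.coe_pow]
  simp only [hq]
  induction s using SuperComm.induction with
  | hR r =>
    ext i j
    fin_cases i <;> fin_cases j <;> simp [Matrix.algebraMap_matrix_apply]
  | hgen x =>
    simp [gderMatrix, parity_pow_gen, lift_gen]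
  | hmul a b ha hb =>
    rw [map_mul, map_mul, ha, hb, Matrix.mul_fin_two]
    simp
  | hadd a b ha hb =>
    rw [map_add, map_add, ha, hb]
    simp

/-- The `R`-linear derivation of parity `q` of `SuperComm R p` with prescribed values `δ x` on the
generators. -/
noncomputable def gder (q : ℕ) (δ : X → SuperComm R p)
    (hδ : ∀ x y, gen p y * δ x = (-1) ^ (p y * (p x + q)) * (δ x * gen p y)) :
    SuperComm R p →ₗ[R] SuperComm R p :=
  (Matrix.entryLinearMap R (SuperComm R p) (0 : Fin 2) (1 : Fin 2)) ∘ₗ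
    (gderMatrix q δ hδ).toLinearMap

section

variable (q : ℕ) (δ : X → SuperComm R p)
    (hδ : ∀ x y, gen p y * δ x = (-1) ^ (p y * (p x + q)) * (δ x * gen p y))

theorem gder_mul (a b : SuperComm R p) :
    gder q δ hδ (a * b) = gder q δ hδ a * b + (parity^[q]) a * gder q δ hδ b := by
  have ha := gderMatrix_apply q δ hδ a
  have hb := gderMatrix_apply q δ hδ b
  change gderMatrix q δ hδ (a * b) 0 1 =
    gderMatrix q δ hδ a 0 1 * b + (parity^[q]) a * gderMatrix q δ hδ b 0 1
  rw [map_mul, ha, hb, Matrix.mul_fin_two]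
  simp [add_comm]

theorem gder_gen (x : X) : gder q δ hδ (gen p x) = δ x := by
  change gderMatrix q δ hδ (gen p x) 0 1 = δ x
  simp [gderMatrix, lift_gen]

theorem gder_algebraMap (r : R) : gder q δ hδ (algebraMap R _ r) = 0 := by
  change gderMatrix q δ hδ (algebraMap R _ r) 0 1 = 0
  simp [Matrix.algebraMap_matrix_apply]

end

/-! ### Weight operators -/

section Weight

variable [Algebra ℂ R] (D : Derivation ℂ R R) (w : X → ℂ)

/-- The `R`-algebra structure `r ↦ r + ε D r` on the dual numbers. -/
noncomputable abbrev dualAlgebra (p : X → ℕ) : Algebra R (TrivSqZeroExt (SuperComm R p) (SuperComm R p)) :=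
  RingHom.toAlgebra'
    { toFun := fun r => TrivSqZeroExt.inl (algebraMap R _ r) + TrivSqZeroExt.inr (algebraMap R _ (D r))
      map_one' := by ext <;> simp
      map_zero' := by ext <;> simp
      map_mul' := by
        intro a b
        ext
        · simp
        · simp
          simp only [Algebra.smul_def, ← map_mul, ← map_add, mul_comm]
      map_add' := by
        intro a b
        ext <;> simp [← Algebra.algebraMap_eq_smul_one] }
    (by
      intro r x
      ext
      · simp [Algebra.commutes]
      · simp [Algebra.commutes, add_comm])

theorem weightAux (x y : X) (A B : TrivSqZeroExt (SuperComm R p) (SuperComm R p))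
    (hA : A = TrivSqZeroExt.inl (gen p x) + TrivSqZeroExt.inr (w x • gen p x))
    (hB : B = TrivSqZeroExt.inl (gen p y) + TrivSqZeroExt.inr (w y • gen p y)) :
    A * B = (-1) ^ (p x * p y) * (B * A) := by
  subst hA hB
  have h := gen_mul_gen (R := R) p x y
  rcases Nat.even_or_odd (p x * p y) with h' | h' <;>
  simp only [h'.neg_one_pow, one_mul, neg_mul] at h ⊢
  · ext
    · simp [h]
    · simp [h, add_comm]
  · ext
    · simp [h]
    · simp [h, add_comm]

/-- The map `s ↦ s + ε W s`. -/
noncomputable def weightHom : SuperComm R p →+* TrivSqZeroExt (SuperComm R p) (SuperComm R p) :=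
  letI := dualAlgebra D p
  ((lift (R := R) (fun x => TrivSqZeroExt.inl (gen p x) + TrivSqZeroExt.inr (w x • gen p x))
    (fun x y => weightAux w x y _ _ rfl rfl) :
      SuperComm R p →ₐ[R] TrivSqZeroExt (SuperComm R p) (SuperComm R p)) : SuperComm R p →+* _)

theorem weightHom_gen (x : X) : weightHom D w (gen p x) =
    TrivSqZeroExt.inl (gen p x) + TrivSqZeroExt.inr (w x • gen p x) := by
  let := dualAlgebra D p
  exact lift_gen (R := R) (B := TrivSqZeroExt (SuperComm R p) (SuperComm R p)) _ _ x

theorem weightHom_algebraMap (r : R) : weightHom D w (algebraMap R (SuperComm R p) r) =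
    TrivSqZeroExt.inl (algebraMap R _ r) + TrivSqZeroExt.inr (algebraMap R _ (D r)) := by
  let := dualAlgebra D p
  exact AlgHom.commutes (lift (R := R) (B := TrivSqZeroExt (SuperComm R p) (SuperComm R p)) _ _) r

theorem weightHom_fst (s : SuperComm R p) : (weightHom D w s).fst = s := by
  have : ((TrivSqZeroExt.fstHom ℂ (SuperComm R p) (SuperComm R p)).toRingHom.comp (weightHom D w)) =
      RingHom.id _ := by
    apply ringHom_ext
    · intro r; simp [weightHom_algebraMap]
    · intro x; simp [weightHom_gen]
  exact congrArg (fun h : SuperComm R p →+* _ => h s) this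

/-- The even `ℂ`-linear derivation extending `D` which multiplies the generator `x` by `w x`. -/
noncomputable def weight : SuperComm R p →ₗ[ℂ] SuperComm R p where
  toFun s := (weightHom D w s).snd
  map_add' a b := by simp
  map_smul' c a := by
    have h : c • a = algebraMap R _ (algebraMap ℂ R c) * a := by
      rw [← IsScalarTower.algebraMap_apply, Algebra.smul_def]
    rw [h, map_mul, TrivSqZeroExt.snd_mul, weightHom_fst, weightHom_fst, weightHom_algebraMap]
    simp [Algebra.smul_def]
    rw [← IsScalarTower.algebraMap_apply]

theorem weight_mul (a b : SuperComm R p) :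
    weight D w (a * b) = weight D w a * b + a * weight D w b := by
  change (weightHom D w (a * b)).snd = (weightHom D w a).snd * b + a * (weightHom D w b).snd
  rw [map_mul, TrivSqZeroExt.snd_mul, weightHom_fst, weightHom_fst]
  simp [add_comm]

theorem weight_gen (x : X) : weight D w (gen p x) = w x • gen p x := by
  change (weightHom D w (gen p x)).snd = _
  simp [weightHom_gen]

theorem weight_algebraMap (r : R) :
    weight D w (algebraMap R (SuperComm R p) r) = algebraMap R _ (D r) := by
  change (weightHom D w (algebraMap R _ r)).snd = _
  simp [weightHom_algebraMap, ← Algebra.algebraMap_eq_smul_one]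

theorem weight_prod (l : List X) :
    weight D w (l.map (gen p)).prod = (l.map w).sum • ((l.map (gen p)).prod : SuperComm R p) := by
  induction l with
  | nil =>
    have := weight_algebraMap (p := p) D w 1
    simpa using this
  | cons x l ih =>
    rw [List.map_cons, List.prod_cons, weight_mul, weight_gen, ih]
    simp [add_smul]

theorem weight_monomial {r : R} {c : ℂ} (hr : D r = c • r) (l : List X) :
    weight D w (algebraMap R _ r * (l.map (gen p)).prod) =
      (c + (l.map w).sum) • (algebraMap R (SuperComm R p) r * (l.map (gen p)).prod) := by
  rw [weight_mul, weight_algebraMap, weight_prod, hr, add_smul]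
  congr 1
  · rw [Algebra.smul_def, map_mul, ← IsScalarTower.algebraMap_apply, mul_assoc, ← Algebra.smul_def]
  · simp

end Weight

/-- The monomials span. -/
theorem monomial_induction {P : SuperComm R p → Prop} (h0 : P 0)
    (hmon : ∀ (r : R) (l : List X), P (algebraMap R _ r * (l.map (gen p)).prod))
    (hadd : ∀ a b, P a → P b → P (a + b)) (s : SuperComm R p) : P s := by
  have key : s ∈ Submodule.span R {z : SuperComm R p | ∃ l : List X, z = (l.map (gen p)).prod} := by
    induction s using SuperComm.induction with
    | hR r =>
      rw [Algebra.algebraMap_eq_smul_one]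
      exact Submodule.smul_mem _ _ (Submodule.subset_span ⟨[], by simp⟩)
    | hgen x => exact Submodule.subset_span ⟨[x], by simp⟩
    | hmul a b ha hb =>
      have := Submodule.mul_mem_mul ha hb
      rw [Submodule.span_mul_span] at this
      refine Submodule.span_mono ?_ this
      rintro _ ⟨_, ⟨l, rfl⟩, _, ⟨l', rfl⟩, rfl⟩
      exact ⟨l ++ l', by simp⟩
    | hadd a b ha hb => exact Submodule.add_mem _ ha hb
  induction key using Submodule.closure_induction with
  | zero => exact h0
  | add a b _ _ ha hb => exact hadd a b ha hb
  | smul_mem r x hx =>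
    obtain ⟨l, rfl⟩ := hx
    rw [Algebra.smul_def]
    exact hmon r l

end

end SuperComm


/-! ## Diagonalisable operators -/

namespace Module.End

variable {V V' : Type*} [AddCommGroup V] [Module ℂ V] [AddCommGroup V'] [Module ℂ V']

/-- The eigenvectors span. -/
def IsDiagonal (W : V →ₗ[ℂ] V) : Prop := ⨆ μ, Module.End.eigenspace W μ = ⊤

open Polynomial

/-- A vector is a finite sum of eigenvectors, so a product of distinct linear factors kills it. That
the factors are distinct is what makes them coprime in the arguments below. -/
theorem IsDiagonal.exists_prod {W : Module.End ℂ V} (hW : IsDiagonal W) (v : V) :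
    ∃ s : Finset ℂ, aeval W (∏ μ ∈ s, (X - C μ)) v = 0 := by
  have hv : v ∈ ⨆ μ, Module.End.eigenspace W μ := hW ▸ Submodule.mem_top
  induction hv using Submodule.iSup_induction' with
  | mem μ x hx =>
    refine ⟨{μ}, ?_⟩
    rw [Module.End.mem_eigenspace_iff] at hx
    simp [hx]
  | zero => exact ⟨∅, by simp⟩
  | add x y _ _ hx hy =>
    obtain ⟨s, hs⟩ := hx
    obtain ⟨t, ht⟩ := hy
    refine ⟨s ∪ t, ?_⟩
    rw [map_add]
    have h1 : ∀ {s u : Finset ℂ} {x : V}, s ⊆ u → aeval W (∏ μ ∈ s, (X - C μ)) x = 0 →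
        aeval W (∏ μ ∈ u, (X - C μ)) x = 0 := by
      intro s u x hsu h
      rw [← Finset.prod_sdiff hsu, map_mul, Module.End.mul_apply, h, map_zero]
    rw [h1 Finset.subset_union_left hs, h1 Finset.subset_union_right ht, add_zero]

/-- Lagrange interpolation: drop the factor `X - c` from an annihilating product of distinct factors
and normalise the rest to take the value `1` at `c`. The result projects `v` to its `c`-component.
Since the projection is a polynomial in `W`, it passes through every map that commutes with `W`. -/
theorem IsDiagonal.exists_poly {W : Module.End ℂ V} (hW : IsDiagonal W) (v : V) (c : ℂ) :
    ∃ q : ℂ[X], q.eval c = 1 ∧ W (aeval W q v) = c • aeval W q v := by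
  obtain ⟨s, hs⟩ := hW.exists_prod v
  have h0 : (∏ μ ∈ s.erase c, (X - C μ)).eval c ≠ 0 := by
    rw [eval_prod, Finset.prod_ne_zero_iff]
    intro μ hμ
    simpa [sub_eq_zero] using (Finset.ne_of_mem_erase hμ).symm
  refine ⟨C ((∏ μ ∈ s.erase c, (X - C μ)).eval c)⁻¹ * ∏ μ ∈ s.erase c, (X - C μ), ?_, ?_⟩
  · rw [eval_mul, eval_C, inv_mul_cancel₀ h0]
  · have h1 : aeval W ((X - C c) * ∏ μ ∈ s.erase c, (X - C μ)) v = 0 := by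
      by_cases hc : c ∈ s
      · rw [Finset.mul_prod_erase s (fun μ => X - C μ) hc, hs]
      · rw [Finset.erase_eq_of_notMem hc, map_mul, Module.End.mul_apply, hs, map_zero]
    have h2 : W (aeval W (∏ μ ∈ s.erase c, (X - C μ)) v) =
        c • aeval W (∏ μ ∈ s.erase c, (X - C μ)) v := by
      rw [map_mul, Module.End.mul_apply, map_sub, aeval_X, aeval_C, LinearMap.sub_apply,
        Module.algebraMap_end_apply, sub_eq_zero] at h1
      exact h1
    rw [map_mul, aeval_C, Module.End.mul_apply, Module.algebraMap_end_apply, map_smul, h2,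
      smul_comm]

/-- A stable subspace is spanned by the eigenvectors in it. -/
theorem IsDiagonal.le_iSup_inf {W : Module.End ℂ V} (hW : IsDiagonal W) {J : Submodule ℂ V}
    (hJ : ∀ x ∈ J, W x ∈ J) : J ≤ ⨆ μ, J ⊓ Module.End.eigenspace W μ := by
  have hq : ∀ (q : ℂ[X]) (x : V), x ∈ J → aeval W q x ∈ J := by
    intro q x hx
    induction q using Polynomial.induction_on' with
    | add a b ha hb => rw [map_add]; exact J.add_mem ha hb
    | monomial n a =>
      rw [aeval_monomial, Module.End.mul_apply, Module.algebraMap_end_apply]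
      refine J.smul_mem _ ?_
      induction n with
      | zero => simpa
      | succ n ih => rw [pow_succ', Module.End.mul_apply]; exact hJ _ ih
  suffices h : ∀ (s : Finset ℂ) (x : V), x ∈ J → aeval W (∏ μ ∈ s, (X - C μ)) x = 0 →
      x ∈ ⨆ μ, J ⊓ Module.End.eigenspace W μ from
    fun x hx => (hW.exists_prod x).elim fun s hs => h s x hx hs
  intro s
  induction s using Finset.induction_on with
  | empty => intro x _ hs; simp at hs; simp [hs]
  | insert a s ha ih =>
    intro x hx hs
    have hc : IsCoprime (X - C a) (∏ μ ∈ s, (X - C μ)) := by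
      apply IsCoprime.prod_right
      intro μ hμ
      apply Polynomial.isCoprime_X_sub_C_of_isUnit_sub
      rw [isUnit_iff_ne_zero, sub_ne_zero]
      rintro rfl
      exact ha hμ
    rw [Finset.prod_insert ha] at hs
    -- The Bézout identity splits `x` into a vector killed by the remaining factors and an
    -- eigenvector for `a`. Both are polynomials in `W` applied to `x`, so both stay in `J`.
    obtain ⟨u, v, huv⟩ := hc
    have hx' : x = aeval W (u * (X - C a)) x + aeval W (v * ∏ μ ∈ s, (X - C μ)) x := by
      rw [← LinearMap.add_apply, ← map_add, huv, map_one, Module.End.one_apply]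
    rw [hx']
    refine Submodule.add_mem _ (ih _ (hq _ _ hx) ?_) ?_
    · rw [← Module.End.mul_apply, ← map_mul]
      rw [show (∏ μ ∈ s, (X - C μ)) * (u * (X - C a)) = u * ((X - C a) * ∏ μ ∈ s, (X - C μ)) by ring,
        map_mul, Module.End.mul_apply, hs, map_zero]
    · refine Submodule.mem_iSup_of_mem a ⟨hq _ _ hx, ?_⟩
      rw [SetLike.mem_coe, Module.End.mem_eigenspace_iff, ← sub_eq_zero]
      have : aeval W ((X - C a) * (v * ∏ μ ∈ s, (X - C μ))) x = 0 := by
        rw [show (X - C a) * (v * ∏ μ ∈ s, (X - C μ)) = v * ((X - C a) * ∏ μ ∈ s, (X - C μ)) by ring,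
          map_mul, Module.End.mul_apply, hs, map_zero]
      rw [map_mul, Module.End.mul_apply] at this
      simpa using this

theorem aeval_apply_of_eigen {W : Module.End ℂ V} {v : V} {c : ℂ} (h : W v = c • v) (q : ℂ[X]) :
    aeval W q v = q.eval c • v := by
  induction q using Polynomial.induction_on' with
  | add a b ha hb => rw [map_add, LinearMap.add_apply, ha, hb, eval_add, add_smul]
  | monomial n a =>
    rw [aeval_monomial, Module.End.mul_apply, Module.algebraMap_end_apply, eval_monomial, mul_smul]
    congr 1
    induction n with
    | zero => simp
    | succ n ih => rw [pow_succ', Module.End.mul_apply, ih, map_smul, h, smul_smul, pow_succ]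

theorem aeval_intertwine {W : Module.End ℂ V} {W' : Module.End ℂ V'} (f : V →ₗ[ℂ] V')
    (h : ∀ v, f (W v) = W' (f v)) (q : ℂ[X]) (v : V) : f (aeval W q v) = aeval W' q (f v) := by
  induction q using Polynomial.induction_on' with
  | add a b ha hb => simp [map_add, ha, hb]
  | monomial n a =>
    rw [aeval_monomial, aeval_monomial, Module.End.mul_apply, Module.algebraMap_end_apply,
      Module.End.mul_apply, Module.algebraMap_end_apply, map_smul]
    congr 1
    induction n with
    | zero => simp
    | succ n ih => rw [pow_succ', Module.End.mul_apply, h, ih, pow_succ', Module.End.mul_apply]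

end Module.End

/-! ## Quasi-isomorphisms -/

namespace OddDerivation

variable {S S' : Type*} [Ring S] [Algebra ℂ S] [Ring S'] [Algebra ℂ S']

/-- The derivation squares to zero, and the parity is an involution with which it anticommutes. -/
structure IsComplex (D : OddDerivation S) : Prop where
  parity_parity : ∀ a, D.parity (D.parity a) = a
  parity_d : ∀ a, D.parity (D.d a) = - D.d (D.parity a)
  d_d : ∀ a, D.d (D.d a) = 0

/-- Homology as a congruence quotient. -/
def IsComplex.ringCon {D : OddDerivation S} (hD : D.IsComplex) : RingCon D.cycles where
  r := D.Homologous
  iseqv :=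
    { refl := fun z => ⟨0, by simp⟩
      symm := by
        rintro z z' ⟨w, hw⟩
        exact ⟨-w, by rw [map_neg, ← hw]; abel⟩
      trans := by
        rintro z z' z'' ⟨w, hw⟩ ⟨w', hw'⟩
        exact ⟨w + w', by rw [map_add, ← hw, ← hw']; abel⟩ }
  add' := by
    rintro z z' y y' ⟨w, hw⟩ ⟨w', hw'⟩
    exact ⟨w + w', by rw [map_add, ← hw, ← hw']; simp; abel⟩
  mul' := by
    rintro z z' y y' ⟨w, hw⟩ ⟨w', hw'⟩
    have hz' : D.d z' = 0 := z'.2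
    have hy : D.d y = 0 := y.2
    -- This comes from `zy - z'y' = (z - z')y + z'(y - y')`; the parity applied to `z'` undoes the
    -- sign in the Leibniz rule.
    refine ⟨w * y + D.parity z' * w', ?_⟩
    have h1 : D.d (D.parity z') = 0 := by
      have := hD.parity_d z'
      rw [hz', map_zero] at this
      rw [← neg_eq_zero, ← this]
    rw [map_add, D.leibniz, D.leibniz, ← hw, ← hw', hy, h1, hD.parity_parity]
    simp [sub_mul, mul_sub]

/-- `RingQuot` divides by the congruence generated by the relation. Being homologous already is a
congruence, so no further cycles are identified. -/
theorem IsComplex.homologyClass_eq_iff {D : OddDerivation S} (hD : D.IsComplex) (z z' : D.cycles) :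
    D.homologyClass z = D.homologyClass z' ↔ D.Homologous z z' := by
  constructor
  · intro h
    have h2 : RingQuot.mkRingHom D.Homologous z = RingQuot.mkRingHom D.Homologous z' := by
      have h' : RingQuot.mkAlgHom ℂ D.Homologous z = RingQuot.mkAlgHom ℂ D.Homologous z' := h
      rwa [← RingQuot.mkAlgHom_coe ℂ D.Homologous]
    have h3 := congrArg (RingQuot.lift ⟨hD.ringCon.mk', fun {x y} hxy =>
      (RingCon.eq hD.ringCon).2 hxy⟩) h2
    exact (RingCon.eq hD.ringCon).1 (((RingQuot.lift_mkRingHom_apply _ _ z).symm.trans h3).trans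
      (RingQuot.lift_mkRingHom_apply _ _ z'))
  · intro h
    exact RingQuot.mkAlgHom_rel ℂ h

theorem homologyClass_surjective (D : OddDerivation S) : Function.Surjective D.homologyClass :=
  RingQuot.mkAlgHom_surjective ℂ D.Homologous

/-- The map on cycles induced by a chain map. -/
def mapCycles {D : OddDerivation S} {D' : OddDerivation S'} (f : S →ₐ[ℂ] S')
    (hf : ∀ a, f (D.d a) = D'.d (f a)) : D.cycles →ₐ[ℂ] D'.cycles :=
  (f.comp D.cycles.val).codRestrict D'.cycles (by
    intro z
    have hz : D.d z = 0 := z.2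
    change D'.d (f z) = 0
    rw [← hf, hz, map_zero])

/-- The map on homology induced by a chain map. -/
noncomputable def mapHomology {D : OddDerivation S} {D' : OddDerivation S'} (f : S →ₐ[ℂ] S')
    (hf : ∀ a, f (D.d a) = D'.d (f a)) : D.Homology →ₐ[ℂ] D'.Homology :=
  RingQuot.liftAlgHom ℂ ⟨D'.homologyClass.comp (mapCycles f hf), by
    rintro z z' ⟨w, hw⟩
    refine RingQuot.mkAlgHom_rel ℂ ⟨f w, ?_⟩
    rw [← hf, ← hw, map_sub]
    rfl⟩

theorem mapHomology_class {D : OddDerivation S} {D' : OddDerivation S'} (f : S →ₐ[ℂ] S')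
    (hf : ∀ a, f (D.d a) = D'.d (f a)) (z : D.cycles) :
    mapHomology f hf (D.homologyClass z) = D'.homologyClass (mapCycles f hf z) :=
  RingQuot.liftAlgHom_mkAlgHom_apply ℂ (s := D.Homologous) _ _ z

open Module.End in
/-- A surjective chain map with acyclic kernel, compatible with weight operators, induces an
isomorphism of homology algebras which respects the weights. -/
theorem exists_homology_equiv {D : OddDerivation S} {D' : OddDerivation S'} (hD : D.IsComplex)
    (hD' : D'.IsComplex) (f : S →ₐ[ℂ] S') (hf : ∀ a, f (D.d a) = D'.d (f a))
    (hs : Function.Surjective f)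
    (hker : ∀ x, f x = 0 → D.d x = 0 → ∃ y, f y = 0 ∧ D.d y = x)
    (Z : S →ₗ[ℂ] S) (Z' : S' →ₗ[ℂ] S') (hZ : IsDiagonal Z) (hfZ : ∀ a, f (Z a) = Z' (f a))
    (hdZ : ∀ a, Z (D.d a) = D.d (Z a) + D.d a) :
    ∃ Φ : D.Homology ≃ₐ[ℂ] D'.Homology, ∀ c,
      (D.homologyPart (eigenspace Z c)).map Φ.toLinearMap =
        D'.homologyPart (eigenspace Z' c) := by
  -- A homogeneous cycle lifts to a homogeneous cycle: both a preimage and the correction that makes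
  -- it closed are projected to the eigenvalue `c` by polynomials in `Z`.
  have hlift : ∀ (z' : S') (c : ℂ), D'.d z' = 0 → Z' z' = c • z' →
      ∃ z : S, D.d z = 0 ∧ Z z = c • z ∧ f z = z' := by
    intro z' c hz' hc
    obtain ⟨u₀, rfl⟩ := hs z'
    obtain ⟨q, hq1, hq⟩ := hZ.exists_poly u₀ c
    set u := Polynomial.aeval (R := ℂ) (A := Module.End ℂ S) Z q u₀ with hu
    have hfu : f u = f u₀ := by
      have := aeval_intertwine (W := Z) (W' := Z') f.toLinearMap hfZ q u₀
      rw [AlgHom.toLinearMap_apply, AlgHom.toLinearMap_apply, aeval_apply_of_eigen hc, hq1,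
        one_smul] at this
      exact this
    obtain ⟨y, hy, hyd⟩ := hker (D.d u) (by rw [hf, hfu, hz']) (hD.d_d u)
    obtain ⟨r, hr1, hr⟩ := hZ.exists_poly y c
    set y' := Polynomial.aeval (R := ℂ) (A := Module.End ℂ S) Z r y with hy'
    have hfy : f y' = 0 := by
      have := aeval_intertwine (W := Z) (W' := Z') f.toLinearMap hfZ r y
      rw [AlgHom.toLinearMap_apply, AlgHom.toLinearMap_apply, hy, map_zero] at this
      exact this
    have hdy : D.d y' = D.d u := by
      -- The differential raises the weight by one, so it intertwines `Z` with `Z - 1`. As `d u` is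
      -- an eigenvector of `Z - 1` for the eigenvalue `c`, the polynomial `r` acts on it as the
      -- identity.
      have h1 := aeval_intertwine (W := Z) (W' := (Z - 1 : Module.End ℂ S)) D.d
        (fun v => by
          rw [LinearMap.sub_apply, hdZ, Module.End.one_apply, add_sub_cancel_right]) r y
      rw [hyd] at h1
      have h2 : (Z - 1 : Module.End ℂ S) (D.d u) = c • D.d u := by
        rw [LinearMap.sub_apply, hdZ, Module.End.one_apply, add_sub_cancel_right, hq, map_smul]
      rw [aeval_apply_of_eigen h2, hr1, one_smul] at h1
      exact h1
    refine ⟨u - y', by rw [map_sub, hdy, sub_self], by rw [map_sub, hq, hr, smul_sub], ?_⟩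
    rw [map_sub, hfy, sub_zero, hfu]
  have hlift' : ∀ z' : S', D'.d z' = 0 → ∃ z : S, D.d z = 0 ∧ f z = z' := by
    intro z' hz'
    obtain ⟨u, rfl⟩ := hs z'
    obtain ⟨y, hy, hyd⟩ := hker (D.d u) (by rw [hf, hz']) (hD.d_d u)
    exact ⟨u - y, by rw [map_sub, hyd, sub_self], by rw [map_sub, hy, sub_zero]⟩
  have hbij : Function.Bijective (mapHomology f hf) := by
    constructor
    · rw [injective_iff_map_eq_zero]
      intro h hh
      obtain ⟨z, rfl⟩ := D.homologyClass_surjective h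
      rw [mapHomology_class, ← map_zero D'.homologyClass, hD'.homologyClass_eq_iff] at hh
      obtain ⟨w', hw'⟩ := hh
      obtain ⟨w, rfl⟩ := hs w'
      have hw2 : f z - 0 = D'.d (f w) := hw'
      have hz : D.d z = 0 := z.2
      obtain ⟨y, hy, hyd⟩ := hker (z - D.d w) (by rw [map_sub, hf, ← hw2]; simp)
        (by rw [map_sub, hz, hD.d_d, sub_zero])
      rw [← map_zero D.homologyClass, hD.homologyClass_eq_iff]
      exact ⟨w + y, by rw [map_add, hyd]; simp⟩
    · intro h
      obtain ⟨z', rfl⟩ := D'.homologyClass_surjective h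
      obtain ⟨z, hz, hzz⟩ := hlift' z' z'.2
      exact ⟨D.homologyClass ⟨z, hz⟩, by
        rw [mapHomology_class]; congr 1; exact Subtype.ext hzz⟩
  refine ⟨AlgEquiv.ofBijective (mapHomology f hf) hbij, fun c => ?_⟩
  ext h
  constructor
  · rintro ⟨_, ⟨z, hz, rfl⟩, rfl⟩
    refine ⟨mapCycles f hf z, ?_, ?_⟩
    · have hz' : Z z = c • (z : S) := mem_eigenspace_iff.1 hz
      refine mem_eigenspace_iff.2 ?_
      change Z' (f z) = c • f z
      rw [← hfZ, hz', map_smul]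
    · exact (mapHomology_class f hf z).symm
  · rintro ⟨z', hz', rfl⟩
    obtain ⟨z, hz, hzc, hzz⟩ := hlift z' c z'.2 (mem_eigenspace_iff.1 hz')
    refine ⟨D.homologyClass ⟨z, hz⟩, ⟨⟨z, hz⟩, mem_eigenspace_iff.2 hzc, rfl⟩, ?_⟩
    exact (mapHomology_class f hf _).trans (congrArg D'.homologyClass (Subtype.ext hzz))

end OddDerivation


/-! ### Eigenspaces of weight operators as spans of monomials -/

open scoped TensorProduct

namespace SuperComm

section

variable {R : Type*} [CommRing R] [Algebra ℂ R] {X : Type*} {p : X → ℕ}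

/-- Monomials with a homogeneous coefficient span. -/
theorem eigen_monomial_induction {D : Derivation ℂ R R}
    (hD : Module.End.IsDiagonal (D : R →ₗ[ℂ] R)) {P : SuperComm R p → Prop} (h0 : P 0)
    (hmon : ∀ (r : R) (c : ℂ) (l : List X), D r = c • r →
      P (algebraMap R _ r * (l.map (gen p)).prod))
    (hadd : ∀ a b, P a → P b → P (a + b)) (s : SuperComm R p) : P s := by
  refine monomial_induction h0 (fun r l => ?_) hadd s
  have hr : r ∈ ⨆ μ, Module.End.eigenspace (D : R →ₗ[ℂ] R) μ := by rw [hD]; trivial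
  induction hr using Submodule.iSup_induction' with
  | mem μ x hx => exact hmon x μ l (Module.End.mem_eigenspace_iff.1 hx)
  | zero => simpa using h0
  | add x y _ _ hx hy => rw [map_add, add_mul]; exact hadd _ _ hx hy

theorem weight_isDiagonal {D : Derivation ℂ R R}
    (hD : Module.End.IsDiagonal (D : R →ₗ[ℂ] R)) (w : X → ℂ) :
    Module.End.IsDiagonal (weight D w : SuperComm R p →ₗ[ℂ] SuperComm R p) := by
  rw [Module.End.IsDiagonal, eq_top_iff]
  rintro s -
  induction s using eigen_monomial_induction hD with
  | h0 => exact Submodule.zero_mem _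
  | hmon r c l hr =>
    exact Submodule.mem_iSup_of_mem _ (Module.End.mem_eigenspace_iff.2 (weight_monomial D w hr l))
  | hadd a b ha hb => exact Submodule.add_mem _ ha hb

/-- Monomials with homogeneous coefficient span and are eigenvectors. Those allowed by `P` and `T`
are exactly the ones with eigenvalue `c`; the others lie in the remaining eigenspaces, which are
independent of this one. -/
theorem eigenspace_weight {D : Derivation ℂ R R}
    (hD : Module.End.IsDiagonal (D : R →ₗ[ℂ] R)) (w : X → ℂ) (P : Submodule ℂ R)
    (T : List X → Prop) (c : ℂ)
    (h1 : ∀ r ∈ P, ∀ l, T l → ∃ c', D r = c' • r ∧ c' + (l.map w).sum = c)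
    (h2 : ∀ r ≠ 0, ∀ c' l, D r = c' • r → c' + (l.map w).sum = c → r ∈ P ∧ T l) :
    Module.End.eigenspace (weight D w : SuperComm R p →ₗ[ℂ] SuperComm R p) c =
      monomialSpan p P T := by
  set W : Module.End ℂ (SuperComm R p) := weight D w with hW
  have hle : monomialSpan p P T ≤ Module.End.eigenspace W c := by
    refine Submodule.span_le.2 ?_
    rintro _ ⟨r, hr, l, hl, rfl⟩
    obtain ⟨c', hc', rfl⟩ := h1 r hr l hl
    exact Module.End.mem_eigenspace_iff.2 (weight_monomial D w hc' l)
  refine le_antisymm ?_ hle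
  intro v hv
  have hdec : ∀ v : SuperComm R p, v ∈ monomialSpan p P T ⊔
      ⨆ μ, ⨆ _ : μ ≠ c, Module.End.eigenspace W μ := by
    intro v
    induction v using eigen_monomial_induction hD with
    | h0 => exact Submodule.zero_mem _
    | hmon r c' l hr =>
      by_cases hr0 : r = 0
      · simp [hr0]
      by_cases hc : c' + (l.map w).sum = c
      · obtain ⟨hrP, hl⟩ := h2 r hr0 c' l hr hc
        exact Submodule.mem_sup_left (Submodule.subset_span ⟨r, hrP, l, hl, rfl⟩)
      · exact Submodule.mem_sup_right (Submodule.mem_iSup_of_mem _ (Submodule.mem_iSup_of_mem hc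
          (Module.End.mem_eigenspace_iff.2 (weight_monomial D w hr l))))
    | hadd a b ha hb => exact Submodule.add_mem _ ha hb
  obtain ⟨v₁, hv₁, v₂, hv₂, rfl⟩ := Submodule.mem_sup.1 (hdec v)
  have : v₂ ∈ Module.End.eigenspace W c := by
    have := Submodule.sub_mem _ hv (hle hv₁)
    rwa [add_sub_cancel_left] at this
  have h0 := (Module.End.eigenspaces_iSupIndep W c).le_bot ⟨this, hv₂⟩
  rw [Submodule.mem_bot] at h0
  rwa [h0, add_zero]

end

/-! ### Splitting off generators -/

section Split

variable {R : Type*} [CommRing R] {X₁ X₂ X : Type*} {p₁ : X₁ → ℕ} {p₂ : X₂ → ℕ}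
  {p : X → ℕ} (e : X₁ ⊕ X₂ ≃ X) (h₁ : ∀ x, p (e (Sum.inl x)) = p₁ x)
  (h₂ : ∀ x, p (e (Sum.inr x)) = p₂ x)

/-- The algebra map given by a map of generators. -/
noncomputable def mapGen {X Y : Type*} {p : X → ℕ} {p' : Y → ℕ} (k : X → Y) (hk : ∀ x, p' (k x) = p x) :
    SuperComm R p →ₐ[R] SuperComm R p' :=
  lift (fun x => gen p' (k x)) (fun x y => by rw [← hk, ← hk]; exact gen_mul_gen p' _ _)

theorem mapGen_gen {X Y : Type*} {p : X → ℕ} {p' : Y → ℕ} (k : X → Y) (hk : ∀ x, p' (k x) = p x)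
    (x : X) : mapGen (R := R) k hk (gen p x) = gen p' (k x) := lift_gen _ _ _

theorem neg_one_pow_mul_apply {V : Type*} [AddCommGroup V] [Module R V] (k : ℕ)
    (f : Module.End R V) (v : V) : ((-1) ^ k * f) v = (-1 : R) ^ k • f v := by
  rcases Nat.even_or_odd k with h | h <;> simp [h.neg_one_pow]

theorem gen_mul_gen' (x y : X) :
    (gen p x * gen p y : SuperComm R p) = ((-1) ^ (p x * p y) : R) • (gen p y * gen p x) := by
  rw [gen_mul_gen, Algebra.smul_def, map_pow, map_neg, map_one]

theorem parity_pow_gen' (q : ℕ) (x : X) :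
    ((parity : SuperComm R p →ₐ[R] _) ^ q) (gen p x) = ((-1) ^ (q * p x) : R) • gen p x := by
  rw [parity_pow_gen, Algebra.smul_def, map_pow, map_neg, map_one]

variable [Algebra ℂ R]

variable (R) in
/-- The algebra map over `ℂ` given by a map of generators. -/
noncomputable def mapGenC {X Y : Type*} {p : X → ℕ} {p' : Y → ℕ} (k : X → Y) (hk : ∀ x, p' (k x) = p x) :
    SuperComm ℂ p →ₐ[ℂ] SuperComm R p' :=
  lift (fun x => gen p' (k x)) (fun x y => by rw [← hk, ← hk]; exact gen_mul_gen p' _ _)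

theorem mapGenC_gen {X Y : Type*} {p : X → ℕ} {p' : Y → ℕ} (k : X → Y) (hk : ∀ x, p' (k x) = p x)
    (x : X) : mapGenC R k hk (gen p x) = gen p' (k x) := lift_gen _ _ _

/-- The multiplication map. -/
noncomputable def splitMul : SuperComm R p₁ ⊗[ℂ] SuperComm ℂ p₂ →ₗ[ℂ] SuperComm R p :=
  TensorProduct.lift ((LinearMap.mul ℂ (SuperComm R p)).compl₁₂
    ((mapGen (R := R) (fun x => e (Sum.inl x)) h₁).toLinearMap.restrictScalars ℂ)
    (mapGenC R (fun x => e (Sum.inr x)) h₂).toLinearMap)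

theorem splitMul_tmul (a : SuperComm R p₁) (b : SuperComm ℂ p₂) :
    splitMul e h₁ h₂ (a ⊗ₜ b) =
      mapGen (R := R) (fun x => e (Sum.inl x)) h₁ a * mapGenC R (fun x => e (Sum.inr x)) h₂ b := rfl

/-- The action of the generators on the tensor product. -/
noncomputable def splitAct (p₁ : X₁ → ℕ) (p₂ : X₂ → ℕ) : X₁ ⊕ X₂ → Module.End R (SuperComm R p₁ ⊗[ℂ] SuperComm ℂ p₂)
  | .inl x => TensorProduct.AlgebraTensorModule.map (LinearMap.mulLeft R (gen p₁ x)) LinearMap.id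
  -- Left multiplication of `a · b` by a generator of the second kind has to move it past `a`, which
  -- costs a power of the parity automorphism.
  | .inr x => TensorProduct.AlgebraTensorModule.map (((parity : SuperComm R p₁ →ₐ[R] _) ^ p₂ x).toLinearMap)
      (LinearMap.mulLeft ℂ (gen p₂ x))

/-- These relations let the action extend to the algebra on all generators. Evaluation of that
action at `1 ⊗ 1` inverts the multiplication map. -/
theorem splitAct_comm (z z' : X₁ ⊕ X₂) :
    splitAct (R := R) p₁ p₂ z * splitAct p₁ p₂ z' = (-1) ^ (Sum.elim p₁ p₂ z * Sum.elim p₁ p₂ z') *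
      (splitAct p₁ p₂ z' * splitAct p₁ p₂ z) := by
  have hs : ∀ (k : ℕ) (a : SuperComm R p₁) (b : SuperComm ℂ p₂),
      a ⊗ₜ[ℂ] (((-1 : ℂ) ^ k) • b) = ((-1 : R) ^ k) • (a ⊗ₜ[ℂ] b) := by
    intro k a b
    rcases Nat.even_or_odd k with h | h <;> simp [h.neg_one_pow, TensorProduct.tmul_neg]
  refine TensorProduct.AlgebraTensorModule.ext ?_
  intro a b
  rw [neg_one_pow_mul_apply]
  rcases z with x | x <;> rcases z' with y | y <;> simp only [splitAct, Sum.elim_inl, Sum.elim_inr,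
    Module.End.mul_apply, TensorProduct.AlgebraTensorModule.map_tmul, LinearMap.mulLeft_apply,
    LinearMap.id_apply, AlgHom.toLinearMap_apply]
  · rw [← mul_assoc, gen_mul_gen', smul_mul_assoc, mul_assoc, TensorProduct.smul_tmul']
  · rw [map_mul, parity_pow_gen', smul_mul_assoc, ← TensorProduct.smul_tmul', smul_smul, mul_comm (p₂ y),
      ← mul_pow]
    simp
  · rw [map_mul, parity_pow_gen', smul_mul_assoc, ← TensorProduct.smul_tmul']
  · rw [← AlgHom.mul_apply, ← AlgHom.mul_apply, ← pow_add, ← pow_add, add_comm, ← mul_assoc,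
      gen_mul_gen', smul_mul_assoc, hs, mul_assoc]

/-- The inverse of the multiplication map. -/
noncomputable def splitInvHom : SuperComm R p →ₐ[R] Module.End R (SuperComm R p₁ ⊗[ℂ] SuperComm ℂ p₂) :=
  lift (fun x => splitAct p₁ p₂ (e.symm x)) (fun x y => by
    rw [splitAct_comm]
    have h : ∀ x, p x = Sum.elim p₁ p₂ (e.symm x) := by
      intro x
      obtain ⟨z, rfl⟩ := e.surjective x
      rw [e.symm_apply_apply]
      rcases z with z | z
      · exact h₁ z
      · exact h₂ z
    rw [h, h])

theorem splitInvHom_inl (a b : SuperComm R p₁) (t : SuperComm ℂ p₂) :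
    splitInvHom e h₁ h₂ (mapGen (fun x => e (Sum.inl x)) h₁ a) (b ⊗ₜ t) = (a * b) ⊗ₜ t := by
  induction a using SuperComm.induction generalizing b with
  | hR r => simp [Module.algebraMap_end_apply, Algebra.smul_def]
  | hgen x => rw [mapGen_gen, splitInvHom, lift_gen, e.symm_apply_apply]; rfl
  | hmul a a' ha ha' => rw [map_mul, map_mul, Module.End.mul_apply, ha', ha, mul_assoc]
  | hadd a a' ha ha' => rw [map_add, map_add, LinearMap.add_apply, ha, ha', add_mul, TensorProduct.add_tmul]

theorem splitInvHom_inr (s t : SuperComm ℂ p₂) :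
    splitInvHom e h₁ h₂ (mapGenC R (fun x => e (Sum.inr x)) h₂ s) (1 ⊗ₜ t) = 1 ⊗ₜ (s * t) := by
  induction s using SuperComm.induction generalizing t with
  | hR r =>
    rw [AlgHom.commutes, IsScalarTower.algebraMap_apply ℂ R (SuperComm R p), AlgHom.commutes,
      Module.algebraMap_end_apply, ← Algebra.smul_def, TensorProduct.smul_tmul', TensorProduct.tmul_smul,
      algebraMap_smul, TensorProduct.smul_tmul']
  | hgen x =>
    rw [mapGenC_gen, splitInvHom, lift_gen, e.symm_apply_apply, splitAct,
      TensorProduct.AlgebraTensorModule.map_tmul, AlgHom.toLinearMap_apply, map_one]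
    rfl
  | hmul a a' ha ha' => rw [map_mul, map_mul, Module.End.mul_apply, ha', ha, mul_assoc]
  | hadd a a' ha ha' => rw [map_add, map_add, LinearMap.add_apply, ha, ha', add_mul, TensorProduct.tmul_add]

/-- `SuperComm` on a disjoint union of generators is a tensor product. -/
theorem splitMul_bijective : Function.Bijective (splitMul (R := R) e h₁ h₂) := by
  constructor
  -- Evaluation at `1 ⊗ 1` is a left inverse. Surjectivity is then checked on monomials, one
  -- generator at a time.
  · let g : SuperComm R p →ₗ[ℂ] SuperComm R p₁ ⊗[ℂ] SuperComm ℂ p₂ :=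
      { toFun := fun s => splitInvHom e h₁ h₂ s (1 ⊗ₜ 1)
        map_add' := fun a b => by rw [map_add, LinearMap.add_apply]
        map_smul' := fun c a => by
          rw [← algebraMap_smul R c a, map_smul, LinearMap.smul_apply, algebraMap_smul]
          rfl }
    have : g ∘ₗ splitMul e h₁ h₂ = LinearMap.id := by
      refine TensorProduct.ext' fun a b => ?_
      change splitInvHom e h₁ h₂ (splitMul e h₁ h₂ (a ⊗ₜ b)) (1 ⊗ₜ 1) = a ⊗ₜ b
      rw [splitMul_tmul, map_mul, Module.End.mul_apply, splitInvHom_inr, splitInvHom_inl, mul_one,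
        mul_one]
    exact Function.LeftInverse.injective (g := g) fun x => LinearMap.congr_fun this x
  · intro s
    change s ∈ LinearMap.range (splitMul e h₁ h₂)
    have hgen : ∀ (x : X) (z : SuperComm R p), z ∈ LinearMap.range (splitMul (R := R) e h₁ h₂) →
        gen p x * z ∈ LinearMap.range (splitMul (R := R) e h₁ h₂) := by
      rintro x _ ⟨u, rfl⟩
      induction u using TensorProduct.induction_on with
      | zero => simp
      | add u v hu hv => rw [map_add, mul_add]; exact Submodule.add_mem _ hu hv
      | tmul a b =>
        obtain ⟨z, rfl⟩ := e.surjective x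
        rcases z with z | z
        · refine ⟨(gen p₁ z * a) ⊗ₜ b, ?_⟩
          rw [splitMul_tmul, splitMul_tmul, map_mul, mapGen_gen, mul_assoc]
        · refine ⟨((parity ^ p₂ z : SuperComm R p₁ →ₐ[R] _) a) ⊗ₜ (gen p₂ z * b), ?_⟩
          rw [splitMul_tmul, splitMul_tmul, map_mul, mapGenC_gen, ← mul_assoc, ← mul_assoc]
          congr 1
          clear b
          induction a using SuperComm.induction with
          | hR r => simp [Algebra.commutes]
          | hgen x =>
            rw [parity_pow_gen', map_smul, mapGen_gen, smul_mul_assoc, gen_mul_gen' (e (Sum.inr z)),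
              h₁, h₂]
          | hmul a a' ha ha' => rw [map_mul, map_mul, map_mul, mul_assoc, ha', ← mul_assoc, ha, mul_assoc]
          | hadd a a' ha ha' => simp only [map_add, add_mul, mul_add, ha, ha']
    refine monomial_induction (P := fun s => s ∈ LinearMap.range (splitMul (R := R) e h₁ h₂))
      (Submodule.zero_mem _) ?_ (fun a b ha hb => Submodule.add_mem _ ha hb) s
    intro r l
    induction l with
    | nil => exact ⟨algebraMap R _ r ⊗ₜ 1, by simp [splitMul_tmul]⟩
    | cons x l ih =>
      rw [List.map_cons, List.prod_cons, ← mul_assoc, Algebra.commutes, mul_assoc]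
      exact hgen _ _ ih

end Split

/-- Without generators, `SuperComm R p` is `R`. -/
theorem algebraMap_bijective {R : Type*} [CommRing R] {X : Type*} [IsEmpty X] (p : X → ℕ) :
    Function.Bijective (algebraMap R (SuperComm R p)) := by
  constructor
  · have h : ∀ r, lift (R := R) (p := p) (B := R) (fun x => isEmptyElim x) (fun x => isEmptyElim x)
        (algebraMap R _ r) = r := fun r => AlgHom.commutes _ r
    exact Function.LeftInverse.injective h
  · intro s
    induction s using SuperComm.induction with
    | hR r => exact ⟨r, rfl⟩
    | hgen x => exact isEmptyElim x
    | hmul a b ha hb =>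
      obtain ⟨a, rfl⟩ := ha
      obtain ⟨b, rfl⟩ := hb
      exact ⟨a * b, map_mul _ _ _⟩
    | hadd a b ha hb =>
      obtain ⟨a, rfl⟩ := ha
      obtain ⟨b, rfl⟩ := hb
      exact ⟨a + b, map_add _ _ _⟩

end SuperComm


/-! ### Elements of definite parity and odd derivations given on generators -/

namespace SuperComm

variable {R : Type*} [CommRing R] {X : Type*} {p : X → ℕ}

/-- Elements of parity `q`, which commute with the generators up to the usual sign. -/
structure IsPar (q : ℕ) (a : SuperComm R p) : Prop where
  comm : ∀ y, gen p y * a = ((-1) ^ (p y * q) : R) • (a * gen p y)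
  parity : parity a = ((-1) ^ q : R) • a

theorem isPar_gen (x : X) : IsPar (p x) (gen p x : SuperComm R p) :=
  ⟨fun y => gen_mul_gen' y x, parity_gen' x⟩

theorem isPar_zero (q : ℕ) : IsPar q (0 : SuperComm R p) := ⟨by simp, by simp⟩

theorem isPar_algebraMap (r : R) : IsPar 0 (algebraMap R (SuperComm R p) r) :=
  ⟨by simp [Algebra.commutes], by simp⟩

theorem IsPar.congr {q q' : ℕ} {a : SuperComm R p} (h : IsPar q a) (hq : Even (q + q')) :
    IsPar q' a := by
  have : ∀ k : ℕ, ((-1 : R)) ^ (k * q') = (-1) ^ (k * q) := by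
    intro k
    rcases Nat.even_or_odd k with hk | hk <;> rcases Nat.even_or_odd q with h1 | h1 <;>
    rcases Nat.even_or_odd q' with h2 | h2 <;>
    simp [pow_mul, hk.neg_one_pow, h1.neg_one_pow, h2.neg_one_pow] <;>
    simp [Nat.even_add, h1, h2, Nat.not_even_iff_odd.2] at hq
  refine ⟨fun y => by rw [this]; exact h.comm y, ?_⟩
  have h1 := this 1
  rw [one_mul, one_mul] at h1
  rw [h1]
  exact h.parity

theorem IsPar.add {q : ℕ} {a b : SuperComm R p} (ha : IsPar q a) (hb : IsPar q b) :
    IsPar q (a + b) :=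
  ⟨fun y => by rw [mul_add, ha.comm, hb.comm, add_mul, smul_add],
    by rw [map_add, ha.parity, hb.parity, smul_add]⟩

theorem IsPar.smul {q : ℕ} {a : SuperComm R p} (ha : IsPar q a) (r : R) : IsPar q (r • a) :=
  ⟨fun y => by rw [mul_smul_comm, ha.comm, smul_mul_assoc, smul_comm],
    by rw [map_smul, ha.parity, smul_comm]⟩

theorem IsPar.csmul [Algebra ℂ R] {q : ℕ} {a : SuperComm R p} (ha : IsPar q a) (r : ℂ) :
    IsPar q (r • a) := by
  rw [← algebraMap_smul R]
  exact ha.smul _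

theorem IsPar.sum {ι : Type*} {q : ℕ} {s : Finset ι} {a : ι → SuperComm R p}
    (ha : ∀ i ∈ s, IsPar q (a i)) : IsPar q (∑ i ∈ s, a i) := by
  classical
  induction s using Finset.induction_on with
  | empty => exact isPar_zero q
  | insert i s hi ih =>
    rw [Finset.sum_insert hi]
    exact (ha i (Finset.mem_insert_self i s)).add
      (ih fun j hj => ha j (Finset.mem_insert_of_mem hj))

theorem IsPar.mul {q q' : ℕ} {a b : SuperComm R p} (ha : IsPar q a) (hb : IsPar q' b) :
    IsPar (q + q') (a * b) :=
  ⟨fun y => by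
      rw [← mul_assoc, ha.comm, smul_mul_assoc, mul_assoc, hb.comm, mul_smul_comm, smul_smul,
        mul_assoc, ← pow_add, mul_add],
    by rw [map_mul, ha.parity, hb.parity, smul_mul_smul_comm, pow_add]⟩

theorem IsPar.der_cond {q : ℕ} {x : X} {a : SuperComm R p} (h : IsPar (p x + q) a) (y : X) :
    gen p y * a = (-1) ^ (p y * (p x + q)) * (a * gen p y) := by
  rw [h.comm, Algebra.smul_def, map_pow, map_neg, map_one]

section Der

variable [Algebra ℂ R] (δ : X → SuperComm R p) (hδ : ∀ x, IsPar (p x + 1) (δ x))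

/-- The odd derivation with given values of the correct parity. -/
noncomputable def oddDer : OddDerivation (SuperComm R p) :=
  der δ (fun x y => (hδ x).der_cond y)

theorem oddDer_gen (x : X) : (oddDer δ hδ).d (gen p x) = δ x := der_d_gen _ _ x

theorem oddDer_smul (r : R) (a : SuperComm R p) : (oddDer δ hδ).d (r • a) = r • (oddDer δ hδ).d a :=
  der_d_smul _ _ r a

theorem oddDer_algebraMap (r : R) : (oddDer δ hδ).d (algebraMap R _ r) = 0 :=
  der_d_algebraMap _ _ r

theorem oddDer_mul (a b : SuperComm R p) : (oddDer δ hδ).d (a * b) =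
    (oddDer δ hδ).d a * b + parity a * (oddDer δ hδ).d b := (oddDer δ hδ).leibniz a b

theorem oddDer_gen_mul (x : X) (b : SuperComm R p) : (oddDer δ hδ).d (gen p x * b) =
    δ x * b + ((-1) ^ p x : R) • (gen p x * (oddDer δ hδ).d b) := by
  rw [oddDer_mul, oddDer_gen, parity_gen', smul_mul_assoc]

theorem oddDer_parity (a : SuperComm R p) :
    parity ((oddDer δ hδ).d a) = - (oddDer δ hδ).d (parity a) := by
  induction a using SuperComm.induction with
  | hR r => simp [oddDer_algebraMap]
  | hgen x => rw [oddDer_gen, (hδ x).parity, parity_gen', oddDer_smul, oddDer_gen, pow_succ]; simp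
  | hmul a b ha hb =>
    rw [oddDer_mul, map_add, map_mul, map_mul, ha, hb, map_mul, oddDer_mul, parity_parity]
    simp; abel
  | hadd a b ha hb => rw [map_add, map_add, ha, hb, map_add, map_add, neg_add]

/-- The square of an odd derivation is again a derivation, so it vanishes once it does so on
generators. -/
theorem oddDer_isComplex (hd : ∀ x, (oddDer δ hδ).d (δ x) = 0) : (oddDer δ hδ).IsComplex where
  parity_parity := parity_parity
  parity_d := oddDer_parity δ hδ
  d_d a := by
    induction a using SuperComm.induction with
    | hR r => simp [oddDer_algebraMap]
    | hgen x => rw [oddDer_gen, hd]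
    | hmul a b ha hb =>
      rw [oddDer_mul, map_add, oddDer_mul, oddDer_mul, ha, hb, oddDer_parity]
      simp
    | hadd a b ha hb => rw [map_add, map_add, ha, hb, add_zero]

variable (δ' : X → SuperComm R p) (hδ' : ∀ x, IsPar (p x + 1) (δ' x))

/-- The anticommutator of two odd derivations. -/
noncomputable def anticomm : SuperComm R p →ₗ[ℂ] SuperComm R p :=
  (oddDer δ hδ).d ∘ₗ (oddDer δ' hδ').d + (oddDer δ' hδ').d ∘ₗ (oddDer δ hδ).d

theorem anticomm_apply (a : SuperComm R p) : anticomm δ hδ δ' hδ' a =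
    (oddDer δ hδ).d ((oddDer δ' hδ').d a) + (oddDer δ' hδ').d ((oddDer δ hδ).d a) := rfl

/-- The mixed terms cancel because both derivations anticommute with the parity. For a differential
and a contraction this is the Lie derivative of Cartan's formula. -/
theorem anticomm_mul (a b : SuperComm R p) : anticomm δ hδ δ' hδ' (a * b) =
    anticomm δ hδ δ' hδ' a * b + a * anticomm δ hδ δ' hδ' b := by
  simp only [anticomm_apply, oddDer_mul, map_add, oddDer_parity, parity_parity, add_mul, mul_add,
    neg_mul]
  abel

end Der

end SuperComm

/-! ## Structure constants -/

open SuperComm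

/-- Structure constants of a positively graded Lie superalgebra with respect to a homogeneous
basis. -/
structure LieConstants (X : Type*) where
  deg : X → ℕ
  pos : ∀ x, 0 < deg x
  ball : ℕ → Finset X
  mem_ball : ∀ {x N}, x ∈ ball N ↔ deg x ≤ N
  c : X → X → X → ℂ
  c_deg : ∀ {s t u}, c s t u ≠ 0 → deg s + deg t = deg u
  skew : ∀ s t u, c t s u = -((-1) ^ (deg s * deg t) * c s t u)
  jacobi : ∀ p q t u, ∑ v ∈ ball (deg u), (c p q v * c v t u +
    (-1) ^ (deg p * (deg q + deg t)) * (c q t v * c v p u) +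
    (-1) ^ (deg t * (deg p + deg q)) * (c t p v * c v q u)) = 0

namespace LieConstants

variable {X : Type*} (C : LieConstants X)

/-- The sign in the Chevalley–Eilenberg differential. -/
def sgn (s t : X) : ℂ := (-1) ^ (C.deg s * (C.deg t + 1))

/-- Structure constants vanish unless the degrees add up, so indices of degree greater than `|u|`
contribute nothing. -/
theorem sum_ball {B : Type*} [AddCommGroup B] [Module ℂ B] (u : X) {N : ℕ} (hN : C.deg u ≤ N)
    (k : X → X → ℂ) (f : X → X → B) :
    ∑ s ∈ C.ball N, ∑ t ∈ C.ball N, (k s t * C.c s t u) • f s t =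
      ∑ s ∈ C.ball (C.deg u), ∑ t ∈ C.ball (C.deg u), (k s t * C.c s t u) • f s t := by
  have hsub : C.ball (C.deg u) ⊆ C.ball N := fun x hx =>
    C.mem_ball.2 ((C.mem_ball.1 hx).trans hN)
  have h0 : ∀ s t, (s ∉ C.ball (C.deg u) ∨ t ∉ C.ball (C.deg u)) → C.c s t u = 0 := by
    intro s t h
    by_contra hc
    have := C.c_deg hc
    simp only [C.mem_ball] at h
    omega
  symm
  rw [Finset.sum_subset hsub]
  · refine Finset.sum_congr rfl fun s _ => Finset.sum_subset hsub fun t _ ht => ?_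
    rw [h0 s t (Or.inr ht), mul_zero, zero_smul]
  · intro s _ hs
    refine Finset.sum_eq_zero fun t _ => ?_
    rw [h0 s t (Or.inl hs), mul_zero, zero_smul]

/-- The Chevalley–Eilenberg differential of a generator. -/
noncomputable def ceVal {B : Type*} [Ring B] [Algebra ℂ B] (ξ : X → B) (u : X) : B :=
  ∑ s ∈ C.ball (C.deg u), ∑ t ∈ C.ball (C.deg u), (-(1 / 2) * C.sgn s t * C.c s t u) • (ξ s * ξ t)

theorem ceVal_eq {B : Type*} [Ring B] [Algebra ℂ B] (ξ : X → B) (u : X) {N : ℕ}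
    (hN : C.deg u ≤ N) : C.ceVal ξ u =
      ∑ s ∈ C.ball N, ∑ t ∈ C.ball N, (-(1 / 2) * C.sgn s t * C.c s t u) • (ξ s * ξ t) :=
  (C.sum_ball u hN (fun s t => -(1 / 2) * C.sgn s t) fun s t => ξ s * ξ t).symm

theorem map_ceVal {B B' F : Type*} [Ring B] [Algebra ℂ B] [Ring B'] [Algebra ℂ B']
    [FunLike F B B'] [AlgHomClass F ℂ B B'] (f : F) (ξ : X → B) (u : X) :
    f (C.ceVal ξ u) = C.ceVal (fun x => f (ξ x)) u := by
  simp only [ceVal, map_sum, map_smul, map_mul]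

/-- The Jacobi identity in terms of the dual generators. -/
theorem sum_ceVal_mul {B : Type*} [Ring B] [Algebra ℂ B] (ξ : X → B)
    (hξ : ∀ s t, ξ s * ξ t = ((-1 : ℂ) ^ ((C.deg s + 1) * (C.deg t + 1))) • (ξ t * ξ s)) (u : X) :
    ∑ s ∈ C.ball (C.deg u), ∑ t ∈ C.ball (C.deg u),
      (C.sgn s t * C.c s t u) • (C.ceVal ξ s * ξ t) = 0 := by
  set Bl := C.ball (C.deg u) with hBl
  let J : X → X → X → ℂ := fun p q t => ∑ v ∈ Bl, C.c p q v * C.c v t u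
  let sg : X → X → X → ℂ := fun p q t =>
    (-1) ^ (C.deg p * (C.deg q + 1) + (C.deg p + C.deg q) * (C.deg t + 1))
  let g : X → X → X → B := fun p q t => (sg p q t * J p q t) • (ξ p * ξ q * ξ t)
  have h1 : ∑ s ∈ Bl, ∑ t ∈ Bl, (C.sgn s t * C.c s t u) • (C.ceVal ξ s * ξ t) =
      (-(1 / 2) : ℂ) • ∑ p ∈ Bl, ∑ q ∈ Bl, ∑ t ∈ Bl, g p q t := by
    have e1 : ∀ s ∈ Bl, ∀ t ∈ Bl, (C.sgn s t * C.c s t u) • (C.ceVal ξ s * ξ t) =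
        ∑ p ∈ Bl, ∑ q ∈ Bl, (-(1 / 2) * (sg p q t * (C.c p q s * C.c s t u))) • (ξ p * ξ q * ξ t) := by
      intro s hs t _
      rw [C.ceVal_eq ξ s (C.mem_ball.1 hs), Finset.sum_mul, Finset.smul_sum]
      refine Finset.sum_congr rfl fun p _ => ?_
      rw [Finset.sum_mul, Finset.smul_sum]
      refine Finset.sum_congr rfl fun q _ => ?_
      rw [smul_mul_assoc, smul_smul]
      by_cases hc : C.c p q s = 0
      · simp [hc]
      · have hd := C.c_deg hc
        simp only [sgn, sg, pow_add, hd]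
        congr 1
        ring
    rw [Finset.sum_congr rfl fun s hs => Finset.sum_congr rfl fun t ht => e1 s hs t ht]
    simp only [Finset.smul_sum, g, J, Finset.mul_sum, Finset.sum_smul]
    rw [Finset.sum_comm]
    have : ∀ t ∈ Bl, ∑ s ∈ Bl, ∑ p ∈ Bl, ∑ q ∈ Bl,
        (-(1 / 2) * (sg p q t * (C.c p q s * C.c s t u))) • (ξ p * ξ q * ξ t) =
        ∑ p ∈ Bl, ∑ q ∈ Bl, ∑ s ∈ Bl,
          (-(1 / 2) * (sg p q t * (C.c p q s * C.c s t u))) • (ξ p * ξ q * ξ t) := by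
      intro t _
      rw [Finset.sum_comm]
      exact Finset.sum_congr rfl fun p _ => Finset.sum_comm
    rw [Finset.sum_congr rfl this, Finset.sum_comm]
    refine Finset.sum_congr rfl fun p _ => ?_
    rw [Finset.sum_comm]
    simp only [smul_smul]
  -- The three cyclic rotations are brought to the same monomial `ξ_p ξ_q ξ_t`; the signs produced
  -- are those of the Jacobi identity.
  have h2 : ∀ p q t, g p q t + g q t p + g t p q = 0 := by
    intro p q t
    have x1 : ξ q * ξ t * ξ p = ((-1 : ℂ) ^ ((C.deg p + 1) * (C.deg q + C.deg t))) • (ξ p * ξ q * ξ t) := by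
      rw [mul_assoc, hξ t p, mul_smul_comm, ← mul_assoc, hξ q p, smul_mul_assoc, smul_smul,
        ← pow_add]
      congr 1
      rcases Nat.even_or_odd (C.deg p) with h | h <;> rcases Nat.even_or_odd (C.deg q) with h' | h' <;>
      rcases Nat.even_or_odd (C.deg t) with h'' | h'' <;>
      simp [pow_add, pow_mul, h.neg_one_pow, h'.neg_one_pow, h''.neg_one_pow]
    have x2 : ξ t * ξ p * ξ q = ((-1 : ℂ) ^ ((C.deg t + 1) * (C.deg p + C.deg q))) • (ξ p * ξ q * ξ t) := by
      rw [hξ t p, smul_mul_assoc, mul_assoc, hξ t q, mul_smul_comm, smul_smul, ← mul_assoc,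
        ← pow_add]
      congr 1
      rcases Nat.even_or_odd (C.deg p) with h | h <;> rcases Nat.even_or_odd (C.deg q) with h' | h' <;>
      rcases Nat.even_or_odd (C.deg t) with h'' | h'' <;>
      simp [pow_add, pow_mul, h.neg_one_pow, h'.neg_one_pow, h''.neg_one_pow]
    have hj := C.jacobi p q t u
    rw [Finset.sum_add_distrib, Finset.sum_add_distrib, ← Finset.mul_sum, ← Finset.mul_sum] at hj
    change J p q t + _ * J q t p + _ * J t p q = 0 at hj
    simp only [g]
    rw [x1, x2, smul_smul, smul_smul, ← add_smul, ← add_smul]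
    have : sg p q t * J p q t + sg q t p * J q t p * (-1) ^ ((C.deg p + 1) * (C.deg q + C.deg t)) +
        sg t p q * J t p q * (-1) ^ ((C.deg t + 1) * (C.deg p + C.deg q)) = sg p q t * (J p q t +
        (-1) ^ (C.deg p * (C.deg q + C.deg t)) * J q t p +
        (-1) ^ (C.deg t * (C.deg p + C.deg q)) * J t p q) := by
      simp only [sg]
      rcases Nat.even_or_odd (C.deg p) with h | h <;> rcases Nat.even_or_odd (C.deg q) with h' | h' <;>
      rcases Nat.even_or_odd (C.deg t) with h'' | h'' <;>
      simp [pow_add, pow_mul, h.neg_one_pow, h'.neg_one_pow, h''.neg_one_pow] <;> ring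
    rw [this, hj, mul_zero, zero_smul]
  rw [h1]
  -- Summed over all triples, each rotation has the same total, so three times the sum is a sum of
  -- Jacobi expressions.
  have h3 : (3 : ℂ) • ∑ p ∈ Bl, ∑ q ∈ Bl, ∑ t ∈ Bl, g p q t = 0 := by
    have e2 : ∑ p ∈ Bl, ∑ q ∈ Bl, ∑ t ∈ Bl, g p q t = ∑ p ∈ Bl, ∑ q ∈ Bl, ∑ t ∈ Bl, g q t p := by
      rw [Finset.sum_comm]
      rw [Finset.sum_congr rfl fun q _ => Finset.sum_comm]
      rw [Finset.sum_comm]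
      rw [Finset.sum_congr rfl fun q _ => Finset.sum_comm]
    have e3 : ∑ p ∈ Bl, ∑ q ∈ Bl, ∑ t ∈ Bl, g p q t = ∑ p ∈ Bl, ∑ q ∈ Bl, ∑ t ∈ Bl, g t p q := by
      rw [Finset.sum_comm]
      rw [Finset.sum_congr rfl fun q _ => Finset.sum_comm]
    have : (3 : ℂ) • ∑ p ∈ Bl, ∑ q ∈ Bl, ∑ t ∈ Bl, g p q t =
        ∑ p ∈ Bl, ∑ q ∈ Bl, ∑ t ∈ Bl, g p q t + ∑ p ∈ Bl, ∑ q ∈ Bl, ∑ t ∈ Bl, g q t p +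
          ∑ p ∈ Bl, ∑ q ∈ Bl, ∑ t ∈ Bl, g t p q := by
      rw [← e2, ← e3, show (3 : ℂ) = 1 + 1 + 1 by norm_num, add_smul, add_smul, one_smul]
    rw [this]
    simp only [← Finset.sum_add_distrib, h2, Finset.sum_const_zero]
  rw [(smul_eq_zero.1 h3).resolve_left (by norm_num), smul_zero]

/-- A set `Y` of basis elements which contains with every element all elements of smaller
degree. -/
structure Window (Y : Type*) where
  κ : Y → X
  inv : X → Option Y
  inv_κ : ∀ y, inv (κ y) = some y
  κ_inv : ∀ {x y}, inv x = some y → κ y = x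
  closed : ∀ {x y}, C.deg x ≤ C.deg (κ y) → ∃ y', κ y' = x

end LieConstants


/-! ### The complex of a window and its Lie derivative -/

open SuperComm

namespace LieConstants.Window

variable {X Y : Type*} {C : LieConstants X} (W : C.Window Y)

/-- Parities of the generators `ξ_x` and `η_y`. -/
def par : X ⊕ Y → ℕ := Sum.elim (fun x => C.deg x + 1) (fun y => C.deg (W.κ y))

/-- The algebra generated by `ξ_x` and `η_y`. -/
abbrev Alg : Type _ := SuperComm ℂ W.par

/-- The generators `ξ_x`. -/
noncomputable def ξ (x : X) : W.Alg := gen W.par (Sum.inl x)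

/-- The generators `η_y`. -/
noncomputable def η (y : Y) : W.Alg := gen W.par (Sum.inr y)

/-- The generators `η`, extended by zero. -/
noncomputable def ηx (x : X) : W.Alg := (W.inv x).elim 0 W.η

theorem ηx_κ (y : Y) : W.ηx (W.κ y) = W.η y := by rw [ηx, W.inv_κ]; rfl

theorem isPar_ξ (x : X) : IsPar (R := ℂ) (C.deg x + 1) (W.ξ x) :=
  isPar_gen (p := W.par) (Sum.inl x)

theorem isPar_η (y : Y) : IsPar (R := ℂ) (C.deg (W.κ y)) (W.η y) :=
  isPar_gen (p := W.par) (Sum.inr y)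

theorem isPar_ηx (x : X) : IsPar (R := ℂ) (C.deg x) (W.ηx x) := by
  rw [ηx]
  cases h : W.inv x with
  | none => exact isPar_zero _
  | some y => rw [← W.κ_inv h]; exact W.isPar_η y

theorem ξ_ξ (s t : X) : W.ξ s * W.ξ t =
    ((-1 : ℂ) ^ ((C.deg s + 1) * (C.deg t + 1))) • (W.ξ t * W.ξ s) := gen_mul_gen' _ _

theorem ξ_ηx (s t : X) : W.ξ s * W.ηx t =
    ((-1 : ℂ) ^ ((C.deg s + 1) * C.deg t)) • (W.ηx t * W.ξ s) := (W.isPar_ηx t).comm _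

theorem ηx_ξ (s t : X) : W.ηx s * W.ξ t =
    ((-1 : ℂ) ^ (C.deg s * (C.deg t + 1))) • (W.ξ t * W.ηx s) := by
  rw [ξ_ηx, smul_smul, mul_comm (C.deg s), ← mul_pow]; simp

theorem isPar_ceVal (u : X) : IsPar (R := ℂ) (C.deg u) (C.ceVal W.ξ u) := by
  refine IsPar.sum fun s _ => IsPar.sum fun t _ => ?_
  by_cases hc : C.c s t u = 0
  · rw [hc, mul_zero, zero_smul]; exact isPar_zero _
  · refine IsPar.smul (((W.isPar_ξ s).mul (W.isPar_ξ t)).congr ?_) _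
    rw [← C.c_deg hc]
    exact ⟨C.deg s + C.deg t + 1, by ring⟩

/-- The linear part `∑ |s| c_{st}^u ξ_t η_s` in the differential of `η_u`. -/
noncomputable def conn (u : X) : W.Alg :=
  ∑ s ∈ C.ball (C.deg u), ∑ t ∈ C.ball (C.deg u),
    ((C.deg s : ℂ) * C.c s t u) • (W.ξ t * W.ηx s)

theorem isPar_conn (u : X) : IsPar (R := ℂ) (C.deg u + 1) (W.conn u) := by
  refine IsPar.sum fun s _ => IsPar.sum fun t _ => ?_
  by_cases hc : C.c s t u = 0
  · rw [hc, mul_zero, zero_smul]; exact isPar_zero _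
  · refine IsPar.smul (((W.isPar_ξ t).mul (W.isPar_ηx s)).congr ?_) _
    rw [← C.c_deg hc]
    exact ⟨C.deg s + C.deg t + 1, by ring⟩

/-- The values of the differential. -/
noncomputable def dVal : X ⊕ Y → W.Alg :=
  -- With `η = |y|⁻¹ ι ξ` and `ξ` of weight `|y|`, Cartan's formula leaves no choice: `dη = ξ -
  -- |y|⁻¹ ι dξ`, and `conn` equals `-ι dξ`.
  Sum.elim (C.ceVal W.ξ) fun y => W.ξ (W.κ y) + ((C.deg (W.κ y) : ℂ)⁻¹) • W.conn (W.κ y)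

/-- The values of the contraction with the Euler field. -/
noncomputable def iVal : X ⊕ Y → W.Alg := Sum.elim (fun x => (C.deg x : ℂ) • W.ηx x) fun _ => 0

theorem isPar_dVal (z : X ⊕ Y) : IsPar (R := ℂ) (W.par z + 1) (W.dVal z) := by
  rcases z with x | y
  · exact (W.isPar_ceVal x).congr ⟨C.deg x + 1, by simp [par]; ring⟩
  · exact (W.isPar_ξ _).add ((W.isPar_conn _).smul _)

theorem isPar_iVal (z : X ⊕ Y) : IsPar (R := ℂ) (W.par z + 1) (W.iVal z) := by
  rcases z with x | y
  · exact ((W.isPar_ηx x).smul _).congr ⟨C.deg x + 1, by simp [par]; ring⟩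
  · exact isPar_zero _

/-- The differential. -/
noncomputable def diff : OddDerivation W.Alg := oddDer W.dVal W.isPar_dVal

/-- The contraction with the Euler field. -/
noncomputable def contr : OddDerivation W.Alg := oddDer W.iVal W.isPar_iVal

theorem diff_ξ (x : X) : W.diff.d (W.ξ x) = C.ceVal W.ξ x := oddDer_gen _ _ _

theorem diff_η (y : Y) : W.diff.d (W.η y) =
    W.ξ (W.κ y) + ((C.deg (W.κ y) : ℂ)⁻¹) • W.conn (W.κ y) := oddDer_gen _ _ _

theorem contr_ξ (x : X) : W.contr.d (W.ξ x) = (C.deg x : ℂ) • W.ηx x := oddDer_gen _ _ _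

theorem contr_η (y : Y) : W.contr.d (W.η y) = 0 := oddDer_gen _ _ _

theorem contr_ηx (x : X) : W.contr.d (W.ηx x) = 0 := by
  rw [ηx]
  cases h : W.inv x with
  | none => exact map_zero _
  | some y => exact W.contr_η y

theorem contr_isComplex : W.contr.IsComplex := by
  refine oddDer_isComplex _ _ ?_
  rintro (x | y)
  · change W.contr.d ((C.deg x : ℂ) • W.ηx x) = 0
    rw [map_smul, contr_ηx, smul_zero]
  · exact map_zero _

theorem diff_ξ_mul (x : X) (b : W.Alg) : W.diff.d (W.ξ x * b) =
    C.ceVal W.ξ x * b + ((-1 : ℂ) ^ (C.deg x + 1)) • (W.ξ x * W.diff.d b) :=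
  oddDer_gen_mul _ _ _ _

theorem contr_ξ_mul (x : X) (b : W.Alg) : W.contr.d (W.ξ x * b) =
    (C.deg x : ℂ) • (W.ηx x * b) + ((-1 : ℂ) ^ (C.deg x + 1)) • (W.ξ x * W.contr.d b) := by
  rw [← smul_mul_assoc]
  exact oddDer_gen_mul _ _ _ _

/-- By skew-symmetry of the structure constants the two factors of the products `ξ_s ξ_t` contribute
equal sums, which cancels the factor `½`. -/
theorem contr_ceVal (u : X) : W.contr.d (C.ceVal W.ξ u) = - W.conn u := by
  have h1 : W.contr.d (C.ceVal W.ξ u) =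
      ∑ s ∈ C.ball (C.deg u), ∑ t ∈ C.ball (C.deg u), (-(1 / 2) * C.deg s * C.c s t u : ℂ) • (W.ξ t * W.ηx s) +
      ∑ s ∈ C.ball (C.deg u), ∑ t ∈ C.ball (C.deg u), (-(1 / 2) * C.deg t * C.c t s u : ℂ) • (W.ξ s * W.ηx t) := by
    simp only [ceVal, map_sum, map_smul, ← Finset.sum_add_distrib]
    refine Finset.sum_congr rfl fun s _ => Finset.sum_congr rfl fun t _ => ?_
    rw [contr_ξ_mul, contr_ξ, ηx_ξ, smul_add, smul_smul, smul_smul, mul_smul_comm, smul_smul,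
      smul_smul, C.skew s t]
    congr 2
    · simp only [sgn]
      rcases neg_one_pow_eq_or ℂ (C.deg s * (C.deg t + 1)) with h | h <;> rw [h] <;> ring
    · simp only [sgn]
      rcases Nat.even_or_odd (C.deg s) with h | h <;> rcases Nat.even_or_odd (C.deg t) with h' | h' <;>
      simp [pow_add, pow_mul, h.neg_one_pow, h'.neg_one_pow] <;> ring
  rw [h1, Finset.sum_comm (s := C.ball (C.deg u)) (t := C.ball (C.deg u))
    (f := fun s t => (-(1 / 2) * C.deg t * C.c t s u : ℂ) • (W.ξ s * W.ηx t)), conn,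
    ← Finset.sum_add_distrib, ← Finset.sum_neg_distrib]
  refine Finset.sum_congr rfl fun s _ => ?_
  rw [← Finset.sum_add_distrib, ← Finset.sum_neg_distrib]
  refine Finset.sum_congr rfl fun t _ => ?_
  rw [← add_smul, ← neg_smul]
  congr 1
  ring

theorem contr_conn (u : X) : W.contr.d (W.conn u) = 0 := by
  have := W.contr_isComplex.d_d (C.ceVal W.ξ u)
  rw [contr_ceVal, map_neg, neg_eq_zero] at this
  exact this

/-- The Lie derivative along the Euler field. -/
noncomputable def lie : W.Alg →ₗ[ℂ] W.Alg := anticomm W.dVal W.isPar_dVal W.iVal W.isPar_iVal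

theorem lie_apply (a : W.Alg) : W.lie a = W.diff.d (W.contr.d a) + W.contr.d (W.diff.d a) := rfl

theorem lie_mul (a b : W.Alg) : W.lie (a * b) = W.lie a * b + a * W.lie b := anticomm_mul _ _ _ _ a b

theorem deg_ne_zero (x : X) : (C.deg x : ℂ) ≠ 0 := Nat.cast_ne_zero.2 (C.pos x).ne'

theorem lie_η (y : Y) : W.lie (W.η y) = (C.deg (W.κ y) : ℂ) • W.η y := by
  rw [lie_apply, contr_η, map_zero, zero_add, diff_η, map_add, contr_ξ, map_smul, contr_conn,
    smul_zero, add_zero, ηx_κ]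

theorem lie_ξ (x : X) : W.lie (W.ξ x) = (C.deg x : ℂ) • W.diff.d (W.ηx x) - W.conn x := by
  rw [lie_apply, contr_ξ, map_smul, diff_ξ, contr_ceVal, sub_eq_add_neg]

/-- The term `conn` in `dη` cancels the one coming from `ι dξ`. Outside the window `ηx` is zero and
`-conn` is left over; this is the strictly triangular part of the Lie derivative met below. -/
theorem lie_ξ_κ (y : Y) : W.lie (W.ξ (W.κ y)) = (C.deg (W.κ y) : ℂ) • W.ξ (W.κ y) := by
  rw [lie_ξ, ηx_κ, diff_η, smul_add, smul_smul, mul_inv_cancel₀ (deg_ne_zero _), one_smul,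
    add_sub_cancel_right]

/-- This is `d²ξ = 0`: both halves of the Leibniz rule reduce to the sum that vanishes by the Jacobi
identity. -/
theorem diff_ceVal (u : X) : W.diff.d (C.ceVal W.ξ u) = 0 := by
  have h0 := C.sum_ceVal_mul W.ξ W.ξ_ξ u
  have h1 : W.diff.d (C.ceVal W.ξ u) =
      ∑ s ∈ C.ball (C.deg u), ∑ t ∈ C.ball (C.deg u),
        (-(1 / 2) * (C.sgn s t * C.c s t u)) • (C.ceVal W.ξ s * W.ξ t) +
      ∑ s ∈ C.ball (C.deg u), ∑ t ∈ C.ball (C.deg u),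
        (-(1 / 2) * (C.sgn t s * C.c t s u)) • (C.ceVal W.ξ t * W.ξ s) := by
    conv_lhs => rw [ceVal]
    simp only [map_sum, map_smul, ← Finset.sum_add_distrib]
    refine Finset.sum_congr rfl fun s _ => Finset.sum_congr rfl fun t _ => ?_
    have hc : W.ξ s * C.ceVal W.ξ t = ((-1 : ℂ) ^ ((C.deg s + 1) * C.deg t)) • (C.ceVal W.ξ t * W.ξ s) :=
      (W.isPar_ceVal t).comm (Sum.inl s)
    rw [diff_ξ_mul, diff_ξ, smul_add, hc, smul_smul, smul_smul, C.skew s t]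
    congr 2
    · ring
    · simp only [sgn]
      rcases Nat.even_or_odd (C.deg s) with h | h <;> rcases Nat.even_or_odd (C.deg t) with h' | h' <;>
      simp [pow_add, pow_mul, h.neg_one_pow, h'.neg_one_pow]
  rw [h1, Finset.sum_comm (s := C.ball (C.deg u)) (t := C.ball (C.deg u))
    (f := fun s t => (-(1 / 2) * (C.sgn t s * C.c t s u)) • (C.ceVal W.ξ t * W.ξ s))]
  simp only [mul_smul (-(1 / 2) : ℂ), ← Finset.smul_sum, h0, smul_zero, add_zero]

/-- Since windows are closed downwards, all indices in the sum lie in the window, where the Lie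
derivative multiplies `ξ` by its degree. -/
theorem lie_ceVal (y : Y) : W.lie (C.ceVal W.ξ (W.κ y)) = (C.deg (W.κ y) : ℂ) • C.ceVal W.ξ (W.κ y) := by
  rw [ceVal, map_sum, Finset.smul_sum]
  refine Finset.sum_congr rfl fun s hs => ?_
  rw [map_sum, Finset.smul_sum]
  refine Finset.sum_congr rfl fun t ht => ?_
  obtain ⟨s, rfl⟩ := W.closed (C.mem_ball.1 hs)
  obtain ⟨t, rfl⟩ := W.closed (C.mem_ball.1 ht)
  by_cases hc : C.c (W.κ s) (W.κ t) (W.κ y) = 0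
  · simp [hc]
  · rw [map_smul, lie_mul, lie_ξ_κ, lie_ξ_κ, ← C.c_deg hc, smul_comm, smul_mul_assoc, mul_smul_comm,
      ← add_smul]
    push_cast
    rfl

theorem diff_isComplex : W.diff.IsComplex := by
  refine oddDer_isComplex _ _ ?_
  rintro (x | y)
  · exact W.diff_ceVal x
  · change W.diff.d (W.ξ (W.κ y) + ((C.deg (W.κ y) : ℂ)⁻¹) • W.conn (W.κ y)) = 0
    -- Cartan's formula applied to the closed element `dξ` gives `d(conn) = -|y| dξ`, which is
    -- exactly what `d²η = 0` requires.
    have h := W.lie_ceVal y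
    rw [lie_apply, diff_ceVal, map_zero, add_zero, contr_ceVal, map_neg] at h
    rw [map_add, map_smul, diff_ξ, ← neg_neg (W.diff.d (W.conn _)), h, smul_neg, smul_smul,
      inv_mul_cancel₀ (deg_ne_zero _), one_smul, add_neg_cancel]

end LieConstants.Window


/-! ### Projection of a window complex to the Chevalley–Eilenberg complex of the remaining degrees
-/

open SuperComm

namespace LieConstants

variable {X : Type*} (C : LieConstants X)

/-- The window consisting of all basis elements. -/
def full : C.Window X where
  κ := id
  inv := some
  inv_κ _ := rfl
  κ_inv h := (Option.some.inj h).symm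
  closed {x} _ _ := ⟨x, rfl⟩

/-- The window given by a summand of smaller degrees. -/
def ofSum {Y X' : Type*} (C : LieConstants (Y ⊕ X'))
    (h : ∀ y x, C.deg (Sum.inl y) < C.deg (Sum.inr x)) : C.Window Y where
  κ := Sum.inl
  inv := Sum.elim some fun _ => none
  inv_κ _ := rfl
  κ_inv {x y} hx := by
    rcases x with x | x
    · exact congrArg Sum.inl (Option.some.inj hx).symm
    · cases hx
  closed {x y} hx := by
    rcases x with x | x
    · exact ⟨x, rfl⟩
    · exact absurd (h y x) (not_lt.2 hx)

theorem Window.lie_diff {Y : Type*} {C : LieConstants X} (W : C.Window Y) (a : W.Alg) :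
    W.diff.d (W.lie a) = W.lie (W.diff.d a) := by
  rw [Window.lie_apply, Window.lie_apply, map_add, W.diff_isComplex.d_d, W.diff_isComplex.d_d,
    map_zero, zero_add, add_zero]

open Polynomial in
/-- A cycle which is annihilated by a polynomial of the Lie derivative with non-zero constant
coefficient is a boundary of a contraction. -/
theorem Window.exists_of_aeval_lie {Y : Type*} {C : LieConstants X} (W : C.Window Y) {z : W.Alg}
    (hz : W.diff.d z = 0) {q : ℂ[X]} (hq : q.coeff 0 ≠ 0)
    (h : aeval (A := Module.End ℂ W.Alg) W.lie q z = 0) : ∃ y, W.diff.d (W.contr.d y) = z := by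
  set L : Module.End ℂ W.Alg := W.lie with hL
  have hd : W.diff.d (aeval L q.divX z) = 0 := by
    rw [Module.End.aeval_intertwine (W := L) (W' := L) W.diff.d W.lie_diff, hz, map_zero]
  -- Writing `q = X q' + q(0)`, the hypothesis reads `q(0) z = -L q'(L) z`. As `q'(L) z` is closed,
  -- `L` acts on it as `d ι`.
  rw [← Polynomial.X_mul_divX_add q, map_add, map_mul, aeval_X, aeval_C, LinearMap.add_apply,
    Module.End.mul_apply, Module.algebraMap_end_apply, hL, Window.lie_apply, ← hL, hd, map_zero,
    add_zero] at h
  refine ⟨-(q.coeff 0)⁻¹ • aeval L q.divX z, ?_⟩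
  rw [map_smul, map_smul, eq_neg_of_add_eq_zero_left h, smul_neg, neg_smul, neg_neg, smul_smul,
    inv_mul_cancel₀ hq, one_smul]

section Contraction

variable {Y X' : Type*} (C : LieConstants (Y ⊕ X'))
    (h : ∀ y x, C.deg (Sum.inl y) < C.deg (Sum.inr x))

/-- The total weight of a generator. -/
def totalWeight : (Y ⊕ X') ⊕ Y → ℕ := Sum.elim C.deg fun y => C.deg (Sum.inl y)

/-- The weight of a generator which counts only the basis elements of the window. -/
def windowWeight : (Y ⊕ X') ⊕ Y → ℕ :=
  Sum.elim (Sum.elim (fun y => C.deg (Sum.inl y)) fun _ => 0) fun y => C.deg (Sum.inl y)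

/-- The span of monomials of bounded total weight and window weight. -/
noncomputable def monomials (a b : ℕ) : Submodule ℂ (C.ofSum h).Alg :=
  Submodule.span ℂ {z | ∃ l : List ((Y ⊕ X') ⊕ Y), (l.map C.totalWeight).sum ≤ a ∧
    b ≤ (l.map C.windowWeight).sum ∧ z = (l.map (gen (C.ofSum h).par)).prod}

theorem monomials_mono {a a' b b' : ℕ} (ha : a ≤ a') (hb : b' ≤ b) :
    C.monomials h a b ≤ C.monomials h a' b' :=
  Submodule.span_mono fun _ ⟨l, h1, h2, h3⟩ => ⟨l, h1.trans ha, hb.trans h2, h3⟩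

theorem mul_mem_monomials {a a' b b' : ℕ} {z z' : (C.ofSum h).Alg} (hz : z ∈ C.monomials h a b)
    (hz' : z' ∈ C.monomials h a' b') : z * z' ∈ C.monomials h (a + a') (b + b') := by
  have := Submodule.mul_mem_mul hz hz'
  rw [monomials, monomials, Submodule.span_mul_span] at this
  refine Submodule.span_mono ?_ this
  rintro _ ⟨_, ⟨l, h1, h2, rfl⟩, _, ⟨l', h3, h4, rfl⟩, rfl⟩
  exact ⟨l ++ l', by simpa using add_le_add h1 h3, by simpa using add_le_add h2 h4, by simp⟩

theorem gen_mem_monomials (x : (Y ⊕ X') ⊕ Y) :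
    gen (C.ofSum h).par x ∈ C.monomials h (C.totalWeight x) (C.windowWeight x) :=
  Submodule.subset_span ⟨[x], by simp, by simp, by simp⟩

/-- `ηx` vanishes outside the window, so every surviving term contains some `η` of the window, which
has positive window weight. -/
theorem conn_mem_monomials (u : Y ⊕ X') : (C.ofSum h).conn u ∈ C.monomials h (C.deg u) 1 := by
  refine Submodule.sum_mem _ fun s _ => Submodule.sum_mem _ fun t _ => ?_
  by_cases hc : C.c s t u = 0
  · rw [hc, mul_zero, zero_smul]; exact Submodule.zero_mem _
  refine Submodule.smul_mem _ _ ?_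
  rcases s with s | s
  · have h1 : (C.ofSum h).ηx (Sum.inl s) = gen (C.ofSum h).par (Sum.inr s) := rfl
    rw [h1]
    refine C.monomials_mono h ?_ ?_ (C.mul_mem_monomials h (C.gen_mem_monomials h (Sum.inl t))
      (C.gen_mem_monomials h (Sum.inr s)))
    · rw [← C.c_deg hc, add_comm]; rfl
    · exact (C.pos (Sum.inl s)).trans_le (Nat.le_add_left _ _)
  · have h1 : (C.ofSum h).ηx (Sum.inr s) = 0 := rfl
    rw [h1, mul_zero]; exact Submodule.zero_mem _

/-- Triangularity: on generators of the window the Lie derivative is multiplication by the weight.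
On an outer `ξ`, of window weight zero, it is `-conn`, which has the same total weight and larger
window weight. -/
theorem lie_gen_sub_mem (x : (Y ⊕ X') ⊕ Y) :
    (C.ofSum h).lie (gen (C.ofSum h).par x) - (C.windowWeight x : ℂ) • gen (C.ofSum h).par x ∈
      C.monomials h (C.totalWeight x) (C.windowWeight x + 1) := by
  rcases x with (x | x) | x
  · have := (C.ofSum h).lie_ξ_κ x
    change (C.ofSum h).lie ((C.ofSum h).ξ (Sum.inl x)) = (C.deg (Sum.inl x) : ℂ) • (C.ofSum h).ξ (Sum.inl x) at this
    change (C.ofSum h).lie ((C.ofSum h).ξ (Sum.inl x)) - (C.deg (Sum.inl x) : ℂ) • (C.ofSum h).ξ (Sum.inl x) ∈ _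
    rw [this, sub_self]; exact Submodule.zero_mem _
  · have h1 := (C.ofSum h).lie_ξ (Sum.inr x)
    have h2 : (C.ofSum h).ηx (Sum.inr x) = 0 := rfl
    rw [h2, map_zero, smul_zero, zero_sub] at h1
    have h3 : (C.windowWeight (Sum.inl (Sum.inr x)) : ℂ) = 0 := Nat.cast_zero
    rw [h3, zero_smul, sub_zero]
    change (C.ofSum h).lie ((C.ofSum h).ξ (Sum.inr x)) ∈ _
    rw [h1]
    exact Submodule.neg_mem _ (C.conn_mem_monomials h _)
  · have := (C.ofSum h).lie_η x
    change (C.ofSum h).lie ((C.ofSum h).η x) - (C.deg (Sum.inl x) : ℂ) • (C.ofSum h).η x ∈ _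
    rw [this]
    change (C.deg (Sum.inl x) : ℂ) • (C.ofSum h).η x - _ ∈ _
    rw [sub_self]; exact Submodule.zero_mem _

theorem lie_monomial_sub_mem (l : List ((Y ⊕ X') ⊕ Y)) :
    (C.ofSum h).lie (l.map (gen (C.ofSum h).par)).prod -
      ((l.map C.windowWeight).sum : ℂ) • (l.map (gen (C.ofSum h).par)).prod ∈
      C.monomials h (l.map C.totalWeight).sum ((l.map C.windowWeight).sum + 1) := by
  induction l with
  | nil =>
    have : (C.ofSum h).lie 1 = 0 := by
      rw [Window.lie_apply, OddDerivation.d_one, OddDerivation.d_one, map_zero, map_zero, add_zero]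
    simp [this]
  | cons x l ih =>
    have hl : (l.map (gen (C.ofSum h).par)).prod ∈
        C.monomials h (l.map C.totalWeight).sum (l.map C.windowWeight).sum :=
      Submodule.subset_span ⟨l, le_rfl, le_rfl, rfl⟩
    simp only [List.map_cons, List.prod_cons, List.sum_cons]
    rw [Window.lie_mul]
    have h1 := C.mul_mem_monomials h (C.lie_gen_sub_mem h x) hl
    have h2 := C.mul_mem_monomials h (C.gen_mem_monomials h x) ih
    rw [add_right_comm] at h1
    rw [← add_assoc] at h2
    convert Submodule.add_mem _ h1 h2 using 1
    rw [sub_mul, mul_sub, Nat.cast_add, add_smul, smul_mul_assoc, mul_smul_comm]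
    abel

theorem lie_sub_mem {a b : ℕ} {z : (C.ofSum h).Alg} (hz : z ∈ C.monomials h a b) :
    (C.ofSum h).lie z - (b : ℂ) • z ∈ C.monomials h a (b + 1) := by
  induction hz using Submodule.span_induction with
  | mem z hz =>
    obtain ⟨l, h1, h2, rfl⟩ := hz
    have h3 := C.monomials_mono h h1 (Nat.succ_le_succ h2) (C.lie_monomial_sub_mem h l)
    rcases h2.eq_or_lt with h4 | h4
    · rwa [← h4] at h3
    · have hl : (l.map (gen (C.ofSum h).par)).prod ∈ C.monomials h a (b + 1) :=
        Submodule.subset_span ⟨l, h1, h4, rfl⟩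
      convert Submodule.add_mem _ h3 (Submodule.smul_mem _
        (((l.map C.windowWeight).sum : ℂ) - b) hl) using 1
      rw [sub_smul]; abel
  | zero => simp
  | add x y _ _ hx hy =>
    convert Submodule.add_mem _ hx hy using 1
    rw [map_add, smul_add]; abel
  | smul c x _ hx =>
    convert Submodule.smul_mem _ c hx using 1
    rw [map_smul, smul_sub, smul_comm]

/-- The window weight of a monomial never exceeds its total weight, so the filtration by window
weight is finite for bounded total weight. -/
theorem monomials_eq_bot {a b : ℕ} (hab : a < b) : C.monomials h a b = ⊥ := by
  rw [eq_bot_iff, monomials, Submodule.span_le]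
  rintro _ ⟨l, h1, h2, rfl⟩
  exfalso
  have : (l.map C.windowWeight).sum ≤ (l.map C.totalWeight).sum := by
    refine List.sum_le_sum fun x _ => ?_
    rcases x with (x | x) | x
    · exact le_rfl
    · exact Nat.zero_le _
    · exact le_rfl
  omega

-- Each factor `L - b` raises the window weight by one, so the product of the factors from `b` up to
-- `a` annihilates the space. The number `k` bounds the steps that are left, and `b > 0` keeps the
-- constant coefficient away from zero.
open Polynomial in
theorem exists_aeval_lie (a k : ℕ) : ∀ b, 0 < b → a < b + k → ∀ z ∈ C.monomials h a b,
    ∃ q : ℂ[X], q.coeff 0 ≠ 0 ∧ aeval (A := Module.End ℂ (C.ofSum h).Alg) (C.ofSum h).lie q z = 0 := by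
  induction k with
  | zero =>
    intro b _ hab z hz
    rw [C.monomials_eq_bot h (by omega)] at hz
    exact ⟨1, by simp, by rw [(Submodule.mem_bot ℂ).1 hz, map_zero]⟩
  | succ k ih =>
    intro b hb hab z hz
    obtain ⟨q, hq, hqz⟩ := ih (b + 1) (by omega) (by omega) _ (C.lie_sub_mem h hz)
    refine ⟨q * (X - Polynomial.C (b : ℂ)), ?_, ?_⟩
    · rw [mul_coeff_zero, coeff_sub, coeff_X_zero, coeff_C_zero, zero_sub]
      exact mul_ne_zero hq (neg_ne_zero.2 (Nat.cast_ne_zero.2 hb.ne'))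
    · rw [map_mul, Module.End.mul_apply, map_sub, aeval_X, aeval_C, LinearMap.sub_apply,
        Module.algebraMap_end_apply]
      exact hqz

variable {p' : X' → ℕ}
  (hp : ∀ x, p' x = C.deg (Sum.inr x) + 1)

/-- The values of the projection on the generators. -/
noncomputable def projVal (Y : Type*) {X' : Type*} (p' : X' → ℕ) : (Y ⊕ X') ⊕ Y → SuperComm ℂ p' :=
  Sum.elim (Sum.elim (fun _ => 0) (gen p')) fun _ => 0

include hp in
theorem projVal_comm (z z' : (Y ⊕ X') ⊕ Y) : projVal Y p' z * projVal Y p' z' =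
    (-1) ^ ((C.ofSum h).par z * (C.ofSum h).par z') * (projVal Y p' z' * projVal Y p' z) := by
  rcases z with (x | x) | x <;> rcases z' with (y | y) | y <;> simp [projVal]
  have := gen_mul_gen (R := ℂ) p' x y
  rw [hp, hp] at this
  exact this

/-- The projection killing the generators of the window. -/
noncomputable def proj : (C.ofSum h).Alg →ₐ[ℂ] SuperComm ℂ p' :=
  lift (projVal Y p') (C.projVal_comm h hp)

theorem proj_gen (z : (Y ⊕ X') ⊕ Y) : C.proj h hp (gen _ z) = projVal Y p' z :=
  lift_gen _ _ _

/-- On generators the contraction yields zero or a multiple of some `η` of the window. Hence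
primitives found as contractions lie in the kernel of `proj` automatically. -/
theorem proj_contr (a : (C.ofSum h).Alg) : C.proj h hp ((C.ofSum h).contr.d a) = 0 := by
  induction a using SuperComm.induction with
  | hR r => rw [Window.contr, oddDer_algebraMap, map_zero]
  | hgen x =>
    rcases x with (x | x) | x
    · have := (C.ofSum h).contr_ξ (Sum.inl x)
      change C.proj h hp ((C.ofSum h).contr.d ((C.ofSum h).ξ (Sum.inl x))) = 0
      rw [this, map_smul]
      change _ • C.proj h hp (gen _ (Sum.inr x)) = 0
      rw [proj_gen]; exact smul_zero _
    · have := (C.ofSum h).contr_ξ (Sum.inr x)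
      change C.proj h hp ((C.ofSum h).contr.d ((C.ofSum h).ξ (Sum.inr x))) = 0
      rw [this, map_smul]
      change _ • C.proj h hp 0 = 0
      simp
    · change C.proj h hp ((C.ofSum h).contr.d ((C.ofSum h).η x)) = 0
      rw [Window.contr_η, map_zero]
  | hmul a b ha hb =>
    rw [(C.ofSum h).contr.leibniz, map_add, map_mul, map_mul, ha, hb, zero_mul, mul_zero, add_zero]
  | hadd a b ha hb => rw [map_add, map_add, ha, hb, add_zero]

include hp in
/-- The section of the projection. -/
theorem exists_proj_section : ∃ s : SuperComm ℂ p' →ₐ[ℂ] (C.ofSum h).Alg,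
    ∀ x, s (gen p' x) = (C.ofSum h).ξ (Sum.inr x) := by
  refine ⟨mapGen (fun x => Sum.inl (Sum.inr x)) (fun x => ?_), fun x => mapGen_gen _ _ x⟩
  rw [hp]; rfl

theorem mul_sub_mem_monomials {a a' : ℕ} {x m n n' : (C.ofSum h).Alg} (hx : x ∈ C.monomials h a 0)
    (hm : m - n ∈ C.monomials h a' 1) (hm' : m ∈ C.monomials h a' 0)
    (hn : n' = x ∨ n' = 0 ∧ x ∈ C.monomials h a 1) : x * m - n' * n ∈ C.monomials h (a + a') 1 := by
  rcases hn with rfl | ⟨rfl, h1⟩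
  · rw [← mul_sub]
    exact C.monomials_mono h le_rfl (Nat.zero_add 1).ge (C.mul_mem_monomials h hx hm)
  · rw [zero_mul, sub_zero]
    exact C.monomials_mono h le_rfl (Nat.add_zero 1).ge (C.mul_mem_monomials h h1 hm')

theorem monomial_sub_mem_monomials (s : SuperComm ℂ p' →ₐ[ℂ] (C.ofSum h).Alg)
    (hs : ∀ x, s (gen p' x) = (C.ofSum h).ξ (Sum.inr x)) (l : List ((Y ⊕ X') ⊕ Y)) :
    (l.map (gen (C.ofSum h).par)).prod - s (C.proj h hp (l.map (gen (C.ofSum h).par)).prod) ∈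
      C.monomials h (l.map C.totalWeight).sum 1 := by
  induction l with
  | nil =>
    simp only [List.map_nil, List.prod_nil, map_one, sub_self]
    exact Submodule.zero_mem _
  | cons x l ih =>
    simp only [List.map_cons, List.prod_cons, List.sum_cons, map_mul]
    refine C.mul_sub_mem_monomials h
      (C.monomials_mono h le_rfl (Nat.zero_le _) (C.gen_mem_monomials h x)) ih
      (Submodule.subset_span ⟨l, le_rfl, Nat.zero_le _, rfl⟩) ?_
    rw [proj_gen]
    rcases x with (x | x) | x
    · exact Or.inr ⟨map_zero s, C.monomials_mono h le_rfl (C.pos _) (C.gen_mem_monomials h _)⟩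
    · exact Or.inl (hs x)
    · exact Or.inr ⟨map_zero s, C.monomials_mono h le_rfl (C.pos _) (C.gen_mem_monomials h _)⟩

/-- What is lost by projecting and lifting back consists of monomials that contain a generator of
the window. In particular an element of the kernel has window weight at least one. -/
theorem exists_sub_mem_monomials (s : SuperComm ℂ p' →ₐ[ℂ] (C.ofSum h).Alg)
    (hs : ∀ x, s (gen p' x) = (C.ofSum h).ξ (Sum.inr x)) (z : (C.ofSum h).Alg) :
    ∃ a, z - s (C.proj h hp z) ∈ C.monomials h a 1 := by
  induction z using monomial_induction with
  | h0 => exact ⟨0, by rw [map_zero, map_zero, sub_zero]; exact Submodule.zero_mem _⟩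
  | hmon r l =>
    rw [← Algebra.smul_def, map_smul, map_smul, ← smul_sub]
    exact ⟨_, Submodule.smul_mem _ _ (C.monomial_sub_mem_monomials h hp s hs l)⟩
  | hadd a b ha hb =>
    obtain ⟨k, hk⟩ := ha
    obtain ⟨k', hk'⟩ := hb
    refine ⟨max k k', ?_⟩
    convert Submodule.add_mem _ (C.monomials_mono h (le_max_left k k') le_rfl hk)
      (C.monomials_mono h (le_max_right k k') le_rfl hk') using 1
    rw [map_add, map_add]; abel

/-- The kernel of the projection is acyclic. -/
theorem proj_acyclic {z : (C.ofSum h).Alg} (hz : C.proj h hp z = 0)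
    (hdz : (C.ofSum h).diff.d z = 0) : ∃ y, C.proj h hp y = 0 ∧ (C.ofSum h).diff.d y = z := by
  obtain ⟨s, hs⟩ := C.exists_proj_section h hp
  obtain ⟨a, ha⟩ := C.exists_sub_mem_monomials h hp s hs z
  rw [hz, map_zero, sub_zero] at ha
  -- Positive window weight makes the Lie derivative invertible at `z`, through a polynomial with
  -- non-zero constant coefficient.
  obtain ⟨q, hq, hqz⟩ := C.exists_aeval_lie h a a 1 one_pos (by omega) z ha
  obtain ⟨y, hy⟩ := (C.ofSum h).exists_of_aeval_lie hdz hq hqz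
  exact ⟨_, C.proj_contr h hp y, hy⟩

theorem proj_surjective : Function.Surjective (C.proj h hp) := by
  obtain ⟨s, hs⟩ := C.exists_proj_section h hp
  have : (C.proj h hp).comp s = AlgHom.id ℂ _ := by
    refine algHom_ext fun x => ?_
    rw [AlgHom.comp_apply, hs]
    exact C.proj_gen h hp _
  exact fun b => ⟨s b, congrArg (fun f : SuperComm ℂ p' →ₐ[ℂ] _ => f b) this⟩

end Contraction

end LieConstants


/-! ## Gradings of algebras generated in degree one -/

/-- A grading of a commutative algebra generated by elements `a₁, …, a_n` of degree one, together
with the projections on its components, its augmentation ideal, and the coordinates in degree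
one. -/
structure StandardGrading (A : Type*) [CommRing A] [Algebra ℂ A] (n : ℕ) where
  a : Fin n → A
  deg : ℕ → Submodule ℂ A
  π : ℕ → A →ₗ[ℂ] A
  P : Ideal A
  coord : Fin n → A →ₗ[ℂ] ℂ
  a_mem : ∀ i, a i ∈ deg 1
  one_mem : 1 ∈ deg 0
  mul_mem : ∀ {i j x y}, x ∈ deg i → y ∈ deg j → x * y ∈ deg (i + j)
  π_of_mem : ∀ {i x}, x ∈ deg i → π i x = x
  π_of_ne : ∀ {i j x}, x ∈ deg i → i ≠ j → π j x = 0
  iSup_deg : ⨆ i, deg i = ⊤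
  deg_zero : ∀ x ∈ deg 0, ∃ r : ℂ, x = algebraMap ℂ A r
  deg_one : deg 1 ≤ Submodule.span ℂ (Set.range a)
  P_eq : P.restrictScalars ℂ = ⨆ i, deg (i + 1)
  P_le_span : P ≤ Ideal.span (Set.range a)
  coord_a : ∀ i k, coord i (a k) = if i = k then 1 else 0
  coord_of_ne : ∀ {i d x}, x ∈ deg d → d ≠ 1 → coord i x = 0

namespace StandardGrading

variable {A : Type*} [CommRing A] [Algebra ℂ A] {n : ℕ} (S : StandardGrading A n)

theorem induction {p : A → Prop} (x : A) (h0 : p 0) (hadd : ∀ x y, p x → p y → p (x + y))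
    (h : ∀ i, ∀ x ∈ S.deg i, p x) : p x :=
  Submodule.iSup_induction S.deg (motive := p) (x := x) (by rw [S.iSup_deg]; trivial) h h0 hadd

theorem deg_le_P {i : ℕ} (hi : 1 ≤ i) {x : A} (hx : x ∈ S.deg i) : x ∈ S.P := by
  have : x ∈ S.P.restrictScalars ℂ := by
    rw [S.P_eq]
    obtain ⟨j, rfl⟩ := Nat.exists_eq_add_of_le' hi
    exact Submodule.mem_iSup_of_mem j hx
  exact this

theorem a_mem_P (i : Fin n) : S.a i ∈ S.P := S.deg_le_P le_rfl (S.a_mem i)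

/-- The generators as elements of the augmentation ideal. -/
def aP (i : Fin n) : S.P := ⟨S.a i, S.a_mem_P i⟩

theorem P_induction {p : S.P → Prop} (x : S.P) (h0 : p 0)
    (hadd : ∀ x y, p x → p y → p (x + y))
    (h : ∀ i, 1 ≤ i → ∀ x : S.P, (x : A) ∈ S.deg i → p x) : p x := by
  obtain ⟨x, hx⟩ := x
  have hx' : x ∈ ⨆ i, S.deg (i + 1) := by rw [← S.P_eq]; exact hx
  have key : ∀ y (hy : y ∈ ⨆ i, S.deg (i + 1)), ∃ hy' : y ∈ S.P, p ⟨y, hy'⟩ := by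
    intro y hy
    refine Submodule.iSup_induction _ (motive := fun y => ∃ hy' : y ∈ S.P, p ⟨y, hy'⟩) hy
      (fun i y hy => ⟨S.deg_le_P (by omega) hy, h (i + 1) (by omega) _ hy⟩) ⟨S.P.zero_mem, h0⟩ ?_
    rintro x y ⟨hx, hpx⟩ ⟨hy, hpy⟩
    exact ⟨S.P.add_mem hx hy, hadd _ _ hpx hpy⟩
  exact (key x hx').2

theorem π_mem (i : ℕ) (x : A) : S.π i x ∈ S.deg i := by
  refine S.induction (p := fun x => S.π i x ∈ S.deg i) x (by simp)
    (fun x y hx hy => by rw [map_add]; exact add_mem hx hy) ?_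
  intro j x hx
  by_cases h : j = i
  · subst h
    rwa [S.π_of_mem hx]
  · rw [S.π_of_ne hx h]
    exact zero_mem _

theorem π_zero_of_mem_P (x : S.P) : S.π 0 (x : A) = 0 := by
  refine S.P_induction (p := fun x => S.π 0 (x : A) = 0) x (by simp)
    (fun x y hx hy => by simp [hx, hy]) ?_
  intro i hi x hx
  exact S.π_of_ne hx (by omega)

theorem coord_a_mul (i k : Fin n) (x : S.P) : S.coord i (S.a k * x) = 0 := by
  refine S.P_induction (p := fun x => S.coord i (S.a k * x) = 0) x (by simp)
    (fun x y hx hy => by simp [mul_add, hx, hy]) ?_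
  intro d hd x hx
  exact S.coord_of_ne (S.mul_mem (S.a_mem k) hx) (by omega)

end StandardGrading

/-! ### The standard grading of a quadratic algebra -/

namespace QuadraticComm

open MvPolynomial

variable {n m : ℕ} (Γ : Fin m → Matrix (Fin n) (Fin n) ℂ)

theorem quadric_mem (k : Fin m) : quadric Γ k ∈ homogeneousSubmodule (Fin n) ℂ 2 := by
  refine Submodule.sum_mem _ fun i _ => Submodule.sum_mem _ fun j _ => ?_
  rw [mem_homogeneousSubmodule]
  exact ((isHomogeneous_X ℂ i).mul (isHomogeneous_X ℂ j)).C_mul _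

theorem homogeneousComponent_mem_ideal {p : MvPolynomial (Fin n) ℂ}
    (hp : p ∈ Ideal.span (Set.range (quadric Γ))) (i : ℕ) :
    homogeneousComponent i p ∈ Ideal.span (Set.range (quadric Γ)) := by
  let _ : GradedAlgebra (homogeneousSubmodule (Fin n) ℂ) := gradedAlgebra
  refine homogeneousComponent_mem_of_mem (Ideal.homogeneous_span _ _ ?_) hp i
  rintro _ ⟨k, rfl⟩
  exact ⟨2, quadric_mem Γ k⟩

/-- The quotient map. -/
noncomputable def toAlg : MvPolynomial (Fin n) ℂ →ₐ[ℂ] Alg Γ :=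
  Ideal.Quotient.mkₐ ℂ (Ideal.span (Set.range (quadric Γ)))

theorem toAlg_surjective : Function.Surjective (toAlg Γ) := Ideal.Quotient.mkₐ_surjective ℂ _

theorem toAlg_eq_zero {p : MvPolynomial (Fin n) ℂ} :
    toAlg Γ p = 0 ↔ p ∈ Ideal.span (Set.range (quadric Γ)) := Ideal.Quotient.eq_zero_iff_mem

theorem toAlg_X (i : Fin n) : toAlg Γ (X i) = a Γ i := rfl

theorem mem_deg {i : ℕ} {x : Alg Γ} :
    x ∈ deg Γ i ↔ ∃ p ∈ homogeneousSubmodule (Fin n) ℂ i, toAlg Γ p = x := Iff.rfl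

/-- The projection on the component of degree `i`. -/
noncomputable def component (i : ℕ) : Alg Γ →ₗ[ℂ] Alg Γ :=
  (LinearMap.ker (toAlg Γ).toLinearMap).liftQ
      ((toAlg Γ).toLinearMap ∘ₗ homogeneousComponent i) (by
        intro p hp
        exact (toAlg_eq_zero Γ).2 (homogeneousComponent_mem_ideal Γ ((toAlg_eq_zero Γ).1 hp) i)) ∘ₗ
    ((toAlg Γ).toLinearMap.quotKerEquivOfSurjective (toAlg_surjective Γ)).symm.toLinearMap

theorem component_toAlg (i : ℕ) (p : MvPolynomial (Fin n) ℂ) :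
    component Γ i (toAlg Γ p) = toAlg Γ (homogeneousComponent i p) := by
  have h : ((toAlg Γ).toLinearMap.quotKerEquivOfSurjective (toAlg_surjective Γ)).symm (toAlg Γ p) =
      Submodule.Quotient.mk p := by
    rw [LinearEquiv.symm_apply_eq]
    rfl
  rw [component, LinearMap.comp_apply, LinearEquiv.coe_coe, h]
  rfl

/-- The algebra `ℂ ⊕ V` of elements of degree at most one is a quotient of `A`. -/
noncomputable def linearPart : Alg Γ →ₐ[ℂ] TrivSqZeroExt ℂ (Fin n → ℂ) :=
  Ideal.Quotient.liftₐ _ (aeval fun i => TrivSqZeroExt.inr (Pi.single i 1)) (by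
    intro p hp
    refine (Ideal.span_le (I := RingHom.ker (aeval fun i => TrivSqZeroExt.inr
      (Pi.single i 1 : Fin n → ℂ) : MvPolynomial (Fin n) ℂ →ₐ[ℂ] _))).2 ?_ hp
    rintro _ ⟨k, rfl⟩
    simp [quadric, RingHom.mem_ker])

theorem linearPart_a (i : Fin n) :
    linearPart Γ (a Γ i) = TrivSqZeroExt.inr (Pi.single i 1) := by
  exact aeval_X (R := ℂ) (fun i => TrivSqZeroExt.inr (Pi.single i 1 : Fin n → ℂ)) i

theorem component_of_mem {i : ℕ} {x : Alg Γ} (hx : x ∈ deg Γ i) : component Γ i x = x := by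
  obtain ⟨p, hp, rfl⟩ := (mem_deg Γ).1 hx
  rw [component_toAlg, homogeneousComponent_of_mem hp, if_pos rfl]

theorem component_of_ne {i j : ℕ} {x : Alg Γ} (hx : x ∈ deg Γ i) (h : i ≠ j) :
    component Γ j x = 0 := by
  obtain ⟨p, hp, rfl⟩ := (mem_deg Γ).1 hx
  rw [component_toAlg, homogeneousComponent_of_mem hp, if_neg h.symm, map_zero]

theorem iSup_deg : ⨆ i, deg Γ i = ⊤ := by
  rw [eq_top_iff]
  rintro x -
  obtain ⟨p, rfl⟩ := toAlg_surjective Γ x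
  rw [← sum_homogeneousComponent p, map_sum]
  refine Submodule.sum_mem _ fun i _ => Submodule.mem_iSup_of_mem i ?_
  exact (mem_deg Γ).2 ⟨_, homogeneousComponent_mem i p, rfl⟩

theorem deg_zero {x : Alg Γ} (hx : x ∈ deg Γ 0) : ∃ r : ℂ, x = algebraMap ℂ (Alg Γ) r := by
  obtain ⟨p, hp, rfl⟩ := (mem_deg Γ).1 hx
  refine ⟨coeff 0 p, ?_⟩
  have : p = MvPolynomial.C (coeff 0 p) := by
    conv_lhs => rw [← homogeneousComponent_eq_self hp, homogeneousComponent_zero]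
  exact (congrArg (toAlg Γ) this).trans ((toAlg Γ).commutes _)

theorem deg_mul {i j : ℕ} {x y : Alg Γ} (hx : x ∈ deg Γ i) (hy : y ∈ deg Γ j) :
    x * y ∈ deg Γ (i + j) := by
  obtain ⟨p, hp, rfl⟩ := (mem_deg Γ).1 hx
  obtain ⟨q, hq, rfl⟩ := (mem_deg Γ).1 hy
  exact (mem_deg Γ).2 ⟨p * q, IsHomogeneous.mul hp hq, map_mul _ _ _⟩

theorem a_mem_deg (i : Fin n) : a Γ i ∈ deg Γ 1 := (mem_deg Γ).2 ⟨X i, isHomogeneous_X ℂ i, rfl⟩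

theorem one_mem_deg : (1 : Alg Γ) ∈ deg Γ 0 :=
  (mem_deg Γ).2 ⟨1, isHomogeneous_one _ _, map_one _⟩

theorem deg_le_span (i : ℕ) : deg Γ i ≤ Submodule.span ℂ (Set.range (a Γ)) ^ i := by
  intro x hx
  obtain ⟨p, hp, rfl⟩ := (mem_deg Γ).1 hx
  have : p ∈ Submodule.span ℂ (Set.range (X : Fin n → MvPolynomial (Fin n) ℂ)) ^ i := by
    have h := homogeneousSubmodule_one_pow (σ := Fin n) (R := ℂ) i
    rw [homogeneousSubmodule_one_eq_span_X] at h
    rw [h]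
    exact hp
  have h2 := Submodule.mem_map_of_mem (f := (toAlg Γ).toLinearMap) this
  rw [Submodule.map_pow, Submodule.map_span, ← Set.range_comp] at h2
  exact h2

theorem deg_succ_le_augIdeal (i : ℕ) : deg Γ (i + 1) ≤ (augIdeal Γ).restrictScalars ℂ := by
  refine (deg_le_span Γ (i + 1)).trans ?_
  rw [Submodule.pow_succ]
  refine Submodule.mul_le.2 fun x _ y hy => ?_
  refine (augIdeal Γ).mul_mem_left x ?_
  have h : Submodule.span ℂ (Set.range (a Γ)) ≤ (augIdeal Γ).restrictScalars ℂ :=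
    Submodule.span_le.2 (Ideal.subset_span (s := Set.range (a Γ)))
  exact h hy

theorem augIdeal_eq : (augIdeal Γ).restrictScalars ℂ = ⨆ i, deg Γ (i + 1) := by
  refine le_antisymm ?_ (iSup_le fun i => deg_succ_le_augIdeal Γ i)
  intro x hx
  refine Submodule.span_induction (p := fun x _ => x ∈ ⨆ i, deg Γ (i + 1)) ?_ (zero_mem _)
    (fun x y _ _ => add_mem) ?_ (show x ∈ augIdeal Γ from hx)
  · rintro _ ⟨k, rfl⟩
    exact Submodule.mem_iSup_of_mem 0 (a_mem_deg Γ k)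
  · intro r x _ hx
    have hr : r ∈ ⨆ i, deg Γ i := by rw [iSup_deg]; trivial
    rw [smul_eq_mul]
    refine Submodule.iSup_induction _ (motive := fun r => r * x ∈ ⨆ i, deg Γ (i + 1)) hr ?_
      (by simp) (fun a b ha hb => by rw [add_mul]; exact add_mem ha hb)
    intro i r hr
    refine Submodule.iSup_induction _ (motive := fun x => r * x ∈ ⨆ i, deg Γ (i + 1)) hx ?_
      (by simp) (fun a b ha hb => by rw [mul_add]; exact add_mem ha hb)
    intro j x hx
    exact Submodule.mem_iSup_of_mem (p := fun i => deg Γ (i + 1)) (i + j)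
      (deg_mul Γ (j := j + 1) hr hx)

/-- The standard grading of `A`. -/
noncomputable def grading : StandardGrading (Alg Γ) n where
  a := a Γ
  deg := deg Γ
  π := component Γ
  P := augIdeal Γ
  coord i := LinearMap.proj i ∘ₗ TrivSqZeroExt.sndHom ℂ (Fin n → ℂ) ∘ₗ
    (linearPart Γ).toLinearMap ∘ₗ component Γ 1
  a_mem := a_mem_deg Γ
  one_mem := one_mem_deg Γ
  mul_mem := deg_mul Γ
  π_of_mem := component_of_mem Γ
  π_of_ne := component_of_ne Γ
  iSup_deg := iSup_deg Γ
  deg_zero _ hx := deg_zero Γ hx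
  deg_one := (deg_le_span Γ 1).trans (Submodule.pow_one _).le
  P_eq := augIdeal_eq Γ
  P_le_span := le_rfl
  coord_a i k := by
    simp [component_of_mem Γ (a_mem_deg Γ k), linearPart_a, Pi.single_apply]
  coord_of_ne hx hd := by
    simp [component_of_ne Γ hx hd]

end QuadraticComm


/-! ## The bar complex, recursively -/

namespace StandardGrading

variable {A : Type*} [CommRing A] [Algebra ℂ A] {n : ℕ} (S : StandardGrading A n)

/-- The bar cochains. -/
abbrev Bar (j : ℕ) : Type _ := MultilinearMap ℂ (fun _ : Fin j => S.P) ℂ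

/-- The first argument of a cochain taken apart. -/
noncomputable def cur (j : ℕ) : S.Bar (j + 1) ≃ₗ[ℂ] (S.P →ₗ[ℂ] S.Bar j) :=
  multilinearCurryLeftEquiv ℂ (fun _ : Fin (j + 1) => S.P) ℂ

theorem cur_apply {j : ℕ} (φ : S.Bar (j + 1)) (x : S.P) (y : Fin j → S.P) :
    S.cur j φ x y = φ (Fin.cons x y) := rfl

/-- Multiplication on the augmentation ideal. -/
noncomputable def mulP : S.P →ₗ[ℂ] S.P →ₗ[ℂ] S.P :=
  LinearMap.mk₂ ℂ (fun x y => (x : A) • y) (fun x y z => by simp [add_smul])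
    (fun c x y => by simp) (fun x y z => by simp) (fun c x y => by
      apply Subtype.ext
      simp)

theorem coe_mulP (x y : S.P) : (S.mulP x y : A) = x * y := rfl

/-- Multiplication of the first argument by `x`. -/
noncomputable def premul {j : ℕ} (x : S.P) (φ : S.Bar (j + 1)) : S.Bar (j + 1) :=
  (S.cur j).symm (S.cur j φ ∘ₗ S.mulP x)

theorem cur_premul {j : ℕ} (x y : S.P) (φ : S.Bar (j + 1)) :
    S.cur j (S.premul x φ) y = S.cur j φ (S.mulP x y) := by
  simp [premul]

theorem cur_ext {j : ℕ} {φ ψ : S.Bar (j + 1)} (h : ∀ x, S.cur j φ x = S.cur j ψ x) : φ = ψ :=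
  (S.cur j).injective (LinearMap.ext h)

/-- The differential of the bar complex. -/
noncomputable def barD : (j : ℕ) → S.Bar j →ₗ[ℂ] S.Bar (j + 1)
  | 0 => 0
  -- Recursion on the first argument: `(dφ)(x, …)` is `φ` with `x` multiplied into its first slot,
  -- minus `d` of the slice `φ(x, …)`.
  | j + 1 => (S.cur (j + 1)).symm.toLinearMap ∘ₗ
      LinearMap.mk₂ ℂ (fun φ x => S.premul x φ - barD j (S.cur j φ x))
        (fun φ ψ x => S.cur_ext fun y => by simp [cur_premul]; abel)
        (fun c φ x => S.cur_ext fun y => by simp [cur_premul, smul_sub])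
        (fun φ x y => S.cur_ext fun z => by simp [cur_premul]; abel)
        (fun c φ x => S.cur_ext fun y => by simp [cur_premul, smul_sub])

theorem barD_zero (φ : S.Bar 0) : S.barD 0 φ = 0 := rfl

theorem cur_barD {j : ℕ} (φ : S.Bar (j + 1)) (x : S.P) :
    S.cur (j + 1) (S.barD (j + 1) φ) x = S.premul x φ - S.barD j (S.cur j φ x) := by
  simp [barD]

/-- The cochains of internal degree `w`. -/
noncomputable def cochains : (j : ℕ) → ℤ → Submodule ℂ (S.Bar j)
  | 0, w => ⨅ _ : w ≠ 0, ⊥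
  -- Weights are integers because fixing an argument of degree `d` lowers the weight by `d`,
  -- possibly below zero.
  | j + 1, w => ⨅ d : ℕ, ⨅ x : S.P, ⨅ _ : (x : A) ∈ S.deg d,
      (cochains j (w - d)).comap (LinearMap.applyₗ x ∘ₗ (S.cur j).toLinearMap)

theorem mem_cochains_zero {w : ℤ} {φ : S.Bar 0} :
    φ ∈ S.cochains 0 w ↔ (w ≠ 0 → φ = 0) := by
  simp [cochains, Submodule.mem_iInf]

theorem mem_cochains_succ {j : ℕ} {w : ℤ} {φ : S.Bar (j + 1)} :
    φ ∈ S.cochains (j + 1) w ↔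
      ∀ (d : ℕ) (x : S.P), (x : A) ∈ S.deg d → S.cur j φ x ∈ S.cochains j (w - d) := by
  simp [cochains, Submodule.mem_iInf]

/-- Arguments lie in the augmentation ideal and so have degree at least one; `j` of them have total
degree at least `j`. -/
theorem eq_zero_of_mem_cochains : ∀ {j : ℕ} {w : ℤ} {φ : S.Bar j}, φ ∈ S.cochains j w → w < j →
    φ = 0
  | 0, w, φ, hφ, hw => S.mem_cochains_zero.1 hφ (by simpa using hw.ne)
  | j + 1, w, φ, hφ, hw => by
    rw [mem_cochains_succ] at hφ
    refine S.cur_ext fun x => ?_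
    rw [map_zero, LinearMap.zero_apply]
    refine S.P_induction (p := fun x => S.cur j φ x = 0) x (by simp)
      (fun x y hx hy => by simp [hx, hy]) fun d hd x hx => ?_
    refine eq_zero_of_mem_cochains (hφ d x hx) ?_
    push_cast at hw
    omega

theorem premul_mem {j : ℕ} {w : ℤ} {φ : S.Bar (j + 1)} (hφ : φ ∈ S.cochains (j + 1) w) {d : ℕ}
    {x : S.P} (hx : (x : A) ∈ S.deg d) : S.premul x φ ∈ S.cochains (j + 1) (w - d) := by
  rw [mem_cochains_succ] at hφ ⊢
  intro d' y hy
  rw [cur_premul]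
  have := hφ (d + d') (S.mulP x y) (S.mul_mem hx hy)
  rwa [Nat.cast_add, ← sub_sub] at this

theorem barD_mem : ∀ {j : ℕ} {w : ℤ} {φ : S.Bar j}, φ ∈ S.cochains j w →
    S.barD j φ ∈ S.cochains (j + 1) w
  | 0, w, φ, _ => by
    rw [barD_zero]
    exact zero_mem _
  | j + 1, w, φ, hφ => by
    rw [mem_cochains_succ]
    intro d x hx
    rw [cur_barD]
    exact sub_mem (S.premul_mem hφ hx) (barD_mem (S.mem_cochains_succ.1 hφ d x hx))

/-- A cochain of bidegree `(j, j)` is determined by its values on the generators. -/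
theorem eq_zero_of_cur_aP {j : ℕ} {φ : S.Bar (j + 1)} (hφ : φ ∈ S.cochains (j + 1) (j + 1 : ℤ))
    (h : ∀ i, S.cur j φ (S.aP i) = 0) : φ = 0 := by
  rw [mem_cochains_succ] at hφ
  refine S.cur_ext fun x => ?_
  rw [map_zero, LinearMap.zero_apply]
  refine S.P_induction (p := fun x => S.cur j φ x = 0) x (by simp)
    (fun x y hx hy => by simp [hx, hy]) fun d hd x hx => ?_
  rcases hd.lt_or_eq with hd | rfl
  · exact S.eq_zero_of_mem_cochains (hφ d x hx) (by omega)
  · have key : ∀ y ∈ Submodule.span ℂ (Set.range S.a), ∃ hy : y ∈ S.P,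
        S.cur j φ ⟨y, hy⟩ = 0 := by
      intro y hy
      induction hy using Submodule.span_induction with
      | mem y hy =>
        obtain ⟨i, rfl⟩ := hy
        exact ⟨S.a_mem_P i, h i⟩
      | zero => exact ⟨S.P.zero_mem, map_zero _⟩
      | add y z _ _ hy hz =>
        obtain ⟨hy, hy'⟩ := hy
        obtain ⟨hz, hz'⟩ := hz
        refine ⟨S.P.add_mem hy hz, ?_⟩
        have := (S.cur j φ).map_add ⟨y, hy⟩ ⟨z, hz⟩
        rw [hy', hz', add_zero] at this
        exact this
      | smul c y _ hy =>
        obtain ⟨hy, hy'⟩ := hy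
        refine ⟨(S.P.restrictScalars ℂ).smul_mem c hy, ?_⟩
        have := (S.cur j φ).map_smul c ⟨y, hy⟩
        rw [hy', smul_zero] at this
        exact this
    exact (key x (S.deg_one hx)).2

/-- The recursive differential is the alternating sum used to define `Ext`; peeling off the first
argument separates the term `r = 0` from the others, whose signs all flip. -/
theorem barD_apply : ∀ (j : ℕ) (φ : S.Bar j) (x : Fin (j + 1) → S.P),
    S.barD j φ x = ∑ r : Fin j,
      (-1) ^ (r : ℕ) * φ (Fin.contractNth r.castSucc (fun y z => (y : A) • z) x)
  | 0, φ, x => by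
    rw [barD_zero]
    simp
  | j + 1, φ, x => by
    obtain ⟨x₀, x, rfl⟩ : ∃ x₀ x', x = Fin.cons x₀ x' :=
      ⟨x 0, Fin.tail x, (Fin.cons_self_tail x).symm⟩
    have h := congrArg (fun ψ => ψ x) (S.cur_barD φ x₀)
    refine h.trans ?_
    obtain ⟨x₁, x, rfl⟩ : ∃ x₁ x', x = Fin.cons x₁ x' :=
      ⟨x 0, Fin.tail x, (Fin.cons_self_tail x).symm⟩
    have h2 := barD_apply j (S.cur j φ x₀) (Fin.cons x₁ x)
    have h3 : S.premul x₀ φ (Fin.cons x₁ x) =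
        φ (Fin.cons (S.mulP x₀ x₁) x) := by
      rw [← cur_apply, cur_premul, cur_apply]
    rw [sub_apply, h3, h2]
    symm
    rw [Fin.sum_univ_succ, sub_eq_add_neg, ← Finset.sum_neg_distrib]
    congr 1
    · rw [Fin.val_zero, pow_zero, one_mul]
      congr 1
      ext r
      refine Fin.cases ?_ (fun r => ?_) r
      · rw [Fin.contractNth_apply_of_eq _ _ _ _ rfl]
        rfl
      · rw [Fin.contractNth_apply_of_gt _ _ _ _ (by simp)]
        rfl
    · refine Finset.sum_congr rfl fun r _ => ?_
      rw [Fin.val_succ, pow_succ, mul_neg_one, neg_mul, cur_apply]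
      congr 3
      ext s
      refine Fin.cases ?_ (fun s => ?_) s
      · rw [Fin.contractNth_apply_of_lt _ _ _ _ (by simp)]
        rfl
      · rcases lt_trichotomy (s : ℕ) r with h | h | h
        · rw [Fin.contractNth_apply_of_lt _ _ _ _ (by simpa using h)]
          change _ = ((Fin.contractNth r.castSucc _ (Fin.cons x₁ x) s : S.P) : A)
          rw [Fin.contractNth_apply_of_lt _ _ _ _ (by simpa using h)]
          rfl
        · rw [Fin.contractNth_apply_of_eq _ _ _ _ (by simpa using h)]
          change _ = ((Fin.contractNth r.castSucc _ (Fin.cons x₁ x) s : S.P) : A)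
          rw [Fin.contractNth_apply_of_eq _ _ _ _ (by simpa using h)]
          rfl
        · rw [Fin.contractNth_apply_of_gt _ _ _ _ (by simpa using h)]
          change _ = ((Fin.contractNth r.castSucc _ (Fin.cons x₁ x) s : S.P) : A)
          rw [Fin.contractNth_apply_of_gt _ _ _ _ (by simpa using h)]
          rfl

theorem mem_cochains_iff : ∀ (j : ℕ) (w : ℤ) (φ : S.Bar j),
    φ ∈ S.cochains j w ↔ ∀ (x : Fin j → S.P) (d : Fin j → ℕ),
      (∀ r, (x r : A) ∈ S.deg (d r)) → ∑ r, (d r : ℤ) ≠ w → φ x = 0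
  | 0, w, φ => by
    rw [mem_cochains_zero]
    constructor
    · intro h x d _ hw
      rw [h (by simpa using hw.symm)]
      rfl
    · intro h hw
      ext x
      exact h x (fun _ => 0) (fun r => r.elim0) (by simpa using hw.symm)
  | j + 1, w, φ => by
    rw [mem_cochains_succ]
    constructor
    · intro h x d hx hw
      have h1 := (mem_cochains_iff j _ _).1 (h (d 0) (x 0) (hx 0)) (Fin.tail x) (Fin.tail d)
        (fun r => hx r.succ) (by
          intro h2
          apply hw
          rw [Fin.sum_univ_succ]
          simp only [Fin.tail] at h2
          omega)
      rw [cur_apply] at h1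
      rwa [← Fin.cons_self_tail x]
    · intro h d x hx
      refine (mem_cochains_iff j _ _).2 fun y e hy hw => ?_
      rw [cur_apply]
      refine h (Fin.cons x y) (Fin.cons d e) (fun r => ?_) ?_
      · refine Fin.cases hx (fun r => hy r) r
      · rw [Fin.sum_univ_succ]
        simp only [Fin.cons_zero, Fin.cons_succ]
        omega

end StandardGrading

namespace QuadraticComm

variable {n m : ℕ} (Γ : Fin m → Matrix (Fin n) (Fin n) ℂ)

theorem barDiff_eq (j : ℕ) (φ : BarCochain Γ j) (x : Fin (j + 1) → augIdeal Γ) :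
    barDiff Γ j φ x = (grading Γ).barD j φ x := ((grading Γ).barD_apply j φ x).symm

theorem mem_barCochains_iff {j w : ℕ} {φ : BarCochain Γ j} :
    φ ∈ barCochains Γ j w ↔ φ ∈ (grading Γ).cochains j w := by
  refine Iff.trans ?_ ((grading Γ).mem_cochains_iff j w φ).symm
  refine forall_congr' fun x => forall_congr' fun d => forall_congr' fun _ => ?_
  rw [← Nat.cast_sum, Ne, Ne, Nat.cast_inj]
  rfl

variable {Γ} in
theorem IsKoszul.exists_barD (hK : IsKoszul Γ) {j w : ℕ} (hw : w ≠ j + 1)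
    {φ : (grading Γ).Bar (j + 1)} (hφ : φ ∈ (grading Γ).cochains (j + 1) w)
    (h : (grading Γ).barD (j + 1) φ = 0) :
    ∃ ψ ∈ (grading Γ).cochains j w, (grading Γ).barD j ψ = φ := by
  have hs := hK (j + 1) w hw.symm
  rw [Submodule.Quotient.subsingleton_iff] at hs
  have hmem : φ ∈ barCocycles Γ (j + 1) w := by
    refine ⟨(mem_barCochains_iff Γ).2 hφ, LinearMap.mem_ker.2 ?_⟩
    funext x
    exact (barDiff_eq Γ _ φ x).trans (congrArg (fun ψ => ψ x) h)
  have := Submodule.mem_top (R := ℂ) (x := (⟨φ, hmem⟩ : barCocycles Γ (j + 1) w))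
  rw [← hs] at this
  obtain ⟨ψ, hψ, hψ'⟩ := this
  refine ⟨ψ, (mem_barCochains_iff Γ).1 hψ, ?_⟩
  ext x
  exact (barDiff_eq Γ j ψ x).symm.trans (hψ' x).symm

end QuadraticComm


/-! ## Exactness from Koszulness -/

theorem LinearMap.exists_comp_eq {V W B : Type*} [AddCommGroup V] [Module ℂ V] [AddCommGroup W]
    [Module ℂ W] [AddCommGroup B] [Module ℂ B] (Q : V →ₗ[ℂ] W) (F : V →ₗ[ℂ] B)
    (h : LinearMap.ker Q ≤ LinearMap.ker F) : ∃ f : W →ₗ[ℂ] B, ∀ v, f (Q v) = F v := by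
  obtain ⟨f, hf⟩ := LinearMap.exists_extend
    ((LinearMap.ker Q).liftQ F h ∘ₗ Q.quotKerEquivRange.symm.toLinearMap)
  refine ⟨f, fun v => ?_⟩
  have h1 := LinearMap.congr_fun hf ⟨Q v, LinearMap.mem_range_self Q v⟩
  have h2 : Q.quotKerEquivRange.symm ⟨Q v, LinearMap.mem_range_self Q v⟩ =
      Submodule.Quotient.mk v := by
    rw [LinearEquiv.symm_apply_eq]
    rfl
  refine h1.trans ?_
  rw [LinearMap.comp_apply, LinearEquiv.coe_coe, h2]
  rfl

/-- Over a field, solving `f u = F x` vector by vector suffices for a linear choice of solutions: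
take a linear section of `f` restricted to `p`, and extend linearly from `U`. -/
theorem LinearMap.exists_lift_on {V W B : Type*} [AddCommGroup V] [Module ℂ V] [AddCommGroup W]
    [Module ℂ W] [AddCommGroup B] [Module ℂ B] (f : B →ₗ[ℂ] W) (F : V →ₗ[ℂ] W)
    (U : Submodule ℂ V) (p : Submodule ℂ B) (h : ∀ x ∈ U, ∃ u ∈ p, f u = F x) :
    ∃ g : V →ₗ[ℂ] B, (∀ x, g x ∈ p) ∧ ∀ x ∈ U, f (g x) = F x := by
  obtain ⟨s, hs⟩ := LinearMap.exists_rightInverse_of_surjective (f ∘ₗ p.subtype).rangeRestrict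
    (LinearMap.range_rangeRestrict _)
  have hF : ∀ x : U, F x ∈ LinearMap.range (f ∘ₗ p.subtype) := by
    intro x
    obtain ⟨u, hu, hux⟩ := h x x.2
    exact ⟨⟨u, hu⟩, hux⟩
  obtain ⟨g, hg⟩ := LinearMap.exists_extend (s ∘ₗ (F ∘ₗ U.subtype).codRestrict _ hF)
  refine ⟨p.subtype ∘ₗ g, fun x => (g x).2, fun x hx => ?_⟩
  have h1 := LinearMap.congr_fun hg ⟨x, hx⟩
  have h2 := LinearMap.congr_fun hs ⟨F x, hF ⟨x, hx⟩⟩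
  have h3 := congrArg Subtype.val h2
  rw [LinearMap.comp_apply, Submodule.subtype_apply] at h1
  rw [LinearMap.comp_apply, h1]
  exact h3

namespace StandardGrading

open scoped TensorProduct

variable {A : Type*} [CommRing A] [Algebra ℂ A] {n : ℕ} (S : StandardGrading A n)

/-- The quadratic relations between the generators. -/
def rel : Submodule ℂ (Fin n → Fin n → ℂ) :=
  LinearMap.ker (∑ i, ∑ k, (LinearMap.toSpanSingleton ℂ A (S.a i * S.a k)) ∘ₗ
    LinearMap.proj (R := ℂ) (φ := fun _ : Fin n => ℂ) k ∘ₗ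
      LinearMap.proj (R := ℂ) (φ := fun _ : Fin n => Fin n → ℂ) i)

theorem mem_rel {q : Fin n → Fin n → ℂ} :
    q ∈ S.rel ↔ ∑ i, ∑ k, q i k • (S.a i * S.a k) = 0 := by
  simp [rel, LinearMap.sum_apply]

/-- The annihilator of the quadratic relations. -/
def dualRel : Set (Fin n → Fin n → ℂ) := {c | ∀ q ∈ S.rel, ∑ i, ∑ k, c i k * q i k = 0}

theorem sum_single_single {B : Type*} [AddCommGroup B] [Module ℂ B] (b : Fin n → Fin n → B)
    (i k : Fin n) :
    ∑ x, ∑ y, (Pi.single i (Pi.single k 1) : Fin n → Fin n → ℂ) x y • b x y = b i k := by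
  rw [Finset.sum_eq_single i, Finset.sum_eq_single k]
  · simp
  · intro y _ hy
    simp [hy]
  · simp
  · intro x _ hx
    simp [hx]
  · simp

/-- Double annihilator: a functional that vanishes on the relations but not at `q` would be an
element of `dualRel` contradicting the hypothesis. -/
theorem mem_rel_of_dualRel {q : Fin n → Fin n → ℂ}
    (h : ∀ c ∈ S.dualRel, ∑ i, ∑ k, c i k * q i k = 0) : q ∈ S.rel := by
  by_contra hq
  obtain ⟨f, hf, hf'⟩ := Submodule.exists_dual_map_eq_bot_of_notMem hq inferInstance
  have key : ∀ q, f q = ∑ i, ∑ k, f (Pi.single i (Pi.single k 1)) * q i k := by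
    intro q
    have h1 : q = ∑ i, ∑ k, q i k • Pi.single i (Pi.single k 1) := by
      ext x y
      simp only [Finset.sum_apply, Pi.smul_apply]
      rw [Finset.sum_eq_single x, Finset.sum_eq_single y]
      · simp
      · intro k _ hk
        simp [hk.symm]
      · simp
      · intro i _ hi
        simp [hi.symm]
      · simp
    conv_lhs => rw [h1]
    simp only [map_sum, map_smul, smul_eq_mul, mul_comm]
  apply hf
  rw [key]
  refine h _ fun q hq => ?_
  rw [← key]
  have := Submodule.mem_map_of_mem (f := f) hq
  rw [hf'] at this
  exact (Submodule.mem_bot ℂ).1 this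

/-- Linear maps on `A₂` are given by their values on the `a_i a_k`. -/
theorem exists_quadratic {B : Type*} [AddCommGroup B] [Module ℂ B] (b : Fin n → Fin n → B)
    (hb : ∀ q ∈ S.rel, ∑ i, ∑ k, q i k • b i k = 0) :
    ∃ f : A →ₗ[ℂ] B, (∀ i k, f (S.a i * S.a k) = b i k) ∧
      ∀ d x, x ∈ S.deg d → d ≠ 2 → f x = 0 := by
  let Q : (Fin n → Fin n → ℂ) →ₗ[ℂ] A :=
    ∑ i, ∑ k, (LinearMap.toSpanSingleton ℂ _ (S.a i * S.a k)) ∘ₗ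
      LinearMap.proj (R := ℂ) (φ := fun _ : Fin n => ℂ) k ∘ₗ
      LinearMap.proj (R := ℂ) (φ := fun _ : Fin n => Fin n → ℂ) i
  have hQ : ∀ q, Q q = ∑ i, ∑ k, q i k • (S.a i * S.a k) := by
    intro q
    simp [Q, LinearMap.sum_apply]
  let F : (Fin n → Fin n → ℂ) →ₗ[ℂ] B :=
    ∑ i, ∑ k, (LinearMap.toSpanSingleton ℂ _ (b i k)) ∘ₗ
      LinearMap.proj (R := ℂ) (φ := fun _ : Fin n => ℂ) k ∘ₗ
      LinearMap.proj (R := ℂ) (φ := fun _ : Fin n => Fin n → ℂ) i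
  have hF : ∀ q, F q = ∑ i, ∑ k, q i k • b i k := by
    intro q
    simp [F, LinearMap.sum_apply]
  obtain ⟨f, hf⟩ := Q.exists_comp_eq F fun q hq => by
    rw [LinearMap.mem_ker, hF]
    exact hb q hq
  refine ⟨f ∘ₗ S.π 2, fun i k => ?_, fun d x hx hd => ?_⟩
  · have h2 := hf (Pi.single i (Pi.single k 1))
    rw [hQ, hF, sum_single_single, sum_single_single] at h2
    rw [LinearMap.comp_apply, S.π_of_mem (S.mul_mem (S.a_mem i) (S.a_mem k)), h2]
  · simp [S.π_of_ne hx hd]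

/-- Expand `v` in a basis of `N`. Each coordinate matrix is orthogonal to `dualRel`, hence is a
relation, and the hypothesis on `b` applies to it. -/
theorem sum_tmul_eq_zero {B N : Type*} [AddCommGroup B] [Module ℂ B] [AddCommGroup N] [Module ℂ N]
    (b : Fin n → Fin n → B) (hb : ∀ q ∈ S.rel, ∑ i, ∑ k, q i k • b i k = 0)
    (v : Fin n → Fin n → N) (hv : ∀ c ∈ S.dualRel, ∑ i, ∑ k, c i k • v i k = 0) :
    ∑ i, ∑ k, b i k ⊗ₜ[ℂ] v i k = 0 := by
  classical
  let β := Module.Basis.ofVectorSpace ℂ N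
  apply (TensorProduct.equivFinsuppOfBasisRight (M := B) β).injective
  ext l
  rw [map_zero, Finsupp.zero_apply, map_sum, Finsupp.finsetSum_apply]
  simp only [map_sum, Finsupp.finsetSum_apply,
    TensorProduct.equivFinsuppOfBasisRight_apply_tmul_apply]
  refine hb (fun i k => β.repr (v i k) l) (S.mem_rel_of_dualRel fun c hc => ?_)
  have h := congrArg (fun x => β.repr x l) (hv c hc)
  simpa [map_sum, Finsupp.finsetSum_apply] using h

/-- A graded module `⨁ M_j` over the quadratic dual, the generators acting by operators of degree
`-1`, which is cofree up to the second step. -/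
structure Comodule (M : ℕ → Type*) [∀ j, AddCommGroup (M j)] [∀ j, Module ℂ (M j)] where
  X : Fin n → ∀ j, M (j + 1) →ₗ[ℂ] M j
  ε : M 0 ≃ₗ[ℂ] ℂ
  rel : ∀ c ∈ S.dualRel, ∀ j f, ∑ i, ∑ k, c i k • X k j (X i (j + 1) f) = 0
  inj : ∀ j f, (∀ i, X i j f = 0) → f = 0
  lift_zero : ∀ h : Fin n → M 0, ∃ g, ∀ i, X i 0 g = h i
  lift : ∀ j (h : Fin n → M (j + 1)), (∀ c ∈ S.dualRel, ∑ i, ∑ k, c i k • X k j (h i) = 0) →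
    ∃ g, ∀ i, X i (j + 1) g = h i

namespace Comodule

variable {S} {M : ℕ → Type*} [∀ j, AddCommGroup (M j)] [∀ j, Module ℂ (M j)] (T : S.Comodule M)

/-- Dual to `inj`: as `M_{j+1}` embeds in the `n`-fold sum of `M_j`, every functional on it extends
to that sum. -/
theorem functional_eq {j : ℕ} (ν : Module.Dual ℂ (M (j + 1))) :
    ∃ g : Fin n → Module.Dual ℂ (M j), ∀ f, ν f = ∑ i, g i (T.X i j f) := by
  obtain ⟨g, hg⟩ := (LinearMap.pi fun i => T.X i j).exists_comp_eq ν (by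
    intro f hf
    rw [T.inj j f fun i => congrFun hf i]
    exact zero_mem _)
  refine ⟨fun i => g ∘ₗ LinearMap.single ℂ (fun _ => M j) i, fun f => ?_⟩
  rw [← hg]
  conv_lhs => rw [← Finset.univ_sum_single (LinearMap.pi (fun i => T.X i j) f)]
  rw [map_sum]
  rfl

/-- Dual to `lift`: a functional on `n`-tuples that vanishes on those coming from `M_{j+2}` factors
through the pairs `X_k h_i` modulo the subspace `N` cut out by the dual relations. Killing `N` is
what makes the resulting `g` compatible with the relations of `A`. -/
theorem functionals_eq {j : ℕ} (h : Fin n → Module.Dual ℂ (M (j + 1)))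
    (hh : ∀ f, ∑ i, h i (T.X i (j + 1) f) = 0) :
    ∃ g : Fin n → Fin n → Module.Dual ℂ (M j), (∀ i f, h i f = ∑ k, g i k (T.X k j f)) ∧
      ∀ q ∈ S.rel, ∑ i, ∑ k, q i k • g i k = 0 := by
  let N : Submodule ℂ (Fin n → Fin n → M j) :=
    { carrier := {v | ∀ c ∈ S.dualRel, ∑ i, ∑ k, c i k • v i k = 0}
      zero_mem' := by simp
      add_mem' := fun {v w} hv hw c hc => by
        simp [Finset.sum_add_distrib, hv c hc, hw c hc]
      smul_mem' := fun r v hv c hc => by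
        have := congrArg (fun x => r • x) (hv c hc)
        simpa [Finset.smul_sum, smul_comm r] using this }
  let Tm : (Fin n → M (j + 1)) →ₗ[ℂ] (Fin n → Fin n → M j) :=
    LinearMap.pi fun i => LinearMap.pi fun k => T.X k j ∘ₗ LinearMap.proj i
  let F : (Fin n → M (j + 1)) →ₗ[ℂ] ℂ := ∑ i, h i ∘ₗ LinearMap.proj i
  have hF : ∀ v, F v = ∑ i, h i (v i) := by
    intro v
    simp [F]
  obtain ⟨g, hg⟩ := (N.mkQ ∘ₗ Tm).exists_comp_eq F (by
    intro v hv
    have hv' : Tm v ∈ N := by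
      rw [LinearMap.mem_ker, LinearMap.comp_apply, Submodule.mkQ_apply,
        Submodule.Quotient.mk_eq_zero] at hv
      exact hv
    obtain ⟨f, hf⟩ := T.lift j v hv'
    rw [LinearMap.mem_ker, hF, ← hh f]
    exact Finset.sum_congr rfl fun i _ => by rw [hf])
  refine ⟨fun i k => g ∘ₗ N.mkQ ∘ₗ LinearMap.single ℂ (fun _ => Fin n → M j) i ∘ₗ
    LinearMap.single ℂ (fun _ => M j) k, fun i f => ?_, fun q hq => ?_⟩
  · have h1 : h i f = F (Pi.single i f) := by
      rw [hF, Finset.sum_eq_single i]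
      · simp
      · intro k _ hk
        simp [hk]
      · simp
    have h2 : Tm (Pi.single i f) = ∑ k, Pi.single i (Pi.single k (T.X k j f)) := by
      ext x y
      rw [Finset.sum_apply, Finset.sum_apply]
      by_cases hx : x = i
      · subst hx
        simp [Tm, Pi.single_apply]
      · simp [Tm, hx]
    rw [h1, ← hg, LinearMap.comp_apply, h2, map_sum, map_sum]
    rfl
  · ext x
    -- A relation `q` is orthogonal to `dualRel`, so the matrix with entries `q_{ik} x` lies in `N`
    -- and is killed by the functional.
    have h1 : ∑ i, ∑ k, Pi.single i (Pi.single k (q i k • x)) ∈ N := by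
      intro c hc
      have h2 := hc q hq
      have h3 : (∑ i, ∑ k, Pi.single i (Pi.single k (q i k • x)) : Fin n → Fin n → M j) =
          fun i k => q i k • x := by
        ext i k
        simp only [Finset.sum_apply]
        rw [Finset.sum_eq_single i, Finset.sum_eq_single k]
        · simp
        · intro y _ hy
          simp [hy.symm]
        · simp
        · intro y _ hy
          simp [hy.symm]
        · simp
      rw [h3]
      simp only [smul_smul, ← Finset.sum_smul]
      rw [h2, zero_smul]
    have h2 := congrArg g ((Submodule.Quotient.mk_eq_zero N).2 h1)
    rw [map_zero, ← Submodule.mkQ_apply, map_sum, map_sum] at h2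
    simp only [map_sum] at h2
    simp only [LinearMap.sum_apply, LinearMap.smul_apply, LinearMap.comp_apply,
      LinearMap.zero_apply, ← map_smul]
    exact h2

/-- Restriction of cochains to `M`, by contraction. -/
noncomputable def res : (j : ℕ) → S.Bar j →ₗ[ℂ] Module.Dual ℂ (M j)
  | 0 => (LinearMap.toSpanSingleton ℂ (Module.Dual ℂ (M 0)) T.ε.toLinearMap) ∘ₗ
      { toFun := fun φ => φ ![]
        map_add' := fun _ _ => rfl
        map_smul' := fun _ _ => rfl }
  | j + 1 => ∑ i, (T.X i j).dualMap ∘ₗ res j ∘ₗ LinearMap.applyₗ (S.aP i) ∘ₗ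
      (S.cur j).toLinearMap

theorem res_zero (φ : S.Bar 0) : T.res 0 φ = φ ![] • T.ε.toLinearMap := rfl

theorem res_succ {j : ℕ} (φ : S.Bar (j + 1)) (f : M (j + 1)) :
    T.res (j + 1) φ f = ∑ i, T.res j (S.cur j φ (S.aP i)) (T.X i j f) := by
  simp [res, LinearMap.sum_apply]

theorem sum_pairing {j : ℕ} (F : S.P →ₗ[ℂ] Module.Dual ℂ (M j)) (f : M (j + 2)) :
    ∑ i, ∑ k, F (S.mulP (S.aP i) (S.aP k)) (T.X k j (T.X i (j + 1) f)) = 0 := by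
  have h := S.sum_tmul_eq_zero (fun i k => S.mulP (S.aP i) (S.aP k)) (fun q hq => by
    have := S.mem_rel.1 hq
    apply Subtype.ext
    rw [← S.P.subtype_apply, ← LinearMap.restrictScalars_apply ℂ]
    simpa [map_sum, coe_mulP, aP] using this) _ (fun c hc => T.rel c hc j f)
  have h2 := congrArg (TensorProduct.lift F) h
  simpa [map_sum] using h2

/-- Repeated contraction embeds `M` in the bar construction as the Koszul subcomplex. There the
products of adjacent arguments cancel, because the relations of `A` and those of the dual are
orthogonal. -/
theorem res_barD : ∀ {j : ℕ} (φ : S.Bar j), T.res (j + 1) (S.barD j φ) = 0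
  | 0, φ => by rw [S.barD_zero, map_zero]
  | j + 1, φ => by
    ext f
    rw [res_succ]
    simp only [S.cur_barD, map_sub, res_barD, sub_zero]
    simp only [res_succ, S.cur_premul]
    exact T.sum_pairing (T.res j ∘ₗ S.cur j φ) f

theorem res_eq_zero : ∀ {j : ℕ} {w : ℤ} {φ : S.Bar j}, φ ∈ S.cochains j w → w ≠ j →
    T.res j φ = 0
  | 0, w, φ, hφ, hw => by
    rw [S.mem_cochains_zero.1 hφ (by simpa using hw), map_zero]
  | j + 1, w, φ, hφ, hw => by
    ext f
    rw [res_succ, LinearMap.zero_apply]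
    refine Finset.sum_eq_zero fun i _ => ?_
    rw [res_eq_zero (S.mem_cochains_succ.1 hφ 1 (S.aP i) (S.a_mem i)) (by
      push_cast at hw ⊢
      omega), LinearMap.zero_apply]

/-- The cochain `x ⊗ y ↦ ∑ x_i g_i(y)`. -/
noncomputable def linCochain {j : ℕ} (g : Fin n → S.Bar j) : S.Bar (j + 1) :=
  (S.cur j).symm (∑ i, (LinearMap.toSpanSingleton ℂ _ (g i)) ∘ₗ S.coord i ∘ₗ
    (S.P.restrictScalars ℂ).subtype)

theorem cur_linCochain {j : ℕ} (g : Fin n → S.Bar j) (x : S.P) :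
    S.cur j (linCochain g) x = ∑ i, S.coord i (x : A) • g i := by
  simp only [linCochain, LinearEquiv.apply_symm_apply, LinearMap.sum_apply]
  rfl

theorem cur_linCochain_aP {j : ℕ} (g : Fin n → S.Bar j) (i : Fin n) :
    S.cur j (linCochain g) (S.aP i) = g i := by
  rw [cur_linCochain]
  have : ∀ k, S.coord k (S.aP i : A) = if k = i then 1 else 0 := fun k => S.coord_a k i
  simp [this]

theorem linCochain_mem {j : ℕ} {w : ℤ} {g : Fin n → S.Bar j} (hg : ∀ i, g i ∈ S.cochains j w) :
    linCochain g ∈ S.cochains (j + 1) (w + 1) := by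
  rw [S.mem_cochains_succ]
  intro d x hx
  rw [cur_linCochain]
  refine Submodule.sum_mem _ fun i _ => ?_
  by_cases hd : d = 1
  · subst hd
    refine Submodule.smul_mem _ _ ?_
    simpa using hg i
  · rw [S.coord_of_ne hx hd, zero_smul]
    exact zero_mem _

theorem exists_res_eq : ∀ {j : ℕ} (ν : Module.Dual ℂ (M j)), ∃ φ ∈ S.cochains j (j : ℤ),
    T.res j φ = ν
  | 0, ν => by
    refine ⟨MultilinearMap.constOfIsEmpty ℂ _ (ν (T.ε.symm 1)),
      S.mem_cochains_zero.2 (fun h => absurd rfl h), ?_⟩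
    rw [res_zero]
    ext f
    have : f = T.ε f • T.ε.symm 1 := by
      apply T.ε.injective
      simp
    conv_rhs => rw [this]
    simp [mul_comm]
  | j + 1, ν => by
    obtain ⟨g, hg⟩ := T.functional_eq ν
    choose φ hφ hφ' using fun i => exists_res_eq (g i)
    refine ⟨linCochain φ, by simpa using linCochain_mem hφ, ?_⟩
    ext f
    rw [res_succ, hg]
    simp only [cur_linCochain_aP, hφ']

theorem exists_section (j : ℕ) : ∃ σ : Module.Dual ℂ (M j) →ₗ[ℂ] S.Bar j,
    (∀ ν, σ ν ∈ S.cochains j (j : ℤ)) ∧ ∀ ν, T.res j (σ ν) = ν := by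
  obtain ⟨σ, h1, h2⟩ := (T.res j).exists_lift_on LinearMap.id ⊤ (S.cochains j (j : ℤ))
    (fun ν _ => T.exists_res_eq ν)
  exact ⟨σ, h1, fun ν => h2 ν trivial⟩

/-- This says that the diagonal cohomology of the bar complex is no larger than the dual of `M`;
Koszulness plays no part. The slices of `φ` at the generators, restricted to `M`, factor through
products of degree two. A cochain `ψ` with first argument in `A₂` absorbs this, after which every
slice restricts to zero and is a coboundary by induction. -/
theorem exists_barD_of_res_eq_zero : ∀ {j : ℕ} {φ : S.Bar (j + 1)},
    φ ∈ S.cochains (j + 1) (j + 1 : ℤ) → T.res (j + 1) φ = 0 →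
    ∃ ψ ∈ S.cochains j (j + 1 : ℤ), S.barD j ψ = φ
  | 0, φ, hφ, h => by
    refine ⟨0, zero_mem _, ?_⟩
    rw [map_zero, eq_comm]
    refine S.eq_zero_of_cur_aP hφ fun i => ?_
    -- Every tuple of constants comes from `M₁`, so the restriction to `M₁` sees each value `φ(a_i)`
    -- separately.
    obtain ⟨g, hg⟩ := T.lift_zero (Pi.single i (T.ε.symm 1))
    have h1 := LinearMap.congr_fun h g
    rw [res_succ, Finset.sum_eq_single i] at h1
    · ext x
      rw [hg] at h1
      rw [Subsingleton.elim x ![]]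
      simpa [res_zero] using h1
    · intro k _ hk
      rw [hg, Pi.single_eq_of_ne hk, map_zero]
    · simp
  | j + 1, φ, hφ, h => by
    obtain ⟨σ, hσ, hσ'⟩ := T.exists_section j
    obtain ⟨g, hg, hg'⟩ := T.functionals_eq (fun i => T.res (j + 1) (S.cur (j + 1) φ (S.aP i)))
      (fun f => by
        have := LinearMap.congr_fun h f
        rwa [res_succ] at this)
    obtain ⟨F, hF, hF'⟩ := S.exists_quadratic g hg'
    -- The section `σ` turns the functionals given by `F` on `A₂` into cochains. The coboundary of
    -- `ψ` has the same slices at the `a_i` as `φ`, up to cochains vanishing on `M`.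
    let ψ : S.Bar (j + 1) := (S.cur j).symm (σ ∘ₗ F ∘ₗ (S.P.restrictScalars ℂ).subtype)
    have hψ : ∀ x : S.P, S.cur j ψ x = σ (F x) := fun x => by
      simp only [ψ, LinearEquiv.apply_symm_apply]
      rfl
    have hψmem : ψ ∈ S.cochains (j + 1) (j + 1 + 1 : ℤ) := by
      rw [S.mem_cochains_succ]
      intro d x hx
      rw [hψ]
      by_cases hd : d = 2
      · subst hd
        have := hσ (F x)
        have e : (j + 1 + 1 : ℤ) - (2 : ℕ) = j := by
          push_cast
          ring
        rwa [e]
      · rw [hF' d _ hx hd, map_zero]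
        exact zero_mem _
    have h0 : φ - S.barD (j + 1) ψ ∈ S.cochains (j + 2) (j + 1 + 1 : ℤ) :=
      sub_mem (by simpa using hφ) (S.barD_mem hψmem)
    have h1 : ∀ i, T.res (j + 1) (S.cur (j + 1) (φ - S.barD (j + 1) ψ) (S.aP i)) = 0 := by
      intro i
      ext f
      rw [map_sub, LinearMap.sub_apply, map_sub, LinearMap.sub_apply, hg, S.cur_barD, map_sub,
        T.res_barD, sub_zero, res_succ, LinearMap.zero_apply, sub_eq_zero]
      refine Finset.sum_congr rfl fun k _ => ?_
      rw [S.cur_premul, hψ, hσ']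
      exact congrArg (fun u => u (T.X k j f)) (hF i k).symm
    have h2 : ∀ i, S.cur (j + 1) (φ - S.barD (j + 1) ψ) (S.aP i) ∈
        S.cochains (j + 1) (j + 1 : ℤ) := by
      intro i
      have := S.mem_cochains_succ.1 h0 1 (S.aP i) (S.a_mem i)
      simpa using this
    -- Assembled with the coordinates of the first argument, the `χ_i` give a cochain whose
    -- coboundary has slices `-dχ_i`: the other term involves linear coordinates of products and
    -- vanishes. Hence the minus sign in the witness.
    choose χ hχ hχ' using fun i => exists_barD_of_res_eq_zero (h2 i) (h1 i)
    have h3 : linCochain χ ∈ S.cochains (j + 1) (j + 1 + 1 : ℤ) := linCochain_mem hχ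
    refine ⟨ψ - linCochain χ, by simpa using sub_mem hψmem h3, ?_⟩
    have h4 : φ - S.barD (j + 1) ψ + S.barD (j + 1) (linCochain χ) = 0 := by
      refine S.eq_zero_of_cur_aP (by simpa using add_mem h0 (S.barD_mem h3)) fun i => ?_
      rw [map_add, LinearMap.add_apply, ← hχ', S.cur_barD, cur_linCochain_aP]
      have : S.premul (S.aP i) (linCochain χ) = 0 := by
        refine S.cur_ext fun x => ?_
        rw [S.cur_premul, cur_linCochain, map_zero, LinearMap.zero_apply]
        refine Finset.sum_eq_zero fun k _ => ?_
        rw [S.coe_mulP]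
        exact (congrArg (fun r => r • χ k) (S.coord_a_mul k i x)).trans (zero_smul _ _)
      rw [this]
      abel
    rw [map_sub]
    rw [sub_add] at h4
    exact (sub_eq_zero.1 h4).symm

end Comodule

end StandardGrading


/-! ### Exactness of the Koszul complex `A ⊗ M` by duality -/

namespace StandardGrading

open scoped TensorProduct

variable {A : Type*} [CommRing A] [Algebra ℂ A] {n : ℕ} (S : StandardGrading A n)

theorem exists_sum_π (x : A) : ∃ N, ∀ N' ≥ N, ∑ i ∈ Finset.range N', S.π i x = x := by
  refine S.induction (p := fun x => ∃ N, ∀ N' ≥ N, ∑ i ∈ Finset.range N', S.π i x = x) x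
    ⟨0, by simp⟩ ?_ ?_
  · rintro x y ⟨N, hN⟩ ⟨N', hN'⟩
    refine ⟨max N N', fun k hk => ?_⟩
    simp only [map_add, Finset.sum_add_distrib]
    rw [hN k (le_of_max_le_left hk), hN' k (le_of_max_le_right hk)]
  · intro i x hx
    refine ⟨i + 1, fun k hk => ?_⟩
    rw [Finset.sum_eq_single i]
    · exact S.π_of_mem hx
    · intro j _ hj
      exact S.π_of_ne hx hj.symm
    · intro h
      simp at h
      omega

theorem exists_sum_rTensor_π {N : Type*} [AddCommGroup N] [Module ℂ N] (t : A ⊗[ℂ] N) :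
    ∃ K, ∀ K' ≥ K, ∑ i ∈ Finset.range K', (S.π i).rTensor N t = t := by
  induction t with
  | zero => exact ⟨0, by simp⟩
  | tmul x y =>
    obtain ⟨K, hK⟩ := S.exists_sum_π x
    refine ⟨K, fun K' h => ?_⟩
    simp only [LinearMap.rTensor_tmul]
    rw [← TensorProduct.sum_tmul, hK K' h]
  | add x y hx hy =>
    obtain ⟨N, hN⟩ := hx
    obtain ⟨N', hN'⟩ := hy
    refine ⟨max N N', fun k hk => ?_⟩
    simp only [map_add, Finset.sum_add_distrib]
    rw [hN k (le_of_max_le_left hk), hN' k (le_of_max_le_right hk)]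

/-- Vanishing of the off-diagonal cohomology of the bar complex. -/
def IsKoszul : Prop := ∀ (j w : ℕ), w ≠ j + 1 → ∀ φ ∈ S.cochains (j + 1) w,
  S.barD (j + 1) φ = 0 → ∃ ψ ∈ S.cochains j w, S.barD j ψ = φ

namespace Comodule

variable {S} {M : ℕ → Type*} [∀ j, AddCommGroup (M j)] [∀ j, Module ℂ (M j)] (T : S.Comodule M)

/-- The cochains `y ↦ Λ(a y)`. -/
noncomputable def shift {j : ℕ} (Λ : A →ₗ[ℂ] S.Bar j) : A →ₗ[ℂ] S.Bar (j + 1) :=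
  (S.cur j).symm.toLinearMap ∘ₗ LinearMap.mk₂ ℂ (fun (a : A) (y : S.P) => Λ (a * y))
    (fun a b y => by rw [add_mul, map_add]) (fun c a y => by rw [smul_mul_assoc, map_smul])
    (fun a x y => by rw [Submodule.coe_add, mul_add, map_add])
    (fun c a y => by rw [← map_smul, ← mul_smul_comm]; rfl)

theorem cur_shift {j : ℕ} (Λ : A →ₗ[ℂ] S.Bar j) (a : A) (y : S.P) :
    S.cur j (shift Λ a) y = Λ (a * y) := by
  simp [shift]

/-- Descending induction on the degree in `A`, starting from any lift of `lam` in degree `i`. In the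
next lower degree the cochain `y ↦ Λ(ay)` has to be a coboundary. The first time it is on the
diagonal, and the hypothesis on `lam` says that it vanishes on `M`. Afterwards it is an off-diagonal
cocycle, and Koszulness applies. -/
theorem exists_twisting (hK : S.IsKoszul) {i j : ℕ} (lam : A →ₗ[ℂ] Module.Dual ℂ (M j))
    (h0 : ∀ l x, x ∈ S.deg l → l ≠ i → lam x = 0)
    (h1 : ∀ a f, ∑ k, lam (a * S.a k) (T.X k j f) = 0) (m : ℕ) (hm : m ≤ i) :
    ∃ Λ : A →ₗ[ℂ] S.Bar j, (∀ l, ∀ x ∈ S.deg l, Λ x ∈ S.cochains j ((i : ℤ) + j - l)) ∧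
      (∀ x ∈ S.deg i, T.res j (Λ x) = lam x) ∧
      ∀ l, i ≤ l + m → ∀ a ∈ S.deg l, S.barD j (Λ a) = shift Λ a := by
  induction m with
  | zero =>
    obtain ⟨σ, hσ, hσ'⟩ := T.exists_section j
    have ha : ∀ l, ∀ x ∈ S.deg l, σ (lam x) ∈ S.cochains j ((i : ℤ) + j - l) := by
      intro l x hx
      by_cases hl : l = i
      · subst hl
        simpa using hσ (lam x)
      · rw [h0 l x hx hl, map_zero]
        exact zero_mem _
    refine ⟨σ ∘ₗ lam, ha, fun x _ => hσ' _, fun l hl a hal => ?_⟩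
    have h2 : shift (σ ∘ₗ lam) a = 0 := by
      refine S.cur_ext fun y => ?_
      rw [cur_shift, map_zero, LinearMap.zero_apply, LinearMap.comp_apply]
      refine S.P_induction (p := fun y => σ (lam (a * y)) = 0) y (by simp)
        (fun x y hx hy => by simp [mul_add, hx, hy]) fun d hd y hy => ?_
      rw [h0 _ _ (S.mul_mem hal hy) (by omega), map_zero]
    rw [h2]
    exact S.eq_zero_of_mem_cochains (S.barD_mem (ha l a hal)) (by push_cast; omega)
  | succ m ih =>
    obtain ⟨Λ, ha, hc, hd⟩ := ih (by omega)
    obtain ⟨l₀, hl₀⟩ := Nat.exists_eq_add_of_le hm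
    have hφ : ∀ a ∈ S.deg l₀, shift Λ a ∈ S.cochains (j + 1) ((j + 1 + m : ℕ) : ℤ) := by
      intro a hal
      rw [S.mem_cochains_succ]
      intro d x hx
      rw [cur_shift]
      have := ha _ _ (S.mul_mem hal hx)
      convert this using 1
      rw [hl₀]
      push_cast
      ring_nf
    have hlift : ∀ a ∈ S.deg l₀, ∃ ψ ∈ S.cochains j ((j + 1 + m : ℕ) : ℤ),
        S.barD j ψ = shift Λ a := by
      intro a hal
      -- The cochain has `j + 1` arguments and weight `j + 1 + m`, so `m = 0` is the diagonal case.
      rcases Nat.eq_zero_or_pos m with rfl | hm0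
      · refine T.exists_barD_of_res_eq_zero (by simpa using hφ a hal) ?_
        ext f
        rw [T.res_succ, LinearMap.zero_apply, ← h1 a f]
        refine Finset.sum_congr rfl fun k _ => ?_
        rw [cur_shift, hc]
        · rfl
        · have := S.mul_mem hal (S.a_mem k)
          rw [show i = l₀ + 1 by omega]
          exact this
      · refine hK j _ (by omega) _ (hφ a hal) ?_
        refine S.cur_ext fun y => ?_
        rw [S.cur_barD, map_zero, LinearMap.zero_apply, cur_shift]
        have h2 : S.premul y (shift Λ a) = shift Λ (a * y) := by
          refine S.cur_ext fun z => ?_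
          rw [S.cur_premul, cur_shift, cur_shift, S.coe_mulP, mul_assoc]
        rw [h2]
        refine S.P_induction (p := fun y => shift Λ (a * y) - S.barD j (Λ (a * y)) = 0) y
          (by simp) (fun x y hx hy => ?_) fun d hd' y hy => ?_
        · rw [Submodule.coe_add, mul_add, map_add, map_add, map_add, add_sub_add_comm, hx, hy,
            add_zero]
        · rw [hd _ (by omega) _ (S.mul_mem hal hy), sub_self]
    obtain ⟨Ψ, hΨ, hΨ'⟩ := (S.barD j).exists_lift_on (shift Λ) _ _ hlift
    -- Only the component in degree `l₀` changes. The conditions already arranged concern higher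
    -- degrees, and `shift` at degree `l₀` looks only at degrees above it.
    let Λ' : A →ₗ[ℂ] S.Bar j := Λ - Λ ∘ₗ S.π l₀ + Ψ ∘ₗ S.π l₀
    have e1 : ∀ x ∈ S.deg l₀, Λ' x = Ψ x := by
      intro x hx
      simp [Λ', S.π_of_mem hx]
    have e2 : ∀ l, l ≠ l₀ → ∀ x ∈ S.deg l, Λ' x = Λ x := by
      intro l hl x hx
      simp [Λ', S.π_of_ne hx hl]
    have e3 : ∀ l, l₀ ≤ l → ∀ x ∈ S.deg l, shift Λ' x = shift Λ x := by
      intro l hl x hx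
      refine S.cur_ext fun y => ?_
      rw [cur_shift, cur_shift]
      refine S.P_induction (p := fun y => Λ' (x * y) = Λ (x * y)) y (by simp)
        (fun y z hy hz => by simp [mul_add, hy, hz]) fun d hd' y hy => ?_
      exact e2 _ (by omega) _ (S.mul_mem hx hy)
    refine ⟨Λ', fun l x hx => ?_, fun x hx => ?_, fun l hl x hx => ?_⟩
    · by_cases h : l = l₀
      · subst h
        rw [e1 x hx]
        convert hΨ x using 1
        rw [hl₀]
        push_cast
        ring_nf
      · rw [e2 l h x hx]
        exact ha l x hx
    · rw [e2 i (by omega) x hx, hc x hx]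
    · by_cases h : l = l₀
      · subst h
        rw [e1 x hx, hΨ' x hx, e3 l le_rfl x hx]
      · rw [e2 l h x hx, e3 l (by omega) x hx, hd l (by omega) x hx]

/-- Let `μ` be the slice of `Λ(1)` restricted to `M`. For `a` of positive degree, `Λ(a)` is the
slice at `a` of `d(Λ(1))`, that is `Λ(1)` with its first argument premultiplied by `a`, minus a
coboundary that dies on `M`. For constants the formula is the definition of the restriction. -/
theorem exists_primitive (hK : S.IsKoszul) {i j : ℕ} (lam : A →ₗ[ℂ] Module.Dual ℂ (M (j + 1)))
    (h0 : ∀ l x, x ∈ S.deg l → l ≠ i → lam x = 0)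
    (h1 : ∀ a f, ∑ k, lam (a * S.a k) (T.X k (j + 1) f) = 0) :
    ∃ μ : A →ₗ[ℂ] Module.Dual ℂ (M j), ∀ a f, lam a f = ∑ k, μ (a * S.a k) (T.X k j f) := by
  obtain ⟨Λ, ha, hc, hd⟩ := T.exists_twisting hK lam h0 h1 i le_rfl
  have hd1 := hd 0 (by omega) 1 S.one_mem
  have hres : ∀ x, T.res (j + 1) (Λ x) = lam x := by
    intro x
    refine S.induction (p := fun x => T.res (j + 1) (Λ x) = lam x) x (by simp)
      (fun x y hx hy => by simp [hx, hy]) fun l x hx => ?_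
    by_cases hl : l = i
    · subst hl
      exact hc x hx
    · rw [h0 l x hx hl, T.res_eq_zero (ha l x hx) (by push_cast; omega)]
  obtain ⟨μ, hμ⟩ := LinearMap.exists_extend (p := S.P.restrictScalars ℂ)
    (T.res j ∘ₗ S.cur j (Λ 1))
  have hμ' : ∀ x : S.P, μ x = T.res j (S.cur j (Λ 1) x) := fun x => LinearMap.congr_fun hμ x
  refine ⟨μ, fun a f => ?_⟩
  refine S.induction (p := fun a => lam a f = ∑ k, μ (a * S.a k) (T.X k j f)) a (by simp)
    (fun x y hx hy => by simp [add_mul, Finset.sum_add_distrib, hx, hy]) fun l a hal => ?_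
  rcases Nat.eq_zero_or_pos l with rfl | hl
  · obtain ⟨r, rfl⟩ := S.deg_zero a hal
    rw [Algebra.algebraMap_eq_smul_one]
    simp only [smul_mul_assoc, one_mul, map_smul, LinearMap.smul_apply, ← Finset.smul_sum]
    congr 1
    rw [← hres, T.res_succ]
    exact Finset.sum_congr rfl fun k _ => by rw [← hμ']; rfl
  · obtain ⟨y, rfl⟩ : ∃ y : S.P, (y : A) = a := ⟨⟨a, S.deg_le_P hl hal⟩, rfl⟩
    have h2 := congrArg (fun φ => S.cur (j + 1) φ y) hd1
    simp only [S.cur_barD, cur_shift, one_mul] at h2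
    rw [← hres, ← h2, map_sub, T.res_barD, sub_zero, T.res_succ]
    refine Finset.sum_congr rfl fun k _ => ?_
    rw [S.cur_premul, ← hμ']
    rfl

/-- The differential of `A ⊗ M`. -/
noncomputable def tensorD (j : ℕ) : A ⊗[ℂ] M (j + 1) →ₗ[ℂ] A ⊗[ℂ] M j :=
  ∑ k, TensorProduct.map (LinearMap.mulRight ℂ (S.a k)) (T.X k j)

theorem tensorD_tmul {j : ℕ} (a : A) (f : M (j + 1)) :
    T.tensorD j (a ⊗ₜ f) = ∑ k, (a * S.a k) ⊗ₜ T.X k j f := by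
  simp [tensorD, LinearMap.sum_apply]

/-- If `t` were not a boundary, some functional would vanish on boundaries but not at `t`, and so
would its component in one degree of `A`. By `exists_primitive` this component factors through the
differential, hence vanishes at the cycle `t`. -/
theorem exists_tensorD_eq (hK : S.IsKoszul) {j : ℕ} {t : A ⊗[ℂ] M (j + 1)}
    (ht : T.tensorD j t = 0) : ∃ s, T.tensorD (j + 1) s = t := by
  by_contra hcon
  obtain ⟨f, hf, hf'⟩ := Submodule.exists_dual_map_eq_bot_of_notMem
    (p := LinearMap.range (T.tensorD (j + 1))) (x := t) hcon inferInstance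
  have hf0 : ∀ s, f (T.tensorD (j + 1) s) = 0 := by
    intro s
    have := Submodule.mem_map_of_mem (f := f) (LinearMap.mem_range_self (T.tensorD (j + 1)) s)
    rw [hf'] at this
    exact (Submodule.mem_bot ℂ).1 this
  obtain ⟨K, hKt⟩ := S.exists_sum_rTensor_π t
  obtain ⟨i, hi⟩ : ∃ i, f ((S.π i).rTensor _ t) ≠ 0 := by
    by_contra! h
    apply hf
    rw [← hKt K le_rfl, map_sum]
    exact Finset.sum_eq_zero fun i _ => h i
  obtain ⟨μ, hμ⟩ := T.exists_primitive hK (i := i) (TensorProduct.curry f ∘ₗ S.π i)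
    (fun l x hx hl => by simp [S.π_of_ne hx hl]) (fun a g => by
      refine S.induction (p := fun a => ∑ k, (TensorProduct.curry f ∘ₗ S.π i) (a * S.a k)
        (T.X k (j + 1) g) = 0) a (by simp)
        (fun x y hx hy => by
          simp only [add_mul, map_add, LinearMap.add_apply, Finset.sum_add_distrib]
          rw [hx, hy, add_zero])
        fun l a hal => ?_
      by_cases hl : l + 1 = i
      · subst hl
        rw [← hf0 (a ⊗ₜ g), T.tensorD_tmul, map_sum]
        refine Finset.sum_congr rfl fun k _ => ?_
        rw [LinearMap.comp_apply, S.π_of_mem (S.mul_mem hal (S.a_mem k)),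
          TensorProduct.curry_apply]
      · refine Finset.sum_eq_zero fun k _ => ?_
        rw [LinearMap.comp_apply, S.π_of_ne (S.mul_mem hal (S.a_mem k)) hl]
        simp)
  have key : f ∘ₗ (S.π i).rTensor _ = TensorProduct.lift μ ∘ₗ T.tensorD j := by
    refine TensorProduct.ext' fun a g => ?_
    rw [LinearMap.comp_apply, LinearMap.comp_apply, T.tensorD_tmul, map_sum]
    simp only [TensorProduct.lift.tmul]
    rw [← hμ]
    simp
  apply hi
  have := LinearMap.congr_fun key t
  simpa [ht] using this

theorem exists_tensorD_zero_eq (t : A ⊗[ℂ] M 0) : ∃ s m, t = T.tensorD 0 s + 1 ⊗ₜ m := by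
  induction t with
  | zero => exact ⟨0, 0, by simp⟩
  | add x y hx hy =>
    obtain ⟨s, m, rfl⟩ := hx
    obtain ⟨s', m', rfl⟩ := hy
    exact ⟨s + s', m + m', by rw [map_add, TensorProduct.tmul_add]; abel⟩
  | tmul a m =>
    refine S.induction (p := fun a => ∃ s m', a ⊗ₜ m = T.tensorD 0 s + 1 ⊗ₜ m') a
      ⟨0, 0, by simp⟩ ?_ fun l a hal => ?_
    · rintro x y ⟨s, m, hs⟩ ⟨s', m', hs'⟩
      exact ⟨s + s', m + m', by
        rw [TensorProduct.add_tmul, hs, hs', map_add, TensorProduct.tmul_add]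
        abel⟩
    rcases Nat.eq_zero_or_pos l with rfl | hl
    · obtain ⟨r, rfl⟩ := S.deg_zero a hal
      exact ⟨0, r • m, by
        rw [map_zero, zero_add, Algebra.algebraMap_eq_smul_one, TensorProduct.smul_tmul]⟩
    · have ha := S.P_le_span (S.deg_le_P hl hal)
      suffices ∃ s, a ⊗ₜ m = T.tensorD 0 s by
        obtain ⟨s, hs⟩ := this
        exact ⟨s, 0, by simpa using hs⟩
      obtain ⟨c, hc⟩ := Ideal.mem_span_range_iff_exists_fun.1 ha
      choose g hg using fun k => T.lift_zero (Pi.single k m)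
      refine ⟨∑ k, c k ⊗ₜ g k, ?_⟩
      rw [map_sum, ← hc, TensorProduct.sum_tmul]
      refine Finset.sum_congr rfl fun k _ => ?_
      rw [T.tensorD_tmul, Finset.sum_eq_single k]
      · rw [hg, Pi.single_eq_same]
      · intro i _ hi
        rw [hg, Pi.single_eq_of_ne hi, TensorProduct.tmul_zero]
      · simp

end Comodule

end StandardGrading


/-! ### The invariant vector fields on the symmetric algebra of the dual -/

open SuperComm

theorem SuperComm.gen_mul_induction {R : Type*} [CommRing R] {X : Type*} {p : X → ℕ}
    {P : SuperComm R p → Prop} (hC : ∀ r : R, P (algebraMap R _ r))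
    (hadd : ∀ a b, P a → P b → P (a + b)) (hgen : ∀ x a, P a → P (gen p x * a))
    (s : SuperComm R p) : P s := by
  refine monomial_induction ?_ (fun r l => ?_) hadd s
  · have := hC 0
    rwa [map_zero] at this
  · induction l with
    | nil => simpa using hC r
    | cons x l ih =>
      rw [List.map_cons, List.prod_cons, ← mul_assoc, Algebra.commutes, mul_assoc]
      exact hgen x _ ih

theorem SuperComm.IsPar.parity_iterate {R : Type*} [CommRing R] {X : Type*} {p : X → ℕ} {q : ℕ}
    {a : SuperComm R p} (h : IsPar q a) (k : ℕ) :
    (SuperComm.parity^[k]) a = ((-1) ^ (k * q) : R) • a := by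
  induction k with
  | zero => simp
  | succ k ih =>
    rw [Function.iterate_succ_apply', ih, map_smul, h.parity, smul_smul, ← pow_add, add_mul,
      one_mul]

namespace LieConstants

theorem neg_one_pow_mul_self (k : ℕ) : ((-1 : ℂ) ^ k) * (-1) ^ k = 1 := by
  rw [← mul_pow]
  norm_num

variable {X : Type*} (C : LieConstants X)

theorem jacobi' (b s t v : X) : ∑ a ∈ C.ball (C.deg v), (C.c b s a * C.c a t v -
    (-1) ^ (C.deg s * C.deg t) * (C.c b t a * C.c a s v) - C.c s t a * C.c b a v) = 0 := by
  rw [← C.jacobi b s t v]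
  refine Finset.sum_congr rfl fun a _ => ?_
  have h1 : (-1 : ℂ) ^ (C.deg b * (C.deg s + C.deg t)) * (C.c s t a * C.c a b v) =
      -(C.c s t a * C.c b a v) := by
    by_cases h : C.c s t a = 0
    · simp [h]
    · rw [C.c_deg h, C.skew b a v]
      linear_combination (-C.c s t a * C.c b a v) * neg_one_pow_mul_self (C.deg b * C.deg a)
  have h2 : (-1 : ℂ) ^ (C.deg t * (C.deg b + C.deg s)) * (C.c t b a * C.c a s v) =
      -((-1) ^ (C.deg s * C.deg t) * (C.c b t a * C.c a s v)) := by
    rw [C.skew b t a, mul_add, pow_add, mul_comm (C.deg t) (C.deg b), mul_comm (C.deg t)]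
    linear_combination (-(-1) ^ (C.deg s * C.deg t) * C.c b t a * C.c a s v) *
      neg_one_pow_mul_self (C.deg b * C.deg t)
  rw [h1, h2]
  ring

/-- The symmetric algebra, in the super sense, on the graded dual. -/
abbrev Sym : Type _ := SuperComm ℂ C.deg

/-- The generators. -/
noncomputable def η (v : X) : C.Sym := gen C.deg v

theorem isPar_η (v : X) : IsPar (R := ℂ) (C.deg v) (C.η v) := isPar_gen (p := C.deg) v

open Classical in
/-- The action of the `u`-th basis vector on a generator. -/
noncomputable def actVal (u v : X) : C.Sym :=
  -- This is the coefficient of `ξ_u` in `dη_v`, so the operators are the vector fields dual to the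
  -- forms `ξ_u`.
  (if u = v then 1 else 0) +
    (C.deg v : ℂ)⁻¹ • ∑ s ∈ C.ball (C.deg v), (C.deg s * C.c s u v) • C.η s

open Classical in
theorem actVal_eq (u v : X) {N : ℕ} (hN : C.deg v ≤ N) : C.actVal u v =
    (if u = v then 1 else 0) +
      (C.deg v : ℂ)⁻¹ • ∑ s ∈ C.ball N, (C.deg s * C.c s u v) • C.η s := by
  rw [actVal]
  congr 2
  refine Finset.sum_subset (fun x hx => C.mem_ball.2 ((C.mem_ball.1 hx).trans hN)) ?_
  intro s _ hs
  have : C.c s u v = 0 := by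
    by_contra hc
    have := C.c_deg hc
    rw [C.mem_ball] at hs
    omega
  rw [this, mul_zero, zero_smul]

theorem isPar_actVal (u v : X) : IsPar (R := ℂ) (C.deg v + C.deg u) (C.actVal u v) := by
  refine IsPar.add ?_ (IsPar.smul (IsPar.sum fun s _ => ?_) _)
  · split_ifs with h
    · subst h
      have := isPar_algebraMap (R := ℂ) (p := C.deg) 1
      rw [map_one] at this
      exact this.congr (by simp)
    · exact isPar_zero _
  · by_cases hc : C.c s u v = 0
    · rw [hc, mul_zero, zero_smul]
      exact isPar_zero _
    · refine ((C.isPar_η s).congr ?_).smul _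
      rw [← C.c_deg hc]
      exact ⟨C.deg s + C.deg u, by ring⟩

/-- The action of the `u`-th basis vector. -/
noncomputable def act (u : X) : C.Sym →ₗ[ℂ] C.Sym :=
  gder (C.deg u) (C.actVal u) fun v y => (C.isPar_actVal u v).der_cond y

theorem act_η (u v : X) : C.act u (C.η v) = C.actVal u v := gder_gen _ _ _ v

theorem act_algebraMap (u : X) (r : ℂ) : C.act u (algebraMap ℂ _ r) = 0 := gder_algebraMap _ _ _ r

theorem act_one (u : X) : C.act u 1 = 0 := by
  have := C.act_algebraMap u 1
  rwa [map_one] at this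

theorem act_mul (u : X) {q : ℕ} {a : C.Sym} (ha : IsPar (R := ℂ) q a) (f : C.Sym) :
    C.act u (a * f) = C.act u a * f + ((-1) ^ (C.deg u * q) : ℂ) • (a * C.act u f) := by
  have h := gder_mul (C.deg u) (C.actVal u) (fun v y => (C.isPar_actVal u v).der_cond y) a f
  rwa [ha.parity_iterate, smul_mul_assoc] at h

theorem act_η_mul (u v : X) (f : C.Sym) : C.act u (C.η v * f) = C.actVal u v * f +
    ((-1) ^ (C.deg u * C.deg v) : ℂ) • (C.η v * C.act u f) := by
  rw [C.act_mul u (C.isPar_η v), act_η]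

theorem deg_ne (v : X) : (C.deg v : ℂ) ≠ 0 := Nat.cast_ne_zero.2 (C.pos v).ne'

theorem act_actVal (s t v : X) : C.act s (C.actVal t v) = (C.deg v : ℂ)⁻¹ •
    ((C.deg s * C.c s t v : ℂ) • 1 + ∑ b ∈ C.ball (C.deg v),
      (C.deg b * ∑ a ∈ C.ball (C.deg v), C.c b s a * C.c a t v : ℂ) • C.η b) := by
  classical
  rw [actVal, map_add, map_smul, map_sum]
  have h0 : C.act s (if t = v then 1 else 0) = 0 := by
    split_ifs
    · exact C.act_one s
    · exact map_zero _
  rw [h0, zero_add]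
  congr 1
  have h1 : ∀ a ∈ C.ball (C.deg v), C.act s ((C.deg a * C.c a t v : ℂ) • C.η a) =
      (if s = a then (C.deg a * C.c a t v : ℂ) • 1 else 0) +
        ∑ b ∈ C.ball (C.deg v), (C.deg b * (C.c b s a * C.c a t v) : ℂ) • C.η b := by
    intro a ha
    rw [map_smul, act_η, C.actVal_eq s a (C.mem_ball.1 ha), smul_add, smul_smul, Finset.smul_sum]
    congr 1
    · split_ifs
      · rfl
      · rw [smul_zero]
    · refine Finset.sum_congr rfl fun b _ => ?_
      rw [smul_smul]
      congr 1
      field_simp [C.deg_ne a]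
  rw [Finset.sum_congr rfl h1, Finset.sum_add_distrib, Finset.sum_comm]
  congr 1
  · rw [Finset.sum_ite_eq]
    split_ifs with h
    · rfl
    · have : C.c s t v = 0 := by
        by_contra hc
        have := C.c_deg hc
        rw [C.mem_ball] at h
        omega
      rw [this, mul_zero, zero_smul]
  · refine Finset.sum_congr rfl fun b _ => ?_
    rw [← Finset.sum_smul, Finset.mul_sum]

/-- The constant terms agree by skew-symmetry and `|s| + |t| = |v|`; the linear terms agree by the
Jacobi identity. -/
theorem act_comm_actVal (s t v : X) : C.act s (C.actVal t v) -
    ((-1) ^ (C.deg s * C.deg t) : ℂ) • C.act t (C.actVal s v) =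
      ∑ u ∈ C.ball (C.deg s + C.deg t), C.c s t u • C.actVal u v := by
  classical
  have hball : ∀ u, C.c s t u ≠ 0 → u ∈ C.ball (C.deg s + C.deg t) := fun u hu =>
    C.mem_ball.2 (C.c_deg hu).ge
  have hR : ∑ u ∈ C.ball (C.deg s + C.deg t), C.c s t u • C.actVal u v = (C.deg v : ℂ)⁻¹ •
      ((C.deg v * C.c s t v : ℂ) • 1 + ∑ b ∈ C.ball (C.deg v),
        (C.deg b * ∑ a ∈ C.ball (C.deg v), C.c s t a * C.c b a v : ℂ) • C.η b) := by
    simp only [actVal, smul_add, Finset.sum_add_distrib]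
    congr 1
    · simp only [smul_ite, smul_zero, Finset.sum_ite_eq']
      rw [smul_smul, inv_mul_cancel_left₀ (C.deg_ne v)]
      split_ifs with h
      · rfl
      · have : C.c s t v = 0 := by
          by_contra hc
          exact h (hball v hc)
        rw [this, zero_smul]
    · simp only [Finset.smul_sum]
      rw [Finset.sum_comm]
      refine Finset.sum_congr rfl fun b _ => ?_
      simp only [smul_smul, ← Finset.sum_smul, Finset.mul_sum]
      congr 1
      have hL : ∀ N, ∑ u ∈ C.ball N, C.c s t u * ((C.deg v : ℂ)⁻¹ * (C.deg b * C.c b u v)) =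
          ∑ u ∈ C.ball N, (C.deg v : ℂ)⁻¹ * (C.deg b * (C.c s t u * C.c b u v)) := fun N =>
        Finset.sum_congr rfl fun u _ => by ring
      rw [hL]
      have h0 : ∀ u, (u ∉ C.ball (C.deg s + C.deg t) ∨ u ∉ C.ball (C.deg v)) →
          (C.deg v : ℂ)⁻¹ * (C.deg b * (C.c s t u * C.c b u v)) = 0 := by
        rintro u (h | h)
        · have : C.c s t u = 0 := by
            by_contra hc
            exact h (hball u hc)
          simp [this]
        · have : C.c b u v = 0 := by
            by_contra hc
            have := C.c_deg hc
            rw [C.mem_ball] at h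
            omega
          simp [this]
      have hsub : ∀ {N N'}, N ≤ N' → C.ball N ⊆ C.ball N' := fun h x hx =>
        C.mem_ball.2 ((C.mem_ball.1 hx).trans h)
      rcases le_total (C.deg s + C.deg t) (C.deg v) with h | h
      · exact Finset.sum_subset (hsub h) fun u _ hu => h0 u (Or.inl hu)
      · exact (Finset.sum_subset (hsub h) fun u _ hu => h0 u (Or.inr hu)).symm
  rw [hR, act_actVal, act_actVal, smul_comm _ ((C.deg v : ℂ)⁻¹), ← smul_sub]
  congr 1
  rw [smul_add, add_sub_add_comm, smul_smul, ← sub_smul, Finset.smul_sum, ← Finset.sum_sub_distrib]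
  congr 1
  · congr 1
    by_cases hc : C.c s t v = 0
    · rw [C.skew s t v, hc]
      simp
    · rw [C.skew s t v, ← C.c_deg hc]
      push_cast
      linear_combination (C.deg t * C.c s t v : ℂ) * neg_one_pow_mul_self (C.deg s * C.deg t)
  · refine Finset.sum_congr rfl fun b _ => ?_
    rw [smul_smul, ← sub_smul]
    congr 1
    have h := C.jacobi' b s t v
    rw [Finset.sum_sub_distrib, Finset.sum_sub_distrib, ← Finset.mul_sum] at h
    linear_combination (C.deg b : ℂ) * h

/-- The `act u` represent the Lie superalgebra. -/
theorem act_comm (s t : X) (f : C.Sym) : C.act s (C.act t f) -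
    ((-1) ^ (C.deg s * C.deg t) : ℂ) • C.act t (C.act s f) =
      ∑ u ∈ C.ball (C.deg s + C.deg t), C.c s t u • C.act u f := by
  -- Both sides are derivations of parity `|s| + |t|`, so what matters is the comparison on a
  -- generator, `act_comm_actVal`.
  induction f using SuperComm.gen_mul_induction with
  | hC r => simp [act_algebraMap]
  | hadd a b ha hb =>
    simp only [map_add, smul_add, Finset.sum_add_distrib, ← ha, ← hb]
    abel
  | hgen v f ih =>
    change C.act s (C.act t (C.η v * f)) - _ • C.act t (C.act s (C.η v * f)) =
      ∑ u ∈ _, _ • C.act u (C.η v * f)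
    have hR : ∑ u ∈ C.ball (C.deg s + C.deg t), C.c s t u • C.act u (C.η v * f) =
        (∑ u ∈ C.ball (C.deg s + C.deg t), C.c s t u • C.actVal u v) * f +
        ((-1) ^ ((C.deg s + C.deg t) * C.deg v) : ℂ) • (C.η v *
          ∑ u ∈ C.ball (C.deg s + C.deg t), C.c s t u • C.act u f) := by
      rw [Finset.sum_mul, Finset.mul_sum, Finset.smul_sum, ← Finset.sum_add_distrib]
      refine Finset.sum_congr rfl fun u _ => ?_
      rw [act_η_mul, smul_add, smul_mul_assoc, mul_smul_comm]
      congr 1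
      by_cases hc : C.c s t u = 0
      · simp [hc]
      · rw [C.c_deg hc, smul_comm]
    have hL : ∀ s t : X, C.act s (C.act t (C.η v * f)) = C.act s (C.actVal t v) * f +
        ((-1) ^ (C.deg s * (C.deg v + C.deg t)) : ℂ) • (C.actVal t v * C.act s f) +
        ((-1) ^ (C.deg t * C.deg v) : ℂ) • (C.actVal s v * C.act t f) +
        ((-1) ^ ((C.deg s + C.deg t) * C.deg v) : ℂ) • (C.η v * C.act s (C.act t f)) := by
      intro s t
      rw [act_η_mul, map_add, map_smul, C.act_mul s (C.isPar_actVal t v), act_η_mul, smul_add,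
        smul_smul, ← pow_add, add_mul, add_comm (C.deg s * C.deg v), add_assoc, add_assoc,
        add_assoc]
    rw [hR, ← act_comm_actVal, ← ih, hL s t, hL t s]
    have e1 : ((-1 : ℂ) ^ (C.deg s * C.deg t)) * (-1) ^ (C.deg t * (C.deg v + C.deg s)) =
        (-1) ^ (C.deg t * C.deg v) := by
      rw [mul_add, pow_add, mul_comm (C.deg t) (C.deg s)]
      linear_combination ((-1 : ℂ) ^ (C.deg t * C.deg v)) *
        neg_one_pow_mul_self (C.deg s * C.deg t)
    have e2 : ((-1 : ℂ) ^ (C.deg s * C.deg t)) * (-1) ^ (C.deg s * C.deg v) =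
        (-1) ^ (C.deg s * (C.deg v + C.deg t)) := by
      rw [mul_add, pow_add, mul_comm]
    have e3 : (C.deg t + C.deg s) * C.deg v = (C.deg s + C.deg t) * C.deg v := by ring
    simp only [smul_add, smul_smul, e1, e2, e3, sub_mul, mul_sub, smul_sub, smul_mul_assoc,
      mul_smul_comm]
    rw [mul_comm ((-1 : ℂ) ^ (C.deg s * C.deg t))]
    abel

end LieConstants


/-! ### Euler's identity and the cofreeness of the symmetric algebra over the quadratic dual -/

open SuperComm

theorem isDiagonal_zero {R : Type*} [CommRing R] [Algebra ℂ R] :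
    Module.End.IsDiagonal ((0 : Derivation ℂ R R) : R →ₗ[ℂ] R) := by
  rw [Module.End.IsDiagonal, eq_top_iff]
  rintro x -
  exact Submodule.mem_iSup_of_mem 0 (Module.End.mem_eigenspace_iff.2 (by simp))
namespace LieConstants

section

variable {X : Type*} (C : LieConstants X)

/-- The grading operator. -/
noncomputable def wt : C.Sym →ₗ[ℂ] C.Sym := weight (0 : Derivation ℂ ℂ ℂ) fun v => (C.deg v : ℂ)

theorem wt_mul (a b : C.Sym) : C.wt (a * b) = C.wt a * b + a * C.wt b := weight_mul _ _ a b

theorem wt_η (v : X) : C.wt (C.η v) = (C.deg v : ℂ) • C.η v := weight_gen _ _ v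

theorem wt_algebraMap (r : ℂ) : C.wt (algebraMap ℂ _ r) = 0 := by
  exact (weight_algebraMap (0 : Derivation ℂ ℂ ℂ) (fun v => (C.deg v : ℂ)) r).trans (by simp)

theorem wt_one : C.wt 1 = 0 := by
  have := C.wt_algebraMap 1
  rwa [map_one] at this

/-- The homogeneous components. -/
noncomputable def symPart (μ : ℂ) : Submodule ℂ C.Sym := Module.End.eigenspace C.wt μ

theorem mem_symPart {μ : ℂ} {f : C.Sym} : f ∈ C.symPart μ ↔ C.wt f = μ • f :=
  Module.End.mem_eigenspace_iff

theorem symPart_eq {μ : ℂ} (T : List X → Prop) (h : ∀ l, T l ↔ ((l.map C.deg).sum : ℂ) = μ) :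
    C.symPart μ = monomialSpan C.deg ⊤ T := by
  have e : ∀ l : List X, (l.map fun v => (C.deg v : ℂ)).sum = ((l.map C.deg).sum : ℕ) := by
    intro l
    rw [Nat.cast_list_sum, List.map_map]
    rfl
  refine eigenspace_weight isDiagonal_zero _ _ _ _ (fun r _ l hl => ⟨0, by simp, ?_⟩)
    (fun r hr c' l hc' hl => ⟨trivial, ?_⟩)
  · rw [e, zero_add]
    exact (h l).1 hl
  · have : c' = 0 := by
      have : (0 : ℂ) = c' • r := by simpa using hc'
      rcases smul_eq_zero.1 this.symm with h | h
      · exact h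
      · exact absurd h hr
    rw [this, zero_add, e] at hl
    exact (h l).2 hl

theorem symPart_eq_bot {μ : ℂ} (h : ∀ k : ℕ, (k : ℂ) ≠ μ) : C.symPart μ = ⊥ := by
  rw [C.symPart_eq (fun _ => False) (fun l => ⟨False.elim, h _⟩), monomialSpan]
  simp

/-- The augmentation. -/
noncomputable def aug : C.Sym →ₐ[ℂ] ℂ := lift (fun _ => 0) (by simp)

theorem symPart_zero : C.symPart 0 = Submodule.span ℂ {1} := by
  rw [C.symPart_eq (fun l => l = []) (fun l => ?_)]
  · refine le_antisymm (Submodule.span_le.2 ?_) (Submodule.span_le.2 ?_)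
    · rintro _ ⟨a, -, l, rfl, rfl⟩
      rw [Algebra.algebraMap_eq_smul_one]
      simpa using Submodule.smul_mem _ a (Submodule.mem_span_singleton_self 1)
    · rintro _ rfl
      exact Submodule.subset_span ⟨1, trivial, [], rfl, by simp⟩
  · rw [Nat.cast_eq_zero]
    cases l with
    | nil => simp
    | cons x l => simp [(C.pos x).ne']

theorem wt_actVal (u v : X) :
    C.wt (C.actVal u v) = (C.deg v - C.deg u : ℂ) • C.actVal u v := by
  classical
  rw [actVal, map_add, map_smul, map_sum, smul_add,
    smul_comm (C.deg v - C.deg u : ℂ) ((C.deg v : ℂ)⁻¹), Finset.smul_sum (r := (C.deg v - C.deg u : ℂ))]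
  congr 1
  · split_ifs with h
    · subst h
      rw [wt_one]
      simp
    · simp
  · congr 1
    refine Finset.sum_congr rfl fun s _ => ?_
    rw [map_smul, wt_η]
    by_cases hc : C.c s u v = 0
    · simp [hc]
    · rw [← C.c_deg hc]
      push_cast
      rw [add_sub_cancel_right, smul_comm]

theorem wt_act (u : X) (f : C.Sym) : C.wt (C.act u f) = C.act u (C.wt f) -
    (C.deg u : ℂ) • C.act u f := by
  induction f using gen_mul_induction with
  | hC r => simp [act_algebraMap, wt_algebraMap]
  | hadd a b ha hb =>
    simp only [map_add, ha, hb, smul_add]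
    abel
  | hgen v f ih =>
    change C.wt (C.act u (C.η v * f)) = C.act u (C.wt (C.η v * f)) - _ • C.act u (C.η v * f)
    simp only [wt_mul, wt_η, map_add, smul_mul_assoc, map_smul, act_η_mul, wt_actVal, ih, mul_sub,
      mul_smul_comm]
    module

theorem act_mem {u : X} {μ : ℂ} {f : C.Sym} (hf : f ∈ C.symPart μ) :
    C.act u f ∈ C.symPart (μ - C.deg u) := by
  rw [mem_symPart] at hf ⊢
  rw [wt_act, hf, map_smul, sub_smul]

theorem eq_zero_of_mem_symPart {w d : ℕ} (h : w < d) {f : C.Sym}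
    (hf : f ∈ C.symPart ((w : ℂ) - d)) : f = 0 := by
  rw [C.symPart_eq_bot] at hf
  · exact (Submodule.mem_bot ℂ).1 hf
  · intro k hk
    rw [eq_sub_iff_add_eq] at hk
    have : k + d = w := by exact_mod_cast hk
    omega

/-- The quadratic terms `|s||a| c_{as}^v η_s η_a` cancel in pairs, since the structure constants are
skew and the `η` supercommute. -/
theorem sum_η_actVal (v : X) {N : ℕ} (hN : C.deg v ≤ N) :
    ∑ s ∈ C.ball N, (C.deg s : ℂ) • (C.η s * C.actVal s v) = (C.deg v : ℂ) • C.η v := by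
  classical
  have h1 : ∀ s, (C.deg s : ℂ) • (C.η s * C.actVal s v) =
      (if s = v then (C.deg v : ℂ) • C.η v else 0) + (C.deg v : ℂ)⁻¹ •
        ∑ a ∈ C.ball N, ((C.deg s * C.deg a * C.c a s v : ℂ)) • (C.η s * C.η a) := by
    intro s
    rw [C.actVal_eq s v hN, mul_add, smul_add, mul_smul_comm, smul_comm, Finset.mul_sum,
      Finset.smul_sum]
    congr 1
    · split_ifs with h
      · rw [h, mul_one]
      · simp
    · congr 1
      refine Finset.sum_congr rfl fun a _ => ?_
      rw [mul_smul_comm, smul_smul, mul_assoc]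
  simp only [h1, Finset.sum_add_distrib, ← Finset.smul_sum]
  have h2 : ∑ s ∈ C.ball N, ∑ a ∈ C.ball N,
      ((C.deg s * C.deg a * C.c a s v : ℂ)) • (C.η s * C.η a) = 0 := by
    have h4 : ∀ x : C.Sym, x = -x → x = 0 := fun x hx => by
      have : (2 : ℂ) • x = 0 := by
        rw [two_smul]
        exact add_eq_zero_iff_eq_neg.2 hx
      simpa using this
    refine h4 _ ?_
    conv_lhs => rw [Finset.sum_comm]
    rw [← Finset.sum_neg_distrib]
    refine Finset.sum_congr rfl fun s _ => ?_
    rw [← Finset.sum_neg_distrib]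
    refine Finset.sum_congr rfl fun a _ => ?_
    have h3 : C.η a * C.η s = ((-1) ^ (C.deg a * C.deg s) : ℂ) • (C.η s * C.η a) :=
      gen_mul_gen' a s
    rw [h3, smul_smul, C.skew a s v, ← neg_smul]
    congr 1
    linear_combination (-C.deg a * C.deg s * C.c a s v : ℂ) *
      neg_one_pow_mul_self (C.deg a * C.deg s)
  rw [h2, smul_zero, add_zero, Finset.sum_ite_eq', if_pos (C.mem_ball.2 hN)]

/-- Euler's identity. -/
theorem sum_η_act_eventually (f : C.Sym) : ∃ N₀, ∀ N ≥ N₀,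
    ∑ s ∈ C.ball N, (C.deg s : ℂ) • (C.η s * C.act s f) = C.wt f := by
  induction f using gen_mul_induction with
  | hC r => exact ⟨0, fun N _ => by simp [act_algebraMap, wt_algebraMap]⟩
  | hadd a b ha hb =>
    obtain ⟨N, hN⟩ := ha
    obtain ⟨N', hN'⟩ := hb
    refine ⟨max N N', fun k hk => ?_⟩
    simp only [map_add, mul_add, smul_add, Finset.sum_add_distrib]
    rw [hN k (le_of_max_le_left hk), hN' k (le_of_max_le_right hk)]
  | hgen v f ih =>
    obtain ⟨N, hN⟩ := ih
    refine ⟨max N (C.deg v), fun k hk => ?_⟩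
    change ∑ s ∈ C.ball k, (C.deg s : ℂ) • (C.η s * C.act s (C.η v * f)) = C.wt (C.η v * f)
    have h1 : ∀ s, (C.deg s : ℂ) • (C.η s * C.act s (C.η v * f)) =
        ((C.deg s : ℂ) • (C.η s * C.actVal s v)) * f +
          C.η v * ((C.deg s : ℂ) • (C.η s * C.act s f)) := by
      intro s
      have h3 : C.η v * C.η s = ((-1) ^ (C.deg s * C.deg v) : ℂ) • (C.η s * C.η v) := by
        rw [mul_comm (C.deg s)]
        exact gen_mul_gen' v s
      rw [act_η_mul, mul_add, smul_add, mul_smul_comm, ← mul_assoc, ← mul_assoc, mul_smul_comm,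
        ← mul_assoc, h3, smul_mul_assoc, smul_mul_assoc]
    rw [Finset.sum_congr rfl fun s _ => h1 s, Finset.sum_add_distrib, ← Finset.sum_mul,
      ← Finset.mul_sum, hN k (le_of_max_le_left hk), C.sum_η_actVal v (le_of_max_le_right hk),
      wt_mul, wt_η]

/-- On weight `w` the fields of degree greater than `w` act as zero, so a finite range of summation
suffices. -/
theorem sum_η_act {w : ℕ} {f : C.Sym} (hf : f ∈ C.symPart w) {N : ℕ} (hN : w ≤ N) :
    ∑ s ∈ C.ball N, (C.deg s : ℂ) • (C.η s * C.act s f) = (w : ℂ) • f := by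
  obtain ⟨N₀, h⟩ := C.sum_η_act_eventually f
  rw [← C.mem_symPart.1 hf, ← h (max N N₀) (le_max_right _ _)]
  refine Finset.sum_subset (fun x hx => C.mem_ball.2 ((C.mem_ball.1 hx).trans (le_max_left _ _))) ?_
  intro s _ hs
  rw [C.mem_ball] at hs
  rw [C.eq_zero_of_mem_symPart (by omega) (C.act_mem (u := s) hf), mul_zero, smul_zero]

/-- Representations of the Lie superalgebra. -/
def IsRep {R : Type*} [Ring R] [Algebra ℂ R] (ρ : X → R) : Prop :=
  ∀ s t, ρ s * ρ t - ((-1) ^ (C.deg s * C.deg t) : ℂ) • (ρ t * ρ s) =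
    ∑ u ∈ C.ball (C.deg s + C.deg t), C.c s t u • ρ u

theorem isRep_act : C.IsRep (R := Module.End ℂ C.Sym) C.act := by
  intro s t
  ext f
  have := C.act_comm s t f
  simpa [LinearMap.sum_apply] using this

end

variable {X : Type} (C : LieConstants X) {A : Type} [CommRing A] [Algebra ℂ A] {n : ℕ}
  (S : StandardGrading A n)

/-- The universal enveloping algebra is presented as the quadratic dual. -/
structure Presentation where
  B : Fin n → X
  B_deg : ∀ i, C.deg (B i) = 1
  B_inj : Function.Injective B
  B_surj : ∀ u, C.deg u = 1 → ∃ i, B i = u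
  p : X → FreeAlgebra ℂ (Fin n)
  p_mem : ∀ u, p u ∈ Submodule.span ℂ (Set.range (FreeAlgebra.ι ℂ (X := Fin n))) ^ C.deg u
  p_B : ∀ i, p (B i) = FreeAlgebra.ι ℂ i
  eval : ∀ {R : Type} [Ring R] [Algebra ℂ R] (ρ : X → R), C.IsRep ρ → ∀ u,
    FreeAlgebra.lift ℂ (fun i => ρ (B i)) (p u) = ρ u
  isRep : ∀ {R : Type} [Ring R] [Algebra ℂ R] (Y : Fin n → R),
    (∀ c ∈ S.dualRel, ∑ i, ∑ k, c i k • (Y i * Y k) = 0) →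
      C.IsRep fun u => FreeAlgebra.lift ℂ Y (p u)
  rel : ∀ {R : Type} [Ring R] [Algebra ℂ R] (ρ : X → R), C.IsRep ρ →
    ∀ c ∈ S.dualRel, ∑ i, ∑ k, c i k • (ρ (B i) * ρ (B k)) = 0

namespace Presentation

variable {C S} (Q : C.Presentation S)

/-- Commutativity of `A` makes the relations stable under transposition. This reconciles the order
of composed operators with the order of the factors in a relation. -/
theorem _root_.StandardGrading.dualRel_swap {c : Fin n → Fin n → ℂ} (hc : c ∈ S.dualRel) :
    (fun i k => c k i) ∈ S.dualRel := by
  intro q hq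
  rw [Finset.sum_comm]
  refine hc (fun i k => q k i) ?_
  rw [S.mem_rel] at hq ⊢
  rw [Finset.sum_comm, ← hq]
  exact Finset.sum_congr rfl fun i _ => Finset.sum_congr rfl fun k _ => by rw [mul_comm]

theorem act_rel {c : Fin n → Fin n → ℂ} (hc : c ∈ S.dualRel) (f : C.Sym) :
    ∑ i, ∑ k, c i k • C.act (Q.B k) (C.act (Q.B i) f) = 0 := by
  have h := LinearMap.congr_fun (Q.rel (R := Module.End ℂ C.Sym) C.act C.isRep_act _
    (S.dualRel_swap hc)) f
  rw [Finset.sum_comm]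
  simpa [LinearMap.sum_apply] using h

theorem exists_mul_span (u : X) :
    ∃ d, C.deg u = d + 1 ∧ Q.p u ∈ Submodule.span ℂ (Set.range (FreeAlgebra.ι ℂ (X := Fin n))) ^ d *
      Submodule.span ℂ (Set.range (FreeAlgebra.ι ℂ (X := Fin n))) := by
  obtain ⟨d, hd⟩ := Nat.exists_eq_add_of_le' (C.pos u)
  refine ⟨d, hd, ?_⟩
  have := Q.p_mem u
  rwa [hd, Submodule.pow_succ] at this

/-- `act u` is a polynomial without constant term in the generating operators, so in each monomial
some generating operator is applied first. -/
theorem act_eq_zero {f : C.Sym} (hf : ∀ i, C.act (Q.B i) f = 0) (u : X) : C.act u f = 0 := by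
  obtain ⟨d, -, hd⟩ := Q.exists_mul_span u
  rw [← Q.eval (R := Module.End ℂ C.Sym) C.act C.isRep_act u]
  generalize Q.p u = q at hd ⊢
  induction hd using Submodule.mul_induction_on' with
  | mem_mul_mem a _ b hb =>
    have : FreeAlgebra.lift ℂ (A := Module.End ℂ C.Sym) (fun i => C.act (Q.B i)) b f = 0 := by
      induction hb using Submodule.span_induction with
      | mem b hb =>
        obtain ⟨i, rfl⟩ := hb
        rw [FreeAlgebra.lift_ι_apply]
        exact hf i
      | zero => simp
      | add x y _ _ hx hy => rw [map_add, LinearMap.add_apply, hx, hy, add_zero]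
      | smul r x _ hx => rw [map_smul, LinearMap.smul_apply, hx, smul_zero]
    rw [map_mul, Module.End.mul_apply, this, map_zero]
  | add a _ b _ ha hb => rw [map_add, LinearMap.add_apply, ha, hb, add_zero]

/-- By Euler's identity the positive weight times `f` is a sum of terms `η_s act_s f`, all of which
vanish. -/
theorem eq_zero {w : ℕ} {f : C.Sym} (hw : f ∈ C.symPart ((w + 1 : ℕ) : ℂ))
    (hf : ∀ i, C.act (Q.B i) f = 0) : f = 0 := by
  have h := C.sum_η_act hw le_rfl
  rw [Finset.sum_eq_zero fun s _ => by rw [Q.act_eq_zero hf, mul_zero, smul_zero]] at h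
  exact (smul_eq_zero.1 h.symm).resolve_left (Nat.cast_ne_zero.2 (Nat.succ_ne_zero w))

section Lift

variable (h : Fin n → C.Sym)

/-- The operators on an extension of the module by a trivial one. -/
noncomputable def extOp (i : Fin n) : Module.End ℂ (C.Sym × ℂ) :=
  LinearMap.inl ℂ C.Sym ℂ ∘ₗ
    (C.act (Q.B i) ∘ₗ LinearMap.fst ℂ C.Sym ℂ +
      LinearMap.toSpanSingleton ℂ _ (h i) ∘ₗ LinearMap.snd ℂ C.Sym ℂ)

theorem extOp_apply (i : Fin n) (v : C.Sym × ℂ) :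
    Q.extOp h i v = (C.act (Q.B i) v.1 + v.2 • h i, 0) := by
  simp [extOp]

/-- The action on the extension. -/
noncomputable def extHom : FreeAlgebra ℂ (Fin n) →ₐ[ℂ] Module.End ℂ (C.Sym × ℂ) :=
  FreeAlgebra.lift ℂ (Q.extOp h)

theorem extHom_fst (q : FreeAlgebra ℂ (Fin n)) (f : C.Sym) : Q.extHom h q (f, 0) =
    (FreeAlgebra.lift ℂ (A := Module.End ℂ C.Sym) (fun i => C.act (Q.B i)) q f, 0) := by
  induction q using FreeAlgebra.induction generalizing f with
  | grade0 r => simp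
  | grade1 i => simp [extHom, extOp_apply]
  | mul a b ha hb => rw [map_mul, map_mul, Module.End.mul_apply, Module.End.mul_apply, hb, ha]
  | add a b ha hb => rw [map_add, map_add, LinearMap.add_apply, LinearMap.add_apply, hb, ha]; simp

theorem extHom_p_fst (u : X) (f : C.Sym) : Q.extHom h (Q.p u) (f, 0) = (C.act u f, 0) := by
  rw [extHom_fst, Q.eval (R := Module.End ℂ C.Sym) C.act C.isRep_act u]

theorem extHom_snd (u : X) (v : C.Sym × ℂ) : (Q.extHom h (Q.p u) v).2 = 0 := by
  have key : ∀ (q : FreeAlgebra ℂ (Fin n)) (v : C.Sym × ℂ),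
      (Q.extHom h q v).2 = FreeAlgebra.lift ℂ (fun _ => (0 : ℂ)) q * v.2 := by
    intro q
    induction q using FreeAlgebra.induction with
    | grade0 r => intro v; simp
    | grade1 i => intro v; simp [extHom, extOp_apply]
    | mul a b ha hb => intro v; rw [map_mul, map_mul, Module.End.mul_apply, ha, hb, mul_assoc]
    | add a b ha hb =>
      intro v
      rw [map_add, map_add, LinearMap.add_apply, Prod.snd_add, ha, hb, add_mul]
  obtain ⟨d, -, hd⟩ := Q.exists_mul_span u
  have h0 : FreeAlgebra.lift ℂ (fun _ => (0 : ℂ)) (Q.p u) = 0 := by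
    generalize Q.p u = q at hd ⊢
    induction hd using Submodule.mul_induction_on' with
    | mem_mul_mem a _ b hb =>
      have : FreeAlgebra.lift ℂ (fun _ => (0 : ℂ)) b = 0 := by
        induction hb using Submodule.span_induction with
        | mem b hb =>
          obtain ⟨i, rfl⟩ := hb
          simp
        | zero => simp
        | add x y _ _ hx hy => rw [map_add, hx, hy, add_zero]
        | smul r x _ hx => rw [map_smul, hx, smul_zero]
      rw [map_mul, this, mul_zero]
    | add a _ b _ ha hb => rw [map_add, ha, hb, add_zero]
  rw [key, h0, zero_mul]

/-- The cocycle. -/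
noncomputable def cocycle (u : X) : C.Sym := (Q.extHom h (Q.p u) (0, 1)).1

theorem extHom_p_snd (u : X) : Q.extHom h (Q.p u) (0, 1) = (Q.cocycle h u, 0) :=
  Prod.ext rfl (Q.extHom_snd h u _)

theorem cocycle_B (i : Fin n) : Q.cocycle h (Q.B i) = h i := by
  simp [cocycle, Q.p_B, extHom, extOp_apply]

variable {h}

/-- The hypothesis on `h` makes the extended operators satisfy the dual relations, so they define a
representation of `L` on an extension by the trivial module. Its commutation rule at the vector `(0,
1)` is the cocycle identity. -/
theorem cocycle_comm (hh : ∀ c ∈ S.dualRel, ∑ i, ∑ k, c i k • C.act (Q.B k) (h i) = 0) (s t : X) :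
    C.act s (Q.cocycle h t) - ((-1) ^ (C.deg s * C.deg t) : ℂ) • C.act t (Q.cocycle h s) =
      ∑ u ∈ C.ball (C.deg s + C.deg t), C.c s t u • Q.cocycle h u := by
  have h1 := Q.isRep (Q.extOp h) (fun c hc => by
    ext v
    · have h2 := Q.act_rel (S.dualRel_swap hc) v
      rw [Finset.sum_comm] at h2
      simpa [LinearMap.sum_apply, extOp_apply, Prod.fst_sum] using h2
    · simp [extOp_apply, Prod.snd_sum]
    · have h2 := hh _ (S.dualRel_swap hc)
      rw [Finset.sum_comm] at h2
      simpa [LinearMap.sum_apply, extOp_apply, Prod.fst_sum] using h2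
    · simp [extOp_apply, Prod.snd_sum]) s t
  have h2 := congrArg Prod.fst (LinearMap.congr_fun h1 (0, 1))
  change (Q.extHom h (Q.p s) (Q.extHom h (Q.p t) (0, 1)) -
    ((-1) ^ (C.deg s * C.deg t) : ℂ) • Q.extHom h (Q.p t) (Q.extHom h (Q.p s) (0, 1))).1 =
      ((∑ u ∈ C.ball (C.deg s + C.deg t), C.c s t u • Q.extHom h (Q.p u) : Module.End ℂ (C.Sym × ℂ)) (0, 1)).1 at h2
  simpa [LinearMap.sum_apply, extHom_p_snd, extHom_p_fst, Prod.fst_sum] using h2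

/-- If the extra vector is given weight `w + 1`, each generating operator lowers the weight by one,
and `p u` is homogeneous of degree `|u|` in them. -/
theorem cocycle_mem {w : ℕ} (hw : ∀ i, h i ∈ C.symPart w) (u : X) :
    Q.cocycle h u ∈ C.symPart (((w + 1 : ℕ) : ℂ) - C.deg u) := by
  let W : Module.End ℂ (C.Sym × ℂ) :=
    LinearMap.prodMap C.wt (((w + 1 : ℕ) : ℂ) • LinearMap.id)
  have hW : ∀ v, W v = (C.wt v.1, ((w + 1 : ℕ) : ℂ) • v.2) := fun v => rfl
  have key : ∀ d : ℕ, ∀ q ∈ Submodule.span ℂ (Set.range (FreeAlgebra.ι ℂ (X := Fin n))) ^ d, ∀ v,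
      W (Q.extHom h q v) = Q.extHom h q (W v) - (d : ℂ) • Q.extHom h q v := by
    have h1 : ∀ q ∈ Submodule.span ℂ (Set.range (FreeAlgebra.ι ℂ (X := Fin n))), ∀ v,
        W (Q.extHom h q v) = Q.extHom h q (W v) - Q.extHom h q v := by
      intro q hq
      induction hq using Submodule.span_induction with
      | mem b hb =>
        obtain ⟨i, rfl⟩ := hb
        intro v
        have := C.mem_symPart.1 (hw i)
        simp only [extHom, FreeAlgebra.lift_ι_apply, extOp_apply, hW, map_add, map_smul, this,
          C.wt_act, Q.B_deg, smul_zero, Prod.mk_sub_mk, sub_zero]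
        rw [Prod.mk.injEq]
        refine ⟨?_, rfl⟩
        simp only [smul_smul, smul_eq_mul]
        push_cast
        module
      | zero => simp
      | add x y _ _ hx hy =>
        intro v
        simp only [map_add, LinearMap.add_apply, hx, hy]
        abel
      | smul r x _ hx =>
        intro v
        simp only [map_smul, LinearMap.smul_apply, hx, smul_sub]
    intro d
    induction d with
    | zero =>
      intro q hq v
      rw [Submodule.pow_zero] at hq
      obtain ⟨r, rfl⟩ := Submodule.mem_one.1 hq
      simp
    | succ d ih =>
      intro q hq
      rw [Submodule.pow_succ] at hq
      induction hq using Submodule.mul_induction_on' with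
      | mem_mul_mem a ha b hb =>
        intro v
        rw [map_mul, Module.End.mul_apply, Module.End.mul_apply, ih a ha, h1 b hb, map_sub]
        push_cast
        module
      | add a _ b _ ha hb =>
        intro v
        simp only [map_add, LinearMap.add_apply, ha, hb, smul_add]
        abel
  have h2 := congrArg Prod.fst (key _ _ (Q.p_mem u) (0, 1))
  have h3 : W ((0, 1) : C.Sym × ℂ) = ((w + 1 : ℕ) : ℂ) • (0, 1) := by
    rw [hW]
    simp
  rw [h3, map_smul, extHom_p_snd, hW] at h2
  rw [mem_symPart, sub_smul]
  exact h2

/-- A Poincaré lemma: contract the closed one-form whose components are the cocycle with the Euler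
field, and divide by the weight `w + 1`. -/
theorem exists_lift {w : ℕ} (hw : ∀ i, h i ∈ C.symPart w)
    (hh : ∀ c ∈ S.dualRel, ∑ i, ∑ k, c i k • C.act (Q.B k) (h i) = 0) :
    ∃ g ∈ C.symPart ((w + 1 : ℕ) : ℂ), ∀ i, C.act (Q.B i) g = h i := by
  classical
  refine ⟨((w + 1 : ℕ) : ℂ)⁻¹ •
    ∑ u ∈ C.ball (w + 1), (C.deg u : ℂ) • (C.η u * Q.cocycle h u), ?_, fun i => ?_⟩
  · refine Submodule.smul_mem _ _ (Submodule.sum_mem _ fun u _ => Submodule.smul_mem _ _ ?_)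
    have := C.mem_symPart.1 (Q.cocycle_mem hw u)
    rw [mem_symPart, wt_mul, wt_η, this]
    simp only [smul_mul_assoc, mul_smul_comm]
    module
  · rw [map_smul, inv_smul_eq_iff₀ (Nat.cast_ne_zero.2 (Nat.succ_ne_zero w)), map_sum]
    set t := Q.B i with ht
    have hdt : C.deg t = 1 := Q.B_deg i
    have h1 : ∀ u ∈ C.ball (w + 1), C.act t ((C.deg u : ℂ) • (C.η u * Q.cocycle h u)) =
        (if t = u then Q.cocycle h t else 0) +
          (∑ s ∈ C.ball (w + 1), (C.deg s : ℂ) • (C.η s * (C.c s t u • Q.cocycle h u)) +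
          (C.deg u : ℂ) • (C.η u * (((-1) ^ (C.deg u * C.deg t) : ℂ) •
            C.act t (Q.cocycle h u)))) := by
      intro u hu
      rw [map_smul, act_η_mul, C.actVal_eq t u (C.mem_ball.1 hu), smul_add, add_mul, smul_add,
        add_assoc]
      congr 1
      · split_ifs with h
        · rw [← h, hdt]
          simp
        · simp
      congr 1
      · rw [smul_mul_assoc, smul_smul, mul_inv_cancel₀ (C.deg_ne u), one_smul, Finset.sum_mul]
        refine Finset.sum_congr rfl fun s _ => ?_
        rw [smul_mul_assoc, mul_smul_comm, smul_smul]
      · rw [mul_smul_comm, mul_comm (C.deg t)]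
    rw [Finset.sum_congr rfl h1, Finset.sum_add_distrib, Finset.sum_add_distrib, Finset.sum_comm,
      ← Finset.sum_add_distrib]
    -- The cocycle identity turns the derivative of the contraction into Euler's sum for `h_i`,
    -- which gives `w h_i`. The constant term of the action contributes one more `h_i`.
    have h2 : ∀ s ∈ C.ball (w + 1),
        ∑ u ∈ C.ball (w + 1), (C.deg s : ℂ) • (C.η s * (C.c s t u • Q.cocycle h u)) +
          (C.deg s : ℂ) • (C.η s * (((-1) ^ (C.deg s * C.deg t) : ℂ) • C.act t (Q.cocycle h s))) =
        (C.deg s : ℂ) • (C.η s * C.act s (Q.cocycle h t)) := by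
      intro s _
      rw [← Finset.smul_sum, ← Finset.mul_sum, ← smul_add, ← mul_add]
      congr 2
      have h0 : ∀ u, (u ∉ C.ball (C.deg s + C.deg t) ∨ u ∉ C.ball (w + 1)) →
          C.c s t u • Q.cocycle h u = 0 := by
        rintro u (h | h)
        · have : C.c s t u = 0 := by
            by_contra hc
            exact h (C.mem_ball.2 (C.c_deg hc).ge)
          rw [this, zero_smul]
        · rw [C.mem_ball] at h
          rw [C.eq_zero_of_mem_symPart (by omega) (Q.cocycle_mem hw u), smul_zero]
      have hsub : ∀ {N N'}, N ≤ N' → C.ball N ⊆ C.ball N' := fun h x hx =>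
        C.mem_ball.2 ((C.mem_ball.1 hx).trans h)
      have e : ∑ u ∈ C.ball (w + 1), C.c s t u • Q.cocycle h u =
          ∑ u ∈ C.ball (C.deg s + C.deg t), C.c s t u • Q.cocycle h u := by
        rcases le_total (C.deg s + C.deg t) (w + 1) with h | h
        · exact (Finset.sum_subset (hsub h) fun u _ hu => h0 u (Or.inl hu)).symm
        · exact Finset.sum_subset (hsub h) fun u _ hu => h0 u (Or.inr hu)
      rw [e, ← Q.cocycle_comm hh s t, sub_add_cancel]
    have h3 : Q.cocycle h t ∈ C.symPart w := by
      rw [ht, cocycle_B]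
      exact hw i
    rw [Finset.sum_congr rfl h2, C.sum_η_act h3 (Nat.le_succ w), Finset.sum_ite_eq,
      if_pos (C.mem_ball.2 (by omega)), ht, cocycle_B]
    push_cast
    module

end Lift

/-- The homogeneous parts form a module over the quadratic dual. -/
noncomputable def comodule : S.Comodule fun j => C.symPart (j : ℂ) where
  X i j := (C.act (Q.B i)).restrict fun f hf => by
    have := C.act_mem (u := Q.B i) hf
    rw [Q.B_deg] at this
    simpa using this
  ε :=
    { C.aug.toLinearMap ∘ₗ (C.symPart ((0 : ℕ) : ℂ)).subtype with
      invFun := fun r => ⟨algebraMap ℂ _ r, C.mem_symPart.2 (by rw [wt_algebraMap]; simp)⟩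
      left_inv := fun f => Subtype.ext (by
        have h0 : C.symPart ((0 : ℕ) : ℂ) = Submodule.span ℂ {1} := by
          rw [Nat.cast_zero, symPart_zero]
        obtain ⟨r, hr⟩ := Submodule.mem_span_singleton.1 (h0.le f.2)
        change algebraMap ℂ _ (C.aug f) = (f : C.Sym)
        rw [← hr, map_smul, map_one, Algebra.algebraMap_eq_smul_one, smul_eq_mul, mul_one])
      right_inv := fun r => C.aug.commutes r }
  rel c hc j f := Subtype.ext (by
    have := Q.act_rel hc f
    simpa using this)
  inj j f hf := Subtype.ext (Q.eq_zero f.2 fun i => congrArg Subtype.val (hf i))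
  lift_zero h := by
    obtain ⟨g, hg, hg'⟩ := Q.exists_lift (h := fun i => (h i : C.Sym)) (w := 0)
      (fun i => (h i).2) (fun c hc => by
        refine Finset.sum_eq_zero fun i _ => Finset.sum_eq_zero fun k _ => ?_
        have h1 := C.act_mem (u := Q.B k) (h i).2
        rw [C.eq_zero_of_mem_symPart (by rw [Q.B_deg]; exact Nat.one_pos) h1, smul_zero])
    exact ⟨⟨g, hg⟩, fun i => Subtype.ext (hg' i)⟩
  lift j h hh := by
    obtain ⟨g, hg, hg'⟩ := Q.exists_lift (h := fun i => (h i : C.Sym)) (w := j + 1)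
      (fun i => (h i).2) (fun c hc => by
        have := congrArg Subtype.val (hh c hc)
        simpa using this)
    exact ⟨⟨g, hg⟩, fun i => Subtype.ext (hg' i)⟩

end Presentation

end LieConstants


open SuperComm

/-! ## Specialisation of the dual generators -/

namespace LieConstants

variable {X : Type*} (C : LieConstants X)

/-- Commuting values for the generators of degree one which annihilate the Chevalley–Eilenberg
differential. -/
structure Twist (A : Type*) [CommRing A] [Algebra ℂ A] where
  val : X → A
  val_of_ne : ∀ {x}, C.deg x ≠ 1 → val x = 0
  ceVal_val : ∀ u, C.ceVal val u = 0

variable {C} {A : Type*} [CommRing A] [Algebra ℂ A] (ψ : C.Twist A)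

namespace Window

variable {Y : Type*} (W : C.Window Y)

/-- The values of the specialisation on generators. -/
noncomputable def specVal : X ⊕ Y → SuperComm A fun y => C.deg (W.κ y) :=
  Sum.elim (fun x => algebraMap A _ (ψ.val x)) (gen _)

theorem isPar_specVal (z : X ⊕ Y) : IsPar (W.par z) (W.specVal ψ z) := by
  rcases z with x | y
  · by_cases hx : C.deg x = 1
    · refine (isPar_algebraMap (p := fun y => C.deg (W.κ y)) (ψ.val x)).congr ?_
      simp [par, hx]
    · change IsPar _ (algebraMap A _ (ψ.val x))
      rw [ψ.val_of_ne hx, map_zero]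
      exact isPar_zero _
  · exact isPar_gen y

theorem specVal_comm (z z' : X ⊕ Y) : W.specVal ψ z * W.specVal ψ z' =
    (-1) ^ (W.par z * W.par z') * (W.specVal ψ z' * W.specVal ψ z) := by
  have hx : ∀ (x : X) (z' : X ⊕ Y), W.specVal ψ (Sum.inl x) * W.specVal ψ z' =
      (-1) ^ (W.par (Sum.inl x) * W.par z') * (W.specVal ψ z' * W.specVal ψ (Sum.inl x)) := by
    intro x z'
    change algebraMap A _ (ψ.val x) * _ = _ * (_ * algebraMap A _ (ψ.val x))
    by_cases hx : C.deg x = 1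
    · have : (-1 : SuperComm A fun y => C.deg (W.κ y)) ^ (W.par (Sum.inl x) * W.par z') = 1 := by
        simp [par, hx, pow_mul]
      rw [this, one_mul, Algebra.commutes]
    · rw [ψ.val_of_ne hx]; simp
  rcases z with x | y
  · exact hx x z'
  · have h := (W.isPar_specVal ψ z').comm y
    rw [Algebra.smul_def, map_pow, map_neg, map_one] at h
    exact h

/-- The specialisation of the generators `ξ`. -/
noncomputable def spec : W.Alg →ₐ[ℂ] SuperComm A fun y => C.deg (W.κ y) :=
  lift (W.specVal ψ) (W.specVal_comm ψ)

theorem spec_gen (z : X ⊕ Y) : W.spec ψ (gen _ z) = W.specVal ψ z := lift_gen _ _ _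

theorem spec_ξ (x : X) : W.spec ψ (W.ξ x) = algebraMap A _ (ψ.val x) := W.spec_gen ψ (Sum.inl x)

theorem spec_η (y : Y) : W.spec ψ (W.η y) = gen _ y := W.spec_gen ψ (Sum.inr y)

theorem spec_parity (a : W.Alg) : W.spec ψ (parity a) = parity (W.spec ψ a) := by
  induction a using SuperComm.induction with
  | hR r =>
    rw [AlgHom.commutes, AlgHom.commutes, IsScalarTower.algebraMap_apply ℂ A, AlgHom.commutes]
  | hgen z =>
    rw [parity_gen, map_mul, map_pow, map_neg, map_one, spec_gen, (W.isPar_specVal ψ z).parity,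
      Algebra.smul_def, map_pow, map_neg, map_one]
  | hmul a b ha hb => rw [map_mul, map_mul, ha, hb, map_mul, map_mul]
  | hadd a b ha hb => rw [map_add, map_add, ha, hb, map_add, map_add]

theorem isPar_spec {q : ℕ} {a : W.Alg} (ha : IsPar q a) : IsPar q (W.spec ψ a) where
  comm y := by
    have h := congrArg (W.spec ψ) (ha.comm (Sum.inr y))
    rw [map_mul, map_smul, map_mul, spec_gen] at h
    refine Eq.trans h ?_
    rw [Algebra.smul_def, Algebra.smul_def, map_pow, map_pow, map_neg, map_neg, map_one, map_one]
    rfl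
  parity := by
    rw [← spec_parity, ha.parity, map_smul, Algebra.smul_def, Algebra.smul_def, map_pow, map_pow,
      map_neg, map_neg, map_one, map_one]

/-- The specialised differential. -/
noncomputable def specD : OddDerivation (SuperComm A fun y => C.deg (W.κ y)) :=
  oddDer (fun y => W.spec ψ (W.dVal (Sum.inr y))) fun y => W.isPar_spec ψ (W.isPar_dVal (Sum.inr y))

theorem specD_gen (y : Y) : (W.specD ψ).d (gen _ y) = W.spec ψ (W.dVal (Sum.inr y)) :=
  oddDer_gen _ _ _

/-- Compatibility need only be checked on generators. On `ξ` both sides vanish: elements of `A` are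
closed, and the twist annihilates the Chevalley–Eilenberg differential. -/
theorem spec_diff (a : W.Alg) : W.spec ψ (W.diff.d a) = (W.specD ψ).d (W.spec ψ a) := by
  induction a using SuperComm.induction with
  | hR r =>
    rw [diff, oddDer_algebraMap, map_zero, AlgHom.commutes, IsScalarTower.algebraMap_apply ℂ A, specD,
      oddDer_algebraMap]
  | hgen z =>
    rcases z with x | y
    · change W.spec ψ (W.diff.d (W.ξ x)) = (W.specD ψ).d (W.spec ψ (W.ξ x))
      rw [spec_ξ, specD, oddDer_algebraMap, diff_ξ, C.map_ceVal]
      have := C.map_ceVal (IsScalarTower.toAlgHom ℂ A (SuperComm A fun y => C.deg (W.κ y))) ψ.val x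
      rw [ψ.ceVal_val, map_zero] at this
      refine Eq.trans ?_ this.symm
      congr 1
      ext x
      exact W.spec_ξ ψ x
    · change W.spec ψ (W.diff.d (W.η y)) = (W.specD ψ).d (W.spec ψ (W.η y))
      rw [spec_η, specD_gen, diff_η]
      rfl
  | hmul a b ha hb =>
    rw [W.diff.leibniz, map_add, map_mul, map_mul, ha, hb, map_mul, (W.specD ψ).leibniz]
    congr 2
    exact W.spec_parity ψ a
  | hadd a b ha hb => rw [map_add, map_add, ha, hb, map_add, map_add]

theorem spec_surjective (hψ : Algebra.adjoin ℂ (Set.range ψ.val) = ⊤) :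
    Function.Surjective (W.spec ψ) := by
  intro b
  change b ∈ (W.spec ψ).range
  induction b using SuperComm.induction with
  | hR r =>
    have hr : r ∈ Algebra.adjoin ℂ (Set.range ψ.val) := hψ ▸ Algebra.mem_top
    induction hr using Algebra.adjoin_induction with
    | mem x hx =>
      obtain ⟨x, rfl⟩ := hx
      exact ⟨W.ξ x, W.spec_ξ ψ x⟩
    | algebraMap r =>
      rw [← IsScalarTower.algebraMap_apply]
      exact Subalgebra.algebraMap_mem _ r
    | add x y _ _ hx hy => rw [map_add]; exact add_mem hx hy
    | mul x y _ _ hx hy => rw [map_mul]; exact mul_mem hx hy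
  | hgen y => exact ⟨W.η y, W.spec_η ψ y⟩
  | hmul a b ha hb => exact mul_mem ha hb
  | hadd a b ha hb => exact add_mem ha hb

end Window

/-! ### The full window is acyclic -/

section Full

/-- Nothing lies outside the full window, so the Lie derivative has no nilpotent part. -/
theorem lie_full (a : C.full.Alg) : C.full.lie a =
    weight (0 : Derivation ℂ ℂ ℂ) (Sum.elim (fun x => (C.deg x : ℂ)) fun x => (C.deg x : ℂ)) a := by
  induction a using SuperComm.induction with
  | hR r =>
    rw [weight_algebraMap, Window.lie_apply, Window.contr, oddDer_algebraMap, Window.diff,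
      oddDer_algebraMap]
    simp
  | hgen z =>
    rw [weight_gen]
    rcases z with x | x
    · exact C.full.lie_ξ_κ x
    · exact C.full.lie_η x
  | hmul a b ha hb => rw [Window.lie_mul, weight_mul, ha, hb]
  | hadd a b ha hb => rw [map_add, map_add, ha, hb]

theorem exists_of_lie_full_eq_zero {a : C.full.Alg} (ha : C.full.lie a = 0) :
    ∃ r : ℂ, a = algebraMap ℂ _ r := by
  have h := eigenspace_weight (p := C.full.par) (isDiagonal_zero (R := ℂ))
    (Sum.elim (fun x => (C.deg x : ℂ)) fun x => (C.deg x : ℂ)) ⊤ (fun l => l = []) 0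
    (fun r _ l hl => ⟨0, by simp, by simp [hl]⟩) (fun r hr c' l hc' hl => ⟨trivial, ?_⟩)
  · have h1 : monomialSpan C.full.par ⊤ (fun l => l = []) ≤
        LinearMap.range (Algebra.linearMap ℂ C.full.Alg) := by
      refine Submodule.span_le.2 ?_
      rintro _ ⟨r, -, l, rfl, rfl⟩
      exact ⟨r, by simp⟩
    have ha' : a ∈ monomialSpan C.full.par ⊤ (fun l => l = []) := by
      rw [← h, Module.End.mem_eigenspace_iff, zero_smul, ← lie_full, ha]
    obtain ⟨r, hr⟩ := h1 ha'
    exact ⟨r, hr.symm⟩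
  · have h0 : c' = 0 := by
      have : (0 : ℂ) = c' • r := by simpa using hc'
      exact (smul_eq_zero.1 this.symm).resolve_right hr
    rw [h0, zero_add] at hl
    have h2 : (l.map (Sum.elim (fun x => (C.deg x : ℂ)) fun x => (C.deg x : ℂ))).sum =
        ((l.map (Sum.elim C.deg C.deg)).sum : ℕ) := by
      rw [Nat.cast_list_sum, List.map_map]
      congr 2
      ext x
      rcases x with x | x <;> rfl
    rw [h2, Nat.cast_eq_zero] at hl
    cases l with
    | nil => rfl
    | cons x l =>
      rcases x with x | x <;> simp [(C.pos x).ne'] at hl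

-- Take `q` with `q(0) = 1` projecting `z` to weight zero, where only constants live. The rest, `(1
-- - q)(L) z`, is `L` applied to a cycle, and there `L` acts as `d ι`.
open Polynomial in
theorem full_acyclic {z : C.full.Alg} (hz : C.full.diff.d z = 0) :
    ∃ y, ∃ r : ℂ, z = C.full.diff.d y + algebraMap ℂ _ r := by
  have hD : Module.End.IsDiagonal C.full.lie := by
    have := weight_isDiagonal (p := C.full.par) (isDiagonal_zero (R := ℂ))
      (Sum.elim (fun x => (C.deg x : ℂ)) fun x => (C.deg x : ℂ))
    convert this using 1
    exact LinearMap.ext lie_full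
  obtain ⟨q, hq, hqz⟩ := hD.exists_poly z 0
  rw [zero_smul] at hqz
  obtain ⟨r, hr⟩ := exists_of_lie_full_eq_zero hqz
  set L : Module.End ℂ C.full.Alg := C.full.lie with hL
  have h1 : Polynomial.X * (1 - q).divX = 1 - q := by
    have := Polynomial.X_mul_divX_add (1 - q)
    rwa [Polynomial.coeff_sub, Polynomial.coeff_zero_eq_eval_zero q, hq, Polynomial.coeff_one_zero,
      sub_self, map_zero, add_zero] at this
  have hd : C.full.diff.d (aeval L (1 - q).divX z) = 0 := by
    rw [Module.End.aeval_intertwine (W := L) (W' := L) C.full.diff.d C.full.lie_diff, hz, map_zero]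
  refine ⟨C.full.contr.d (aeval L (1 - q).divX z), r, ?_⟩
  rw [← hr]
  have h2 : aeval L (1 - q) z = C.full.diff.d (C.full.contr.d (aeval L (1 - q).divX z)) := by
    refine (congrArg (fun p => aeval L p z) h1).symm.trans ?_
    change aeval L (Polynomial.X * (1 - q).divX) z = _
    rw [map_mul, Module.End.mul_apply, aeval_X, hL, Window.lie_apply, ← hL, hd, map_zero, add_zero]
  rw [← h2, map_sub, map_one, LinearMap.sub_apply, Module.End.one_apply, sub_add_cancel]

end Full

end LieConstants


/-! ### The specialised full complex is the Koszul complex of `A` -/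

open SuperComm
open scoped TensorProduct

namespace SuperComm

variable {R : Type*} [CommRing R] [Algebra ℂ R] {X : Type*} {p : X → ℕ}

theorem eigenspace_weight_zero (w : X → ℂ) (c : ℂ) (T : List X → Prop)
    (hT : ∀ l, T l ↔ (l.map w).sum = c) :
    Module.End.eigenspace (weight (0 : Derivation ℂ R R) w : SuperComm R p →ₗ[ℂ] SuperComm R p) c =
      monomialSpan p ⊤ T := by
  refine eigenspace_weight isDiagonal_zero w ⊤ T c
    (fun r _ l hl => ⟨0, by simp, by rw [zero_add]; exact (hT l).1 hl⟩)
    (fun r hr c' l hc' hl => ⟨trivial, (hT l).2 ?_⟩)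
  have h0 : c' = 0 := by
    have : (0 : R) = c' • r := by simpa using hc'
    rcases smul_eq_zero.1 this.symm with h | h
    · exact h
    · exact absurd h hr
  rw [← hl, h0, zero_add]

theorem weight_zero_smul (w : X → ℂ) (r : R) (b : SuperComm R p) :
    weight (0 : Derivation ℂ R R) w (r • b) = r • weight (0 : Derivation ℂ R R) w b := by
  rw [Algebra.smul_def, weight_mul, weight_algebraMap, Algebra.smul_def]
  simp

theorem weight_mapGenC {X' : Type*} {p' : X' → ℕ} (k : X' → X) (hk : ∀ x, p (k x) = p' x)
    (w : X → ℂ) (b : SuperComm ℂ p') : weight (0 : Derivation ℂ R R) w (mapGenC R k hk b) =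
      mapGenC R k hk (weight (0 : Derivation ℂ ℂ ℂ) (fun x => w (k x)) b) := by
  induction b using SuperComm.induction with
  | hR r =>
    rw [AlgHom.commutes, IsScalarTower.algebraMap_apply ℂ R, weight_algebraMap, weight_algebraMap]
    simp
  | hgen x => rw [mapGenC_gen, weight_gen, weight_gen, map_smul, mapGenC_gen]
  | hmul a b ha hb => rw [map_mul, weight_mul, ha, hb, weight_mul, map_add, map_mul, map_mul]
  | hadd a b ha hb => rw [map_add, map_add, ha, hb, map_add, map_add]

end SuperComm

namespace LieConstants

namespace Presentation

variable {X : Type} {C : LieConstants X} {A : Type} [CommRing A] [Algebra ℂ A] {n : ℕ}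
  {S : StandardGrading A n} (Q : C.Presentation S)

/-- The generators of the algebra, as values of the dual generators. -/
noncomputable def val (u : X) : A := by
  classical exact ∑ i, if Q.B i = u then S.a i else 0

theorem val_B (i : Fin n) : Q.val (Q.B i) = S.a i := by
  classical
  simp [val, Q.B_inj.eq_iff]

theorem val_of_ne {u : X} (hu : C.deg u ≠ 1) : Q.val u = 0 := by
  classical
  refine Finset.sum_eq_zero fun i _ => if_neg ?_
  rintro rfl
  exact hu (Q.B_deg i)

theorem sum_ball_val {N : ℕ} (hN : 1 ≤ N) {M : Type*} [AddCommGroup M] (g : X → A →+ M) :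
    ∑ s ∈ C.ball N, g s (Q.val s) = ∑ i, g (Q.B i) (S.a i) := by
  classical
  have : ∀ s, g s (Q.val s) = ∑ i, if Q.B i = s then g s (S.a i) else 0 := by
    intro s
    rw [val, map_sum]
    refine Finset.sum_congr rfl fun i _ => ?_
    split_ifs <;> simp
  simp only [this]
  rw [Finset.sum_comm]
  refine Finset.sum_congr rfl fun i _ => ?_
  rw [Finset.sum_ite_eq, if_pos]
  rw [C.mem_ball, Q.B_deg]
  exact hN

/-- Apply a dual relation to the operators acting on `η_u` and take the constant term: this is
`|u|⁻¹` times the pairing of the relation with the structure constants. The double annihilator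
property concludes. -/
theorem c_mem_rel (u : X) : (fun i k => C.c (Q.B i) (Q.B k) u) ∈ S.rel := by
  refine S.mem_rel_of_dualRel fun c hc => ?_
  have h := LinearMap.congr_fun (Q.rel (R := Module.End ℂ C.Sym) C.act C.isRep_act _ hc) (C.η u)
  have h2 := congrArg C.aug h
  have h3 : ∀ i k, C.aug (C.act (Q.B i) (C.act (Q.B k) (C.η u))) =
      (C.deg u : ℂ)⁻¹ * C.c (Q.B i) (Q.B k) u := by
    intro i k
    have h4 : ∀ b, C.aug (C.η b) = 0 := fun b => lift_gen _ _ b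
    rw [act_η, act_actVal, map_smul, map_add, map_smul, map_one, map_sum]
    simp [h4, Q.B_deg]
  simp only [LinearMap.sum_apply, LinearMap.smul_apply, Module.End.mul_apply, map_sum, map_smul, h3,
    LinearMap.zero_apply, map_zero, smul_eq_mul, mul_left_comm _ (C.deg u : ℂ)⁻¹, ← Finset.mul_sum] at h2
  exact (mul_eq_zero.1 h2).resolve_left (inv_ne_zero (C.deg_ne u))

/-- The twist given by the generators of the algebra. -/
noncomputable def twist : C.Twist A where
  val := Q.val
  val_of_ne := Q.val_of_ne
  ceVal_val u := by
    -- Values of the twist vanish outside degree one, where the sign is trivial. What remains is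
    -- `-½` times a quadratic relation of `A`.
    have h1 : ∀ s ∈ C.ball (C.deg u), ∀ t ∈ C.ball (C.deg u),
        (-(1 / 2) * C.sgn s t * C.c s t u) • (Q.val s * Q.val t) =
          (-(1 / 2) * C.c s t u) • (Q.val s * Q.val t) := by
      intro s _ t _
      by_cases hs : C.deg t = 1
      · simp [sgn, hs, (Even.mul_left even_two _).neg_one_pow]
      · simp [Q.val_of_ne hs]
    rw [ceVal, Finset.sum_congr rfl fun s hs => Finset.sum_congr rfl fun t ht => h1 s hs t ht]
    have h2 : ∀ s, ∑ t ∈ C.ball (C.deg u), (-(1 / 2) * C.c s t u) • (Q.val s * Q.val t) =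
        ∑ k, (-(1 / 2) * C.c s (Q.B k) u) • (Q.val s * S.a k) := fun s =>
      Q.sum_ball_val (C.pos u) fun t =>
        ((-(1 / 2) * C.c s t u) • LinearMap.mulLeft ℂ (Q.val s)).toAddMonoidHom
    simp only [h2]
    have h3 := Q.sum_ball_val (C.pos u) fun s =>
      (∑ k, (-(1 / 2) * C.c s (Q.B k) u) • LinearMap.mulRight ℂ (S.a k)).toAddMonoidHom
    simp only [LinearMap.toAddMonoidHom_coe, LinearMap.sum_apply, LinearMap.smul_apply,
      LinearMap.mulRight_apply] at h3
    rw [h3]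
    have h4 := S.mem_rel.1 (Q.c_mem_rel u)
    simp only [mul_smul, ← Finset.smul_sum, h4, smul_zero]

theorem adjoin_val (hA : Algebra.adjoin ℂ (Set.range S.a) = ⊤) :
    Algebra.adjoin ℂ (Set.range Q.twist.val) = ⊤ := by
  rw [eq_top_iff, ← hA]
  refine Algebra.adjoin_mono ?_
  rintro _ ⟨i, rfl⟩
  exact ⟨Q.B i, Q.val_B i⟩

/-! ### Cycles in the full specialised complex -/

/-- The full specialised complex. -/
abbrev KAlg (_ : C.Presentation S) : Type := SuperComm A fun x => C.deg (C.full.κ x)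

/-- Inclusion of the symmetric algebra. -/
noncomputable def incl : C.Sym →ₐ[ℂ] Q.KAlg := mapGenC A id fun _ => rfl

theorem incl_η (v : X) : Q.incl (C.η v) = gen _ v := mapGenC_gen _ _ v

theorem spec_dVal (v : X) : C.full.spec Q.twist (C.full.dVal (Sum.inr v)) =
    ∑ k, S.a k • Q.incl (C.actVal (Q.B k) v) := by
  classical
  have hη : ∀ x, C.full.spec Q.twist (C.full.ηx x) = gen _ x := fun x => C.full.spec_η Q.twist x
  change C.full.spec Q.twist (C.full.ξ v + ((C.deg v : ℂ)⁻¹) • C.full.conn v) = _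
  rw [map_add, map_smul, Window.spec_ξ, Window.conn, map_sum]
  simp only [map_sum, map_smul, map_mul, hη, Window.spec_ξ]
  have h1 : ∀ s, ∑ t ∈ C.ball (C.deg v), ((C.deg s : ℂ) * C.c s t v) •
        (algebraMap A Q.KAlg (Q.twist.val t) * gen _ s) =
      ∑ k, ((C.deg s : ℂ) * C.c s (Q.B k) v) • (algebraMap A Q.KAlg (S.a k) * gen _ s) := fun s =>
    Q.sum_ball_val (C.pos v) fun t =>
      (((C.deg s : ℂ) * C.c s t v) • (LinearMap.mulRight ℂ (gen _ s) ∘ₗ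
        (IsScalarTower.toAlgHom ℂ A Q.KAlg).toLinearMap)).toAddMonoidHom
  have h2 : algebraMap A Q.KAlg (Q.twist.val v) =
      ∑ k, S.a k • (if Q.B k = v then (1 : Q.KAlg) else 0) := by
    change algebraMap A Q.KAlg (∑ i, if Q.B i = v then S.a i else 0) = _
    rw [map_sum]
    refine Finset.sum_congr rfl fun k _ => ?_
    split_ifs
    · rw [Algebra.algebraMap_eq_smul_one]
    · rw [map_zero, smul_zero]
  refine Eq.trans ?_ (Finset.sum_congr rfl fun k _ => ?_ : ∑ k, (S.a k • (if Q.B k = v then (1 : Q.KAlg) else 0) +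
    (C.deg v : ℂ)⁻¹ • ∑ s ∈ C.ball (C.deg v), ((C.deg s : ℂ) * C.c s (Q.B k) v) •
      (algebraMap A Q.KAlg (S.a k) * gen _ s)) = _)
  · rw [Finset.sum_add_distrib, ← h2, ← Finset.smul_sum]
    congr 2
    rw [Finset.sum_comm (s := Finset.univ)]
    exact Finset.sum_congr rfl fun s _ => h1 s
  · rw [actVal, map_add, smul_add, map_smul, map_sum]
    congr 1
    · split_ifs <;> simp
    · rw [smul_comm (S.a k), Finset.smul_sum (r := S.a k)]
      congr 1
      refine Finset.sum_congr rfl fun s _ => ?_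
      rw [map_smul, incl_η, smul_comm (S.a k), Algebra.smul_def (S.a k)]

/-- In the full complex a function has differential `∑ ξ_u act_u f`; specialisation keeps only the
degree-one terms, with `a_k` in place of `ξ`. -/
theorem specD_incl (f : C.Sym) : (C.full.specD Q.twist).d (Q.incl f) =
    ∑ k, S.a k • Q.incl (C.act (Q.B k) f) := by
  induction f using gen_mul_induction with
  | hC r =>
    rw [AlgHom.commutes, IsScalarTower.algebraMap_apply ℂ A, Window.specD, oddDer_algebraMap]
    simp [act_algebraMap]
  | hadd a b ha hb => simp only [map_add, ha, hb, smul_add, Finset.sum_add_distrib]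
  | hgen v f ih =>
    change (C.full.specD Q.twist).d (Q.incl (C.η v * f)) = ∑ k, S.a k • Q.incl (C.act (Q.B k) (C.η v * f))
    rw [map_mul, incl_η]
    refine (oddDer_gen_mul _ _ _ _).trans ?_
    change _ + _ • (_ * (C.full.specD Q.twist).d _) = _
    rw [spec_dVal, ih, Finset.sum_mul, Finset.mul_sum, Finset.smul_sum, ← Finset.sum_add_distrib]
    refine Finset.sum_congr rfl fun k _ => ?_
    rw [act_η_mul, map_add, map_mul, map_smul, map_mul, incl_η, smul_add, smul_mul_assoc, Q.B_deg,
      one_mul, mul_smul_comm, smul_comm (S.a k)]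
    congr 1
    rw [← algebraMap_smul A ((-1 : ℂ) ^ _), map_pow, map_neg, map_one]
    rfl

/-- The specialised complex as a tensor product. -/
noncomputable def tens : A ⊗[ℂ] C.Sym →ₗ[ℂ] Q.KAlg :=
  TensorProduct.lift ((LinearMap.mul ℂ Q.KAlg).compl₁₂
    (IsScalarTower.toAlgHom ℂ A Q.KAlg).toLinearMap Q.incl.toLinearMap)

theorem tens_tmul (a : A) (f : C.Sym) : Q.tens (a ⊗ₜ f) = algebraMap A _ a * Q.incl f := rfl

theorem tens_injective : Function.Injective Q.tens := by
  have h1 := (splitMul_bijective (R := A) (p₁ := fun x : Empty => x.elim) (p₂ := C.deg)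
    (p := fun x => C.deg (C.full.κ x)) (Equiv.emptySum Empty X) (fun x => x.elim) (fun x => rfl)).1
  have h2 : Function.Injective (TensorProduct.map
      (IsScalarTower.toAlgHom ℂ A (SuperComm A fun x : Empty => (x.elim : ℕ))).toLinearMap
      (LinearMap.id (R := ℂ) (M := C.Sym))) :=
    Module.Flat.rTensor_preserves_injective_linearMap _
      (algebraMap_bijective (R := A) fun x : Empty => (x.elim : ℕ)).1
  have h3 : Q.tens = splitMul (R := A) (p₁ := fun x : Empty => x.elim) (p₂ := C.deg)
    (p := fun x => C.deg (C.full.κ x)) (Equiv.emptySum Empty X) (fun x => x.elim) (fun x => rfl) ∘ₗ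
      TensorProduct.map
      (IsScalarTower.toAlgHom ℂ A (SuperComm A fun x : Empty => (x.elim : ℕ))).toLinearMap
      (LinearMap.id (R := ℂ) (M := C.Sym)) := by
    refine TensorProduct.ext' fun a f => ?_
    rw [tens_tmul, LinearMap.comp_apply, TensorProduct.map_tmul]
    refine Eq.trans ?_ (splitMul_tmul (R := A) (p₁ := fun x : Empty => x.elim) (p₂ := C.deg)
      (p := fun x => C.deg (C.full.κ x)) (Equiv.emptySum Empty X) _ _ _ _).symm
    congr 1
    exact (AlgHom.commutes _ _).symm
  rw [h3]
  exact h1.comp h2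

/-- The specialised complex in one degree. -/
noncomputable def tensPart (j : ℕ) : A ⊗[ℂ] C.symPart (j : ℂ) →ₗ[ℂ] Q.KAlg :=
  Q.tens ∘ₗ (C.symPart (j : ℂ)).subtype.lTensor A

theorem tensPart_tmul (j : ℕ) (a : A) (f : C.symPart (j : ℂ)) :
    Q.tensPart j (a ⊗ₜ f) = algebraMap A _ a * Q.incl f := rfl

theorem tensPart_injective (j : ℕ) : Function.Injective (Q.tensPart j) :=
  Q.tens_injective.comp (Module.Flat.lTensor_preserves_injective_linearMap _
    (Submodule.injective_subtype _))

theorem specD_tensPart (j : ℕ) (t : A ⊗[ℂ] C.symPart ((j + 1 : ℕ) : ℂ)) :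
    (C.full.specD Q.twist).d (Q.tensPart (j + 1) t) = Q.tensPart j (Q.comodule.tensorD j t) := by
  induction t with
  | zero => simp
  | add x y hx hy => simp only [map_add, hx, hy]
  | tmul a f =>
    rw [tensPart_tmul, ← Algebra.smul_def, Window.specD, oddDer_smul, ← Window.specD, specD_incl,
      Q.comodule.tensorD_tmul, map_sum, Finset.smul_sum]
    refine Finset.sum_congr rfl fun k _ => ?_
    rw [tensPart_tmul, map_mul, mul_assoc, ← Algebra.smul_def, ← Algebra.smul_def]
    rfl

/-- The grading operator which counts the generators. -/
noncomputable def wtK : Q.KAlg →ₗ[ℂ] Q.KAlg :=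
  weight (0 : Derivation ℂ A A) fun x => (C.deg (C.full.κ x) : ℂ)

theorem wtK_incl (f : C.Sym) : Q.wtK (Q.incl f) = Q.incl (C.wt f) := weight_mapGenC _ _ _ f

theorem wtK_specD (b : Q.KAlg) : Q.wtK ((C.full.specD Q.twist).d b) =
    (C.full.specD Q.twist).d (Q.wtK b) - (C.full.specD Q.twist).d b := by
  induction b using gen_mul_induction with
  | hC r =>
    rw [wtK, weight_algebraMap, Window.specD, oddDer_algebraMap]
    simp
  | hadd a b ha hb =>
    simp only [map_add, ha, hb]
    abel
  | hgen v b ih =>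
    have h1 : Q.wtK (gen _ v * b) = (C.deg v : ℂ) • (gen _ v * b) + gen _ v * Q.wtK b := by
      rw [wtK, weight_mul, weight_gen, smul_mul_assoc]
      rfl
    have h2 : ∀ b, (C.full.specD Q.twist).d (gen _ v * b) =
        (∑ k, S.a k • Q.incl (C.actVal (Q.B k) v)) * b +
          ((-1) ^ C.deg v : A) • (gen _ v * (C.full.specD Q.twist).d b) := by
      intro b
      rw [← spec_dVal]
      exact oddDer_gen_mul _ _ _ _
    have h3 : Q.wtK (∑ k, S.a k • Q.incl (C.actVal (Q.B k) v)) =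
        ((C.deg v : ℂ) - 1) • ∑ k, S.a k • Q.incl (C.actVal (Q.B k) v) := by
      rw [map_sum, Finset.smul_sum]
      refine Finset.sum_congr rfl fun k _ => ?_
      rw [wtK, weight_zero_smul, ← wtK, wtK_incl, wt_actVal, map_smul, Q.B_deg, Nat.cast_one,
        smul_comm]
    have h4 : ∀ a b, Q.wtK (a * b) = Q.wtK a * b + a * Q.wtK b := weight_mul _ _
    have h5 : Q.wtK (gen _ v) = (C.deg v : ℂ) • gen _ v := weight_gen _ _ v
    rw [h1, map_add, map_smul, h2, h2, map_add, h4, h3]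
    rw [wtK, weight_zero_smul, ← wtK, h4, ih, h5]
    simp only [smul_mul_assoc, mul_sub, sub_mul, smul_sub, smul_add, sub_smul, one_smul,
      smul_comm (C.deg v : ℂ) ((-1) ^ C.deg v : A)]
    abel

theorem exists_tensPart {μ : ℂ} {b : Q.KAlg} (hb : Q.wtK b = μ • b) :
    b = 0 ∨ ∃ j : ℕ, ∃ t, b = Q.tensPart j t := by
  have hb' := Module.End.mem_eigenspace_iff.2 hb
  rw [wtK, eigenspace_weight_zero _ _ (fun l => ((l.map C.deg).sum : ℂ) = μ) (fun l => by
    rw [Nat.cast_list_sum, List.map_map]; rfl)] at hb'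
  by_cases h : ∃ j : ℕ, (j : ℂ) = μ
  · obtain ⟨j, rfl⟩ := h
    refine Or.inr ⟨j, ?_⟩
    have h1 : monomialSpan (fun x => C.deg (C.full.κ x)) (⊤ : Submodule ℂ A)
        (fun l => ((l.map C.deg).sum : ℂ) = (j : ℂ)) ≤ LinearMap.range (Q.tensPart j) := by
      refine Submodule.span_le.2 ?_
      rintro _ ⟨a, -, l, hl, rfl⟩
      have hm : (l.map C.η).prod ∈ C.symPart (j : ℂ) := by
        rw [C.symPart_eq (fun l => ((l.map C.deg).sum : ℂ) = (j : ℂ)) fun l => Iff.rfl]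
        exact Submodule.subset_span ⟨1, trivial, l, hl, by simp; rfl⟩
      refine ⟨a ⊗ₜ ⟨_, hm⟩, ?_⟩
      rw [tensPart_tmul, map_list_prod, List.map_map]
      congr 3
      ext x
      exact Q.incl_η x
    obtain ⟨t, ht⟩ := h1 hb'
    exact ⟨t, ht.symm⟩
  · left
    have : monomialSpan (fun x => C.deg (C.full.κ x)) (⊤ : Submodule ℂ A)
        (fun l => ((l.map C.deg).sum : ℂ) = μ) ≤ ⊥ := by
      refine Submodule.span_le.2 ?_
      rintro _ ⟨a, -, l, hl, rfl⟩
      exact absurd ⟨_, hl⟩ h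
    exact (Submodule.mem_bot ℂ).1 (this hb')

/-- The weight components of a cycle are cycles. In positive weight the Koszul complex is exact, and
in weight zero everything is a boundary up to a constant. -/
theorem full_cycle (hK : S.IsKoszul) {b : Q.KAlg} (hb : (C.full.specD Q.twist).d b = 0) :
    ∃ y, ∃ r : ℂ, b = (C.full.specD Q.twist).d y + algebraMap ℂ _ r := by
  have hD : Module.End.IsDiagonal Q.wtK := weight_isDiagonal isDiagonal_zero _
  have h1 := hD.le_iSup_inf (J := LinearMap.ker (C.full.specD Q.twist).d) (fun x hx => by
    rw [LinearMap.mem_ker] at hx ⊢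
    have := Q.wtK_specD x
    rw [hx, map_zero, sub_zero] at this
    exact this.symm) hb
  refine Submodule.iSup_induction _ (motive := fun b =>
    ∃ y, ∃ r : ℂ, b = (C.full.specD Q.twist).d y + algebraMap ℂ _ r) h1 ?_ ⟨0, 0, by simp⟩ ?_
  · rintro μ x ⟨hx, hμ⟩
    have hx : (C.full.specD Q.twist).d x = 0 := hx
    rcases Q.exists_tensPart (Module.End.mem_eigenspace_iff.1 hμ) with rfl | ⟨j, t, rfl⟩
    · exact ⟨0, 0, by simp⟩
    cases j with
    | zero =>
      obtain ⟨s, m, rfl⟩ := Q.comodule.exists_tensorD_zero_eq t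
      obtain ⟨r, hr⟩ : ∃ r : ℂ, r • 1 = (m : C.Sym) := by
        have h0 : C.symPart ((0 : ℕ) : ℂ) = Submodule.span ℂ {1} := by
          rw [Nat.cast_zero, symPart_zero]
        exact Submodule.mem_span_singleton.1 (h0.le m.2)
      refine ⟨Q.tensPart 1 s, r, ?_⟩
      rw [map_add, Q.specD_tensPart 0 s, tensPart_tmul, ← hr, map_smul, map_one, map_one, one_mul,
        Algebra.algebraMap_eq_smul_one]
    | succ j =>
      rw [specD_tensPart] at hx
      obtain ⟨s, rfl⟩ := Q.comodule.exists_tensorD_eq hK (Q.tensPart_injective j (hx.trans (map_zero _).symm))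
      exact ⟨Q.tensPart _ s, 0, by rw [specD_tensPart, map_zero, add_zero]⟩
  · rintro x x' ⟨y, r, rfl⟩ ⟨y', r', rfl⟩
    exact ⟨y + y', r + r', by rw [map_add, map_add]; abel⟩

/-- Setting all `η` to zero sends boundaries into the augmentation ideal, which contains no non-zero
constant. -/
theorem eq_zero_of_specD_eq [Nontrivial A] {b : Q.KAlg} {r : ℂ}
    (hb : (C.full.specD Q.twist).d b = algebraMap ℂ _ r) : r = 0 := by
  let ζ : Q.KAlg →ₐ[A] A := lift (fun _ => 0) (by simp)
  have hζ : ∀ x, ζ (gen _ x) = 0 := fun x => lift_gen _ _ x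
  have h1 : ∀ b : Q.KAlg, ζ ((C.full.specD Q.twist).d b) ∈ S.P := by
    intro b
    induction b using SuperComm.induction with
    | hR r => rw [Window.specD, oddDer_algebraMap, map_zero]; exact S.P.zero_mem
    | hgen v =>
      rw [Window.specD_gen, spec_dVal, map_sum]
      refine S.P.sum_mem fun k _ => ?_
      rw [map_smul, smul_eq_mul]
      exact S.P.mul_mem_right _ (S.a_mem_P k)
    | hmul a b ha hb =>
      rw [(C.full.specD Q.twist).leibniz, map_add, map_mul, map_mul]
      exact S.P.add_mem (S.P.mul_mem_right _ ha) (S.P.mul_mem_left _ hb)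
    | hadd a b ha hb => rw [map_add, map_add]; exact S.P.add_mem ha hb
  have h2 := h1 b
  rw [hb, IsScalarTower.algebraMap_apply ℂ A, AlgHom.commutes] at h2
  have h3 : S.π 0 (algebraMap ℂ A r) = 0 := S.π_zero_of_mem_P ⟨_, h2⟩
  rw [Algebra.algebraMap_eq_smul_one, map_smul, S.π_of_mem S.one_mem] at h3
  exact (smul_eq_zero.1 h3).resolve_right one_ne_zero

/-- The kernel of the specialisation of the full window is acyclic. -/
theorem full_spec_acyclic [Nontrivial A] (hK : S.IsKoszul) (hA : Algebra.adjoin ℂ (Set.range S.a) = ⊤)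
    {z : C.full.Alg} (hz : C.full.spec Q.twist z = 0) (hdz : C.full.diff.d z = 0) :
    ∃ y, C.full.spec Q.twist y = 0 ∧ C.full.diff.d y = z := by
  obtain ⟨b, r, rfl⟩ := full_acyclic hdz
  -- The image of `z` is zero, so `-r` would be a boundary in the specialised complex.
  have hr : r = 0 := by
    have h := hz
    rw [map_add, Window.spec_diff, AlgHom.commutes, add_eq_zero_iff_eq_neg, ← map_neg] at h
    exact neg_eq_zero.1 (Q.eq_zero_of_specD_eq h)
  subst hr
  rw [map_zero, add_zero] at *
  rw [Window.spec_diff] at hz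
  -- The image of the primitive `b` is a cycle, hence `dk + c`. Lifting `k` and subtracting moves
  -- `b` into the kernel without changing `db`.
  obtain ⟨k, c, hk⟩ := Q.full_cycle hK hz
  obtain ⟨e, rfl⟩ := C.full.spec_surjective Q.twist (Q.adjoin_val hA) k
  refine ⟨b - C.full.diff.d e - algebraMap ℂ _ c, ?_, ?_⟩
  · rw [map_sub, map_sub, hk, Window.spec_diff, AlgHom.commutes]
    abel
  · rw [map_sub, map_sub, C.full.diff_isComplex.d_d, sub_zero, Window.diff, oddDer_algebraMap,
      sub_zero]

end Presentation

end LieConstants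


/-! ### Kernels in tensor products and gradings of a window complex -/

open SuperComm
open scoped TensorProduct

/-- Induction on the elements of a tensor product which are killed by two maps. -/
theorem TensorProduct.induction_ker {U V V' T : Type*} [AddCommGroup U] [Module ℂ U]
    [AddCommGroup V] [Module ℂ V] [AddCommGroup V'] [Module ℂ V'] [AddCommGroup T] [Module ℂ T]
    (d : U →ₗ[ℂ] V) (f : U →ₗ[ℂ] V') {p : U ⊗[ℂ] T → Prop} (h0 : p 0)
    (hadd : ∀ x y, p x → p y → p (x + y)) (h : ∀ u τ, d u = 0 → f u = 0 → p (u ⊗ₜ τ))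
    {t : U ⊗[ℂ] T} (hd : d.rTensor T t = 0) (hf : f.rTensor T t = 0) : p t := by
  -- Tensoring over a field is exact, so the common kernel of the two induced maps is the common
  -- kernel of `d` and `f` tensored with `T`.
  have hex : Function.Exact (LinearMap.ker (d.prod f)).subtype (d.prod f) :=
    LinearMap.exact_subtype_ker_map _
  have h1 : (d.prod f).rTensor T t = 0 := by
    refine (TensorProduct.prodLeft ℂ ℂ V V' T).injective ?_
    rw [map_zero]
    have : ∀ t : U ⊗[ℂ] T, TensorProduct.prodLeft ℂ ℂ V V' T ((d.prod f).rTensor T t) =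
        (d.rTensor T t, f.rTensor T t) := by
      intro t
      induction t with
      | zero => simp; rfl
      | tmul x y => simp
      | add x y hx hy => simp only [map_add, hx, hy, Prod.mk_add_mk]
    rw [this, hd, hf]
    rfl
  obtain ⟨s, rfl⟩ := (Module.Flat.rTensor_exact T hex t).1 h1
  clear h1 hd hf
  induction s with
  | zero => rw [map_zero]; exact h0
  | add x y hx hy => rw [map_add]; exact hadd _ _ hx hy
  | tmul x y =>
    have hx := LinearMap.mem_ker.1 x.2
    rw [LinearMap.prod_apply, Function.prod_apply, Prod.mk_eq_zero] at hx
    exact h _ _ hx.1 hx.2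

namespace SuperComm

variable {R : Type*} [CommRing R] {X : Type*} {p : X → ℕ}

theorem gen_mul_eq (x : X) (a : SuperComm R p) :
    gen p x * a = ((parity : SuperComm R p →ₐ[R] _) ^ p x) a * gen p x := by
  induction a using SuperComm.induction with
  | hR r => rw [AlgHom.commutes, Algebra.commutes]
  | hgen y => rw [gen_mul_gen, parity_pow_gen, mul_assoc]
  | hmul a b ha hb => rw [map_mul, ← mul_assoc, ha, mul_assoc, hb, mul_assoc]
  | hadd a b ha hb => rw [mul_add, ha, hb, map_add, add_mul]

theorem mapGen_parity {Y : Type*} {p' : Y → ℕ} (k : X → Y) (hk : ∀ x, p' (k x) = p x)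
    (a : SuperComm R p) : mapGen (R := R) k hk (parity a) = parity (mapGen (R := R) k hk a) := by
  have : (mapGen (R := R) k hk).comp parity = (parity : SuperComm R p' →ₐ[R] _).comp (mapGen k hk) := by
    refine algHom_ext fun x => ?_
    rw [AlgHom.comp_apply, AlgHom.comp_apply, parity_gen, map_mul, map_pow, map_neg, map_one,
      mapGen_gen, parity_gen, hk]
  exact congrArg (fun f : SuperComm R p →ₐ[R] SuperComm R p' => f a) this

variable [Algebra ℂ R]

theorem weight_parity (D : Derivation ℂ R R) (w : X → ℂ) (a : SuperComm R p) :
    weight D w (parity a) = parity (weight D w a) := by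
  induction a using SuperComm.induction with
  | hR r => rw [AlgHom.commutes, weight_algebraMap, AlgHom.commutes]
  | hgen x =>
    rw [weight_gen, ← algebraMap_smul R (w x), map_smul, parity_gen]
    rcases neg_one_pow_eq_or (SuperComm R p) (p x) with h | h <;> rw [h] <;> simp [weight_gen]
  | hmul a b ha hb => rw [map_mul, weight_mul, ha, hb, weight_mul, map_add, map_mul, map_mul]
  | hadd a b ha hb => rw [map_add, map_add, ha, hb, map_add, map_add]

theorem weight_mapGen {Y : Type*} {p' : Y → ℕ} (D : Derivation ℂ R R) (k : X → Y)
    (hk : ∀ x, p' (k x) = p x) (w : Y → ℂ) (b : SuperComm R p) :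
    weight D w (mapGen (R := R) k hk b) = mapGen (R := R) k hk (weight D (fun x => w (k x)) b) := by
  induction b using SuperComm.induction with
  | hR r => rw [AlgHom.commutes, weight_algebraMap, weight_algebraMap, AlgHom.commutes]
  | hgen x =>
    rw [mapGen_gen, weight_gen, weight_gen, ← algebraMap_smul R (w (k x)) (gen p x), map_smul, mapGen_gen,
      algebraMap_smul]
  | hmul a b ha hb => rw [map_mul, weight_mul, ha, hb, weight_mul, map_add, map_mul, map_mul]
  | hadd a b ha hb => rw [map_add, map_add, ha, hb, map_add, map_add]

theorem weight_zero_zero (b : SuperComm R p) : weight (0 : Derivation ℂ R R) (fun _ : X => 0) b = 0 := by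
  induction b using SuperComm.induction with
  | hR r => rw [weight_algebraMap]; simp
  | hgen x => rw [weight_gen, zero_smul]
  | hmul a b ha hb => rw [weight_mul, ha, hb]; simp
  | hadd a b ha hb => rw [map_add, ha, hb, add_zero]

end SuperComm

namespace LieConstants.Window

variable {X Y : Type*} {C : LieConstants X} (W : C.Window Y)

/-- Weights of the generators. -/
def genDeg : X ⊕ Y → ℕ := Sum.elim C.deg fun y => C.deg (W.κ y)

/-- The grading operator which extends the grading of the Lie superalgebra, with a multiple of the
number of factors `ξ`. -/
noncomputable def wt (α β : ℂ) : W.Alg →ₗ[ℂ] W.Alg :=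
  weight (0 : Derivation ℂ ℂ ℂ) (Sum.elim (fun x => α + β * C.deg x) fun y => β * C.deg (W.κ y))

variable (α β : ℂ)

theorem wt_mul (a b : W.Alg) : W.wt α β (a * b) = W.wt α β a * b + a * W.wt α β b :=
  weight_mul _ _ a b

theorem wt_ξ (x : X) : W.wt α β (W.ξ x) = (α + β * C.deg x) • W.ξ x := weight_gen _ _ _

theorem wt_η (y : Y) : W.wt α β (W.η y) = (β * C.deg (W.κ y)) • W.η y := weight_gen _ _ _

theorem wt_ηx (x : X) : W.wt α β (W.ηx x) = (β * C.deg x) • W.ηx x := by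
  rw [ηx]
  cases h : W.inv x with
  | none => simp
  | some y => rw [← W.κ_inv h]; exact W.wt_η α β y

theorem wt_algebraMap (r : ℂ) : W.wt α β (algebraMap ℂ _ r) = 0 :=
  (weight_algebraMap (0 : Derivation ℂ ℂ ℂ) _ r).trans (by simp)

theorem wt_ceVal (u : X) : W.wt α β (C.ceVal W.ξ u) = (α + (α + β * C.deg u)) • C.ceVal W.ξ u := by
  rw [ceVal, map_sum, Finset.smul_sum]
  refine Finset.sum_congr rfl fun s _ => ?_
  rw [map_sum, Finset.smul_sum]
  refine Finset.sum_congr rfl fun t _ => ?_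
  by_cases hc : C.c s t u = 0
  · simp [hc]
  · rw [map_smul, wt_mul, wt_ξ, wt_ξ, ← C.c_deg hc, smul_comm, smul_mul_assoc, mul_smul_comm,
      ← add_smul]
    congr 2
    push_cast
    ring

theorem wt_conn (u : X) : W.wt α β (W.conn u) = (α + β * C.deg u) • W.conn u := by
  rw [conn, map_sum, Finset.smul_sum]
  refine Finset.sum_congr rfl fun s _ => ?_
  rw [map_sum, Finset.smul_sum]
  refine Finset.sum_congr rfl fun t _ => ?_
  by_cases hc : C.c s t u = 0
  · simp [hc]
  · rw [map_smul, wt_mul, wt_ξ, wt_ηx, ← C.c_deg hc, smul_comm, smul_mul_assoc, mul_smul_comm,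
      ← add_smul]
    congr 2
    push_cast
    ring

/-- The differential preserves the grading by `L` and adds one factor `ξ`, which counts `α`. -/
theorem wt_diff (a : W.Alg) : W.wt α β (W.diff.d a) = W.diff.d (W.wt α β a) + α • W.diff.d a := by
  induction a using SuperComm.induction with
  | hR r => rw [wt_algebraMap, diff, oddDer_algebraMap]; simp
  | hgen z =>
    rcases z with x | y
    · change W.wt α β (W.diff.d (W.ξ x)) = W.diff.d (W.wt α β (W.ξ x)) + α • W.diff.d (W.ξ x)
      rw [diff_ξ, wt_ceVal, wt_ξ, map_smul, diff_ξ, ← add_smul, add_comm]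
    · change W.wt α β (W.diff.d (W.η y)) = W.diff.d (W.wt α β (W.η y)) + α • W.diff.d (W.η y)
      rw [wt_η, map_smul, diff_η, map_add, map_smul, wt_conn, wt_ξ, smul_comm, ← smul_add,
        ← add_smul, add_comm]
  | hmul a b ha hb =>
    rw [W.diff.leibniz, map_add, wt_mul, wt_mul, ha, hb, wt_mul, map_add, W.diff.leibniz,
      W.diff.leibniz]
    have : W.wt α β (W.diff.parity a) = W.diff.parity (W.wt α β a) := weight_parity _ _ a
    rw [this]
    simp only [add_mul, mul_add, smul_add, smul_mul_assoc, mul_smul_comm]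
    abel
  | hadd a b ha hb => rw [map_add, map_add, ha, hb, map_add, map_add]; module

theorem spec_wt {A : Type*} [CommRing A] [Algebra ℂ A] (ψ : C.Twist A) (D : Derivation ℂ A A)
    (hD : ∀ x, D (ψ.val x) = (α + β * C.deg x) • ψ.val x) (a : W.Alg) :
    W.spec ψ (W.wt α β a) = weight D (fun y => β * C.deg (W.κ y)) (W.spec ψ a) := by
  induction a using SuperComm.induction with
  | hR r =>
    rw [wt_algebraMap, AlgHom.commutes, IsScalarTower.algebraMap_apply ℂ A, weight_algebraMap]
    simp
  | hgen z =>
    rcases z with x | y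
    · change W.spec ψ (W.wt α β (W.ξ x)) = weight D _ (W.spec ψ (W.ξ x))
      rw [wt_ξ, map_smul, spec_ξ, weight_algebraMap, hD, Algebra.smul_def, Algebra.smul_def,
        map_mul, ← IsScalarTower.algebraMap_apply]
    · change W.spec ψ (W.wt α β (W.η y)) = weight D _ (W.spec ψ (W.η y))
      rw [wt_η, map_smul, spec_η, weight_gen]
  | hmul a b ha hb => rw [wt_mul, map_add, map_mul, map_mul, ha, hb, map_mul, weight_mul]
  | hadd a b ha hb => rw [map_add, map_add, ha, hb, map_add, map_add]

theorem wt_isDiagonal : Module.End.IsDiagonal (W.wt α β) := weight_isDiagonal isDiagonal_zero _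

/-- The components for the grading of the Lie superalgebra. -/
noncomputable def part (μ : ℂ) : Submodule ℂ W.Alg := Module.End.eigenspace (W.wt 0 1) μ

theorem mem_part {μ : ℂ} {a : W.Alg} : a ∈ W.part μ ↔ W.wt 0 1 a = μ • a :=
  Module.End.mem_eigenspace_iff

theorem part_eq (μ : ℂ) :
    W.part μ = monomialSpan W.par ⊤ (fun l => ((l.map W.genDeg).sum : ℂ) = μ) := by
  refine eigenspace_weight_zero _ _ _ fun l => ?_
  rw [Nat.cast_list_sum, List.map_map]
  have : (Nat.cast ∘ W.genDeg : X ⊕ Y → ℂ) =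
      Sum.elim (fun x => 0 + 1 * (C.deg x : ℂ)) fun y => 1 * (C.deg (W.κ y) : ℂ) := by
    ext z
    rcases z with x | y <;> simp [genDeg]
  rw [this]

theorem part_eq_bot {μ : ℂ} (h : ∀ j : ℕ, (j : ℂ) ≠ μ) : W.part μ = ⊥ := by
  rw [part_eq, eq_bot_iff]
  refine Submodule.span_le.2 ?_
  rintro _ ⟨a, -, l, hl, rfl⟩
  exact absurd hl (h _)

theorem diff_mem_part {μ : ℂ} {a : W.Alg} (ha : a ∈ W.part μ) : W.diff.d a ∈ W.part μ := by
  rw [mem_part] at ha ⊢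
  rw [wt_diff, ha, map_smul, zero_smul, add_zero]

theorem parity_mem_part {μ : ℂ} {a : W.Alg} (ha : a ∈ W.part μ) : parity a ∈ W.part μ := by
  rw [mem_part] at ha ⊢
  exact (weight_parity _ _ a).trans ((congrArg parity ha).trans (map_smul _ _ _))

theorem mul_mem_part {μ ν : ℂ} {a b : W.Alg} (ha : a ∈ W.part μ) (hb : b ∈ W.part ν) :
    a * b ∈ W.part (μ + ν) := by
  rw [mem_part] at ha hb ⊢
  rw [wt_mul, ha, hb, smul_mul_assoc, mul_smul_comm, add_smul]

theorem ξ_mem_part (x : X) : W.ξ x ∈ W.part (C.deg x) := by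
  rw [mem_part, wt_ξ, zero_add, one_mul]

theorem η_mem_part (y : Y) : W.η y ∈ W.part (C.deg (W.κ y)) := by
  rw [mem_part, wt_η, one_mul]

end LieConstants.Window


/-! ### Filtration of the full complex by the degree in the remaining generators -/

open SuperComm
open scoped TensorProduct

namespace SuperComm

section Tail

variable {R : Type*} [CommRing R] [Algebra ℂ R] {X₁ X₂ X : Type*} {p₁ : X₁ → ℕ} {p₂ : X₂ → ℕ}
  {p : X → ℕ} (e : X₁ ⊕ X₂ ≃ X) (h₁ : ∀ x, p (e (Sum.inl x)) = p₁ x)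
  (h₂ : ∀ x, p (e (Sum.inr x)) = p₂ x)

/-- The component of degree `i`, for generators graded by their parity degrees. -/
noncomputable def tailPart (p₂ : X₂ → ℕ) (i : ℕ) : Submodule ℂ (SuperComm ℂ p₂) :=
  Module.End.eigenspace (weight (0 : Derivation ℂ ℂ ℂ) fun x => (p₂ x : ℂ)) (i : ℂ)

theorem mem_tailPart {i : ℕ} {τ : SuperComm ℂ p₂} :
    τ ∈ tailPart p₂ i ↔ weight (0 : Derivation ℂ ℂ ℂ) (fun x => (p₂ x : ℂ)) τ = (i : ℂ) • τ :=
  Module.End.mem_eigenspace_iff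

theorem tailPart_eq (i : ℕ) :
    tailPart p₂ i = monomialSpan p₂ ⊤ fun l => (l.map p₂).sum = i := by
  refine eigenspace_weight_zero _ _ _ fun l => ?_
  have : (l.map fun x => (p₂ x : ℂ)).sum = ((l.map p₂).sum : ℕ) := by
    rw [Nat.cast_list_sum, List.map_map]; rfl
  rw [this, Nat.cast_inj]

theorem mul_mem_tailPart {i j : ℕ} {a b : SuperComm ℂ p₂} (ha : a ∈ tailPart p₂ i)
    (hb : b ∈ tailPart p₂ j) : a * b ∈ tailPart p₂ (i + j) := by
  rw [mem_tailPart] at *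
  rw [weight_mul, ha, hb, smul_mul_assoc, mul_smul_comm, ← add_smul, Nat.cast_add]

theorem gen_mem_tailPart (x : X₂) : gen p₂ x ∈ tailPart p₂ (p₂ x) :=
  mem_tailPart.2 (weight_gen _ _ _)

theorem one_mem_tailPart : (1 : SuperComm ℂ p₂) ∈ tailPart p₂ 0 := by
  rw [tailPart_eq]
  exact Submodule.subset_span ⟨1, trivial, [], rfl, by simp⟩

/-- The products of degree less than `k` in the generators that are split off. -/
noncomputable def lowTail (k : ℕ) : Submodule ℂ (SuperComm R p) :=
  Submodule.span ℂ {z | ∃ i < k, ∃ a : SuperComm R p₁, ∃ τ ∈ tailPart p₂ i,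
    z = splitMul e h₁ h₂ (a ⊗ₜ τ)}

/-- The degree in the generators that are split off. -/
noncomputable def tailWt (p₂ : X₂ → ℕ) : SuperComm R p →ₗ[ℂ] SuperComm R p :=
  weight (0 : Derivation ℂ R R) fun x => Sum.elim (fun _ => 0) (fun x => (p₂ x : ℂ)) (e.symm x)

theorem tailWt_splitMul {i : ℕ} (a : SuperComm R p₁) {τ : SuperComm ℂ p₂} (hτ : τ ∈ tailPart p₂ i) :
    tailWt e p₂ (splitMul e h₁ h₂ (a ⊗ₜ τ)) = (i : ℂ) • splitMul e h₁ h₂ (a ⊗ₜ τ) := by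
  rw [splitMul_tmul, tailWt, weight_mul, weight_mapGen, weight_mapGenC]
  simp only [Equiv.symm_apply_apply, Sum.elim_inl, Sum.elim_inr]
  rw [weight_zero_zero, mem_tailPart.1 hτ]
  simp

/-- The degree in the split-off generators is the eigenvalue of a weight operator, and eigenspaces
are independent; the tensor splitting is injective. -/
theorem eq_zero_of_mem_lowTail {k : ℕ} {t : SuperComm R p₁ ⊗[ℂ] tailPart p₂ k}
    (ht : splitMul e h₁ h₂ ((tailPart p₂ k).subtype.lTensor _ t) ∈ lowTail e h₁ h₂ k) : t = 0 := by
  have hinj : Function.Injective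
      ((tailPart p₂ k).subtype.lTensor (SuperComm R p₁)) :=
    Module.Flat.lTensor_preserves_injective_linearMap _ (Submodule.injective_subtype _)
  refine hinj ((splitMul_bijective e h₁ h₂).1 ?_)
  rw [map_zero, map_zero]
  have h3 : tailWt e p₂ (splitMul e h₁ h₂ ((tailPart p₂ k).subtype.lTensor _ t)) =
      (k : ℂ) • splitMul e h₁ h₂ ((tailPart p₂ k).subtype.lTensor _ t) := by
    clear ht
    induction t with
    | zero => simp
    | add x y hx hy => simp only [map_add, hx, hy, smul_add]
    | tmul a τ => exact tailWt_splitMul e h₁ h₂ a τ.2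
  have h4 : lowTail e h₁ h₂ k ≤
      ⨆ μ, ⨆ _ : μ ≠ (k : ℂ), Module.End.eigenspace (tailWt (R := R) (p := p) e p₂) μ := by
    refine Submodule.span_le.2 ?_
    rintro _ ⟨i, hi, a, τ, hτ, rfl⟩
    exact Submodule.mem_iSup_of_mem (i : ℂ) (Submodule.mem_iSup_of_mem
      (Nat.cast_injective.ne hi.ne) (Module.End.mem_eigenspace_iff.2 (tailWt_splitMul e h₁ h₂ a hτ)))
  exact (Module.End.eigenspaces_iSupIndep (tailWt (R := R) (p := p) e p₂) (k : ℂ)).le_bot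
    ⟨Module.End.mem_eigenspace_iff.2 h3, h4 ht⟩

end Tail

end SuperComm

namespace LieConstants

section Descent

variable {Y X' : Type*} (C : LieConstants (Y ⊕ X'))
  (h : ∀ y x, C.deg (Sum.inl y) < C.deg (Sum.inr x))

/-- The parities of the generators outside the window. -/
abbrev tailDeg (x : X') : ℕ := C.deg (Sum.inr x)

theorem full_par_inl (z : (Y ⊕ X') ⊕ Y) :
    C.full.par (Equiv.sumAssoc (Y ⊕ X') Y X' (Sum.inl z)) = (C.ofSum h).par z := by
  rcases z with (z | z) | z <;> rfl

theorem full_par_inr (x : X') :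
    C.full.par (Equiv.sumAssoc (Y ⊕ X') Y X' (Sum.inr x)) = C.tailDeg x := rfl

/-- The inclusion of the complex of the window in the full complex. -/
noncomputable def winMap : (C.ofSum h).Alg →ₐ[ℂ] C.full.Alg :=
  mapGen (R := ℂ) (fun z => Equiv.sumAssoc (Y ⊕ X') Y X' (Sum.inl z)) (C.full_par_inl h)

/-- The inclusion of the algebra of the remaining generators `η`. -/
noncomputable def tailMap : SuperComm ℂ C.tailDeg →ₐ[ℂ] C.full.Alg :=
  mapGenC ℂ (fun x => Equiv.sumAssoc (Y ⊕ X') Y X' (Sum.inr x)) C.full_par_inr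

/-- The full complex as a tensor product. -/
noncomputable def winSplit : (C.ofSum h).Alg ⊗[ℂ] SuperComm ℂ C.tailDeg →ₗ[ℂ] C.full.Alg :=
  splitMul (Equiv.sumAssoc (Y ⊕ X') Y X') (C.full_par_inl h) C.full_par_inr

theorem winSplit_tmul (r : (C.ofSum h).Alg) (τ : SuperComm ℂ C.tailDeg) :
    C.winSplit h (r ⊗ₜ τ) = C.winMap h r * C.tailMap τ := rfl

theorem winMap_ξ (x : Y ⊕ X') : C.winMap h ((C.ofSum h).ξ x) = C.full.ξ x := mapGen_gen _ _ _

theorem winMap_η (y : Y) : C.winMap h ((C.ofSum h).η y) = C.full.η (Sum.inl y) := mapGen_gen _ _ _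

theorem tailMap_gen (x : X') : C.tailMap (gen _ x) = C.full.η (Sum.inr x) := mapGenC_gen _ _ _

theorem winMap_parity (r : (C.ofSum h).Alg) : C.winMap h (parity r) = parity (C.winMap h r) :=
  mapGen_parity _ _ r

/-- Only indices of degree at most that of the window element occur, and these lie in the window,
where the two extensions of `η` agree. -/
theorem winMap_conn (y : Y) :
    C.winMap h ((C.ofSum h).conn (Sum.inl y)) = C.full.conn (Sum.inl y) := by
  rw [Window.conn, Window.conn, map_sum]
  refine Finset.sum_congr rfl fun s hs => ?_
  rw [map_sum]
  refine Finset.sum_congr rfl fun t _ => ?_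
  rw [map_smul, map_mul, winMap_ξ]
  rcases s with s | s
  · congr 2
    exact C.winMap_η h s
  · exact absurd (h y s) (not_lt.2 (C.mem_ball.1 hs))

theorem winMap_diff (r : (C.ofSum h).Alg) :
    C.winMap h ((C.ofSum h).diff.d r) = C.full.diff.d (C.winMap h r) := by
  induction r using SuperComm.induction with
  | hR r => rw [AlgHom.commutes, Window.diff, Window.diff, oddDer_algebraMap, oddDer_algebraMap, map_zero]
  | hgen z =>
    rcases z with x | y
    · change C.winMap h ((C.ofSum h).diff.d ((C.ofSum h).ξ x)) =
        C.full.diff.d (C.winMap h ((C.ofSum h).ξ x))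
      rw [winMap_ξ, Window.diff_ξ, Window.diff_ξ, C.map_ceVal]
      simp only [winMap_ξ]
    · change C.winMap h ((C.ofSum h).diff.d ((C.ofSum h).η y)) =
        C.full.diff.d (C.winMap h ((C.ofSum h).η y))
      rw [winMap_η, Window.diff_η, Window.diff_η, map_add, map_smul, winMap_ξ]
      congr 2
      exact C.winMap_conn h y
  | hmul a b ha hb =>
    rw [(C.ofSum h).diff.leibniz, map_add, map_mul, map_mul, ha, hb, map_mul, C.full.diff.leibniz]
    congr 2
    exact C.winMap_parity h a
  | hadd a b ha hb => rw [map_add, map_add, ha, hb, map_add, map_add]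

theorem winMap_injective : Function.Injective (C.winMap h) := by
  have h1 := (splitMul_bijective (R := ℂ) (Equiv.sumAssoc (Y ⊕ X') Y X') (C.full_par_inl h)
    C.full_par_inr).1
  have h2 : Function.Injective
      (fun r : (C.ofSum h).Alg => (r ⊗ₜ 1 : (C.ofSum h).Alg ⊗[ℂ] SuperComm ℂ C.tailDeg)) := by
    have hf : Function.Injective
        ((Algebra.linearMap ℂ (SuperComm ℂ C.tailDeg)).lTensor (C.ofSum h).Alg) := by
      refine Module.Flat.lTensor_preserves_injective_linearMap _ ?_
      have hs : (lift (R := ℂ) (fun _ => 0) (by simp) : SuperComm ℂ C.tailDeg →ₐ[ℂ] ℂ).toLinearMap ∘ₗ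
          Algebra.linearMap ℂ (SuperComm ℂ C.tailDeg) = LinearMap.id := by
        ext; simp
      exact Function.LeftInverse.injective (fun r => LinearMap.congr_fun hs r)
    intro r r' hr
    refine (TensorProduct.rid ℂ (C.ofSum h).Alg).symm.injective (hf ?_)
    simpa using hr
  intro r r' hr
  refine h2 (h1 ?_)
  change C.winSplit h _ = C.winSplit h _
  rw [winSplit_tmul, winSplit_tmul, hr]

/-- The span of the products of elements of total weight `N` and of weight less than `k` in the
remaining generators `η`. -/
noncomputable def fil (N k : ℕ) : Submodule ℂ C.full.Alg :=
  Submodule.span ℂ {z | ∃ i < k, ∃ j : ℕ, i + j = N ∧ ∃ r ∈ (C.ofSum h).part j,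
    ∃ τ ∈ tailPart C.tailDeg i, z = C.winMap h r * C.tailMap τ}

theorem fil_mono {N k k' : ℕ} (hk : k ≤ k') : C.fil h N k ≤ C.fil h N k' :=
  Submodule.span_mono fun _ ⟨i, hi, hz⟩ => ⟨i, hi.trans_le hk, hz⟩

theorem fil_le_lowTail (N k : ℕ) : C.fil h N k ≤
    lowTail (R := ℂ) (Equiv.sumAssoc (Y ⊕ X') Y X') (C.full_par_inl h) C.full_par_inr k :=
  Submodule.span_mono fun _ ⟨i, hi, _, _, r, _, τ, hτ, hz⟩ => ⟨i, hi, r, τ, hτ, hz⟩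

theorem mul_mem_fil {N k i j : ℕ} {r : (C.ofSum h).Alg} (hr : r ∈ (C.ofSum h).part j)
    {τ : SuperComm ℂ C.tailDeg} (hτ : τ ∈ tailPart C.tailDeg i) {z : C.full.Alg}
    (hz : z ∈ C.fil h N k) : C.winMap h r * (z * C.tailMap τ) ∈ C.fil h (N + i + j) (k + i) := by
  induction hz using Submodule.span_induction with
  | mem z hz =>
    obtain ⟨i', hi', j', hN, r', hr', τ', hτ', rfl⟩ := hz
    refine Submodule.subset_span ⟨i' + i, by omega, j + j', by omega, r * r', ?_, τ' * τ,
      mul_mem_tailPart hτ' hτ, ?_⟩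
    · rw [Nat.cast_add]
      exact (C.ofSum h).mul_mem_part hr hr'
    · rw [map_mul, map_mul]
      simp only [mul_assoc]
  | zero => simp
  | add x y _ _ hx hy => rw [add_mul, mul_add]; exact add_mem hx hy
  | smul c x _ hx => rw [smul_mul_assoc, mul_smul_comm]; exact Submodule.smul_mem _ _ hx

theorem winMap_mul_mem_fil {N k j : ℕ} {r : (C.ofSum h).Alg} (hr : r ∈ (C.ofSum h).part j)
    {z : C.full.Alg} (hz : z ∈ C.fil h N k) : C.winMap h r * z ∈ C.fil h (N + j) k := by
  have := C.mul_mem_fil h hr one_mem_tailPart hz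
  rwa [map_one, mul_one] at this

theorem mul_tailMap_mem_fil {N k i : ℕ} {τ : SuperComm ℂ C.tailDeg} (hτ : τ ∈ tailPart C.tailDeg i)
    {z : C.full.Alg} (hz : z ∈ C.fil h N k) : z * C.tailMap τ ∈ C.fil h (N + i) (k + i) := by
  have h1 : (1 : (C.ofSum h).Alg) ∈ (C.ofSum h).part ((0 : ℕ) : ℂ) := by
    rw [Window.part_eq]
    exact Submodule.subset_span ⟨1, trivial, [], by simp, by simp⟩
  have := C.mul_mem_fil h h1 hτ hz
  rwa [map_one, one_mul] at this

theorem η_mul_mem_fil {N k : ℕ} (x : X') {z : C.full.Alg} (hz : z ∈ C.fil h N k) :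
    C.full.η (Sum.inr x) * z ∈ C.fil h (N + C.tailDeg x) (k + C.tailDeg x) := by
  induction hz using Submodule.span_induction with
  | mem z hz =>
    obtain ⟨i, hi, j, hN, r, hr, τ, hτ, rfl⟩ := hz
    have h1 : ∀ q : ℕ, ((parity : C.full.Alg →ₐ[ℂ] _) ^ q) (C.winMap h r) =
        C.winMap h (((parity : (C.ofSum h).Alg →ₐ[ℂ] _) ^ q) r) ∧
        ((parity : (C.ofSum h).Alg →ₐ[ℂ] _) ^ q) r ∈ (C.ofSum h).part j := by
      intro q
      induction q with
      | zero => exact ⟨rfl, hr⟩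
      | succ q ih =>
        rw [pow_succ', pow_succ', AlgHom.mul_apply, AlgHom.mul_apply, ih.1, winMap_parity]
        exact ⟨rfl, (C.ofSum h).parity_mem_part ih.2⟩
    refine Submodule.subset_span ⟨C.tailDeg x + i, by omega, j, by omega, _, (h1 (C.tailDeg x)).2,
      gen _ x * τ, mul_mem_tailPart (gen_mem_tailPart x) hτ, ?_⟩
    rw [← mul_assoc, map_mul, tailMap_gen, ← mul_assoc, ← (h1 _).1]
    congr 1
    exact gen_mul_eq _ _
  | zero => simp
  | add x y _ _ hx hy => rw [mul_add]; exact add_mem hx hy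
  | smul c x _ hx => rw [mul_smul_comm]; exact Submodule.smul_mem _ _ hx

theorem winMap_mem_fil {N k : ℕ} (hk : 0 < k) {r : (C.ofSum h).Alg} (hr : r ∈ (C.ofSum h).part N) :
    C.winMap h r ∈ C.fil h N k :=
  Submodule.subset_span ⟨0, hk, N, zero_add _, r, hr, 1, one_mem_tailPart, by simp⟩

/-- A non-zero `c_{st}^x` with `|t| > 0` forces `|s| < |x|`: even when `η_s` lies outside the
window, the tail degree has dropped strictly. -/
theorem full_conn_mem_fil (x : X') :
    C.full.conn (Sum.inr x) ∈ C.fil h (C.tailDeg x) (C.tailDeg x) := by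
  refine Submodule.sum_mem _ fun s _ => Submodule.sum_mem _ fun t _ => ?_
  by_cases hc : C.c s t (Sum.inr x) = 0
  · rw [hc, mul_zero, zero_smul]; exact Submodule.zero_mem _
  refine Submodule.smul_mem _ _ ?_
  have hd : C.deg s + C.deg t = C.tailDeg x := C.c_deg hc
  have ht := (C.ofSum h).ξ_mem_part t
  rw [← winMap_ξ C h]
  rcases s with s | s
  · change C.winMap h _ * C.full.η (Sum.inl s) ∈ _
    rw [← winMap_η C h, ← map_mul]
    refine C.winMap_mem_fil h (C.pos _) ?_
    have := (C.ofSum h).mul_mem_part ht ((C.ofSum h).η_mem_part s)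
    rw [← Nat.cast_add, add_comm] at this
    rw [← hd]
    exact this
  · change C.winMap h _ * C.full.η (Sum.inr s) ∈ _
    have := C.pos t
    rw [← tailMap_gen]
    exact Submodule.subset_span ⟨C.tailDeg s, by change C.deg _ < _; omega, C.deg t, hd, _, ht, _,
      gen_mem_tailPart s, rfl⟩

theorem diff_tailMap_mem_fil {i : ℕ} {τ : SuperComm ℂ C.tailDeg} (hτ : τ ∈ tailPart C.tailDeg i) :
    C.full.diff.d (C.tailMap τ) ∈ C.fil h i i := by
  rw [tailPart_eq] at hτ
  induction hτ using Submodule.span_induction with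
  | zero => simp
  | add x y _ _ hx hy => rw [map_add, map_add]; exact add_mem hx hy
  | smul c x _ hx => rw [map_smul, map_smul]; exact Submodule.smul_mem _ _ hx
  | mem τ hτ =>
    obtain ⟨c, -, l, rfl, rfl⟩ := hτ
    rw [← Algebra.smul_def, map_smul, map_smul]
    refine Submodule.smul_mem _ _ ?_
    induction l with
    | nil => simp [OddDerivation.d_one]
    | cons x l ih =>
      have hm : (l.map (gen C.tailDeg)).prod ∈ tailPart C.tailDeg (l.map C.tailDeg).sum := by
        rw [tailPart_eq]
        exact Submodule.subset_span ⟨1, trivial, l, rfl, by simp⟩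
      simp only [List.map_cons, List.prod_cons, List.sum_cons, map_mul, tailMap_gen]
      have h1 : C.full.diff.d (C.full.η (Sum.inr x) * C.tailMap (l.map (gen C.tailDeg)).prod) =
          (C.full.ξ (Sum.inr x) + ((C.tailDeg x : ℂ)⁻¹) • C.full.conn (Sum.inr x)) *
            C.tailMap (l.map (gen C.tailDeg)).prod + ((-1) ^ C.tailDeg x : ℂ) •
            (C.full.η (Sum.inr x) * C.full.diff.d (C.tailMap (l.map (gen C.tailDeg)).prod)) := by
        refine (oddDer_gen_mul _ _ _ _).trans ?_
        rfl
      rw [h1]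
      refine add_mem (C.mul_tailMap_mem_fil h hm (add_mem ?_ (Submodule.smul_mem _ _
        (C.full_conn_mem_fil h x)))) (Submodule.smul_mem _ _ ?_)
      · rw [← winMap_ξ C h]
        exact C.winMap_mem_fil h (C.pos _) ((C.ofSum h).ξ_mem_part _)
      · have := C.η_mul_mem_fil h x ih
        rwa [add_comm] at this

/-- Differentiating the tail factor lowers its degree, so to leading order the differential is that
of the window tensored with the identity. -/
theorem diff_mul_sub_mem_fil {i j : ℕ} {r : (C.ofSum h).Alg} (hr : r ∈ (C.ofSum h).part j)
    {τ : SuperComm ℂ C.tailDeg} (hτ : τ ∈ tailPart C.tailDeg i) :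
    C.full.diff.d (C.winMap h r * C.tailMap τ) - C.winMap h ((C.ofSum h).diff.d r) * C.tailMap τ ∈
      C.fil h (i + j) i := by
  have h1 : C.full.diff.d (C.winMap h r * C.tailMap τ) =
      C.full.diff.d (C.winMap h r) * C.tailMap τ +
        parity (C.winMap h r) * C.full.diff.d (C.tailMap τ) := C.full.diff.leibniz _ _
  rw [h1, winMap_diff, add_sub_cancel_left, ← winMap_parity]
  exact C.winMap_mul_mem_fil h ((C.ofSum h).parity_mem_part hr) (C.diff_tailMap_mem_fil h hτ)

theorem diff_mem_fil {N k : ℕ} {z : C.full.Alg} (hz : z ∈ C.fil h N k) :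
    C.full.diff.d z ∈ C.fil h N k := by
  induction hz using Submodule.span_induction with
  | mem z hz =>
    obtain ⟨i, hi, j, hN, r, hr, τ, hτ, rfl⟩ := hz
    have h1 := C.fil_mono h hi.le (C.diff_mul_sub_mem_fil h hr hτ)
    rw [hN] at h1
    have h2 : C.winMap h ((C.ofSum h).diff.d r) * C.tailMap τ ∈ C.fil h N k :=
      Submodule.subset_span ⟨i, hi, j, hN, _, (C.ofSum h).diff_mem_part hr, τ, hτ, rfl⟩
    simpa using add_mem h1 h2
  | zero => simp
  | add x y _ _ hx hy => rw [map_add]; exact add_mem hx hy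
  | smul c x _ hx => rw [map_smul]; exact Submodule.smul_mem _ _ hx

theorem full_part_le_fil (N : ℕ) : C.full.part (N : ℂ) ≤ C.fil h N (N + 1) := by
  rw [Window.part_eq]
  refine Submodule.span_le.2 ?_
  rintro _ ⟨c, -, l, hl, rfl⟩
  rw [Nat.cast_inj] at hl
  subst hl
  rw [SetLike.mem_coe, ← Algebra.smul_def]
  refine Submodule.smul_mem _ _ ?_
  induction l with
  | nil =>
    have h1 : (1 : (C.ofSum h).Alg) ∈ (C.ofSum h).part ((0 : ℕ) : ℂ) := by
      rw [Window.part_eq]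
      exact Submodule.subset_span ⟨1, trivial, [], by simp, by simp⟩
    have := C.winMap_mem_fil h (Nat.succ_pos 0) h1
    simpa using this
  | cons z l ih =>
    simp only [List.map_cons, List.prod_cons, List.sum_cons]
    rcases z with x | (y | x)
    · have := C.winMap_mul_mem_fil h ((C.ofSum h).ξ_mem_part x) ih
      rw [winMap_ξ, add_comm] at this
      exact C.fil_mono h (by omega) this
    · have := C.winMap_mul_mem_fil h ((C.ofSum h).η_mem_part y) ih
      rw [winMap_η, add_comm] at this
      exact C.fil_mono h (by omega) this
    · have := C.η_mul_mem_fil h x ih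
      rw [add_comm (List.sum _)] at this
      exact C.fil_mono h (by change _ + C.deg (Sum.inr x) ≤ C.deg (Sum.inr x) + _ + 1; omega) this

theorem exists_of_mem_fil_one {N : ℕ} {z : C.full.Alg} (hz : z ∈ C.fil h N 1) :
    ∃ r ∈ (C.ofSum h).part N, z = C.winMap h r := by
  induction hz using Submodule.span_induction with
  | mem z hz =>
    obtain ⟨i, hi, j, hN, r, hr, τ, hτ, rfl⟩ := hz
    obtain rfl : i = 0 := by omega
    obtain rfl : j = N := by omega
    have h1 : ∃ c : ℂ, τ = c • 1 := by
      rw [tailPart_eq] at hτ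
      have : monomialSpan C.tailDeg (⊤ : Submodule ℂ ℂ) (fun l => (l.map C.tailDeg).sum = 0) ≤
          Submodule.span ℂ {1} := by
        refine Submodule.span_le.2 ?_
        rintro _ ⟨c, -, l, hl, rfl⟩
        cases l with
        | nil =>
          rw [SetLike.mem_coe, ← Algebra.smul_def]
          exact Submodule.smul_mem _ _ (Submodule.mem_span_singleton_self _)
        | cons x l => simp [tailDeg, (C.pos (Sum.inr x)).ne'] at hl
      obtain ⟨c, hc⟩ := Submodule.mem_span_singleton.1 (this hτ)
      exact ⟨c, hc.symm⟩
    obtain ⟨c, rfl⟩ := h1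
    exact ⟨c • r, Submodule.smul_mem _ _ hr, by rw [map_smul, map_one, mul_smul_comm, mul_one, map_smul]⟩
  | zero => exact ⟨0, zero_mem _, by simp⟩
  | add x y _ _ hx hy =>
    obtain ⟨r, hr, rfl⟩ := hx
    obtain ⟨r', hr', rfl⟩ := hy
    exact ⟨r + r', add_mem hr hr', by rw [map_add]⟩
  | smul c x _ hx =>
    obtain ⟨r, hr, rfl⟩ := hx
    exact ⟨c • r, Submodule.smul_mem _ _ hr, by rw [map_smul]⟩

end Descent

end LieConstants


/-! ### Descent of acyclicity from the full window to a smaller one -/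

open SuperComm
open scoped TensorProduct

namespace LieConstants

section

variable {X Y : Type*} {C : LieConstants X} (W : C.Window Y) {A : Type*} [CommRing A] [Algebra ℂ A]
  (ψ : C.Twist A) (D : Derivation ℂ A A) (hD : ∀ x, D (ψ.val x) = ψ.val x)

namespace Window

include hD

theorem spec_wt_zero_one (a : W.Alg) :
    W.spec ψ (W.wt 0 1 a) = weight D (fun y => 1 * (C.deg (W.κ y) : ℂ)) (W.spec ψ a) := by
  refine W.spec_wt 0 1 ψ D (fun x => ?_) a
  by_cases hx : C.deg x = 1
  · rw [hD, hx]; simp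
  · rw [ψ.val_of_ne hx, map_zero, smul_zero]

open Polynomial in
theorem exists_mem_part {μ : ℂ} {z : W.Alg} (hz : z ∈ W.part μ) {y : W.Alg}
    (hy : W.spec ψ y = 0) (hdy : W.diff.d y = z) :
    ∃ y ∈ W.part μ, W.spec ψ y = 0 ∧ W.diff.d y = z := by
  obtain ⟨q, hq, hqy⟩ := (W.wt_isDiagonal 0 1).exists_poly y μ
  set L : Module.End ℂ W.Alg := W.wt 0 1 with hL
  refine ⟨aeval L q y, W.mem_part.2 hqy, ?_, ?_⟩
  · have := Module.End.aeval_intertwine (W := L)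
      (W' := weight D (fun y => 1 * (C.deg (W.κ y) : ℂ))) (W.spec ψ).toLinearMap
      (fun v => W.spec_wt_zero_one ψ D hD v) q y
    rw [AlgHom.toLinearMap_apply, AlgHom.toLinearMap_apply, hy, map_zero] at this
    exact this
  · have := Module.End.aeval_intertwine (W := L) (W' := L) W.diff.d
      (fun v => by
        have := W.wt_diff 0 1 v
        rw [zero_smul, add_zero] at this
        exact this.symm) q y
    rw [this, hdy, Module.End.aeval_apply_of_eigen (W.mem_part.1 hz), hq, one_smul]

end Window

end

section Descent

variable {Y X' : Type*} (C : LieConstants (Y ⊕ X'))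
  (h : ∀ y x, C.deg (Sum.inl y) < C.deg (Sum.inr x))
  {A : Type*} [CommRing A]

/-- The algebra of the specialised complex of a window. -/
abbrev Window.SpecAlg {X Y : Type*} {C : LieConstants X} (W : C.Window Y) (A : Type*) [CommRing A] : Type _ :=
  SuperComm A fun y => C.deg (W.κ y)

theorem specDeg_inl (y : Y) :
    C.deg (C.full.κ (Equiv.refl (Y ⊕ X') (Sum.inl y))) = C.deg ((C.ofSum h).κ y) := rfl

theorem specDeg_inr (x : X') :
    C.deg (C.full.κ (Equiv.refl (Y ⊕ X') (Sum.inr x))) = C.tailDeg x := rfl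

/-- The inclusion of specialised complexes. -/
noncomputable def specMap : (C.ofSum h).SpecAlg A →ₐ[A] C.full.SpecAlg A :=
  mapGen (R := A) (fun y => Equiv.refl (Y ⊕ X') (Sum.inl y)) (C.specDeg_inl h)

theorem specMap_injective : Function.Injective (C.specMap (A := A) h) := by
  let g : C.full.SpecAlg A →ₐ[A] (C.ofSum h).SpecAlg A :=
    lift (Sum.elim (gen _) fun _ => 0) (by
      rintro (x | x) (y | y) <;> simp
      exact gen_mul_gen _ x y)
  have hg : ∀ z, g (gen _ z) = Sum.elim (gen _) (fun _ => 0) z := fun z => lift_gen _ _ z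
  have : g.comp (C.specMap h) = AlgHom.id A _ := by
    refine algHom_ext fun y => ?_
    rw [AlgHom.comp_apply, specMap, mapGen_gen]
    exact hg _
  exact Function.LeftInverse.injective (g := g)
    (fun b => congrArg (fun f : (C.ofSum h).SpecAlg A →ₐ[A] _ => f b) this)

variable [Algebra ℂ A] (ψ : C.Twist A)

/-- The inclusion of the remaining generators in the specialised complex. -/
noncomputable def specTail (A : Type*) [CommRing A] [Algebra ℂ A] : SuperComm ℂ C.tailDeg →ₐ[ℂ] C.full.SpecAlg A :=
  mapGenC A (fun x => Equiv.refl (Y ⊕ X') (Sum.inr x)) C.specDeg_inr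

/-- The full specialised complex as a tensor product. -/
noncomputable def specSplit (A : Type*) [CommRing A] [Algebra ℂ A] : (C.ofSum h).SpecAlg A ⊗[ℂ] SuperComm ℂ C.tailDeg →ₗ[ℂ] C.full.SpecAlg A :=
  splitMul (R := A) (Equiv.refl (Y ⊕ X')) (C.specDeg_inl h) C.specDeg_inr

/-- The products of degree less than `k` in the remaining generators. -/
noncomputable def specLow (A : Type*) [CommRing A] [Algebra ℂ A] (k : ℕ) :
    Submodule ℂ (C.full.SpecAlg A) :=
  lowTail (R := A) (Equiv.refl (Y ⊕ X')) (C.specDeg_inl h) C.specDeg_inr k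

theorem eq_zero_of_mem_specLow {k : ℕ} {t : (C.ofSum h).SpecAlg A ⊗[ℂ] tailPart C.tailDeg k}
    (ht : C.specSplit h A ((tailPart C.tailDeg k).subtype.lTensor _ t) ∈ C.specLow h A k) : t = 0 :=
  eq_zero_of_mem_lowTail (R := A) (Equiv.refl (Y ⊕ X')) (C.specDeg_inl h) C.specDeg_inr ht

theorem full_spec_winMap (r : (C.ofSum h).Alg) :
    C.full.spec ψ (C.winMap h r) = C.specMap h ((C.ofSum h).spec ψ r) := by
  have : (C.full.spec ψ).comp (C.winMap h) =
      ((C.specMap h).restrictScalars ℂ).comp ((C.ofSum h).spec ψ) := by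
    refine algHom_ext fun z => ?_
    rcases z with x | y
    · change C.full.spec ψ (C.winMap h ((C.ofSum h).ξ x)) =
        C.specMap h ((C.ofSum h).spec ψ ((C.ofSum h).ξ x))
      rw [winMap_ξ, Window.spec_ξ, Window.spec_ξ, AlgHom.commutes]
    · change C.full.spec ψ (C.winMap h ((C.ofSum h).η y)) =
        C.specMap h ((C.ofSum h).spec ψ ((C.ofSum h).η y))
      rw [winMap_η, Window.spec_η, Window.spec_η]
      exact (mapGen_gen _ _ _).symm
  exact congrArg (fun f : (C.ofSum h).Alg →ₐ[ℂ] C.full.SpecAlg A => f r) this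

theorem full_spec_tailMap (τ : SuperComm ℂ C.tailDeg) :
    C.full.spec ψ (C.tailMap τ) = C.specTail A τ := by
  have : (C.full.spec ψ).comp C.tailMap = C.specTail A := by
    refine algHom_ext fun x => ?_
    rw [AlgHom.comp_apply, tailMap_gen, Window.spec_η]
    exact (mapGenC_gen _ _ _).symm
  exact congrArg (fun f : SuperComm ℂ C.tailDeg →ₐ[ℂ] C.full.SpecAlg A => f τ) this

/-- The statement that the kernel of the specialisation is acyclic in one weight. -/
def AcyclicAt (N : ℕ) : Prop := ∀ z ∈ (C.ofSum h).part N, (C.ofSum h).spec ψ z = 0 →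
  (C.ofSum h).diff.d z = 0 → ∃ y ∈ (C.ofSum h).part N, (C.ofSum h).spec ψ y = 0 ∧
    (C.ofSum h).diff.d y = z

variable {C h ψ}

/-- The leading term `t` is killed by `d ⊗ 1`, since `db` has smaller tail degree, and by `spec ⊗
1`, since `b` is in the kernel of `spec`. Hence it is a sum of `u ⊗ τ` with `u` a cycle in the
kernel for the window. Acyclicity in weight `j` supplies primitives, and subtracting the
differential of the resulting `e` removes the leading term. -/
theorem AcyclicAt.exists_lower {j k : ℕ} (hj : C.AcyclicAt h ψ j) {b : C.full.Alg}
    {t : (C.ofSum h).part (j : ℂ) ⊗[ℂ] tailPart C.tailDeg k}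
    (hb : b - C.winSplit h (TensorProduct.map ((C.ofSum h).part (j : ℂ)).subtype
      (tailPart C.tailDeg k).subtype t) ∈ C.fil h (k + j) k)
    (hdb : C.full.diff.d b ∈ C.fil h (k + j) k) (hfb : C.full.spec ψ b = 0) :
    ∃ e, C.full.spec ψ e = 0 ∧ b - C.full.diff.d e ∈ C.fil h (k + j) k := by
  set El := C.winSplit h ∘ₗ (TensorProduct.map ((C.ofSum h).part (j : ℂ)).subtype
      (tailPart C.tailDeg k).subtype) with hEl
  have hEl' : ∀ r τ, El (r ⊗ₜ τ) = C.winMap h r * C.tailMap τ := fun r τ => rfl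
  let d := (C.ofSum h).diff.d ∘ₗ ((C.ofSum h).part (j : ℂ)).subtype
  let f := ((C.ofSum h).spec ψ).toLinearMap ∘ₗ ((C.ofSum h).part (j : ℂ)).subtype
  have h1 : ∀ t, C.full.diff.d (El t) -
      C.winSplit h ((tailPart C.tailDeg k).subtype.lTensor _ (d.rTensor _ t)) ∈ C.fil h (k + j) k := by
    intro t
    induction t with
    | zero => simp
    | add x y hx hy =>
      convert add_mem hx hy using 1
      simp only [map_add]
      abel
    | tmul r τ => exact C.diff_mul_sub_mem_fil h r.2 τ.2
  -- The element `(d ⊗ 1) t` has tail degree `k`, yet agrees with a sum of terms of smaller tail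
  -- degree.
  have hd : d.rTensor _ t = 0 := by
    refine eq_zero_of_mem_lowTail (R := ℂ) (Equiv.sumAssoc (Y ⊕ X') Y X') (C.full_par_inl h)
      C.full_par_inr (C.fil_le_lowTail h (k + j) k ?_)
    have h2 := C.diff_mem_fil h hb
    rw [map_sub] at h2
    have h3 := sub_mem (sub_mem hdb h2) (h1 t)
    change C.winSplit h _ ∈ _
    convert h3 using 1
    change _ = _ - (_ - C.full.diff.d (El t)) - _
    abel
  have h2 : ∀ t, C.full.spec ψ (El t) =
      C.specSplit h A ((tailPart C.tailDeg k).subtype.lTensor _ (f.rTensor _ t)) := by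
    intro t
    induction t with
    | zero => simp
    | add x y hx hy => simp only [map_add, hx, hy]
    | tmul r τ =>
      rw [hEl', map_mul, full_spec_winMap, full_spec_tailMap]
      rfl
  have h3 : ∀ z ∈ C.fil h (k + j) k, C.full.spec ψ z ∈ C.specLow h A k := by
    intro z hz
    induction hz using Submodule.span_induction with
    | mem z hz =>
      obtain ⟨i, hi, _, _, r, _, τ, hτ, rfl⟩ := hz
      rw [map_mul, full_spec_winMap, full_spec_tailMap]
      exact Submodule.subset_span ⟨i, hi, _, τ, hτ, rfl⟩
    | zero => rw [map_zero]; exact zero_mem _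
    | add x y _ _ hx hy => rw [map_add]; exact add_mem hx hy
    | smul c x _ hx => rw [map_smul]; exact Submodule.smul_mem _ _ hx
  have hf : f.rTensor _ t = 0 := by
    refine C.eq_zero_of_mem_specLow h ?_
    have h4 := h3 _ hb
    rw [map_sub, hfb, zero_sub, neg_mem_iff] at h4
    rw [← h2]
    exact h4
  have h4 : ∃ e, C.full.spec ψ e = 0 ∧ El t - C.full.diff.d e ∈ C.fil h (k + j) k := by
    refine TensorProduct.induction_ker d f
      (p := fun t => ∃ e, C.full.spec ψ e = 0 ∧ El t - C.full.diff.d e ∈ C.fil h (k + j) k)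
      ⟨0, by simp, by simp⟩ ?_ ?_ hd hf
    · rintro x y ⟨e, he, hx⟩ ⟨e', he', hy⟩
      refine ⟨e + e', by rw [map_add, he, he', add_zero], ?_⟩
      convert add_mem hx hy using 1
      simp only [map_add]
      abel
    · intro r τ hr hr'
      obtain ⟨c, hc, hfc, hdc⟩ := hj r r.2 hr' hr
      refine ⟨C.winMap h c * C.tailMap τ, ?_, ?_⟩
      · rw [map_mul, full_spec_winMap, hfc, map_zero, zero_mul]
      · have := C.diff_mul_sub_mem_fil h hc τ.2
        rw [hdc] at this
        rw [← neg_sub]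
        exact neg_mem this
  obtain ⟨e, he, he'⟩ := h4
  refine ⟨e, he, ?_⟩
  convert add_mem hb he' using 1
  change _ = b - El t + _
  abel

/-- The top part of an element of the filtration. -/
theorem exists_top_part {N k : ℕ} {b : C.full.Alg} (hb : b ∈ C.fil h N (k + 1)) (hk : k ≤ N) :
    ∃ t : (C.ofSum h).part ((N - k : ℕ) : ℂ) ⊗[ℂ] tailPart C.tailDeg k,
      b - C.winSplit h (TensorProduct.map ((C.ofSum h).part ((N - k : ℕ) : ℂ)).subtype
        (tailPart C.tailDeg k).subtype t) ∈ C.fil h N k := by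
  induction hb using Submodule.span_induction with
  | mem z hz =>
    obtain ⟨i, hi, j, hN, r, hr, τ, hτ, rfl⟩ := hz
    rcases (Nat.lt_succ_iff.1 hi).lt_or_eq with h1 | rfl
    · exact ⟨0, by rw [map_zero, map_zero, sub_zero]; exact Submodule.subset_span ⟨i, h1, j, hN, r, hr, τ, hτ, rfl⟩⟩
    · obtain rfl : j = N - i := by omega
      refine ⟨⟨r, hr⟩ ⊗ₜ ⟨τ, hτ⟩, ?_⟩
      rw [TensorProduct.map_tmul, winSplit_tmul]
      simp
  | zero => exact ⟨0, by simp⟩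
  | add x y _ _ hx hy =>
    obtain ⟨t, ht⟩ := hx
    obtain ⟨t', ht'⟩ := hy
    refine ⟨t + t', ?_⟩
    convert add_mem ht ht' using 1
    simp only [map_add]
    abel
  | smul c x _ hx =>
    obtain ⟨t, ht⟩ := hx
    exact ⟨c • t, by rw [map_smul, map_smul, ← smul_sub]; exact Submodule.smul_mem _ c ht⟩

variable (C h ψ)

/-- Leading terms of tail degree `k ≥ 1` have window weight `N - k < N`, so acyclicity in lower
weights removes them successively without changing the differential. -/
theorem exists_mem_fil_one {N : ℕ} (hlow : ∀ j < N, C.AcyclicAt h ψ j) {z : C.full.Alg}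
    (hz : z ∈ C.fil h N 1) (k : ℕ) (hk : k ≤ N) : ∀ b ∈ C.fil h N (k + 1), C.full.spec ψ b = 0 →
      C.full.diff.d b = z → ∃ b' ∈ C.fil h N 1, C.full.spec ψ b' = 0 ∧ C.full.diff.d b' = z := by
  induction k with
  | zero => exact fun b hb hf hd => ⟨b, hb, hf, hd⟩
  | succ k ih =>
    intro b hb hf hd
    obtain ⟨t, ht⟩ := exists_top_part hb hk
    have hN : k + 1 + (N - (k + 1)) = N := by omega
    obtain ⟨e, he, he'⟩ := (hlow (N - (k + 1)) (by omega)).exists_lower (b := b) (t := t)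
      (by rw [hN]; exact ht) (by rw [hN, hd]; exact C.fil_mono h (by omega) hz) hf
    rw [hN] at he'
    exact ih (by omega) _ he' (by rw [map_sub, hf, Window.spec_diff, he, map_zero, sub_zero])
      (by rw [map_sub, C.full.diff_isComplex.d_d, sub_zero, hd])

theorem winMap_mem_part {μ : ℂ} {r : (C.ofSum h).Alg} (hr : r ∈ (C.ofSum h).part μ) :
    C.winMap h r ∈ C.full.part μ := by
  rw [Window.mem_part] at *
  refine (weight_mapGen _ _ _ _ r).trans (Eq.trans (congrArg _ ?_) (map_smul (C.winMap h) μ r))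
  rw [← hr, Window.wt]
  congr 2
  ext z
  rcases z with (z | z) | z <;> rfl

variable (D : Derivation ℂ A A) (hD : ∀ x, D (ψ.val x) = ψ.val x)

include hD

/-- Strong induction on the weight. The full complex provides a primitive, which can be taken
homogeneous and then of tail degree zero. It then comes from the window, and injectivity of the
inclusions carries both equations back. -/
theorem acyclicAt (hfull : ∀ z : C.full.Alg, C.full.spec ψ z = 0 → C.full.diff.d z = 0 →
      ∃ y, C.full.spec ψ y = 0 ∧ C.full.diff.d y = z) (N : ℕ) : C.AcyclicAt h ψ N := by
  induction N using Nat.strong_induction_on with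
  | _ N ih =>
  intro z hz hfz hdz
  have hz1 : C.winMap h z ∈ C.full.part (N : ℂ) := C.winMap_mem_part h hz
  obtain ⟨y, hy, hdy⟩ := hfull (C.winMap h z) (by rw [full_spec_winMap, hfz, map_zero])
    (by rw [← winMap_diff, hdz, map_zero])
  obtain ⟨y, hyN, hy, hdy⟩ := C.full.exists_mem_part ψ D hD hz1 hy hdy
  obtain ⟨b, hb, hfb, hdb⟩ := C.exists_mem_fil_one h ψ ih (C.winMap_mem_fil h one_pos hz) N le_rfl y
    (C.full_part_le_fil h N hyN) hy hdy
  obtain ⟨r, hr, rfl⟩ := C.exists_of_mem_fil_one h hb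
  refine ⟨r, hr, C.specMap_injective h ?_, C.winMap_injective h ?_⟩
  · rw [← full_spec_winMap, hfb, map_zero]
  · rw [winMap_diff, hdb]

/-- The kernel of the specialisation of a window is acyclic if that of the full window is. -/
theorem spec_acyclic (hfull : ∀ z : C.full.Alg, C.full.spec ψ z = 0 → C.full.diff.d z = 0 →
      ∃ y, C.full.spec ψ y = 0 ∧ C.full.diff.d y = z) {z : (C.ofSum h).Alg}
    (hz : (C.ofSum h).spec ψ z = 0) (hdz : (C.ofSum h).diff.d z = 0) :
    ∃ y, (C.ofSum h).spec ψ y = 0 ∧ (C.ofSum h).diff.d y = z := by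
  have h1 := ((C.ofSum h).wt_isDiagonal 0 1).le_iSup_inf
    (J := LinearMap.ker (C.ofSum h).diff.d ⊓ LinearMap.ker ((C.ofSum h).spec ψ).toLinearMap)
    (fun x hx => by
      have hx1 : (C.ofSum h).diff.d x = 0 := hx.1
      have hx2 : (C.ofSum h).spec ψ x = 0 := hx.2
      refine ⟨?_, ?_⟩
      · have := (C.ofSum h).wt_diff 0 1 x
        rw [hx1, map_zero, smul_zero, add_zero] at this
        exact this.symm
      · have := (C.ofSum h).spec_wt_zero_one ψ D hD x
        rw [hx2, map_zero] at this
        exact this) ⟨hdz, hz⟩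
  refine Submodule.iSup_induction _ (motive := fun z =>
    ∃ y, (C.ofSum h).spec ψ y = 0 ∧ (C.ofSum h).diff.d y = z) h1 ?_ ⟨0, by simp, by simp⟩ ?_
  · rintro μ x ⟨⟨hx1, hx2⟩, hμ⟩
    -- Only natural numbers occur as weights; for any other eigenvalue the component is zero.
    by_cases hj : ∃ j : ℕ, (j : ℂ) = μ
    · obtain ⟨j, rfl⟩ := hj
      obtain ⟨y, -, hy⟩ := C.acyclicAt h ψ D hD hfull j x hμ hx2 hx1
      exact ⟨y, hy⟩
    · have h2 : x ∈ (C.ofSum h).part μ := hμ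
      rw [(C.ofSum h).part_eq_bot (fun j hj' => hj ⟨j, hj'⟩)] at h2
      exact ⟨0, by simp, by rw [map_zero, (Submodule.mem_bot ℂ).1 h2]⟩
  · rintro x x' ⟨y, hy, rfl⟩ ⟨y', hy', rfl⟩
    exact ⟨y + y', by rw [map_add, hy, hy', add_zero], by rw [map_add]⟩

end Descent

end LieConstants


open Module

/-! ## Structure constants of a graded Lie superalgebra -/

namespace GradedLieSuperalgebra

variable {L : Type*} [AddCommGroup L] [Module ℂ L] (G : GradedLieSuperalgebra L)

/-- A basis of homogeneous elements. -/
structure HomogeneousBasis (X : Type*) where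
  basis : Basis X ℂ L
  deg : X → ℕ
  mem : ∀ x, basis x ∈ G.deg (deg x)

theorem iSupIndep_deg : iSupIndep G.deg :=
  ((DirectSum.isInternal_submodule_iff_iSupIndep_and_iSup_eq_top _).1 G.isInternal).1

theorem iSup_deg : ⨆ m, G.deg m = ⊤ :=
  ((DirectSum.isInternal_submodule_iff_iSupIndep_and_iSup_eq_top _).1 G.isInternal).2

/-- The standard homogeneous basis. -/
noncomputable def homogeneousBasis : G.HomogeneousBasis G.Index where
  basis := G.basis
  deg := Sigma.fst
  mem x := by
    have := G.finite
    exact DirectSum.IsInternal.collectedBasis_mem _ _ x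

namespace HomogeneousBasis

variable {G} {X : Type*} (b : G.HomogeneousBasis X)

/-- Split the expansion of `y` into its terms of degree `m` and the rest. The rest lies in degree
`m` and also in the sum of the other degrees, hence vanishes. -/
theorem repr_of_ne {m : ℕ} {y : L} (hy : y ∈ G.deg m) {u : X} (hu : b.deg u ≠ m) :
    b.basis.repr y u = 0 := by
  classical
  have hsum := Finsupp.filter_add_filter_not (b.basis.repr y) (fun u => b.deg u = m)
  set f₁ := (b.basis.repr y).filter fun u => b.deg u = m with hf₁
  set f₂ := (b.basis.repr y).filter fun u => ¬ b.deg u = m with hf₂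
  have h1 : Finsupp.linearCombination ℂ b.basis f₁ ∈ G.deg m := by
    rw [Finsupp.linearCombination_apply]
    refine Submodule.sum_mem _ fun v hv => Submodule.smul_mem _ _ ?_
    have : b.deg v = m := by
      by_contra h
      rw [Finsupp.mem_support_iff, hf₁, Finsupp.filter_apply, if_neg h] at hv
      exact hv rfl
    exact this ▸ b.mem v
  have h2 : Finsupp.linearCombination ℂ b.basis f₂ ∈ ⨆ j, ⨆ _ : j ≠ m, G.deg j := by
    rw [Finsupp.linearCombination_apply]
    refine Submodule.sum_mem _ fun v hv => Submodule.smul_mem _ _ ?_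
    have : b.deg v ≠ m := by
      intro h
      rw [Finsupp.mem_support_iff, hf₂, Finsupp.filter_apply, if_neg (not_not.2 h)] at hv
      exact hv rfl
    exact Submodule.mem_iSup_of_mem _ (Submodule.mem_iSup_of_mem this (b.mem v))
  have h3 : Finsupp.linearCombination ℂ b.basis f₁ + Finsupp.linearCombination ℂ b.basis f₂ = y := by
    rw [← map_add, hsum, b.basis.linearCombination_repr]
  have h4 : Finsupp.linearCombination ℂ b.basis f₂ ∈ G.deg m := by
    rw [← add_sub_cancel_left (Finsupp.linearCombination ℂ b.basis f₁)
      (Finsupp.linearCombination ℂ b.basis f₂), h3]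
    exact Submodule.sub_mem _ hy h1
  have h5 := (G.iSupIndep_deg m).le_bot ⟨h4, h2⟩
  have h6 : f₂ = 0 := b.basis.linearIndependent
    (((Submodule.mem_bot ℂ).1 h5).trans (map_zero _).symm)
  have h7 := DFunLike.congr_fun h6 u
  rw [hf₂, Finsupp.filter_apply, if_pos hu] at h7
  exact h7

theorem deg_pos (x : X) : 0 < b.deg x := by
  refine Nat.pos_of_ne_zero fun h => b.basis.ne_zero x ?_
  have := b.mem x
  rwa [h, G.deg_zero, Submodule.mem_bot] at this

theorem finite_deg_eq (m : ℕ) : {x | b.deg x = m}.Finite := by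
  have := G.finite m
  let v : {x // b.deg x = m} → G.deg m := fun x => ⟨b.basis x, (congrArg G.deg x.2).le (b.mem x)⟩
  have hv : LinearIndependent ℂ v := by
    refine LinearIndependent.of_comp (G.deg m).subtype ?_
    exact b.basis.linearIndependent.comp _ Subtype.val_injective
  exact hv.finite

theorem finite_deg_le (N : ℕ) : {x | b.deg x ≤ N}.Finite := by
  have : {x | b.deg x ≤ N} = ⋃ m ∈ Finset.range (N + 1), {x | b.deg x = m} := by
    ext x
    simp
  rw [this]
  exact Set.Finite.biUnion (Finset.finite_toSet _) fun m _ => b.finite_deg_eq m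

theorem mem_span_of_mem_deg {m : ℕ} {y : L} (hy : y ∈ G.deg m) :
    y ∈ Submodule.span ℂ (b.basis '' {x | b.deg x = m}) := by
  rw [← b.basis.linearCombination_repr y, Finsupp.linearCombination_apply]
  refine Submodule.sum_mem _ fun v hv => Submodule.smul_mem _ _ (Submodule.subset_span ⟨v, ?_, rfl⟩)
  by_contra h
  exact Finsupp.mem_support_iff.1 hv (b.repr_of_ne hy h)

theorem sum_repr_eq {m : ℕ} {y : L} (hy : y ∈ G.deg m) {M : Type*} [AddCommGroup M] [Module ℂ M]
    (f : L →ₗ[ℂ] M) {s : Finset X} (hs : ∀ x, b.deg x = m → x ∈ s) :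
    ∑ u ∈ s, b.basis.repr y u • f (b.basis u) = f y := by
  conv_rhs => rw [← b.basis.linearCombination_repr y, Finsupp.linearCombination_apply, Finsupp.sum,
    map_sum]
  simp only [map_smul]
  symm
  refine Finset.sum_subset (fun v hv => hs v ?_) fun v _ hv => ?_
  · by_contra h
    exact Finsupp.mem_support_iff.1 hv (b.repr_of_ne hy h)
  · rw [Finsupp.notMem_support_iff.1 hv, zero_smul]

theorem _root_.GradedLieSuperalgebra.jacobi' {i j k : ℕ} {x y z : L} (hx : x ∈ G.deg i)
    (hy : y ∈ G.deg j) (hz : z ∈ G.deg k) :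
    G.bracket (G.bracket x y) z + (-1 : ℂ) ^ (i * (j + k)) • G.bracket (G.bracket y z) x +
      (-1 : ℂ) ^ (k * (i + j)) • G.bracket (G.bracket z x) y = 0 := by
  rw [G.skew (G.bracket_mem hx hy) hz, G.skew (G.bracket_mem hy hz) hx,
    G.skew (G.bracket_mem hz hx) hy]
  have h := congrArg (fun v => (-(-1 : ℂ) ^ (i * k)) • v) (G.jacobi hx hy hz)
  rw [smul_zero] at h
  refine Eq.trans ?_ h
  simp only [smul_add, smul_neg, smul_smul]
  rcases Nat.even_or_odd i with hi | hi <;> rcases Nat.even_or_odd j with hj | hj <;>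
  rcases Nat.even_or_odd k with hk | hk <;>
  simp [pow_add, pow_mul, hi.neg_one_pow, hj.neg_one_pow, hk.neg_one_pow] <;> abel

/-- The structure constants. -/
noncomputable def constants : LieConstants X where
  deg := b.deg
  pos := b.deg_pos
  ball N := (b.finite_deg_le N).toFinset
  mem_ball := by simp
  c s t u := b.basis.repr (G.bracket (b.basis s) (b.basis t)) u
  c_deg {s t u} h := by
    by_contra hne
    exact h (b.repr_of_ne (G.bracket_mem (b.mem s) (b.mem t)) (Ne.symm hne))
  skew s t u := by
    rw [G.skew (b.mem t) (b.mem s), map_neg, map_smul, mul_comm (b.deg s)]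
    simp
  jacobi p q t u := by
    have key : ∀ p q t, b.deg p + b.deg q ≤ b.deg u → ∑ v ∈ (b.finite_deg_le (b.deg u)).toFinset,
        b.basis.repr (G.bracket (b.basis p) (b.basis q)) v *
          b.basis.repr (G.bracket (b.basis v) (b.basis t)) u =
        b.basis.repr (G.bracket (G.bracket (b.basis p) (b.basis q)) (b.basis t)) u := by
      intro p q t hpq
      exact b.sum_repr_eq (G.bracket_mem (b.mem p) (b.mem q))
        (Finsupp.lapply u ∘ₗ b.basis.repr.toLinearMap ∘ₗ G.bracket.flip (b.basis t))
        (by simp; intro x hx; omega)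
    -- Cutting the sum off at degree `|u|` is harmless: if `|p| + |q|` exceeds `|u|`, both sides
    -- vanish for degree reasons.
    have key' : ∀ p q t, ∑ v ∈ (b.finite_deg_le (b.deg u)).toFinset,
        b.basis.repr (G.bracket (b.basis p) (b.basis q)) v *
          b.basis.repr (G.bracket (b.basis v) (b.basis t)) u =
        b.basis.repr (G.bracket (G.bracket (b.basis p) (b.basis q)) (b.basis t)) u := by
      intro p q t
      by_cases h : b.deg p + b.deg q ≤ b.deg u
      · exact key p q t h
      · rw [b.repr_of_ne (G.bracket_mem (G.bracket_mem (b.mem p) (b.mem q)) (b.mem t)) (by omega)]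
        refine Finset.sum_eq_zero fun v hv => ?_
        rw [Set.Finite.mem_toFinset] at hv
        have hv : b.deg v ≤ b.deg u := hv
        rw [b.repr_of_ne (G.bracket_mem (b.mem p) (b.mem q)) (by omega), zero_mul]
    simp only [Finset.sum_add_distrib, ← Finset.mul_sum, key']
    have := congrArg (fun y => b.basis.repr y u) (G.jacobi' (b.mem p) (b.mem q) (b.mem t))
    simpa using this

theorem constants_isRep_iff {R : Type*} [Ring R] [Algebra ℂ R] (f : L →ₗ[ℂ] R) :
    b.constants.IsRep (fun u => f (b.basis u)) ↔ ∀ s t, f (b.basis s) * f (b.basis t) -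
      ((-1) ^ (b.deg s * b.deg t) : ℂ) • (f (b.basis t) * f (b.basis s)) =
        f (G.bracket (b.basis s) (b.basis t)) := by
  refine forall_congr' fun s => forall_congr' fun t => ?_
  have : ∑ u ∈ b.constants.ball (b.deg s + b.deg t),
      b.basis.repr (G.bracket (b.basis s) (b.basis t)) u • f (b.basis u) = _ :=
    b.sum_repr_eq (G.bracket_mem (b.mem s) (b.mem t)) f
      (fun x hx => b.constants.mem_ball.2 hx.le)
  rw [← this]
  rfl

theorem _root_.GradedLieSuperalgebra.envι_comm {i j : ℕ} {x y : L} (hx : x ∈ G.deg i)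
    (hy : y ∈ G.deg j) : G.envι x * G.envι y - ((-1) ^ (i * j) : ℂ) • (G.envι y * G.envι x) =
      G.envι (G.bracket x y) := by
  have h := RingQuot.mkAlgHom_rel ℂ (EnvRel.rel (G := G) hx hy)
  rw [map_sub, map_smul, map_mul, map_mul] at h
  exact h

theorem isRep_env : b.constants.IsRep (fun u => G.envι (b.basis u)) :=
  (b.constants_isRep_iff G.envι).2 fun s t => G.envι_comm (b.mem s) (b.mem t)

theorem _root_.LieConstants.IsRep.map {R R' : Type*} [Ring R] [Algebra ℂ R] [Ring R']
    [Algebra ℂ R'] {C : LieConstants X} {ρ : X → R} (hρ : C.IsRep ρ) (f : R →ₐ[ℂ] R') :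
    C.IsRep fun u => f (ρ u) := by
  intro s t
  have := congrArg f (hρ s t)
  simpa using this

/-- The algebra map from the enveloping algebra given by a representation. -/
theorem exists_env_lift {R : Type*} [Ring R] [Algebra ℂ R] {ρ : X → R}
    (hρ : b.constants.IsRep ρ) : ∃ f : G.Env →ₐ[ℂ] R, ∀ u, f (G.envι (b.basis u)) = ρ u := by
  let g : L →ₗ[ℂ] R := b.basis.constr ℂ ρ
  have hg : ∀ u, g (b.basis u) = ρ u := fun u => b.basis.constr_basis ℂ ρ u
  have h1 := (b.constants_isRep_iff g).1 (by simpa only [hg] using hρ)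
  have h2 : ∀ {i j : ℕ} {x y : L}, x ∈ G.deg i → y ∈ G.deg j →
      g x * g y - ((-1) ^ (i * j) : ℂ) • (g y * g x) = g (G.bracket x y) := by
    intro i j x y hx hy
    have hx' := b.mem_span_of_mem_deg hx
    have hy' := b.mem_span_of_mem_deg hy
    clear hx hy
    induction hx' using Submodule.span_induction with
    | zero => simp
    | add x x' _ _ ih ih' =>
      simp only [map_add, LinearMap.add_apply, ← ih, ← ih', add_mul, mul_add, smul_add]
      abel
    | smul c x _ ih =>
      simp only [map_smul, LinearMap.smul_apply, ← ih, smul_mul_assoc, mul_smul_comm, smul_sub,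
        smul_comm c]
    | mem x hx =>
      obtain ⟨s, rfl, rfl⟩ := hx
      induction hy' using Submodule.span_induction with
      | zero => simp
      | add y y' _ _ ih ih' =>
        simp only [map_add, ← ih, ← ih', add_mul, mul_add, smul_add]
        abel
      | smul c y _ ih =>
        simp only [map_smul, ← ih, smul_mul_assoc, mul_smul_comm, smul_sub, smul_comm c]
      | mem y hy =>
        obtain ⟨t, rfl, rfl⟩ := hy
        exact h1 s t
  refine ⟨RingQuot.liftAlgHom ℂ ⟨TensorAlgebra.lift ℂ g, ?_⟩, fun u => ?_⟩
  · rintro _ _ ⟨hx, hy⟩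
    rw [map_sub, map_smul, map_mul, map_mul, TensorAlgebra.lift_ι_apply, TensorAlgebra.lift_ι_apply,
      TensorAlgebra.lift_ι_apply]
    exact h2 hx hy
  · refine (RingQuot.liftAlgHom_mkAlgHom_apply ℂ _ _ _).trans ?_
    rw [TensorAlgebra.lift_ι_apply, hg]

end HomogeneousBasis

end GradedLieSuperalgebra


/-! ### The Koszul dual as an enveloping algebra, and the degree-one component of `L` -/

open Module

namespace QuadraticComm

variable {n m : ℕ} {Γ : Fin m → Matrix (Fin n) (Fin n) ℂ}

variable (Γ) in
/-- The quotient map onto the Koszul dual algebra. -/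
noncomputable def dualMk : FreeAlgebra ℂ (Fin n) →ₐ[ℂ] KoszulDual Γ := RingQuot.mkAlgHom ℂ (DualRel Γ)

theorem dualMk_ι (i : Fin n) : dualMk Γ (FreeAlgebra.ι ℂ i) = dualGen Γ i := rfl

theorem mem_dualRel_iff {c : Fin n → Fin n → ℂ} : c ∈ (grading Γ).dualRel ↔ c ∈ dualRelations Γ :=
  ⟨fun h q hq => h q ((grading Γ).mem_rel.2 hq), fun h q hq => h q ((grading Γ).mem_rel.1 hq)⟩

/-- The universal property of the Koszul dual algebra. -/
theorem exists_dual_lift {R : Type*} [Ring R] [Algebra ℂ R] (Y : Fin n → R)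
    (hY : ∀ c ∈ dualRelations Γ, ∑ i, ∑ k, c i k • (Y i * Y k) = 0) :
    ∃ f : KoszulDual Γ →ₐ[ℂ] R, ∀ q, f (dualMk Γ q) = FreeAlgebra.lift ℂ Y q := by
  refine ⟨RingQuot.liftAlgHom ℂ ⟨FreeAlgebra.lift ℂ Y, ?_⟩,
    fun q => RingQuot.liftAlgHom_mkAlgHom_apply ℂ _ _ _⟩
  rintro _ _ ⟨c, hc⟩
  simpa using hY c hc

theorem dual_rel {c : Fin n → Fin n → ℂ} (hc : c ∈ dualRelations Γ) :
    ∑ i, ∑ k, c i k • (dualGen Γ i * dualGen Γ k) = 0 := by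
  have h := RingQuot.mkAlgHom_rel ℂ (DualRel.rel (Γ := Γ) c hc)
  rw [map_zero] at h
  refine Eq.trans ?_ h
  simp only [map_sum, map_smul, map_mul]
  rfl

theorem exists_of_mem_dualDeg {j : ℕ} {x : KoszulDual Γ} (hx : x ∈ dualDeg Γ j) :
    ∃ q ∈ Submodule.span ℂ (Set.range (FreeAlgebra.ι ℂ (X := Fin n))) ^ j, dualMk Γ q = x := by
  have : dualDeg Γ j = (Submodule.span ℂ (Set.range (FreeAlgebra.ι ℂ (X := Fin n))) ^ j).map
      (dualMk Γ).toLinearMap := by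
    rw [Submodule.map_pow, Submodule.map_span, ← Set.range_comp]
    rfl
  rw [this] at hx
  exact hx

variable {L : Type*} [AddCommGroup L] [Module ℂ L] {G : GradedLieSuperalgebra L}
  (e : G.Env ≃ₐ[ℂ] KoszulDual Γ) (he : ∀ j, ∀ x ∈ G.deg j, e (G.envι x) ∈ dualDeg Γ j)

include he in
/-- A homogeneous basis which extends the dual generators gives a presentation. -/
theorem exists_presentation {X : Type} (b : G.HomogeneousBasis X) (B : Fin n → X)
    (hB : ∀ i, e (G.envι (b.basis (B i))) = dualGen Γ i) (hdeg : ∀ i, b.deg (B i) = 1)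
    (hinj : Function.Injective B) (hsurj : ∀ u, b.deg u = 1 → ∃ i, B i = u) :
    ∃ Q : b.constants.Presentation (grading Γ), Q.B = B := by
  have h1 : ∀ u, ∃ q ∈ Submodule.span ℂ (Set.range (FreeAlgebra.ι ℂ (X := Fin n))) ^ b.deg u,
      dualMk Γ q = e (G.envι (b.basis u)) ∧ ∀ i, B i = u → q = FreeAlgebra.ι ℂ i := by
    intro u
    by_cases hu : ∃ i, B i = u
    · obtain ⟨i, rfl⟩ := hu
      refine ⟨FreeAlgebra.ι ℂ i, ?_, (hB i).symm, fun k hk => by rw [hinj hk]⟩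
      rw [hdeg, Submodule.pow_one]
      exact Submodule.subset_span ⟨i, rfl⟩
    · obtain ⟨q, hq, hq'⟩ := exists_of_mem_dualDeg (he _ _ (b.mem u))
      exact ⟨q, hq, hq', fun i hi => absurd ⟨i, hi⟩ hu⟩
  choose p hp hpe hpB using h1
  have h2 : ∀ {R : Type} [Ring R] [Algebra ℂ R] (ρ : X → R), b.constants.IsRep ρ →
      ∃ f : KoszulDual Γ →ₐ[ℂ] R, ∀ u, f (e (G.envι (b.basis u))) = ρ u := by
    intro R _ _ ρ hρ
    obtain ⟨f, hf⟩ := b.exists_env_lift hρ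
    exact ⟨f.comp e.symm.toAlgHom, fun u => by simpa using hf u⟩
  refine ⟨⟨B, hdeg, hinj, hsurj, p, hp, fun i => hpB _ i rfl, ?_, ?_, ?_⟩, rfl⟩
  · intro R _ _ ρ hρ u
    obtain ⟨f, hf⟩ := h2 ρ hρ
    have h3 : FreeAlgebra.lift ℂ (fun i => ρ (B i)) = f.comp (dualMk Γ) := by
      ext i
      simp [dualMk_ι, ← hB, hf]
    rw [h3, AlgHom.comp_apply, hpe, hf]
  · intro R _ _ Y hY
    obtain ⟨f, hf⟩ := exists_dual_lift (Γ := Γ) Y fun c hc => hY c (mem_dualRel_iff.2 hc)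
    have h3 := b.isRep_env.map (f.comp e.toAlgHom)
    convert h3 using 1
    ext u
    rw [← hf, hpe]
    rfl
  · intro R _ _ ρ hρ c hc
    obtain ⟨f, hf⟩ := h2 ρ hρ
    have h3 := congrArg f (dual_rel (mem_dualRel_iff.1 hc))
    simpa [← hB, hf] using h3

/-! ### The components of degree one and two -/

/-- Homomorphisms from the enveloping algebra which are trivial on brackets. -/
theorem _root_.GradedLieSuperalgebra.HomogeneousBasis.exists_env_trivSqZero {X : Type*}
    (b : G.HomogeneousBasis X) {M : Type*} [AddCommGroup M] [Module ℂ M] [Module ℂᵐᵒᵖ M]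
    [IsCentralScalar ℂ M] (f : L →ₗ[ℂ] M)
    (hf : ∀ s t, f (G.bracket (b.basis s) (b.basis t)) = 0) :
    ∃ φ : G.Env →ₐ[ℂ] TrivSqZeroExt ℂ M, ∀ y, φ (G.envι y) = TrivSqZeroExt.inr (f y) := by
  have h1 : b.constants.IsRep fun u => TrivSqZeroExt.inrHom ℂ M (f (b.basis u)) := by
    refine (b.constants_isRep_iff (TrivSqZeroExt.inrHom ℂ M ∘ₗ f)).2 fun s t => ?_
    simp [TrivSqZeroExt.inr_mul_inr, hf]
  obtain ⟨φ, hφ⟩ := b.exists_env_lift h1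
  refine ⟨φ, fun y => ?_⟩
  have : φ.toLinearMap ∘ₗ G.envι = TrivSqZeroExt.inrHom ℂ M ∘ₗ f := b.basis.ext hφ
  exact LinearMap.congr_fun this y

/-- Generators go to an ideal of square zero, so products of two or more of them vanish. -/
theorem dualDeg_le_ker {M : Type*} [AddCommGroup M] [Module ℂ M] [Module ℂᵐᵒᵖ M]
    [IsCentralScalar ℂ M] (φ : KoszulDual Γ →ₐ[ℂ] TrivSqZeroExt ℂ M)
    (hφ : ∀ i, (φ (dualGen Γ i)).fst = 0) {j : ℕ} (hj : 2 ≤ j) {x : KoszulDual Γ}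
    (hx : x ∈ dualDeg Γ j) : φ x = 0 := by
  have h1 : ∀ x ∈ Submodule.span ℂ (Set.range (dualGen Γ)), (φ x).fst = 0 := by
    intro x hx
    induction hx using Submodule.span_induction with
    | zero => simp
    | add x y _ _ hx hy => simp [hx, hy]
    | smul c x _ hx => simp [hx]
    | mem x hx => obtain ⟨i, rfl⟩ := hx; exact hφ i
  obtain ⟨j, rfl⟩ := Nat.exists_eq_add_of_le' hj
  rw [dualDeg, Submodule.pow_succ, Submodule.pow_succ, mul_assoc] at hx
  refine Submodule.mul_induction_on hx (fun a _ b hb => ?_) fun a b ha hb => by simp [ha, hb]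
  suffices φ b = 0 by simp [this]
  refine Submodule.mul_induction_on hb (fun a ha b hb => ?_) fun a b ha hb => by simp [ha, hb]
  rw [map_mul]
  ext <;> simp [h1 a ha, h1 b hb]

variable (Γ) in
theorem exists_dual_trivSqZero : ∃ φ : KoszulDual Γ →ₐ[ℂ] TrivSqZeroExt ℂ (Fin n → ℂ),
    ∀ i, φ (dualGen Γ i) = TrivSqZeroExt.inr (Pi.single i 1) := by
  obtain ⟨φ, hφ⟩ := exists_dual_lift (Γ := Γ)
    (fun i => (TrivSqZeroExt.inr (Pi.single i 1) : TrivSqZeroExt ℂ (Fin n → ℂ)))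
    (fun c _ => by simp [TrivSqZeroExt.inr_mul_inr])
  exact ⟨φ, fun i => by simpa [dualMk_ι] using hφ (FreeAlgebra.ι ℂ i)⟩

/-- The relations of `A^!` are quadratic, so a square-zero extension detects its linear part. -/
theorem linearIndependent_dualGen : LinearIndependent ℂ (dualGen Γ) := by
  obtain ⟨φ, hφ⟩ := exists_dual_trivSqZero Γ
  refine LinearIndependent.of_comp ((TrivSqZeroExt.sndHom ℂ (Fin n → ℂ)) ∘ₗ φ.toLinearMap) ?_
  convert (Pi.basisFun ℂ (Fin n)).linearIndependent using 1
  ext i : 1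
  simp [hφ]

theorem _root_.GradedLieSuperalgebra.env_induction (G : GradedLieSuperalgebra L) {P : G.Env → Prop}
    (hR : ∀ r : ℂ, P (algebraMap ℂ _ r)) (hι : ∀ j, ∀ x ∈ G.deg j, P (G.envι x))
    (hmul : ∀ a b, P a → P b → P (a * b)) (hadd : ∀ a b, P a → P b → P (a + b)) (s : G.Env) :
    P s := by
  obtain ⟨t, ht⟩ := RingQuot.mkAlgHom_surjective ℂ G.EnvRel s
  obtain rfl : (RingQuot.mkAlgHom ℂ G.EnvRel t : G.Env) = s := ht
  induction t using TensorAlgebra.induction with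
  | algebraMap r => rw [AlgHom.commutes]; exact hR r
  | ι x =>
    have hx : x ∈ ⨆ m, G.deg m := G.iSup_deg ▸ Submodule.mem_top
    change P (G.envι x)
    induction hx using Submodule.iSup_induction' with
    | mem j x hx => exact hι j x hx
    | zero => simpa using hR 0
    | add x y _ _ hx hy => rw [map_add]; exact hadd _ _ hx hy
  | mul a b ha hb => rw [map_mul]; exact hmul _ _ ha hb
  | add a b ha hb => rw [map_add]; exact hadd _ _ ha hb

include he in
/-- The dual generators come from elements of degree one. -/
theorem exists_lie_generator (i : Fin n) : ∃ x ∈ G.deg 1, e (G.envι x) = dualGen Γ i := by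
  obtain ⟨φ, hφ⟩ := exists_dual_trivSqZero Γ
  let g : L →ₗ[ℂ] (Fin n → ℂ) :=
    TrivSqZeroExt.sndHom ℂ (Fin n → ℂ) ∘ₗ φ.toLinearMap ∘ₗ e.toLinearMap ∘ₗ G.envι
  -- The linear part of an element of `U(L)` comes from `L₁` alone: `L₀` is zero, and `L_j` for `j ≥
  -- 2` lands in the degree `j` part of `A^!`, on which `φ` vanishes.
  have h1 : ∀ s, (φ (e s)).snd ∈ (G.deg 1).map g := by
    intro s
    induction s using G.env_induction with
    | hR r =>
      rw [AlgEquiv.commutes, AlgHom.commutes, TrivSqZeroExt.algebraMap_eq_inl, TrivSqZeroExt.snd_inl]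
      exact Submodule.zero_mem _
    | hι j x hx =>
      obtain hj | rfl | hj : j = 0 ∨ j = 1 ∨ 2 ≤ j := by omega
      · rw [hj, G.deg_zero, Submodule.mem_bot] at hx
        simp [hx]
      · exact ⟨x, hx, rfl⟩
      · rw [dualDeg_le_ker φ (fun i => by simp [hφ]) hj (he _ _ hx)]
        simp
    | hmul a b ha hb =>
      simp only [map_mul, TrivSqZeroExt.snd_mul, op_smul_eq_smul]
      exact Submodule.add_mem _ (Submodule.smul_mem _ _ hb) (Submodule.smul_mem _ _ ha)
    | hadd a b ha hb =>
      simp only [map_add, TrivSqZeroExt.snd_add]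
      exact Submodule.add_mem _ ha hb
  obtain ⟨x, hx, hgx⟩ := h1 (e.symm (dualGen Γ i))
  refine ⟨x, hx, ?_⟩
  have h2 := he _ _ hx
  rw [dualDeg, Submodule.pow_one, Submodule.mem_span_range_iff_exists_fun] at h2
  obtain ⟨c, hc⟩ := h2
  have h3 : c = Pi.single i 1 := by
    have : g x = c := by
      change (φ (e (G.envι x))).snd = c
      rw [← hc, ← TrivSqZeroExt.sndHom_apply (R := ℂ), map_sum, map_sum]
      ext k
      simp [hφ, Pi.single_apply]
    rw [← this, hgx, AlgEquiv.apply_symm_apply, hφ, TrivSqZeroExt.snd_inr]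
  rw [← hc, h3]
  simp [Pi.single_apply]

theorem _root_.GradedLieSuperalgebra.HomogeneousBasis.exists_component {X : Type*}
    (b : G.HomogeneousBasis X) (k : ℕ) : ∃ f : L →ₗ[ℂ] L, (∀ y ∈ G.deg k, f y = y) ∧
      ∀ j ≠ k, ∀ y ∈ G.deg j, f y = 0 := by
  classical
  let f := b.basis.constr ℂ fun u => if b.deg u = k then b.basis u else 0
  have h1 : ∀ j, ∀ y ∈ G.deg j, f y = if j = k then y else 0 := by
    intro j y hy
    have hy' := b.mem_span_of_mem_deg hy
    clear hy
    induction hy' using Submodule.span_induction with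
    | zero => simp
    | add x y _ _ hx hy => rw [map_add, hx, hy]; split_ifs <;> simp
    | smul c x _ hx => rw [map_smul, hx]; split_ifs <;> simp
    | mem x hx =>
      obtain ⟨s, rfl, rfl⟩ := hx
      exact b.basis.constr_basis ℂ _ s
  exact ⟨f, fun y hy => by simp [h1 k y hy], fun j hj y hy => by simp [h1 j y hy, hj]⟩

theorem _root_.GradedLieSuperalgebra.bracket_eq_zero {i j : ℕ} (hij : i + j < 2) {x y : L}
    (hx : x ∈ G.deg i) (hy : y ∈ G.deg j) : G.bracket x y = 0 := by
  obtain rfl | rfl : i = 0 ∨ j = 0 := by omega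
  · rw [G.deg_zero, Submodule.mem_bot] at hx
    simp [hx]
  · rw [G.deg_zero, Submodule.mem_bot] at hy
    simp [hy]

/-- This replaces Poincaré–Birkhoff–Witt in degree one: brackets that can be non-zero have degree at
least two, so a functional supported on `L₁` extends to a homomorphism from `U(L)` to a square-zero
extension of `ℂ`. -/
theorem _root_.GradedLieSuperalgebra.envι_injOn_deg_one {y : L} (hy : y ∈ G.deg 1)
    (h : G.envι y = 0) : y = 0 := by
  let b := G.homogeneousBasis
  obtain ⟨f, hf, hf'⟩ := b.exists_component 1
  refine b.basis.ext_elem fun u => ?_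
  obtain ⟨φ, hφ⟩ := b.exists_env_trivSqZero (b.basis.coord u ∘ₗ f) fun s t => by
    rw [LinearMap.comp_apply]
    by_cases hst : b.deg s + b.deg t < 2
    · rw [G.bracket_eq_zero hst (b.mem s) (b.mem t), map_zero, map_zero]
    · rw [hf' _ (by omega) _ (G.bracket_mem (b.mem s) (b.mem t)), map_zero]
  have h1 := hφ y
  rw [h, map_zero, LinearMap.comp_apply, hf y hy] at h1
  have h2 := TrivSqZeroExt.inr_injective (h1.symm.trans (TrivSqZeroExt.inr_zero _).symm)
  simpa using h2

include he in
/-- The dual generators, as a basis of the component of degree one. -/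
theorem exists_lie_generators : ∃ x : Fin n → L, (∀ i, x i ∈ G.deg 1) ∧
    (∀ i, e (G.envι (x i)) = dualGen Γ i) ∧ LinearIndependent ℂ x ∧
      Submodule.span ℂ (Set.range x) = G.deg 1 := by
  choose x hx hx' using exists_lie_generator e he
  refine ⟨x, hx, hx', ?_, le_antisymm ?_ fun y hy => ?_⟩
  · refine LinearIndependent.of_comp (e.toLinearMap ∘ₗ G.envι) ?_
    convert linearIndependent_dualGen (Γ := Γ) using 1
    ext i : 1
    exact hx' i
  · rw [Submodule.span_le]
    rintro _ ⟨i, rfl⟩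
    exact hx i
  · have h2 := he _ _ hy
    rw [dualDeg, Submodule.pow_one, Submodule.mem_span_range_iff_exists_fun] at h2
    obtain ⟨c, hc⟩ := h2
    have h3 : y - ∑ i, c i • x i = 0 := by
      refine G.envι_injOn_deg_one (Submodule.sub_mem _ hy
        (Submodule.sum_mem _ fun i _ => Submodule.smul_mem _ _ (hx i))) (e.injective ?_)
      simp [hx', hc]
    rw [sub_eq_zero.1 h3]
    exact Submodule.sum_mem _ fun i _ => Submodule.smul_mem _ _ (Submodule.subset_span ⟨i, rfl⟩)

end QuadraticComm


/-! ### Bases adapted to the truncations, and the degree-two component of `L` -/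

open Module

namespace GradedLieSuperalgebra

variable {L : Type*} [AddCommGroup L] [Module ℂ L] {G : GradedLieSuperalgebra L}

theorem HomogeneousBasis.eq_zero_of_mem {X : Type*} (b : G.HomogeneousBasis X) {k : ℕ}
    {y : L} (hy : y ∈ ⨆ m, ⨆ _ : m < k, G.deg m) (hy' : y ∈ G.tail k) : y = 0 := by
  have h1 : ∀ u, k ≤ b.deg u → b.basis.repr y u = 0 := by
    intro u hu
    have : ⨆ m, ⨆ _ : m < k, G.deg m ≤ LinearMap.ker (b.basis.coord u) :=
      iSup₂_le fun m hm z hz => b.repr_of_ne hz (by omega)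
    exact this hy
  have h2 : ∀ u, b.deg u < k → b.basis.repr y u = 0 := by
    intro u hu
    have : G.tail k ≤ LinearMap.ker (b.basis.coord u) :=
      iSup₂_le fun m hm z hz => b.repr_of_ne hz (by omega)
    exact this hy'
  refine b.basis.ext_elem fun u => ?_
  rw [map_zero, Finsupp.zero_apply]
  rcases lt_or_ge (b.deg u) k with h | h
  exacts [h2 u h, h1 u h]

/-- A homogeneous basis of `L` which extends the standard basis of `L_{≥ k}`. -/
theorem exists_basis (G : GradedLieSuperalgebra L) (k : ℕ) {Y : Type*} {y : Y → L} {dy : Y → ℕ}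
    (hy : ∀ i, y i ∈ G.deg (dy i)) (hdy : ∀ i, dy i < k) (hli : LinearIndependent ℂ y)
    (hspan : ∀ m < k, G.deg m ≤ Submodule.span ℂ (Set.range y)) :
    ∃ b : G.HomogeneousBasis (Y ⊕ (G.trunc k).Index), (∀ i, b.basis (Sum.inl i) = y i) ∧
      (∀ u, b.basis (Sum.inr u) = ((G.trunc k).basis u : L)) ∧ b.deg = Sum.elim dy Sigma.fst := by
  let z : (G.trunc k).Index → L := fun u => (G.trunc k).basis u
  have hz : LinearIndependent ℂ z :=
    (G.trunc k).basis.linearIndependent.map' (G.tail k).subtype (Submodule.ker_subtype _)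
  have hzs : Submodule.span ℂ (Set.range z) = G.tail k := by
    have := congrArg (Submodule.map (G.tail k).subtype) (G.trunc k).basis.span_eq
    rw [Submodule.map_span, ← Set.range_comp, Submodule.map_subtype_top] at this
    exact this
  have hli' : LinearIndependent ℂ (Sum.elim y z) := by
    refine hli.sum_type hz (Submodule.disjoint_def.2 fun v hv hv' => ?_)
    refine G.homogeneousBasis.eq_zero_of_mem (k := k) ?_ (hzs ▸ hv')
    refine Submodule.span_le.2 ?_ hv
    rintro _ ⟨i, rfl⟩
    exact Submodule.mem_iSup_of_mem _ (Submodule.mem_iSup_of_mem (hdy i) (hy i))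
  have hsp : ⊤ ≤ Submodule.span ℂ (Set.range (Sum.elim y z)) := by
    rw [← G.iSup_deg, Set.Sum.elim_range, Submodule.span_union]
    refine iSup_le fun m => ?_
    rcases lt_or_ge m k with h | h
    · exact (hspan m h).trans le_sup_left
    · rw [hzs]
      exact (G.deg_le_tail h).trans le_sup_right
  refine ⟨⟨Basis.mk hli' hsp, Sum.elim dy Sigma.fst, ?_⟩, fun i => ?_, fun u => ?_, rfl⟩
  · rintro (i | u)
    · simpa using hy i
    · rw [Basis.mk_apply]
      exact (G.trunc k).homogeneousBasis.mem u
  · simp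
  · simp [z]

theorem le_of_trunc_index (G : GradedLieSuperalgebra L) {k : ℕ} (u : (G.trunc k).Index) :
    k ≤ u.1 := by
  by_contra h
  have h2 : (G.trunc k).basis u ∈ (G.trunc k).deg u.1 := (G.trunc k).homogeneousBasis.mem u
  have h3 : ((G.trunc k).basis u : L) = 0 := by
    refine G.homogeneousBasis.eq_zero_of_mem (k := k) ?_ ((G.trunc k).basis u).2
    exact Submodule.mem_iSup_of_mem u.1 (Submodule.mem_iSup_of_mem (not_le.1 h) h2)
  exact (G.trunc k).basis.ne_zero u (Subtype.ext h3)

end GradedLieSuperalgebra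

namespace QuadraticComm

variable {n m : ℕ} {Γ : Fin m → Matrix (Fin n) (Fin n) ℂ}

/-- Second derivatives at the origin of the multiples of a quadratic form. -/
theorem eval_pderiv_pderiv (f : MvPolynomial (Fin n) ℂ) (q : Fin n → Fin n → ℂ) (i k : Fin n) :
    MvPolynomial.eval 0 (MvPolynomial.pderiv i (MvPolynomial.pderiv k
      (f * ∑ s, ∑ t, MvPolynomial.C (q s t) * (MvPolynomial.X s * MvPolynomial.X t)))) =
      MvPolynomial.eval 0 f * (q i k + q k i) := by
  set S : MvPolynomial (Fin n) ℂ :=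
    ∑ s, ∑ t, MvPolynomial.C (q s t) * (MvPolynomial.X s * MvPolynomial.X t) with hS
  have h0 : MvPolynomial.eval 0 S = 0 := by simp [hS]
  have h1 : ∀ k, MvPolynomial.pderiv k S = ∑ s, MvPolynomial.C (q s k) * MvPolynomial.X s +
      ∑ t, MvPolynomial.C (q k t) * MvPolynomial.X t := by
    intro k
    have h2 : ∀ s t, MvPolynomial.pderiv k
        (MvPolynomial.C (q s t) * (MvPolynomial.X s * MvPolynomial.X t)) =
        (if t = k then MvPolynomial.C (q s t) * MvPolynomial.X s else 0) +
          if s = k then MvPolynomial.C (q s t) * MvPolynomial.X t else 0 := by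
      intro s t
      rw [MvPolynomial.pderiv_C_mul, MvPolynomial.pderiv_mul, MvPolynomial.pderiv_X,
        MvPolynomial.pderiv_X]
      by_cases hs : s = k <;> by_cases ht : t = k <;>
      simp [hs, ht, MvPolynomial.C_mul', add_comm]
    simp only [hS, map_sum, h2, Finset.sum_add_distrib]
    congr 1
    · simp
    · rw [Finset.sum_comm]
      simp
  have h3 : MvPolynomial.eval 0 (MvPolynomial.pderiv i (MvPolynomial.pderiv k S)) =
      q i k + q k i := by
    rw [h1]
    simp only [map_add, map_sum, MvPolynomial.pderiv_C_mul, MvPolynomial.pderiv_X]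
    simp [Pi.single_apply, apply_ite]
  have h4 : ∀ k, MvPolynomial.eval 0 (MvPolynomial.pderiv k S) = 0 := by
    intro k
    rw [h1]
    simp
  simp only [MvPolynomial.pderiv_mul, map_add, map_mul, h0, h3, h4]
  ring

theorem mk_C_mul_X_mul_X (c : ℂ) (i j : Fin n) :
    Ideal.Quotient.mk (Ideal.span (Set.range (quadric Γ))) (MvPolynomial.C c) *
      (Ideal.Quotient.mk _ (MvPolynomial.X i) * Ideal.Quotient.mk _ (MvPolynomial.X j)) =
      c • (a Γ i * a Γ j) := by
  change _ = Ideal.Quotient.mk (Ideal.span (Set.range (quadric Γ)))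
    (c • (MvPolynomial.X i * MvPolynomial.X j))
  rw [MvPolynomial.smul_eq_C_mul, map_mul, map_mul]

theorem mem_relations_Γ (r : Fin m) : Γ r ∈ relations Γ := by
  have h : Ideal.Quotient.mk (Ideal.span (Set.range (quadric Γ))) (quadric Γ r) = 0 :=
    Ideal.Quotient.eq_zero_iff_mem.2 (Ideal.subset_span ⟨r, rfl⟩)
  refine Eq.trans ?_ h
  simp only [quadric, map_sum, map_mul]
  refine Finset.sum_congr rfl fun i _ => Finset.sum_congr rfl fun j _ => ?_
  exact (mk_C_mul_X_mul_X _ i j).symm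

/-- The quadratic form of `q` is a combination of the `Γ_r` with polynomial coefficients. Second
derivatives at the origin see only the constant terms of these, and only the symmetric part of each
matrix. -/
theorem exists_of_mem_relations {q : Fin n → Fin n → ℂ} (hq : q ∈ relations Γ) :
    ∃ μ : Fin m → ℂ, ∀ i k, q i k + q k i = ∑ r, μ r * (Γ r i k + Γ r k i) := by
  have h1 : ∑ s, ∑ t, MvPolynomial.C (q s t) * (MvPolynomial.X s * MvPolynomial.X t) ∈
      Ideal.span (Set.range (quadric Γ)) := by
    rw [← Ideal.Quotient.eq_zero_iff_mem]
    refine Eq.trans ?_ hq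
    simp only [map_sum, map_mul]
    refine Finset.sum_congr rfl fun i _ => Finset.sum_congr rfl fun j _ => ?_
    exact mk_C_mul_X_mul_X _ i j
  rw [Ideal.mem_span_range_iff_exists_fun] at h1
  obtain ⟨c, hc⟩ := h1
  refine ⟨fun r => MvPolynomial.eval 0 (c r), fun i k => ?_⟩
  have h2 := eval_pderiv_pderiv 1 q i k
  rw [one_mul, ← hc, map_one, one_mul] at h2
  rw [← h2]
  simp only [map_sum]
  exact Finset.sum_congr rfl fun r _ => eval_pderiv_pderiv (c r) (Γ r) i k

/-- The symmetrised matrix represents `2 Γ_r`, so the hypothesis is a linear relation between the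
quadrics. -/
theorem eq_zero_of_sum_eq_zero (hΓ : LinearIndependent ℂ (quadric Γ)) {μ : Fin m → ℂ}
    (hμ : ∀ i k, ∑ r, μ r * (Γ r i k + Γ r k i) = 0) : μ = 0 := by
  have h1 : ∀ r, (2 : ℂ) • quadric Γ r =
      ∑ i, ∑ k, (Γ r i k + Γ r k i) • (MvPolynomial.X i * MvPolynomial.X k) := by
    intro r
    have : quadric Γ r = ∑ i, ∑ k, Γ r k i • (MvPolynomial.X i * MvPolynomial.X k) := by
      rw [quadric, Finset.sum_comm]
      refine Finset.sum_congr rfl fun i _ => Finset.sum_congr rfl fun k _ => ?_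
      rw [MvPolynomial.C_mul', mul_comm (MvPolynomial.X k)]
    rw [two_smul]
    nth_rw 2 [this]
    simp only [quadric, MvPolynomial.C_mul', add_smul, Finset.sum_add_distrib]
  have h2 : ∑ r, μ r • quadric Γ r = 0 := by
    have : (2 : ℂ) • ∑ r, μ r • quadric Γ r = 0 := by
      simp only [Finset.smul_sum, smul_comm (2 : ℂ), h1, smul_smul]
      rw [Finset.sum_comm]
      refine Finset.sum_eq_zero fun i _ => ?_
      rw [Finset.sum_comm]
      refine Finset.sum_eq_zero fun k _ => ?_
      rw [← Finset.sum_smul, hμ, zero_smul]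
    exact (smul_eq_zero.1 this).resolve_left two_ne_zero
  exact funext (Fintype.linearIndependent_iff.1 hΓ μ h2)

variable (Γ) in
/-- The action of the Koszul dual algebra which detects the quadratic relations. -/
theorem exists_dual_matrix : ∃ F : KoszulDual Γ →ₐ[ℂ]
    Matrix (Unit ⊕ (Fin n ⊕ Fin m)) (Unit ⊕ (Fin n ⊕ Fin m)) ℂ, ∀ i k r,
      F (dualGen Γ i * dualGen Γ k) (Sum.inl ()) (Sum.inr (Sum.inr r)) = Γ r i k := by
  -- Strictly upper triangular blocks on `ℂ ⊕ ℂⁿ ⊕ ℂᵐ`: the first step records the index `i`, the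
  -- second applies `Γ`. A product of two leaves only the corner row with entries `Γ^r_{ik}`, so
  -- orthogonality to the `Γ_r` gives the dual relations.
  let Y : Fin n → Matrix (Unit ⊕ (Fin n ⊕ Fin m)) (Unit ⊕ (Fin n ⊕ Fin m)) ℂ := fun i =>
    Matrix.fromBlocks 0 (Matrix.of fun _ => Sum.elim (Pi.single i 1) 0) 0
      (Matrix.fromBlocks 0 (Matrix.of fun l r => Γ r l i) 0 0)
  have hY : ∀ i k, Y i * Y k = Matrix.fromBlocks 0
      (Matrix.of fun _ => Sum.elim 0 (fun r => Γ r i k)) 0 0 := by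
    intro i k
    ext (s | s | s) (t | t | t) <;>
    simp [Y, Matrix.mul_apply, Fintype.sum_sum_type, Pi.single_apply]
  obtain ⟨F, hF⟩ := exists_dual_lift (Γ := Γ) Y fun c hc => by
    simp only [hY]
    ext (s | s | s) (t | t | t) <;> simp [Matrix.sum_apply]
    exact hc _ (mem_relations_Γ t)
  refine ⟨F, fun i k r => ?_⟩
  have h := hF (FreeAlgebra.ι ℂ i * FreeAlgebra.ι ℂ k)
  rw [map_mul, map_mul (FreeAlgebra.lift ℂ Y), FreeAlgebra.lift_ι_apply, FreeAlgebra.lift_ι_apply,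
    hY] at h
  exact congrFun (congrFun h _) _

variable {L : Type*} [AddCommGroup L] [Module ℂ L] {G : GradedLieSuperalgebra L}
  (e : G.Env ≃ₐ[ℂ] KoszulDual Γ) (he : ∀ j, ∀ x ∈ G.deg j, e (G.envι x) ∈ dualDeg Γ j)

theorem deg_le_span_of_lt_two {x : Fin n → L} (hspan : Submodule.span ℂ (Set.range x) = G.deg 1)
    (j : ℕ) (hj : j < 2) : G.deg j ≤ Submodule.span ℂ (Set.range x) := by
  obtain rfl | rfl : j = 0 ∨ j = 1 := by omega
  · rw [G.deg_zero]
    exact bot_le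
  · exact hspan.ge

include he in
/-- The basis of `L` adapted to the decomposition `L = L₁ ⊕ L_{≥ 2}`. -/
theorem exists_syzygy_basis {x : Fin n → L} (hx : ∀ i, x i ∈ G.deg 1)
    (hxe : ∀ i, e (G.envι (x i)) = dualGen Γ i) (hli : LinearIndependent ℂ x)
    (hspan : Submodule.span ℂ (Set.range x) = G.deg 1) :
    ∃ b : G.HomogeneousBasis (Fin n ⊕ (G.trunc 2).Index), (∀ i, b.basis (Sum.inl i) = x i) ∧
      (∀ u, b.basis (Sum.inr u) = ((G.trunc 2).basis u : L)) ∧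
      b.deg = Sum.elim (fun _ => 1) Sigma.fst ∧
      ∃ Q : b.constants.Presentation (grading Γ), Q.B = Sum.inl := by
  obtain ⟨b, hb1, hb2, hb3⟩ := G.exists_basis 2 hx (fun _ => one_lt_two) hli
    (deg_le_span_of_lt_two hspan)
  refine ⟨b, hb1, hb2, hb3, exists_presentation e he b Sum.inl (fun i => by rw [hb1, hxe])
    (fun i => by simp [hb3]) Sum.inl_injective ?_⟩
  rintro (i | u) hu
  · exact ⟨i, rfl⟩
  · exfalso
    have h1 : u.1 = 1 := by simpa [hb3] using hu
    have h2 := G.le_of_trunc_index u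
    omega

include he in
/-- The component of degree two is dual to the space of quadrics. -/
theorem exists_lie_quadrics (hΓ : LinearIndependent ℂ (quadric Γ)) {x : Fin n → L}
    (hx : ∀ i, x i ∈ G.deg 1) (hxe : ∀ i, e (G.envι (x i)) = dualGen Γ i)
    (hli : LinearIndependent ℂ x) (hspan : Submodule.span ℂ (Set.range x) = G.deg 1) :
    ∃ f : Fin m → L, (∀ r, f r ∈ G.deg 2) ∧ LinearIndependent ℂ f ∧
      Submodule.span ℂ (Set.range f) = G.deg 2 ∧
      ∀ i k, G.bracket (x i) (x k) = ∑ r, (Γ r i k + Γ r k i) • f r := by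
  obtain ⟨b, hb1, hb2, hb3, Q, hQ⟩ := exists_syzygy_basis e he hx hxe hli hspan
  obtain ⟨F, hF⟩ := exists_dual_matrix Γ
  have hx2 : ∀ i k, G.bracket (x i) (x k) ∈ G.deg 2 := fun i k => G.bracket_mem (hx i) (hx k)
  -- The corner entries, read off on `L₂`; on a bracket of two odd generators they give the
  -- symmetrised matrices. This map will identify `L₂` with `ℂᵐ`.
  let Λ : L →ₗ[ℂ] Fin m → ℂ := LinearMap.pi fun r =>
    Matrix.entryLinearMap ℂ ℂ (Sum.inl ()) (Sum.inr (Sum.inr r)) ∘ₗ F.toLinearMap ∘ₗ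
      e.toLinearMap ∘ₗ G.envι
  have hΛ : ∀ i k r, Λ (G.bracket (x i) (x k)) r = Γ r i k + Γ r k i := by
    intro i k r
    have h1 := G.envι_comm (hx i) (hx k)
    have h2 : Λ (G.bracket (x i) (x k)) r =
      F (e (G.envι (G.bracket (x i) (x k)))) (Sum.inl ()) (Sum.inr (Sum.inr r)) := rfl
    rw [h2, ← h1, map_sub, map_smul, map_mul, map_mul, hxe, hxe, map_sub, map_smul,
      Matrix.sub_apply, Matrix.smul_apply, hF, hF]
    simp
  let E : G.deg 2 →ₗ[ℂ] Fin m → ℂ := Λ ∘ₗ (G.deg 2).subtype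
  have hinj : Function.Injective E := by
    rw [injective_iff_map_eq_zero]
    rintro ⟨y, hy⟩ hEy
    have hEy : Λ y = 0 := hEy
    refine Subtype.ext (b.basis.ext_elem fun u => ?_)
    change b.basis.repr y u = b.basis.repr 0 u
    rw [map_zero, Finsupp.zero_apply]
    obtain ⟨π, hπ, hπ'⟩ := b.exists_component 2
    -- The structure constants with target `u` form a relation of `A`, so on brackets of generators
    -- the coordinate `u` is a combination of the components of `Λ`.
    obtain ⟨μ, hμ⟩ := exists_of_mem_relations ((grading Γ).mem_rel.1 (Q.c_mem_rel u))
    have hμ' : ∀ i k, b.basis.coord u (G.bracket (x i) (x k)) =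
        ∑ r, (1 / 2 * μ r) * (Γ r i k + Γ r k i) := by
      intro i k
      have h1 := hμ i k
      simp only [hQ] at h1
      have h2 : b.constants.c (Sum.inl i) (Sum.inl k) u =
        b.basis.coord u (G.bracket (x i) (x k)) := by rw [← hb1, ← hb1]; rfl
      have h3 : b.constants.c (Sum.inl k) (Sum.inl i) u =
          b.basis.coord u (G.bracket (x i) (x k)) := by
        rw [← h2, b.constants.skew (Sum.inl i)]
        simp [GradedLieSuperalgebra.HomogeneousBasis.constants, hb3]
      rw [h2, h3] at h1
      simp only [mul_assoc, ← Finset.mul_sum, ← h1]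
      ring
    -- The difference of the coordinate and that combination kills all brackets, so it extends to
    -- `U(L)` with values in a square-zero extension. Elements of `L₂` become products of two
    -- generators in `A^!` and go to zero, so `Λ y = 0` forces the coordinate of `y` to vanish.
    obtain ⟨φ, hφ⟩ := b.exists_env_trivSqZero
      ((b.basis.coord u - ∑ r, (1 / 2 * μ r) • (LinearMap.proj r ∘ₗ Λ)) ∘ₗ π) fun s t => by
      rw [LinearMap.comp_apply]
      have hm := G.bracket_mem (b.mem s) (b.mem t)
      obtain hst | hst | hst : b.deg s + b.deg t < 2 ∨ (b.deg s = 1 ∧ b.deg t = 1) ∨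
          2 ≠ b.deg s + b.deg t := by
        have := b.deg_pos s
        have := b.deg_pos t
        omega
      · rw [G.bracket_eq_zero hst (b.mem s) (b.mem t), map_zero, map_zero]
      · obtain ⟨i, rfl⟩ := Q.B_surj s hst.1
        obtain ⟨k, rfl⟩ := Q.B_surj t hst.2
        rw [hQ, hb1, hb1, hπ _ (hx2 i k)]
        simp only [LinearMap.sub_apply, LinearMap.sum_apply, LinearMap.smul_apply,
          LinearMap.comp_apply, LinearMap.proj_apply, hΛ, hμ', smul_eq_mul, sub_self]
      · rw [hπ' _ hst.symm _ hm, map_zero]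
    have h1 := dualDeg_le_ker (φ.comp e.symm.toAlgHom) (fun i => by
      rw [← hxe]
      simp [hφ]) le_rfl (he _ _ hy)
    have h2 : φ (G.envι y) = 0 := by simpa using h1
    rw [hφ, LinearMap.comp_apply, hπ _ hy] at h2
    have h3 := TrivSqZeroExt.inr_injective (h2.trans (TrivSqZeroExt.inr_zero _).symm)
    simpa [LinearMap.sum_apply, hEy] using h3
  -- A functional vanishing on the image would be a linear relation between the symmetrised `Γ_r`,
  -- excluded by independence of the quadrics.
  have hsurj : Function.Surjective E := by
    rw [← LinearMap.range_eq_top]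
    by_contra h
    obtain ⟨ψ, hψ, hψ'⟩ := Submodule.exists_le_ker_of_lt_top _ (lt_top_iff_ne_top.2 h)
    refine hψ ?_
    have h1 : (fun r => ψ (Pi.single r 1)) = 0 := by
      refine eq_zero_of_sum_eq_zero hΓ fun i k => ?_
      have h2 : ψ (Λ (G.bracket (x i) (x k))) = 0 := hψ' ⟨⟨_, hx2 i k⟩, rfl⟩
      rw [LinearMap.pi_apply_eq_sum_univ] at h2
      refine Eq.trans (Finset.sum_congr rfl fun r _ => ?_) h2
      rw [hΛ, smul_eq_mul, mul_comm]
      congr 2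
      ext t
      simp [Pi.single_apply, eq_comm]
    refine LinearMap.pi_ext' fun r => LinearMap.ext_ring ?_
    exact congrFun h1 r
  let E' := LinearEquiv.ofBijective E ⟨hinj, hsurj⟩
  let B := (Pi.basisFun ℂ (Fin m)).map E'.symm
  refine ⟨fun r => B r, fun r => (B r).2, ?_, ?_, fun i k => ?_⟩
  · exact B.linearIndependent.map' (G.deg 2).subtype (Submodule.ker_subtype _)
  · have := congrArg (Submodule.map (G.deg 2).subtype) B.span_eq
    rw [Submodule.map_span, ← Set.range_comp, Submodule.map_subtype_top] at this
    exact this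
  · have h1 := B.sum_repr ⟨_, hx2 i k⟩
    have h2 := congrArg (G.deg 2).subtype h1
    rw [map_sum] at h2
    refine h2.symm.trans (Finset.sum_congr rfl fun r _ => ?_)
    rw [map_smul]
    congr 1
    exact hΛ i k r

include he in
/-- The basis of `L` adapted to the decomposition `L = L₁ ⊕ L₂ ⊕ L_{≥ 3}`. -/
theorem exists_berkovits_basis (hΓ : LinearIndependent ℂ (quadric Γ)) :
    ∃ b : G.HomogeneousBasis ((Fin n ⊕ Fin m) ⊕ (G.trunc 3).Index),
      (∀ u, b.basis (Sum.inr u) = ((G.trunc 3).basis u : L)) ∧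
      b.deg = Sum.elim berkovitsDegree Sigma.fst ∧
      (∀ i k r, b.constants.c (Sum.inl (Sum.inl i)) (Sum.inl (Sum.inl k)) (Sum.inl (Sum.inr r)) =
        Γ r i k + Γ r k i) ∧
      ∃ Q : b.constants.Presentation (grading Γ), Q.B = fun i => Sum.inl (Sum.inl i) := by
  classical
  obtain ⟨x, hx, hxe, hli, hspan⟩ := exists_lie_generators e he
  obtain ⟨f, hf, hfli, hfspan, hxf⟩ := exists_lie_quadrics e he hΓ hx hxe hli hspan
  obtain ⟨b, hb1, hb2, hb3⟩ := G.exists_basis 3 (y := Sum.elim x f) (dy := berkovitsDegree)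
    (by rintro (i | r); exacts [hx i, hf r]) (by rintro (i | r) <;> simp [berkovitsDegree])
    (hli.sum_type hfli (by
      rw [hspan, hfspan]
      exact G.iSupIndep_deg.pairwiseDisjoint (by decide)))
    (fun j hj => by
      rw [Set.Sum.elim_range, Submodule.span_union]
      obtain hj | rfl : j < 2 ∨ j = 2 := by omega
      · exact (deg_le_span_of_lt_two hspan j hj).trans le_sup_left
      · exact hfspan.ge.trans le_sup_right)
  refine ⟨b, hb2, hb3, fun i k r => ?_, exists_presentation e he b (fun i => Sum.inl (Sum.inl i))
    (fun i => by rw [hb1, Sum.elim_inl, hxe]) (fun i => by simp [hb3, berkovitsDegree])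
    (Sum.inl_injective.comp Sum.inl_injective) ?_⟩
  · change b.basis.repr (G.bracket (b.basis _) (b.basis _)) _ = _
    rw [hb1, hb1, Sum.elim_inl, Sum.elim_inl, hxf, map_sum]
    have : ∀ r, f r = b.basis (Sum.inl (Sum.inr r)) := fun r => by rw [hb1, Sum.elim_inr]
    simp only [this, map_smul, Basis.repr_self]
    simp [Finsupp.single_apply, Finset.sum_add_distrib]
  · rintro ((i | r) | u) hu
    · exact ⟨i, rfl⟩
    · simp [hb3, berkovitsDegree] at hu
    · have h1 : u.1 = 1 := by simpa [hb3] using hu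
      have := G.le_of_trunc_index u
      omega

end QuadraticComm


open Module SuperComm

/-! ## Comparison of the differentials -/

theorem OddDerivation.intertwine {R : Type*} [CommRing R] [Algebra ℂ R] {X : Type*} {p : X → ℕ}
    {T : Type*} [Ring T] [Algebra ℂ T] {D : OddDerivation (SuperComm R p)} {D' : OddDerivation T}
    {f : SuperComm R p →ₐ[ℂ] T} (hpar : ∀ a, f (D.parity a) = D'.parity (f a))
    (hR : ∀ r, f (D.d (algebraMap R _ r)) = D'.d (f (algebraMap R _ r)))
    (hgen : ∀ x, f (D.d (gen p x)) = D'.d (f (gen p x))) (a : SuperComm R p) :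
    f (D.d a) = D'.d (f a) := by
  induction a using SuperComm.induction with
  | hR r => exact hR r
  | hgen x => exact hgen x
  | hmul a b ha hb =>
    rw [D.leibniz, map_add, map_mul, map_mul, ha, hb, map_mul, D'.leibniz, hpar]
  | hadd a b ha hb => rw [map_add, map_add, ha, hb, map_add, map_add]

theorem OddDerivation.IsComplex.of_surjective {S S' : Type*} [Ring S] [Algebra ℂ S] [Ring S']
    [Algebra ℂ S'] {D : OddDerivation S} (hD : D.IsComplex) {D' : OddDerivation S'} {f : S →ₐ[ℂ] S'}
    (hf : Function.Surjective f) (hpar : ∀ a, f (D.parity a) = D'.parity (f a))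
    (hd : ∀ a, f (D.d a) = D'.d (f a)) : D'.IsComplex where
  parity_parity a := by
    obtain ⟨a, rfl⟩ := hf a
    rw [← hpar, ← hpar, hD.parity_parity]
  parity_d a := by
    obtain ⟨a, rfl⟩ := hf a
    rw [← hd, ← hpar, ← hpar, ← hd, hD.parity_d, map_neg]
  d_d a := by
    obtain ⟨a, rfl⟩ := hf a
    rw [← hd, ← hd, hD.d_d, map_zero]

namespace GradedLieSuperalgebra

variable {L : Type*} [AddCommGroup L] [Module ℂ L] (G : GradedLieSuperalgebra L)

theorem ceValue_eq (u : G.Index) :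
    G.ceValue u = G.homogeneousBasis.constants.ceVal (gen G.cePar) u := by
  let g : G.Index → G.Index → G.CEAlg := fun s t =>
    (-(1 / 2) * (-1) ^ (s.1 * (t.1 + 1)) * G.basis.repr (G.bracket (G.basis s) (G.basis t)) u : ℂ) •
      (gen G.cePar s * gen G.cePar t)
  have hg : ∀ s t, s.1 + t.1 ≠ u.1 → g s t = 0 := by
    intro s t h
    have := G.homogeneousBasis.repr_of_ne
      (G.bracket_mem (G.homogeneousBasis.mem s) (G.homogeneousBasis.mem t)) (Ne.symm h)
    change G.basis.repr (G.bracket (G.basis s) (G.basis t)) u = 0 at this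
    simp only [g, this, mul_zero, zero_smul]
  have hball : G.homogeneousBasis.constants.ball u.1 =
      (Finset.range (u.1 + 1)).sigma fun _ => Finset.univ := by
    ext s
    rw [G.homogeneousBasis.constants.mem_ball]
    simp only [Finset.mem_sigma, Finset.mem_range, Finset.mem_univ, and_true, Nat.lt_succ_iff]
    rfl
  have h1 : G.homogeneousBasis.constants.ceVal (gen G.cePar) u =
      ∑ s ∈ G.homogeneousBasis.constants.ball u.1,
        ∑ t ∈ G.homogeneousBasis.constants.ball u.1, g s t := rfl
  rw [h1, hball, Finset.sum_sigma]
  change ∑ q ∈ Finset.HasAntidiagonal.antidiagonal u.1, ∑ i, ∑ j, g ⟨q.1, i⟩ ⟨q.2, j⟩ = _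
  rw [Finset.Nat.sum_antidiagonal_eq_sum_range_succ_mk]
  refine Finset.sum_congr rfl fun a ha => Finset.sum_congr rfl fun i _ => ?_
  have ha' : a ≤ u.1 := Nat.lt_succ_iff.1 (Finset.mem_range.1 ha)
  rw [Finset.sum_sigma, Finset.sum_eq_single (u.1 - a)]
  · intro c _ hc
    refine Finset.sum_eq_zero fun j _ => hg _ _ ?_
    simp only
    omega
  · intro h
    exact absurd (Finset.mem_range.2 (by omega)) h

namespace HomogeneousBasis

variable {G} {Y : Type*} {k : ℕ} (b : G.HomogeneousBasis (Y ⊕ (G.trunc k).Index))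
  (hb : ∀ u, b.basis (Sum.inr u) = ((G.trunc k).basis u : L))

include hb in
theorem constants_c_inr (s t u : (G.trunc k).Index) :
    b.constants.c (Sum.inr s) (Sum.inr t) (Sum.inr u) =
      (G.trunc k).homogeneousBasis.constants.c s t u := by
  classical
  have h : ∀ z : G.tail k, b.basis.repr z (Sum.inr u) = (G.trunc k).basis.repr z u := by
    intro z
    have : (b.basis.coord (Sum.inr u)) ∘ₗ (G.tail k).subtype = (G.trunc k).basis.coord u := by
      refine (G.trunc k).basis.ext fun v => ?_
      rw [LinearMap.comp_apply, Submodule.subtype_apply, ← hb]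
      simp [Finsupp.single_apply, Sum.inr_injective.eq_iff]
    exact LinearMap.congr_fun this z
  change b.basis.repr (G.bracket (b.basis _) (b.basis _)) _ =
    (G.trunc k).basis.repr ((G.trunc k).bracket _ _) u
  rw [← h, hb, hb]
  rfl

include hb in
theorem ceVal_inr (hdeg : ∀ u, b.deg (Sum.inr u) = u.1) {B : Type*} [Ring B] [Algebra ℂ B]
    (ξ : Y ⊕ (G.trunc k).Index → B) (hξ : ∀ y, ξ (Sum.inl y) = 0) (u : (G.trunc k).Index) :
    b.constants.ceVal ξ (Sum.inr u) =
      (G.trunc k).homogeneousBasis.constants.ceVal (fun s => ξ (Sum.inr s)) u := by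
  classical
  have h1 : ∀ {M : Type _} [AddCommMonoid M] (N : ℕ) (g : Y ⊕ (G.trunc k).Index → M),
      (∀ y, g (Sum.inl y) = 0) → ∑ s ∈ b.constants.ball N, g s =
        ∑ s ∈ (G.trunc k).homogeneousBasis.constants.ball N, g (Sum.inr s) := by
    intro M _ N g hg
    have hsub : ((G.trunc k).homogeneousBasis.constants.ball N).map Function.Embedding.inr ⊆
        b.constants.ball N := by
      intro s hs
      obtain ⟨t, ht, rfl⟩ := Finset.mem_map.1 hs
      rw [LieConstants.mem_ball] at ht ⊢
      exact (hdeg t).le.trans ht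
    rw [← Finset.sum_subset hsub, Finset.sum_map]
    · rfl
    · rintro (y | t) ht hs
      · exact hg y
      · refine absurd (Finset.mem_map.2 ⟨t, ?_, rfl⟩) hs
        rw [LieConstants.mem_ball] at ht ⊢
        exact (hdeg t).ge.trans ht
  have h2 : b.constants.deg (Sum.inr u) = u.1 := hdeg u
  have h3 : ∀ s t : (G.trunc k).Index, b.constants.sgn (Sum.inr s) (Sum.inr t) =
      (G.trunc k).homogeneousBasis.constants.sgn s t := by
    intro s t
    have h4 : ∀ s : (G.trunc k).Index, b.constants.deg (Sum.inr s) =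
      (G.trunc k).homogeneousBasis.constants.deg s := hdeg
    rw [LieConstants.sgn, LieConstants.sgn, h4, h4]
  rw [LieConstants.ceVal, h2, h1]
  · refine Finset.sum_congr rfl fun s _ => ?_
    rw [h1]
    · refine Finset.sum_congr rfl fun t _ => ?_
      rw [b.constants_c_inr hb, h3]
    · intro y
      rw [hξ, mul_zero, smul_zero]
  · intro y
    refine Finset.sum_eq_zero fun t _ => ?_
    rw [hξ, zero_mul, smul_zero]

variable (h : ∀ y x, b.constants.deg (Sum.inl y) < b.constants.deg (Sum.inr x))
  (hp : ∀ x, (G.trunc k).cePar x = b.constants.deg (Sum.inr x) + 1)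

theorem proj_parity (a : (b.constants.ofSum h).Alg) : b.constants.proj h hp (parity a) =
    parity (b.constants.proj h hp a) := by
  induction a using SuperComm.induction with
  | hR r => simp only [AlgHom.commutes]
  | hgen z =>
    rw [parity_gen, map_mul, map_pow, map_neg, map_one, LieConstants.proj_gen]
    rcases z with (y | x) | y
    · change _ * (0 : (G.trunc k).CEAlg) = parity (0 : (G.trunc k).CEAlg)
      rw [mul_zero, map_zero]
    · change _ * gen _ x = parity (gen (G.trunc k).cePar x)
      rw [parity_gen, hp]
      rfl
    · change _ * (0 : (G.trunc k).CEAlg) = parity (0 : (G.trunc k).CEAlg)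
      rw [mul_zero, map_zero]
  | hmul a b ha hb => rw [map_mul, map_mul, ha, hb, map_mul, map_mul]
  | hadd a b ha hb => rw [map_add, map_add, ha, hb, map_add, map_add]

theorem proj_ξ_inl (y : Y) :
    b.constants.proj h hp ((b.constants.ofSum h).ξ (Sum.inl y)) = 0 :=
  b.constants.proj_gen h hp _

theorem proj_ξ_inr (x : (G.trunc k).Index) :
    b.constants.proj h hp ((b.constants.ofSum h).ξ (Sum.inr x)) = gen _ x :=
  b.constants.proj_gen h hp _

theorem proj_η (y : Y) : b.constants.proj h hp ((b.constants.ofSum h).η y) = 0 :=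
  b.constants.proj_gen h hp _

theorem proj_ηx (x : Y ⊕ (G.trunc k).Index) :
    b.constants.proj h hp ((b.constants.ofSum h).ηx x) = 0 := by
  rcases x with y | x
  · exact b.proj_η h hp y
  · exact map_zero _

include hb in
/-- The projection is a map of complexes. -/
theorem proj_diff (hdeg : ∀ u, b.deg (Sum.inr u) = u.1) (a : (b.constants.ofSum h).Alg) :
    b.constants.proj h hp ((b.constants.ofSum h).diff.d a) =
      (G.trunc k).ceComplex.d (b.constants.proj h hp a) := by
  refine OddDerivation.intertwine (D := (b.constants.ofSum h).diff) (D' := (G.trunc k).ceComplex)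
    (b.proj_parity h hp) (fun r => ?_) (fun z => ?_) a
  · rw [AlgHom.commutes, LieConstants.Window.diff, oddDer_algebraMap, map_zero]
    exact (der_d_algebraMap _ _ r).symm
  · rcases z with (y | x) | y
    · change b.constants.proj h hp ((b.constants.ofSum h).diff.d
        ((b.constants.ofSum h).ξ (Sum.inl y))) =
          (G.trunc k).ceComplex.d (b.constants.proj h hp ((b.constants.ofSum h).ξ (Sum.inl y)))
      rw [proj_ξ_inl, map_zero, LieConstants.Window.diff_ξ, LieConstants.map_ceVal]
      refine Finset.sum_eq_zero fun s _ => Finset.sum_eq_zero fun t _ => ?_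
      by_cases hc : b.constants.c s t (Sum.inl y) = 0
      · rw [hc, mul_zero, zero_smul]
      -- A non-zero constant with target in the window has its indices in the window too, and `proj`
      -- kills the corresponding `ξ`.
      · rcases s with s | s
        · beta_reduce
          rw [proj_ξ_inl, zero_mul, smul_zero]
        · have h1 := b.constants.c_deg hc
          have h2 := h y s
          omega
    · change b.constants.proj h hp ((b.constants.ofSum h).diff.d
        ((b.constants.ofSum h).ξ (Sum.inr x))) =
          (G.trunc k).ceComplex.d (b.constants.proj h hp ((b.constants.ofSum h).ξ (Sum.inr x)))
      rw [proj_ξ_inr, LieConstants.Window.diff_ξ, LieConstants.map_ceVal,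
        b.ceVal_inr hb hdeg _ (b.proj_ξ_inl h hp)]
      simp only [proj_ξ_inr]
      rw [← ceValue_eq]
      exact (der_d_gen _ _ x).symm
    · change b.constants.proj h hp ((b.constants.ofSum h).diff.d ((b.constants.ofSum h).η y)) =
        (G.trunc k).ceComplex.d (b.constants.proj h hp ((b.constants.ofSum h).η y))
      rw [proj_η, map_zero, LieConstants.Window.diff_η, map_add, map_smul,
        LieConstants.Window.conn]
      simp only [map_sum, map_smul, map_mul, proj_ηx, mul_zero, smul_zero, Finset.sum_const_zero,
        add_zero]
      exact b.proj_ξ_inl h hp y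

theorem proj_wt (hdeg : ∀ u, b.deg (Sum.inr u) = u.1) (α β : ℂ) (a : (b.constants.ofSum h).Alg) :
    b.constants.proj h hp ((b.constants.ofSum h).wt α β a) =
      weight (0 : Derivation ℂ ℂ ℂ) (fun u : (G.trunc k).Index => α + β * u.1)
        (b.constants.proj h hp a) := by
  induction a using SuperComm.induction with
  | hR r =>
    rw [AlgHom.commutes, weight_algebraMap]
    refine Eq.trans (congrArg _ ((b.constants.ofSum h).wt_algebraMap α β r)) ?_
    simp
  | hgen z =>
    rcases z with (y | x) | y
    · change b.constants.proj h hp ((b.constants.ofSum h).wt α β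
        ((b.constants.ofSum h).ξ (Sum.inl y))) =
          weight _ _ (b.constants.proj h hp ((b.constants.ofSum h).ξ (Sum.inl y)))
      rw [LieConstants.Window.wt_ξ, map_smul, proj_ξ_inl, map_zero, smul_zero]
    · change b.constants.proj h hp ((b.constants.ofSum h).wt α β
        ((b.constants.ofSum h).ξ (Sum.inr x))) =
          weight _ _ (b.constants.proj h hp ((b.constants.ofSum h).ξ (Sum.inr x)))
      have : b.constants.deg (Sum.inr x) = x.1 := hdeg x
      rw [LieConstants.Window.wt_ξ, map_smul, proj_ξ_inr, weight_gen, this]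
    · change b.constants.proj h hp ((b.constants.ofSum h).wt α β ((b.constants.ofSum h).η y)) =
        weight _ _ (b.constants.proj h hp ((b.constants.ofSum h).η y))
      rw [LieConstants.Window.wt_η, map_smul, proj_η, map_zero, smul_zero]
  | hmul a c ha hc =>
    rw [LieConstants.Window.wt_mul, map_add, map_mul, map_mul, ha, hc, map_mul, weight_mul]
  | hadd a c ha hc => rw [map_add, map_add, ha, hc, map_add, map_add]

include hb in
/-- The homology of a complex isomorphic to the specialisation of the window is the cohomology of
the truncation. -/
theorem exists_cohomology_equiv (hdeg : ∀ u, b.deg (Sum.inr u) = u.1)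
    (h : ∀ y x, b.constants.deg (Sum.inl y) < b.constants.deg (Sum.inr x)) {A : Type*} [CommRing A]
    [Algebra ℂ A] (ψ : b.constants.Twist A) (hψ : Algebra.adjoin ℂ (Set.range ψ.val) = ⊤)
    (D : Derivation ℂ A A) (hD : ∀ x, D (ψ.val x) = ψ.val x)
    (hfull : ∀ z : b.constants.full.Alg, b.constants.full.spec ψ z = 0 →
      b.constants.full.diff.d z = 0 → ∃ y, b.constants.full.spec ψ y = 0 ∧
        b.constants.full.diff.d y = z) (β : ℂ)
    {p : Y → ℕ} {K : OddDerivation (SuperComm A p)}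
    (F : ((b.constants.ofSum h).SpecAlg A) →ₐ[A] SuperComm A p) (hF : Function.Bijective F)
    (hFpar : ∀ x, F (parity x) = K.parity (F x))
    (hFd : ∀ x, F (((b.constants.ofSum h).specD ψ).d x) = K.d (F x))
    (hFw : ∀ x, F (weight ((1 + β) • D) (fun y => β * b.deg (Sum.inl y)) x) =
      weight ((1 + β) • D) (fun y => β * p y) (F x)) :
    ∃ Φ : K.Homology ≃ₐ[ℂ] (G.trunc k).Cohomology, ∀ c,
      (K.homologyPart (End.eigenspace (weight ((1 + β) • D) fun y => β * p y) c)).map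
        Φ.toLinearMap = (G.trunc k).ceComplex.homologyPart (End.eigenspace
          (weight (0 : Derivation ℂ ℂ ℂ) (fun u : (G.trunc k).Index => 1 + β * u.1)) c) := by
  have hp : ∀ x, (G.trunc k).cePar x = b.constants.deg (Sum.inr x) + 1 := fun x =>
    congrArg (· + 1) (hdeg x).symm
  have hR := (b.constants.ofSum h).diff_isComplex
  have hwt := (b.constants.ofSum h).wt_diff 1 β
  simp only [one_smul] at hwt
  -- The twist is supported in degree one, where the weight `1 + β |x|` of `ξ_x` equals `1 + β`;
  -- hence the factor in front of the derivation.
  have hD' : ∀ x, ((1 + β) • D) (ψ.val x) = (1 + β * b.constants.deg x) • ψ.val x := by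
    intro x
    rw [Derivation.smul_apply, hD]
    by_cases hx : b.constants.deg x = 1
    · rw [hx, Nat.cast_one, mul_one]
    · rw [ψ.val_of_ne hx, smul_zero, smul_zero]
  let f : (b.constants.ofSum h).Alg →ₐ[ℂ] SuperComm A p :=
    (F.restrictScalars ℂ).comp ((b.constants.ofSum h).spec ψ)
  have hf : Function.Surjective f :=
    hF.2.comp ((b.constants.ofSum h).spec_surjective ψ hψ)
  have hfd : ∀ a, f ((b.constants.ofSum h).diff.d a) = K.d (f a) := fun a =>
    (congrArg F ((b.constants.ofSum h).spec_diff ψ a)).trans (hFd _)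
  have hker : ∀ z, f z = 0 ↔ (b.constants.ofSum h).spec ψ z = 0 := fun z =>
    map_eq_zero_iff F hF.1
  have hK : K.IsComplex := hR.of_surjective hf
    (fun a => (congrArg F ((b.constants.ofSum h).spec_parity ψ a)).trans (hFpar _)) hfd
  have hCE : (G.trunc k).ceComplex.IsComplex := hR.of_surjective
    (b.constants.proj_surjective h hp) (b.proj_parity h hp) (b.proj_diff hb h hp hdeg)
  obtain ⟨Φ₁, hΦ₁⟩ := OddDerivation.exists_homology_equiv hR hK f hfd hf (fun z hz hdz => by
    obtain ⟨y, hy, hyz⟩ := b.constants.spec_acyclic h ψ D hD hfull ((hker z).1 hz) hdz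
    exact ⟨y, (hker y).2 hy, hyz⟩) _ _ ((b.constants.ofSum h).wt_isDiagonal 1 β)
    (fun a => (congrArg F ((b.constants.ofSum h).spec_wt 1 β ψ _ hD' a)).trans (hFw _)) hwt
  obtain ⟨Φ₂, hΦ₂⟩ := OddDerivation.exists_homology_equiv hR hCE (b.constants.proj h hp)
    (b.proj_diff hb h hp hdeg) (b.constants.proj_surjective h hp)
    (fun z hz hdz => b.constants.proj_acyclic h hp hz hdz) _ _
    ((b.constants.ofSum h).wt_isDiagonal 1 β) (b.proj_wt h hp hdeg 1 β) hwt
  -- The isomorphism is the zigzag through the window complex, whose weight operator with `α = 1`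
  -- and parameter `β` is compatible with both surjections.
  refine ⟨Φ₁.symm.trans Φ₂, fun c => ?_⟩
  rw [← hΦ₁, ← hΦ₂, ← Submodule.map_comp]
  congr 1
  ext x
  simp

end HomogeneousBasis

end GradedLieSuperalgebra


open Module SuperComm

namespace QuadraticComm

variable {n m : ℕ} (Γ : Fin m → Matrix (Fin n) (Fin n) ℂ)

/-! ## The Euler derivation -/

theorem adjoin_range_a : Algebra.adjoin ℂ (Set.range (a Γ)) = ⊤ := by
  have h := congrArg (Subalgebra.map (toAlg Γ)) (MvPolynomial.adjoin_range_X (R := ℂ) (σ := Fin n))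
  rw [AlgHom.map_adjoin, ← Set.range_comp, Algebra.map_top,
    (AlgHom.range_eq_top _).2 (toAlg_surjective Γ)] at h
  exact h

instance : Nontrivial (Alg Γ) := (linearPart Γ).toRingHom.domain_nontrivial

/-- The Euler derivation of the polynomial ring multiplies each quadric by two, so it preserves the
ideal and descends. -/
theorem exists_euler : ∃ D : Derivation ℂ (Alg Γ) (Alg Γ), ∀ i, ∀ x ∈ deg Γ i, D x = (i : ℂ) • x := by
  let E : Derivation ℂ (MvPolynomial (Fin n) ℂ) (MvPolynomial (Fin n) ℂ) :=
    MvPolynomial.mkDerivation ℂ MvPolynomial.X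
  have hE : ∀ i, E (MvPolynomial.X i) = MvPolynomial.X i := MvPolynomial.mkDerivation_X ℂ _
  have hEC : ∀ c, E (MvPolynomial.C c) = 0 := fun c => E.map_algebraMap c
  have hq : ∀ k, E (quadric Γ k) = quadric Γ k + quadric Γ k := by
    intro k
    simp only [quadric, map_sum, ← Finset.sum_add_distrib]
    refine Finset.sum_congr rfl fun i _ => Finset.sum_congr rfl fun j _ => ?_
    simp only [Derivation.leibniz, hE, hEC, smul_eq_mul]
    ring
  have hker : ∀ x, toAlg Γ x = 0 → toAlg Γ (E x) = 0 := by
    intro x hx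
    rw [toAlg_eq_zero] at hx ⊢
    induction hx using Submodule.span_induction with
    | zero => rw [map_zero]; exact zero_mem _
    | add x y _ _ hx hy => rw [map_add]; exact add_mem hx hy
    | smul c x hx' hx =>
      rw [smul_eq_mul, Derivation.leibniz]
      exact add_mem (Ideal.mul_mem_left _ _ hx) (Ideal.mul_mem_right _ _ hx')
    | mem x hx =>
      obtain ⟨k, rfl⟩ := hx
      rw [hq]
      exact add_mem (Ideal.subset_span ⟨k, rfl⟩) (Ideal.subset_span ⟨k, rfl⟩)
  let D := Derivation.liftOfSurjective (toAlg_surjective Γ) hker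
  have hD : ∀ x, D (toAlg Γ x) = toAlg Γ (E x) :=
    Derivation.liftOfSurjective_apply (toAlg_surjective Γ) hker
  have hDa : ∀ x ∈ Submodule.span ℂ (Set.range (a Γ)), D x = x := by
    intro x hx
    induction hx using Submodule.span_induction with
    | zero => rw [map_zero]
    | add x y _ _ hx hy => rw [map_add, hx, hy]
    | smul c x _ hx => exact (D.map_smul c x).trans (congrArg (c • ·) hx)
    | mem x hx =>
      obtain ⟨k, rfl⟩ := hx
      rw [← toAlg_X, hD, hE]
  refine ⟨D, fun i x hx => ?_⟩
  have hx' := deg_le_span Γ i hx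
  clear hx
  induction i generalizing x with
  | zero =>
    rw [Submodule.pow_zero] at hx'
    obtain ⟨c, rfl⟩ := Submodule.mem_one.1 hx'
    rw [Derivation.map_algebraMap, Nat.cast_zero, zero_smul]
  | succ i ih =>
    rw [Submodule.pow_succ] at hx'
    refine Submodule.mul_induction_on hx' (fun x hx y hy => ?_) fun x y hx hy => by
      rw [map_add, hx, hy, smul_add]
    rw [Derivation.leibniz, hDa y hy, ih x hx, Nat.cast_succ, add_smul, one_smul, smul_eq_mul,
      smul_eq_mul, mul_smul_comm, mul_comm y x, add_comm]

theorem eq_sum_component (x : Alg Γ) : ∃ N, x = ∑ i ∈ Finset.range N, component Γ i x := by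
  obtain ⟨p, rfl⟩ := toAlg_surjective Γ x
  refine ⟨p.totalDegree + 1, ?_⟩
  simp only [component_toAlg, ← map_sum]
  rw [MvPolynomial.sum_homogeneousComponent]

theorem component_mem (i : ℕ) (x : Alg Γ) : component Γ i x ∈ deg Γ i := (grading Γ).π_mem i x

variable {Γ} {D : Derivation ℂ (Alg Γ) (Alg Γ)} (hD : ∀ i, ∀ x ∈ deg Γ i, D x = (i : ℂ) • x)

include hD

theorem component_euler (i : ℕ) (x : Alg Γ) : component Γ i (D x) = (i : ℂ) • component Γ i x := by
  have hx : x ∈ ⨆ i, deg Γ i := iSup_deg Γ ▸ Submodule.mem_top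
  induction hx using Submodule.iSup_induction' with
  | zero => simp
  | add x y _ _ hx hy => rw [map_add, map_add, hx, hy, map_add, smul_add]
  | mem j x hx =>
    rw [hD j x hx, map_smul]
    by_cases hij : j = i
    · rw [hij]
    · rw [component_of_ne Γ hx hij, smul_zero, smul_zero]

/-- The eigenvectors of the Euler derivation are homogeneous. -/
theorem mem_deg_of_euler {x : Alg Γ} (hx : x ≠ 0) {μ : ℂ} (h : D x = μ • x) :
    ∃ k : ℕ, μ = k ∧ x ∈ deg Γ k := by
  have h1 : ∀ i, component Γ i x ≠ 0 → μ = i := by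
    intro i hi
    have h2 := component_euler hD i x
    rw [h, map_smul, ← sub_eq_zero, ← sub_smul] at h2
    exact sub_eq_zero.1 ((smul_eq_zero.1 h2).resolve_right hi)
  obtain ⟨N, hN⟩ := eq_sum_component Γ x
  obtain ⟨k, hk⟩ : ∃ k, component Γ k x ≠ 0 := by
    by_contra! hc
    refine hx (hN.trans (Finset.sum_eq_zero fun i _ => hc i))
  refine ⟨k, h1 k hk, ?_⟩
  rw [hN]
  refine Submodule.sum_mem _ fun i _ => ?_
  by_cases hi : component Γ i x = 0
  · rw [hi]
    exact zero_mem _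
  · have := (h1 i hi).symm.trans (h1 k hk)
    rw [Nat.cast_inj] at this
    rw [this]
    exact component_mem Γ k x

/-- The bigraded parts are eigenspaces of a grading operator. -/
theorem eigenspace_weight_euler {Y : Type*} {p : Y → ℕ} (w : Y → ℕ) (i r : ℕ) :
    End.eigenspace (weight (p := p) ((1 + Complex.I) • D) fun y => Complex.I * w y)
      (i + Complex.I * (i + r : ℕ)) = monomialSpan p (deg Γ i) fun l => (l.map w).sum = r := by
  have hsum : ∀ l : List Y, (l.map fun y => Complex.I * (w y : ℂ)).sum =
      Complex.I * ((l.map w).sum : ℕ) := by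
    intro l
    rw [List.sum_map_mul_left, Nat.cast_list_sum, List.map_map]
    rfl
  have hD' : ∀ k, ∀ x ∈ deg Γ k, ((1 + Complex.I) • D) x = ((1 + Complex.I) * k) • x := by
    intro k x hx
    rw [Derivation.smul_apply, hD k x hx, smul_smul]
  refine eigenspace_weight ?_ _ _ _ _ (fun x hx l hl => ⟨_, hD' i x hx, ?_⟩) fun x hx c l hc hl => ?_
  · rw [End.IsDiagonal, eq_top_iff, ← iSup_deg Γ]
    refine iSup_le fun k => le_trans (fun x hx => ?_) (le_iSup _ ((1 + Complex.I) * (k : ℂ)))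
    exact End.mem_eigenspace_iff.2 (hD' k x hx)
  · rw [hsum, hl]
    push_cast
    ring
  · have h0 : (1 + Complex.I) ≠ 0 := fun h => by simpa using congrArg Complex.im h
    rw [Derivation.smul_apply] at hc
    have h1 : D x = ((1 + Complex.I)⁻¹ * c) • x := by
      rw [mul_smul, ← hc, smul_smul, inv_mul_cancel₀ h0, one_smul]
    obtain ⟨k, hk, hxk⟩ := mem_deg_of_euler hD hx h1
    rw [inv_mul_eq_iff_eq_mul₀ h0] at hk
    rw [hsum, hk] at hl
    generalize (l.map w).sum = s at hl ⊢
    -- A monomial of `A`-degree `k` and homological degree `s` has eigenvalue `k + I (k + s)`, so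
    -- real and imaginary parts determine both degrees.
    have hre := congrArg Complex.re hl
    have him := congrArg Complex.im hl
    simp at hre him
    have hre' : k = i := by exact_mod_cast hre
    subst hre'
    refine ⟨hxk, ?_⟩
    have : k + s = k + r := by exact_mod_cast him
    omega

end QuadraticComm

namespace GradedLieSuperalgebra

variable {L : Type*} [AddCommGroup L] [Module ℂ L] (G : GradedLieSuperalgebra L)

/-- Each factor `ξ_u` contributes `1 + I |u|`: the real part counts factors, the imaginary part is
the internal degree. -/
theorem eigenspace_weight_ceAlg (i j : ℕ) :
    End.eigenspace (weight (p := G.cePar) (0 : Derivation ℂ ℂ ℂ) fun u => 1 + Complex.I * u.1)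
      (i + Complex.I * j) =
        monomialSpan G.cePar ⊤ fun l => l.length = i ∧ (l.map Sigma.fst).sum = j := by
  refine eigenspace_weight_zero _ _ _ fun l => ?_
  have hsum : (l.map fun u : G.Index => 1 + Complex.I * (u.1 : ℂ)).sum =
      l.length + Complex.I * ((l.map Sigma.fst).sum : ℕ) := by
    induction l with
    | nil => simp
    | cons u l ih =>
      simp only [List.map_cons, List.sum_cons, ih, List.length_cons]
      push_cast
      ring
  rw [hsum]
  constructor
  · rintro ⟨h1, h2⟩
    rw [h1, h2]
  · intro h
    generalize (l.map Sigma.fst).sum = s at h ⊢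
    have hre := congrArg Complex.re h
    have him := congrArg Complex.im h
    simp at hre him
    exact ⟨hre, him⟩

end GradedLieSuperalgebra


/-! ### Identification of the specialised complexes with the syzygy and Berkovits complexes -/

open Module SuperComm

namespace SuperComm

variable {R : Type*} [CommRing R] {X : Type*} {p p' : X → ℕ}

theorem IsPar.commute {a : SuperComm R p} {q : ℕ} (hq : Even q) (ha : IsPar q a)
    (b : SuperComm R p) : Commute a b := by
  induction b using SuperComm.induction with
  | hR r => exact (Algebra.commutes r a).symm
  | hgen x =>
    have h := ha.comm x
    rw [pow_mul', hq.neg_one_pow, one_pow, one_smul] at h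
    exact h.symm
  | hmul b c hb hc => exact hb.mul_right hc
  | hadd b c hb hc => exact hb.add_right hc

theorem mapGen_id_bijective (hp : ∀ x, p' (id x) = p x) :
    Function.Bijective (mapGen (R := R) id hp) := by
  obtain rfl : p' = p := funext hp
  have : mapGen (R := R) id hp = AlgHom.id R _ :=
    algHom_ext fun x => mapGen_gen _ _ x
  rw [this]
  exact Function.bijective_id

/-- The algebra map which adds even elements to the even generators. -/
noncomputable def translate (hp : ∀ x, p' x = p x) (τ : X → SuperComm R p')
    (hτ : ∀ x, τ x = 0 ∨ Even (p' x) ∧ IsPar (p' x) (τ x)) : SuperComm R p →ₐ[R] SuperComm R p' :=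
  lift (fun x => gen p' x + τ x) (by
    have heven : ∀ x, Even (p' x) → ∀ b, Commute (gen p' x + τ x) b := by
      intro x hx b
      refine IsPar.commute hx ((isPar_gen x).add ?_) b
      rcases hτ x with h | h
      · rw [h]
        exact isPar_zero _
      · exact h.2
    intro x y
    rw [← hp, ← hp]
    by_cases hx : Even (p' x)
    · rw [(hx.mul_right _).neg_one_pow, one_mul]
      exact heven x hx _
    by_cases hy : Even (p' y)
    · rw [(hy.mul_left _).neg_one_pow, one_mul]
      exact (heven y hy _).symm
    · rw [(hτ x).resolve_right fun h => hx h.1, (hτ y).resolve_right fun h => hy h.1, add_zero,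
        add_zero]
      exact gen_mul_gen p' x y)

theorem translate_gen (hp : ∀ x, p' x = p x) (τ : X → SuperComm R p')
    (hτ : ∀ x, τ x = 0 ∨ Even (p' x) ∧ IsPar (p' x) (τ x)) (x : X) :
    translate hp τ hτ (gen p x) = gen p' x + τ x := lift_gen _ _ _

theorem translate_parity (hp : ∀ x, p' x = p x) (τ : X → SuperComm R p')
    (hτ : ∀ x, τ x = 0 ∨ Even (p' x) ∧ IsPar (p' x) (τ x)) (a : SuperComm R p) :
    translate hp τ hτ (parity a) = parity (translate hp τ hτ a) := by
  have : (translate hp τ hτ).comp parity =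
      (parity : SuperComm R p' →ₐ[R] _).comp (translate hp τ hτ) := by
    refine algHom_ext fun x => ?_
    rw [AlgHom.comp_apply, AlgHom.comp_apply, parity_gen', map_smul, translate_gen, map_add,
      parity_gen', smul_add, hp]
    congr 1
    rcases hτ x with h | h
    · rw [h, smul_zero, map_zero]
    · rw [h.2.parity, hp]
  exact congrArg (fun f : SuperComm R p →ₐ[R] SuperComm R p' => f a) this

theorem translate_weight [Algebra ℂ R] (D : Derivation ℂ R R) (hp : ∀ x, p' x = p x)
    (τ : X → SuperComm R p') (hτ : ∀ x, τ x = 0 ∨ Even (p' x) ∧ IsPar (p' x) (τ x)) (w : X → ℂ)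
    (hw : ∀ x, weight D w (τ x) = w x • τ x) (a : SuperComm R p) :
    translate hp τ hτ (weight D w a) = weight D w (translate hp τ hτ a) := by
  induction a using SuperComm.induction with
  | hR r => rw [AlgHom.commutes, weight_algebraMap, weight_algebraMap, AlgHom.commutes]
  | hgen x =>
    rw [weight_gen, ← algebraMap_smul R (w x) (gen p x), map_smul, algebraMap_smul, translate_gen,
      map_add, weight_gen, hw, smul_add]
  | hmul a b ha hb => rw [weight_mul, map_add, map_mul, map_mul, map_mul, weight_mul, ha, hb]
  | hadd a b ha hb => rw [map_add, map_add, ha, hb, map_add, map_add]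

end SuperComm

namespace LieConstants

variable {X : Type*} {C : LieConstants X}

theorem Window.conn_of_deg_eq_one {Y : Type*} (W : C.Window Y) {u : X} (hu : C.deg u = 1) :
    W.conn u = 0 := by
  refine Finset.sum_eq_zero fun s _ => Finset.sum_eq_zero fun t _ => ?_
  by_cases hc : C.c s t u = 0
  · rw [hc, mul_zero, zero_smul]
  · have h1 := C.c_deg hc
    have h2 := C.pos s
    have h3 := C.pos t
    omega

end LieConstants

namespace LieConstants.Presentation

variable {X : Type} {C : LieConstants X} {A : Type} [CommRing A] [Algebra ℂ A] {n : ℕ}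
  {S : StandardGrading A n} (Q : C.Presentation S)

theorem sum_ball_B {N : ℕ} (hN : 1 ≤ N) {M : Type*} [AddCommMonoid M] {f : X → M}
    (hf : ∀ s, C.deg s ≠ 1 → f s = 0) : ∑ s ∈ C.ball N, f s = ∑ i, f (Q.B i) := by
  have hsub : Finset.univ.map ⟨Q.B, Q.B_inj⟩ ⊆ C.ball N := by
    intro s hs
    obtain ⟨i, -, rfl⟩ := Finset.mem_map.1 hs
    rw [C.mem_ball]
    exact (Q.B_deg i).trans_le hN
  rw [← Finset.sum_subset hsub, Finset.sum_map]
  · rfl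
  · intro s _ hs
    refine hf s fun h => hs ?_
    obtain ⟨i, rfl⟩ := Q.B_surj s h
    exact Finset.mem_map.2 ⟨i, Finset.mem_univ _, rfl⟩

theorem twist_val_B (i : Fin n) : Q.twist.val (Q.B i) = S.a i := Q.val_B i

variable {Y : Type*} (W : C.Window Y)

theorem spec_dVal_of_deg_eq_one {y : Y} {i : Fin n} (hy : W.κ y = Q.B i) :
    W.spec Q.twist (W.dVal (Sum.inr y)) = algebraMap A _ (S.a i) := by
  change W.spec Q.twist (W.ξ (W.κ y) + _ • W.conn (W.κ y)) = _
  rw [hy, W.conn_of_deg_eq_one (Q.B_deg i), smul_zero, add_zero, W.spec_ξ, twist_val_B]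

/-- A non-zero structure constant with target in degree two has both indices in degree one; the
factor `½` is `|y|⁻¹`, and `ξ` itself specialises to zero. -/
theorem spec_dVal_of_deg_eq_two {y : Y} (hy : C.deg (W.κ y) = 2) {θ : Fin n → Y}
    (hθ : ∀ i, W.κ (θ i) = Q.B i) :
    W.spec Q.twist (W.dVal (Sum.inr y)) = (2 : ℂ)⁻¹ • ∑ i, ∑ k, C.c (Q.B i) (Q.B k) (W.κ y) •
      (algebraMap A _ (S.a k) * gen (fun y => C.deg (W.κ y)) (θ i)) := by
  change W.spec Q.twist (W.ξ (W.κ y) + _ • W.conn (W.κ y)) = _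
  rw [map_add, W.spec_ξ, Q.twist.val_of_ne (by omega), map_zero, zero_add, map_smul, hy]
  congr 1
  have h1 : ∀ {s t}, C.c s t (W.κ y) ≠ 0 → C.deg s = 1 ∧ C.deg t = 1 := by
    intro s t hc
    have h1 := C.c_deg hc
    have h2 := C.pos s
    have h3 := C.pos t
    omega
  rw [LieConstants.Window.conn, map_sum, Q.sum_ball_B (by omega)]
  · refine Finset.sum_congr rfl fun i _ => ?_
    rw [map_sum, Q.sum_ball_B (by omega)]
    · refine Finset.sum_congr rfl fun k _ => ?_
      rw [map_smul, map_mul, W.spec_ξ, twist_val_B, ← hθ, W.ηx_κ, W.spec_η, hθ, Q.B_deg,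
        Nat.cast_one, one_mul]
    · intro t ht
      by_cases hc : C.c (Q.B i) t (W.κ y) = 0
      · rw [hc, mul_zero, zero_smul, map_zero]
      · exact absurd (h1 hc).2 ht
  · intro s hs
    rw [map_sum]
    refine Finset.sum_eq_zero fun t _ => ?_
    by_cases hc : C.c s t (W.κ y) = 0
    · rw [hc, mul_zero, zero_smul, map_zero]
    · exact absurd (h1 hc).1 hs

end LieConstants.Presentation

namespace QuadraticComm

variable {n m : ℕ} (Γ : Fin m → Matrix (Fin n) (Fin n) ℂ)

theorem syzygyComplex_d_gen (i : Fin n) :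
    (syzygyComplex Γ).d (gen _ i) = algebraMap (Alg Γ) _ (a Γ i) := der_d_gen _ _ i

theorem berkovitsComplex_d_gen (z : Fin n ⊕ Fin m) :
    (berkovitsComplex Γ).d (gen _ z) = berkovitsValue Γ z := der_d_gen _ _ z

theorem berkovitsComplex_d_theta_mul (i k : Fin n) :
    (berkovitsComplex Γ).d (gen _ (Sum.inl i) * gen _ (Sum.inl k)) =
      algebraMap (Alg Γ) _ (a Γ i) * gen _ (Sum.inl k) -
        algebraMap (Alg Γ) _ (a Γ k) * gen _ (Sum.inl i) := by
  have h : (berkovitsComplex Γ).parity (gen _ (Sum.inl i)) = - gen _ (Sum.inl i) := by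
    refine (parity_gen _).trans ?_
    change (-1) ^ 1 * _ = _
    rw [pow_one, neg_one_mul]
  rw [(berkovitsComplex Γ).leibniz, h, berkovitsComplex_d_gen, berkovitsComplex_d_gen]
  change algebraMap (Alg Γ) _ (a Γ i) * _ + _ * algebraMap (Alg Γ) _ (a Γ k) = _
  rw [neg_mul, ← Algebra.commutes, sub_eq_add_neg]

/-- Quadratic corrections of the even generators. -/
noncomputable def shearVal (T : Fin m → Matrix (Fin n) (Fin n) ℂ) (p : Fin n ⊕ Fin m → ℕ) :
    Fin n ⊕ Fin m → SuperComm (Alg Γ) p :=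
  Sum.elim (fun _ => 0) fun r => ∑ i, ∑ k, T r i k • (gen p (Sum.inl i) * gen p (Sum.inl k))

theorem shearVal_spec (T : Fin m → Matrix (Fin n) (Fin n) ℂ) {p : Fin n ⊕ Fin m → ℕ}
    (hp : ∀ z, berkovitsDegree z = p z) (z : Fin n ⊕ Fin m) :
    shearVal Γ T p z = 0 ∨ Even (p z) ∧ IsPar (p z) (shearVal Γ T p z) := by
  rcases z with i | r
  · exact Or.inl rfl
  · refine Or.inr ⟨?_, ?_⟩
    · rw [← hp]
      exact even_two
    · change IsPar _ (∑ i, ∑ k, T r i k • (gen p (Sum.inl i) * gen p (Sum.inl k)))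
      refine IsPar.sum fun i _ => IsPar.sum fun k _ => IsPar.csmul ?_ _
      refine ((isPar_gen (Sum.inl i)).mul (isPar_gen (Sum.inl k))).congr ?_
      rw [← hp, ← hp, ← hp]
      exact ⟨2, rfl⟩

variable {p p' : Fin n ⊕ Fin m → ℕ} (hp : ∀ z, berkovitsDegree z = p z)
  (hp' : ∀ z, berkovitsDegree z = p' z)

/-- The algebra map which adds quadratic corrections to the even generators. -/
noncomputable def shear (T : Fin m → Matrix (Fin n) (Fin n) ℂ) :
    SuperComm (Alg Γ) p →ₐ[Alg Γ] SuperComm (Alg Γ) p' :=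
  translate (fun z => (hp' z).symm.trans (hp z)) (shearVal Γ T p') (shearVal_spec Γ T hp')

theorem shear_inl (T : Fin m → Matrix (Fin n) (Fin n) ℂ) (i : Fin n) :
    shear Γ hp hp' T (gen p (Sum.inl i)) = gen p' (Sum.inl i) :=
  (translate_gen _ _ _ _).trans (add_zero _)

theorem shear_inr (T : Fin m → Matrix (Fin n) (Fin n) ℂ) (r : Fin m) :
    shear Γ hp hp' T (gen p (Sum.inr r)) = gen p' (Sum.inr r) +
      ∑ i, ∑ k, T r i k • (gen p' (Sum.inl i) * gen p' (Sum.inl k)) :=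
  translate_gen _ _ _ _

theorem shear_shear {T T' : Fin m → Matrix (Fin n) (Fin n) ℂ} (hT : T + T' = 0)
    (x : SuperComm (Alg Γ) p) : shear Γ hp' hp T' (shear Γ hp hp' T x) = x := by
  have : (shear Γ hp' hp T').comp (shear Γ hp hp' T) = AlgHom.id (Alg Γ) _ := by
    refine algHom_ext fun z => ?_
    rw [AlgHom.comp_apply, AlgHom.id_apply]
    rcases z with i | r
    · rw [shear_inl, shear_inl]
    · have h2 : ∀ i k, T' r i k = - T r i k := fun i k =>
        eq_neg_of_add_eq_zero_right (congrFun (congrFun (congrFun hT r) i) k)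
      rw [shear_inr, map_add, shear_inr, add_assoc]
      simp only [map_sum, AlgHom.map_smul_of_tower, map_mul, shear_inl, h2, neg_smul,
        Finset.sum_neg_distrib, neg_add_cancel, add_zero]
  exact congrArg (fun f : SuperComm (Alg Γ) p →ₐ[Alg Γ] SuperComm (Alg Γ) p => f x) this

theorem shear_bijective (T : Fin m → Matrix (Fin n) (Fin n) ℂ) :
    Function.Bijective (shear Γ hp hp' T) :=
  Function.bijective_iff_has_inverse.2 ⟨shear Γ hp' hp (-T), shear_shear Γ hp hp' (add_neg_cancel T),
    shear_shear Γ hp' hp (neg_add_cancel T)⟩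

/-- Symmetrising the coefficients costs only multiples of `E_{ik} - E_{ki}`, which for `E_{ik} = a_i
θ_k` are the boundaries `d(θ_i θ_k)`. -/
theorem symmetrize_sum {M : Type*} [AddCommGroup M] [Module ℂ M] (T : Matrix (Fin n) (Fin n) ℂ)
    (E : Fin n → Fin n → M) : (2 : ℂ)⁻¹ • ∑ i, ∑ k, (T i k + T k i) • E k i =
      ∑ i, ∑ k, T i k • E i k + ∑ i, ∑ k, (-(2 : ℂ)⁻¹ * T i k) • (E i k - E k i) := by
  have h : ∑ i, ∑ k, T k i • E k i = ∑ i, ∑ k, T i k • E i k := Finset.sum_comm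
  simp only [add_smul, smul_sub, mul_smul, Finset.sum_add_distrib, Finset.sum_sub_distrib, h,
    ← Finset.smul_sum]
  module

variable {Γ} {L : Type*} [AddCommGroup L] [Module ℂ L] {G : GradedLieSuperalgebra L}

/-- Both halves of the theorem reduce to matching the differentials on generators. Taking `β = I`
lets one operator encode the two gradings. -/
theorem exists_cohomology_equiv (hK : IsKoszul Γ) {Y : Type} {k : ℕ}
    (b : G.HomogeneousBasis (Y ⊕ (G.trunc k).Index))
    (hb : ∀ u, b.basis (Sum.inr u) = ((G.trunc k).basis u : L)) {p : Y → ℕ}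
    (hdeg : b.deg = Sum.elim p Sigma.fst)
    (h : ∀ y u, b.constants.deg (Sum.inl y) < b.constants.deg (Sum.inr u))
    (Q : b.constants.Presentation (grading Γ)) {K : OddDerivation (SuperComm (Alg Γ) p)}
    (hKR : ∀ r, K.d (algebraMap (Alg Γ) _ r) = 0)
    (F : (b.constants.ofSum h).SpecAlg (Alg Γ) →ₐ[Alg Γ] SuperComm (Alg Γ) p)
    (hF : Function.Bijective F) (hpar : ∀ z, F (parity z) = K.parity (F z))
    (hd : ∀ y, F ((b.constants.ofSum h).spec Q.twist ((b.constants.ofSum h).dVal (Sum.inr y))) =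
      K.d (F (gen _ y)))
    (hw : ∀ (D : Derivation ℂ (Alg Γ) (Alg Γ)) z, F (weight D (fun y => Complex.I * p y) z) =
      weight D (fun y => Complex.I * p y) (F z)) :
    ∃ Φ : K.Homology ≃ₐ[ℂ] (G.trunc k).Cohomology, ∀ i r,
      (K.homologyPart (monomialSpan p (deg Γ i) fun l => (l.map p).sum = r)).map Φ.toLinearMap =
        (G.trunc k).cohomologyPart i (i + r) := by
  obtain ⟨D, hD⟩ := exists_euler Γ
  have hval : ∀ u, D (Q.twist.val u) = Q.twist.val u := by
    intro u
    by_cases hu : b.constants.deg u = 1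
    · obtain ⟨i, rfl⟩ := Q.B_surj u hu
      rw [Q.twist_val_B]
      refine (hD 1 _ (a_mem_deg Γ i)).trans ?_
      rw [Nat.cast_one, one_smul]
      rfl
    · rw [Q.twist.val_of_ne hu, map_zero]
  have hp : (fun y => Complex.I * (b.deg (Sum.inl y) : ℂ)) = fun y => Complex.I * (p y : ℂ) := by
    rw [hdeg]
    rfl
  have hFd : ∀ z, F (((b.constants.ofSum h).specD Q.twist).d z) = K.d (F z) := by
    refine OddDerivation.intertwine (D := (b.constants.ofSum h).specD Q.twist) (D' := K)
      (f := F.restrictScalars ℂ) hpar (fun r => ?_) fun y => ?_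
    · rw [LieConstants.Window.specD, oddDer_algebraMap, map_zero]
      refine Eq.trans (hKR r).symm (congrArg K.d ?_)
      exact (F.commutes r).symm
    · rw [LieConstants.Window.specD_gen]
      exact hd y
  obtain ⟨Φ, hΦ⟩ := b.exists_cohomology_equiv hb (fun u => congrFun hdeg (Sum.inr u)) h Q.twist
    (Q.adjoin_val (adjoin_range_a Γ)) D hval
    (fun z hz hdz => Q.full_spec_acyclic (fun j w hw φ hφ hd => hK.exists_barD hw hφ hd)
      (adjoin_range_a Γ) hz hdz) Complex.I F hF hpar hFd (fun z => by rw [hp]; exact hw _ z)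
  refine ⟨Φ, fun i r => ?_⟩
  have h3 := hΦ (i + Complex.I * (i + r : ℕ))
  rw [eigenspace_weight_euler hD, GradedLieSuperalgebra.eigenspace_weight_ceAlg] at h3
  exact h3

theorem exists_syzygy_equiv (hK : IsKoszul Γ) (e : G.Env ≃ₐ[ℂ] KoszulDual Γ)
    (he : ∀ j, ∀ x ∈ G.deg j, e (G.envι x) ∈ dualDeg Γ j) :
    ∃ Φ : (syzygyComplex Γ).Homology ≃ₐ[ℂ] (G.trunc 2).Cohomology, ∀ i r,
      (syzygyPart Γ i r).map Φ.toLinearMap = (G.trunc 2).cohomologyPart i (i + r) := by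
  obtain ⟨x, hx, hxe, hli, hspan⟩ := exists_lie_generators e he
  obtain ⟨b, -, hb, hdeg, Q, hQ⟩ := exists_syzygy_basis e he hx hxe hli hspan
  have hinl : ∀ y, b.constants.deg (Sum.inl y) = 1 := fun y => congrFun hdeg (Sum.inl y)
  have hinr : ∀ u, b.constants.deg (Sum.inr u) = u.1 := fun u => congrFun hdeg (Sum.inr u)
  have h : ∀ y u, b.constants.deg (Sum.inl y) < b.constants.deg (Sum.inr u) := fun y u => by
    rw [hinl, hinr]
    exact G.le_of_trunc_index u
  let F : (b.constants.ofSum h).SpecAlg (Alg Γ) →ₐ[Alg Γ] SuperComm (Alg Γ) (fun _ : Fin n => 1) :=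
    mapGen id fun y => (hinl y).symm
  have hF : ∀ y, F (gen _ y) = gen _ y := fun y => mapGen_gen _ _ y
  have hd : ∀ y, F ((b.constants.ofSum h).spec Q.twist ((b.constants.ofSum h).dVal (Sum.inr y))) =
      (syzygyComplex Γ).d (F (gen _ y)) := by
    intro y
    rw [Q.spec_dVal_of_deg_eq_one (i := y) _ (congrFun hQ y).symm, hF, syzygyComplex_d_gen]
    exact F.commutes _
  have hpar : ∀ z, F (parity z) = (syzygyComplex Γ).parity (F z) := by
    intro z
    exact mapGen_parity _ _ z
  have hw : ∀ (D : Derivation ℂ (Alg Γ) (Alg Γ)) z,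
      F (weight D (fun _ => Complex.I * ((1 : ℕ) : ℂ)) z) =
        weight D (fun _ => Complex.I * ((1 : ℕ) : ℂ)) (F z) := by
    intro D z
    exact (weight_mapGen D id _ (fun _ => Complex.I * ((1 : ℕ) : ℂ)) z).symm
  have hbij : Function.Bijective F := mapGen_id_bijective _
  have hKR : ∀ r, (syzygyComplex Γ).d (algebraMap (Alg Γ) _ r) = 0 := der_d_algebraMap _ _
  clear_value F
  obtain ⟨Φ, hΦ⟩ := exists_cohomology_equiv hK b hb hdeg h Q (K := syzygyComplex Γ)
    hKR F hbij hpar hd hw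
  refine ⟨Φ, fun i r => ?_⟩
  have h3 := hΦ i r
  rw [← h3, syzygyPart]
  simp only [List.map_const', List.sum_replicate, smul_eq_mul, mul_one]

theorem exists_berkovits_equiv (hΓ : LinearIndependent ℂ (quadric Γ)) (hK : IsKoszul Γ)
    (e : G.Env ≃ₐ[ℂ] KoszulDual Γ) (he : ∀ j, ∀ x ∈ G.deg j, e (G.envι x) ∈ dualDeg Γ j) :
    ∃ Φ : (berkovitsComplex Γ).Homology ≃ₐ[ℂ] (G.trunc 3).Cohomology, ∀ i r,
      (berkovitsPart Γ i r).map Φ.toLinearMap = (G.trunc 3).cohomologyPart i (i + r) := by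
  obtain ⟨b, hb, hdeg, hc, Q, hQ⟩ := exists_berkovits_basis e he hΓ
  have hinl : ∀ y, berkovitsDegree y = b.constants.deg (Sum.inl y) :=
    fun y => (congrFun hdeg (Sum.inl y)).symm
  have hinr : ∀ u, b.constants.deg (Sum.inr u) = u.1 := fun u => congrFun hdeg (Sum.inr u)
  have h : ∀ y u, b.constants.deg (Sum.inl y) < b.constants.deg (Sum.inr u) := fun y u => by
    have := G.le_of_trunc_index u
    rw [← hinl, hinr]
    rcases y with i | r
    · change 1 < u.1
      omega
    · change 2 < u.1
      omega
  -- The shift by `-½ ∑ Γ^r_{ik} θ_i θ_k` turns the Berkovits value `∑ Γ^r_{ik} a_i θ_k` into its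
  -- symmetrisation, which is the specialised differential of `η_r`.
  let F : (b.constants.ofSum h).SpecAlg (Alg Γ) →ₐ[Alg Γ] BerkovitsAlg Γ :=
    shear Γ hinl (fun _ => rfl) fun r => (-(2 : ℂ)⁻¹) • Γ r
  refine exists_cohomology_equiv hK b hb hdeg h Q (K := berkovitsComplex Γ)
    (fun r => der_d_algebraMap _ _ r) F (shear_bijective _ _ _ _)
    (fun z => translate_parity _ _ _ z) (fun y => ?_)
    (fun D z => translate_weight D _ _ _ _ (fun y => ?_) z)
  · rcases y with i | r
    · have h1 : F (gen _ (Sum.inl i)) = gen _ (Sum.inl i) := shear_inl _ _ _ _ i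
      rw [Q.spec_dVal_of_deg_eq_one (i := i) _ (congrFun hQ i).symm, h1, berkovitsComplex_d_gen]
      exact F.commutes _
    · have h1 : ∀ i, F (gen _ (Sum.inl i)) = gen _ (Sum.inl i) := shear_inl _ _ _ _
      have h2 : F (gen _ (Sum.inr r)) = gen _ (Sum.inr r) + ∑ i, ∑ k, (-(2 : ℂ)⁻¹ * Γ r i k) •
        (gen _ (Sum.inl i) * gen _ (Sum.inl k)) := shear_inr _ _ _ _ r
      have h3 : ∀ i k, b.constants.c (Q.B i) (Q.B k) ((b.constants.ofSum h).κ (Sum.inr r)) =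
          Γ r i k + Γ r k i := by
        intro i k
        rw [hQ]
        exact hc i k r
      have h4 : b.constants.deg ((b.constants.ofSum h).κ (Sum.inr r)) = 2 := (hinl (Sum.inr r)).symm
      rw [Q.spec_dVal_of_deg_eq_two _ h4 (θ := Sum.inl) fun i => (congrFun hQ i).symm, h2, map_add,
        berkovitsComplex_d_gen]
      simp only [h3, AlgHom.map_smul_of_tower, map_sum, map_mul, map_smul, AlgHom.commutes,
        berkovitsComplex_d_theta_mul]
      refine Eq.trans ?_ (symmetrize_sum (Γ r) fun i k =>
        (algebraMap (Alg Γ) (BerkovitsAlg Γ) (a Γ i) * gen _ (Sum.inl k)))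
      congr 1
      refine Finset.sum_congr rfl fun i _ => Finset.sum_congr rfl fun k _ => ?_
      congr 2
      exact h1 i
  · rcases y with i | r
    · exact (map_zero _).trans (smul_zero _).symm
    · change weight D _ (∑ i, ∑ k, _ • (gen berkovitsDegree (Sum.inl i) *
        gen berkovitsDegree (Sum.inl k))) = _ • ∑ i, ∑ k, _ • (gen berkovitsDegree (Sum.inl i) *
        gen berkovitsDegree (Sum.inl k))
      simp only [map_sum, map_smul, weight_mul, weight_gen, Finset.smul_sum]
      refine Finset.sum_congr rfl fun i _ => Finset.sum_congr rfl fun k _ => ?_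
      rw [smul_mul_assoc, mul_smul_comm, ← add_smul, smul_comm]
      congr 2
      simp [berkovitsDegree]
      ring

end QuadraticComm


theorem mainTheorem1 {n m : ℕ} (Γ : Fin m → Matrix (Fin n) (Fin n) ℂ)
    (hΓ : LinearIndependent ℂ (QuadraticComm.quadric Γ))
    (hK : QuadraticComm.IsKoszul Γ)
    {L : Type*} [AddCommGroup L] [Module ℂ L] (G : GradedLieSuperalgebra L)
    (e : G.Env ≃ₐ[ℂ] QuadraticComm.KoszulDual Γ)
    (he : ∀ j, ∀ x ∈ G.deg j, e (G.envι x) ∈ QuadraticComm.dualDeg Γ j) :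
    (∃ Φ : (QuadraticComm.syzygyComplex Γ).Homology ≃ₐ[ℂ] (G.trunc 2).Cohomology,
      ∀ i r, (QuadraticComm.syzygyPart Γ i r).map Φ.toLinearMap =
        (G.trunc 2).cohomologyPart i (i + r)) ∧
    (∃ Ψ : (QuadraticComm.berkovitsComplex Γ).Homology ≃ₐ[ℂ] (G.trunc 3).Cohomology,
      ∀ i r, (QuadraticComm.berkovitsPart Γ i r).map Ψ.toLinearMap =
        (G.trunc 3).cohomologyPart i (i + r)) := by
  exact ⟨QuadraticComm.exists_syzygy_equiv hK e he, QuadraticComm.exists_berkovits_equiv hΓ hK e he⟩
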